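/- **Setting.** Let $\Omega=(l_x,r_x)\times(l_y,r_y)$, $T>0$, $Q_L=\sqrt{(r_x-l_x)(r_y-l_y)}$, $0<\bar\alpha<1$. Let $\alpha:[0,T]\to(1,2)$ be three times differentiable with bounded derivatives, $\alpha'(0)=0$ and $\alpha(0)=\alpha_0=1+\bar\alpha$, and put $$k(t)=\frac{t^{1-\alpha(t)}}{\Gamma(2-\alpha(t))},\quad \beta_{\bar\alpha}(t)=\frac{t^{\bar\alpha-1}}{\Gamma(\bar\alpha)},\quad g(t)=\int_0^t\beta_{\bar\alpha}(t-s)k(s)\,ds\ (0<t\le T),\quad g(0)=1 .$$ Let $f\in C^2(\mathbb R)$ with $|f'|\le Q_f$, and let $u$ satisfy $$\int_0^t k(t-s)\,\partial_s^2u(x,y,s)\,ds-\Delta u=f(u)\ \text{ in }\Omega\times(0,T],\qquad u=0\ \text{ on }\partial\Omega\times[0,T],$$ $$u(\cdot,0)=u_0,\quad \partial_tu(\cdot,0)=\bar u_0\ \text{ on }\bar\Omega .$$ **Regularity conditions, with constant $C$.** $u,\partial_\chi^2u,\partial_\chi^6u,\partial_tu,\partial_t\partial_\chi^2u$ are continuous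 on $\bar\Omega\times[0,T]$; $\partial_t^2u,\partial_t^3u,\partial_t^2\partial_\chi^2u$ are continuous on $\bar\Omega\times(0,T]$ ($\chi=x,y$); and on $\bar\Omega\times(0,T]$ $$|u|,\ |\partial_\chi^4u|,\ |\partial_\chi^6u|\le C,\qquad |\partial_tu|,\ |\partial_t\partial_\chi^2u|\le C(1+t^{\alpha_0-1}),$$ $$|\partial_t^2u|,\ |\partial_t^2\partial_\chi^2u|\le Ct^{\alpha_0-2},\qquad |\partial_t^3u|\le Ct^{\alpha_0-3}.$$ **Grids and operators.** Let $\tau=T/N$, $t_n=n\tau$. For $\kappa\in\{H,h\}$ the grid has $M_{\kappa,x}\times M_{\kappa,y}$ cells, step sizes $\kappa_x=(r_x-l_x)/M_{\kappa,x}$, $\kappa_y=(r_y-l_y)/M_{\kappa,y}$ and nodes $x_i=l_x+i\kappa_x$, $y_j=l_y+j\kappa_y$; here $N,M_{H,x},M_{H,y}\ge1$, $M_{h,x}=JM_{H,x}$, $M_{h,y}=JM_{H,y}$, $J\ge2$. Write $\omega_\kappa$ and $\partial\omega_\kappa$ for the interior and boundary indices. Let $$\delta_{\kappa,x}^2v_{i,j}=\frac{v_{i+1,j}-2v_{i,j}+v_{i-1,j}}{\kappa_x^2},\qquad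 \mathcal A_{\kappa,x}v_{i,j}=\frac{v_{i-1,j}+10v_{i,j}+v_{i+1,j}}{12}\ (0<i<M_{\kappa,x}),$$ $\mathcal A_{\kappa,x}v_{i,j}=v_{i,j}$ for $i\in\{0,M_{\kappa,x}\}$, similarly in $y$, and $\mathcal A_\kappa=\mathcal A_{\kappa,x}\mathcal A_{\kappa,y}$, $\Lambda_\kappa=\mathcal A_{\kappa,y}\delta_{\kappa,x}^2+\mathcal A_{\kappa,x}\delta_{\kappa,y}^2$, $\|v\|_\kappa^2=\kappa_x\kappa_y\sum_{(i,j)\in\omega_\kappa}v_{i,j}^2$. Let $\delta_tv^n=(v^n-v^{n-1})/\tau$, and $$\lambda_{n,j}=\frac1\tau\int_{t_{n-1}}^{t_n}\int_{t_{j-1}}^{\min\{t,t_j\}}\beta_{\bar\alpha}(t-s)\,ds\,dt,\qquad \mathfrak I^nv^n=\lambda_{n,1}v^1+\sum_{j=2}^n\lambda_{n,j}\frac{v^j+v^{j-1}}2,$$ $\widetilde\lambda_{n,1}=\lambda_{n,1}+\frac{\lambda_{n,2}}2$, $\widetilde\lambda_{n,k}=\frac{\lambda_{n,k+1}+\lambda_{n,k}}2$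 for $2\le k\le n-1$, $w_k=g(t_{k+1})-g(t_k)$, $\tilde w_k=\frac{w_k+w_{k-1}}2$ for $k\ge1$, $c_0=1+\frac{w_0}2$, $b^n_{i,j}=\frac1\tau\int_{t_{n-1}}^{t_n}g(t)\bar u_0(x_i,y_j)\,dt$. **The scheme.** A function $U_\kappa^n$ on the grid $\kappa$, $0\le n\le N$, satisfies the scheme with source $(\Phi^n)$ if $U^0_\kappa=u_0$ on $\omega_\kappa$, $U_\kappa^n=0$ on $\partial\omega_\kappa$ for $0\le n\le N$, and on $\omega_\kappa$ $$c_0\mathcal A_\kappa\delta_tU_\kappa^1-\lambda_{1,1}\Lambda_\kappa U_\kappa^1=\lambda_{1,1}\mathcal A_\kappa\Phi^1+\mathcal A_\kappa b^1,$$ $$c_0\mathcal A_\kappa\delta_tU_\kappa^n+\sum_{k=1}^{n-1}\tilde w_{n-k}\mathcal A_\kappa\delta_tU_\kappa^k-\mathfrak I^n\Lambda_\kappa U_\kappa^n=\frac{\lambda_{n,n}}2\mathcal A_\kappa\Phi^n+\sum_{k=1}^{n-1}\widetilde\lambda_{n,k}\mathcal A_\kappa f(U_\kappa^k)+\mathcal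 A_\kappa b^n,\quad 2\le n\le N.$$ The coarse solution $U_H$ satisfies it on the coarse grid with $\Phi^n=f(U_H^n)$ (a nonlinear system). The two-grid solution $U_h$ satisfies it on the fine grid with the Newton linearization $\Phi^n=f(\Pi_HU_H^n)+f'(\Pi_HU_H^n)(U_h^n-\Pi_HU_H^n)$ (a linear system). Here $\Pi_H=\Pi_{H,y}\Pi_{H,x}$ is bicubic spline interpolation from the coarse grid: $\Pi_{H,x}$ and $\Pi_{H,y}$ are one-dimensional $C^2$ cubic spline interpolation in each direction, with second derivative at both end points prescribed as $-f(0)$, the value which the differential equation and $u=0$ give for the second normal derivative of $u$ on $\partial\Omega$. **Theorem.** 1. For every such $\alpha$ there is a constant $Q_g$ with $|g|\le Q_g$ on $[0,T]$ and $|g'(t)|\le Q_g$, $|g''(t)|\le Q_g(|\ln t|+1)$ for $0<t<T$. 2. There are constants $Q>0$ and $\delta>0$, depending only on $T,\bar\alpha,Q_L$, on a constant $Q_g$ as in 1, on $Q_f$, on $C$ and on a bound of $|f''|$ on $[-C,C]$, such that whenever $\tau,h_x,h_y\le\delta$, every coarse solution $U_H$ and every corresponding two-grid solution $U_h$ satisfy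 $$\|u^n-U_h^n\|_h\le Q\left(\tau^2+h_x^4+h_y^4+H_x^4+H_y^4\right),\qquad 1\le n\le N,$$ where $u^n_{i,j}=u(x_i,y_j,t_n)$. -/

import Mathlib

open Set

noncomputable section

namespace TwoGrid

/-! ### The space-time cylinder and the continuous problem -/

/-- The space-time cylinder `[lx, rx] × [ly, ry] × [0, T]`. -/
structure Cylinder where
  lx : ℝ
  rx : ℝ
  ly : ℝ
  ry : ℝ
  T : ℝ
  hx : lx < rx
  hy : ly < ry
  hT : 0 < T

/-- The open rectangle `Ω`. -/
def Cylinder.Omega (D : Cylinder) : Set (ℝ × ℝ) := Ioo D.lx D.rx ×ˢ Ioo D.ly D.ry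

/-- The closed rectangle. -/
def Cylinder.OmegaBar (D : Cylinder) : Set (ℝ × ℝ) := Icc D.lx D.rx ×ˢ Icc D.ly D.ry

/-- `k`-th partial derivative in `x` (one-sided at the ends of `[lx, rx]`). -/
def pdx (D : Cylinder) (k : ℕ) (u : ℝ → ℝ → ℝ → ℝ) (x y t : ℝ) : ℝ :=
  iteratedDerivWithin k (fun ξ => u ξ y t) (Icc D.lx D.rx) x

/-- `k`-th partial derivative in `y` (one-sided at the ends of `[ly, ry]`). -/
def pdy (D : Cylinder) (k : ℕ) (u : ℝ → ℝ → ℝ → ℝ) (x y t : ℝ) : ℝ :=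
  iteratedDerivWithin k (fun η => u x η t) (Icc D.ly D.ry) y

/-- `k`-th partial derivative in `t` (one-sided at the ends of `[0, T]`). -/
def pdt (D : Cylinder) (k : ℕ) (u : ℝ → ℝ → ℝ → ℝ) (x y t : ℝ) : ℝ :=
  iteratedDerivWithin k (fun s => u x y s) (Icc 0 D.T) t

/-- The variable-exponent Abel kernel `k(t) = t^(1-α(t)) / Γ(2-α(t))`. -/
def abelKernel (α : ℝ → ℝ) (t : ℝ) : ℝ := t ^ (1 - α t) / Real.Gamma (2 - α t)

/-- `β_a(t) = t^(a-1) / Γ(a)`. -/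
def beta (a t : ℝ) : ℝ := t ^ (a - 1) / Real.Gamma a

/-- The generalized identity function `g = β_{α(0)-1} * k` for `t > 0`, with its limit value
`g(0) = 1` at `t = 0` (where the convolution integral itself is over an empty interval). -/
def gfun (α : ℝ → ℝ) (t : ℝ) : ℝ :=
  if t = 0 then 1 else ∫ s in (0 : ℝ)..t, beta (α 0 - 1) (t - s) * abelKernel α s

/-- `α : [0,T] → (1,2)` is three times differentiable with bounded derivatives, `α'(0) = 0`. -/
structure IsAdmissibleExponent (T : ℝ) (α : ℝ → ℝ) : Prop where
  range : ∀ t ∈ Icc 0 T, 1 < α t ∧ α t < 2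
  diff : ∀ k < 3, DifferentiableOn ℝ (iteratedDerivWithin k α (Icc 0 T)) (Icc 0 T)
  bound : ∃ Qα : ℝ, ∀ t ∈ Icc 0 T,
    |iteratedDerivWithin 1 α (Icc 0 T) t| + |iteratedDerivWithin 2 α (Icc 0 T) t|
      + |iteratedDerivWithin 3 α (Icc 0 T) t| ≤ Qα
  deriv_zero : iteratedDerivWithin 1 α (Icc 0 T) 0 = 0

/-- `Qg` is a constant with `|g| ≤ Qg`, `|g'| ≤ Qg` and `|g''(t)| ≤ Qg (|ln t| + 1)`. -/
structure IsKernelBound (T : ℝ) (α : ℝ → ℝ) (Qg : ℝ) : Prop where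
  g_le : ∀ t ∈ Icc 0 T, |gfun α t| ≤ Qg
  g_diff : ∀ t ∈ Ioo 0 T, DifferentiableAt ℝ (gfun α) t ∧ |deriv (gfun α) t| ≤ Qg
  g_diff2 : ∀ t ∈ Ioo 0 T, DifferentiableAt ℝ (deriv (gfun α)) t ∧
    |deriv (deriv (gfun α)) t| ≤ Qg * (|Real.log t| + 1)

/-- `u` solves the initial-boundary value problem
`k * ∂_t² u - Δu = f(u)`, `u(·,0) = u₀`, `∂_t u(·,0) = v₀`, `u = 0` on the boundary. -/
structure IsSolution (D : Cylinder) (α f : ℝ → ℝ) (u₀ v₀ : ℝ → ℝ → ℝ)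
    (u : ℝ → ℝ → ℝ → ℝ) : Prop where
  pde : ∀ x y t, (x, y) ∈ D.Omega → t ∈ Ioc 0 D.T →
    (∫ s in (0 : ℝ)..t, abelKernel α (t - s) * pdt D 2 u x y s)
      - (pdx D 2 u x y t + pdy D 2 u x y t) = f (u x y t)
  init : ∀ x y, (x, y) ∈ D.OmegaBar → u x y 0 = u₀ x y
  init_deriv : ∀ x y, (x, y) ∈ D.OmegaBar → pdt D 1 u x y 0 = v₀ x y
  boundary : ∀ x y t, (x, y) ∈ D.OmegaBar \ D.Omega → t ∈ Icc 0 D.T → u x y t = 0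

/-- Joint continuity of a function of `(x, y, t)` on `OmegaBar × I`. -/
def JointlyContinuous (D : Cylinder) (I : Set ℝ) (v : ℝ → ℝ → ℝ → ℝ) : Prop :=
  ContinuousOn (fun p : (ℝ × ℝ) × ℝ => v p.1.1 p.1.2 p.2) (D.OmegaBar ×ˢ I)

/-- The regularity conditions, with constant `C`; `α₀ = α(0)`. All derivatives that occur are
required to exist: `ContDiffOn` gives the one-variable differentiability and `JointlyContinuous`
the continuity in `(x, y, t)`. -/
structure IsRegular (D : Cylinder) (α₀ C : ℝ) (u : ℝ → ℝ → ℝ → ℝ) : Prop where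
  -- existence of the derivatives
  diff_x : ∀ y ∈ Icc D.ly D.ry, ∀ t ∈ Icc 0 D.T,
    ContDiffOn ℝ 6 (fun x => u x y t) (Icc D.lx D.rx)
  diff_y : ∀ x ∈ Icc D.lx D.rx, ∀ t ∈ Icc 0 D.T,
    ContDiffOn ℝ 6 (fun y => u x y t) (Icc D.ly D.ry)
  diff_t : ∀ x y, (x, y) ∈ D.OmegaBar →
    ContDiffOn ℝ 1 (fun t => u x y t) (Icc 0 D.T) ∧
    ContDiffOn ℝ 3 (fun t => u x y t) (Ioc 0 D.T)
  diff_t_xx : ∀ x y, (x, y) ∈ D.OmegaBar →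
    ContDiffOn ℝ 1 (fun t => pdx D 2 u x y t) (Icc 0 D.T) ∧
    ContDiffOn ℝ 2 (fun t => pdx D 2 u x y t) (Ioc 0 D.T)
  diff_t_yy : ∀ x y, (x, y) ∈ D.OmegaBar →
    ContDiffOn ℝ 1 (fun t => pdy D 2 u x y t) (Icc 0 D.T) ∧
    ContDiffOn ℝ 2 (fun t => pdy D 2 u x y t) (Ioc 0 D.T)
  -- continuity
  cont : JointlyContinuous D (Icc 0 D.T) u
  cont_xx : JointlyContinuous D (Icc 0 D.T) (pdx D 2 u)
  cont_yy : JointlyContinuous D (Icc 0 D.T) (pdy D 2 u)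
  cont_x6 : JointlyContinuous D (Icc 0 D.T) (pdx D 6 u)
  cont_y6 : JointlyContinuous D (Icc 0 D.T) (pdy D 6 u)
  cont_t : JointlyContinuous D (Icc 0 D.T) (pdt D 1 u)
  cont_t_xx : JointlyContinuous D (Icc 0 D.T) (pdt D 1 (pdx D 2 u))
  cont_t_yy : JointlyContinuous D (Icc 0 D.T) (pdt D 1 (pdy D 2 u))
  cont_tt : JointlyContinuous D (Ioc 0 D.T) (pdt D 2 u)
  cont_ttt : JointlyContinuous D (Ioc 0 D.T) (pdt D 3 u)
  cont_tt_xx : JointlyContinuous D (Ioc 0 D.T) (pdt D 2 (pdx D 2 u))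
  cont_tt_yy : JointlyContinuous D (Ioc 0 D.T) (pdt D 2 (pdy D 2 u))
  -- bounds
  bound : ∀ x y t, (x, y) ∈ D.OmegaBar → t ∈ Ioc 0 D.T →
    |u x y t| ≤ C ∧ |pdx D 4 u x y t| ≤ C ∧ |pdy D 4 u x y t| ≤ C ∧
    |pdx D 6 u x y t| ≤ C ∧ |pdy D 6 u x y t| ≤ C ∧
    |pdt D 1 u x y t| ≤ C * (1 + t ^ (α₀ - 1)) ∧
    |pdt D 1 (pdx D 2 u) x y t| ≤ C * (1 + t ^ (α₀ - 1)) ∧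
    |pdt D 1 (pdy D 2 u) x y t| ≤ C * (1 + t ^ (α₀ - 1)) ∧
    |pdt D 2 u x y t| ≤ C * t ^ (α₀ - 2) ∧
    |pdt D 3 u x y t| ≤ C * t ^ (α₀ - 3) ∧
    |pdt D 2 (pdx D 2 u) x y t| ≤ C * t ^ (α₀ - 2) ∧
    |pdt D 2 (pdy D 2 u) x y t| ≤ C * t ^ (α₀ - 2)

/-! ### Grids, grid functions and discrete operators

A grid function on a grid with `Mx × My` cells is a function of two indices; only its values at
`0 ≤ i ≤ Mx`, `0 ≤ j ≤ My` are ever used. -/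

def tau (D : Cylinder) (N : ℕ) : ℝ := D.T / N

def time (D : Cylinder) (N n : ℕ) : ℝ := n * tau D N

def stepX (D : Cylinder) (Mx : ℕ) : ℝ := (D.rx - D.lx) / Mx

def stepY (D : Cylinder) (My : ℕ) : ℝ := (D.ry - D.ly) / My

def nodeX (D : Cylinder) (Mx i : ℕ) : ℝ := D.lx + i * stepX D Mx

def nodeY (D : Cylinder) (My j : ℕ) : ℝ := D.ly + j * stepY D My

/-- Interior indices `ω`. -/
def Interior (Mx My i j : ℕ) : Prop := (1 ≤ i ∧ i + 1 ≤ Mx) ∧ (1 ≤ j ∧ j + 1 ≤ My)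

/-- Boundary indices `∂ω`. -/
def Boundary (Mx My i j : ℕ) : Prop := (i ≤ Mx ∧ j ≤ My) ∧ ¬ Interior Mx My i j

/-- Compact averaging operator in the `x` direction. -/
def avgX (Mx : ℕ) (v : ℕ → ℕ → ℝ) (i j : ℕ) : ℝ :=
  if i = 0 ∨ i = Mx then v i j else (v (i - 1) j + 10 * v i j + v (i + 1) j) / 12

/-- Compact averaging operator in the `y` direction. -/
def avgY (My : ℕ) (v : ℕ → ℕ → ℝ) (i j : ℕ) : ℝ :=
  if j = 0 ∨ j = My then v i j else (v i (j - 1) + 10 * v i j + v i (j + 1)) / 12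

/-- `A = A_x A_y`. -/
def avg (Mx My : ℕ) (v : ℕ → ℕ → ℝ) : ℕ → ℕ → ℝ := avgX Mx (avgY My v)

/-- Second difference quotient in `x` (used for `1 ≤ i ≤ Mx - 1`). -/
def secondX (D : Cylinder) (Mx : ℕ) (v : ℕ → ℕ → ℝ) (i j : ℕ) : ℝ :=
  (v (i + 1) j - 2 * v i j + v (i - 1) j) / stepX D Mx ^ 2

/-- Second difference quotient in `y` (used for `1 ≤ j ≤ My - 1`). -/
def secondY (D : Cylinder) (My : ℕ) (v : ℕ → ℕ → ℝ) (i j : ℕ) : ℝ :=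
  (v i (j + 1) - 2 * v i j + v i (j - 1)) / stepY D My ^ 2

/-- `Λ = A_y δ_x² + A_x δ_y²`. -/
def compactLaplacian (D : Cylinder) (Mx My : ℕ) (v : ℕ → ℕ → ℝ) (i j : ℕ) : ℝ :=
  avgY My (secondX D Mx v) i j + avgX Mx (secondY D My v) i j

/-- The discrete norm `‖v‖ = (κ_x κ_y ∑_{i=1}^{Mx-1} ∑_{j=1}^{My-1} v_{ij}²)^{1/2}`. -/
def gridNorm (D : Cylinder) (Mx My : ℕ) (v : ℕ → ℕ → ℝ) : ℝ :=
  Real.sqrt (stepX D Mx * stepY D My *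
    ∑ i ∈ Finset.Ico 1 Mx, ∑ j ∈ Finset.Ico 1 My, v i j ^ 2)

/-! ### Time discretization -/

/-- Backward difference quotient in time of a sequence of grid functions, for `n ≥ 1`. -/
def diffT (D : Cylinder) (N : ℕ) (U : ℕ → ℕ → ℕ → ℝ) (n i j : ℕ) : ℝ :=
  (U n i j - U (n - 1) i j) / tau D N

/-- The weights `λ_{n,j}`, `1 ≤ j ≤ n`, of the averaged product integration rule. -/
def lam (D : Cylinder) (N : ℕ) (α : ℝ → ℝ) (n j : ℕ) : ℝ :=
  (1 / tau D N) * ∫ t in (time D N (n - 1))..(time D N n),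
    ∫ s in (time D N (j - 1))..(min t (time D N j)), beta (α 0 - 1) (t - s)

/-- The averaged product integration rule
`I^n φ = λ_{n,1} φ^1 + ∑_{j=2}^n λ_{n,j} (φ^j + φ^{j-1}) / 2`. -/
def avgPI (D : Cylinder) (N : ℕ) (α : ℝ → ℝ) (φ : ℕ → ℝ) (n : ℕ) : ℝ :=
  lam D N α n 1 * φ 1
    + ∑ j ∈ Finset.Icc 2 n, lam D N α n j * ((φ j + φ (j - 1)) / 2)

/-- `λ̃_{n,1} = λ_{n,1} + λ_{n,2}/2`, `λ̃_{n,k} = (λ_{n,k+1} + λ_{n,k})/2` for `2 ≤ k ≤ n-1`. -/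
def lamTilde (D : Cylinder) (N : ℕ) (α : ℝ → ℝ) (n k : ℕ) : ℝ :=
  if k = 1 then lam D N α n 1 + lam D N α n 2 / 2
  else (lam D N α n (k + 1) + lam D N α n k) / 2

/-- `w_k = g(t_{k+1}) - g(t_k)`. -/
def wt (D : Cylinder) (N : ℕ) (α : ℝ → ℝ) (k : ℕ) : ℝ :=
  gfun α (time D N (k + 1)) - gfun α (time D N k)

/-- `w̃_0 = w_0/2` and `w̃_k = (w_k + w_{k-1})/2` for `k ≥ 1`. -/
def wtTilde (D : Cylinder) (N : ℕ) (α : ℝ → ℝ) (k : ℕ) : ℝ :=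
  if k = 0 then wt D N α 0 / 2 else (wt D N α k + wt D N α (k - 1)) / 2

/-- `b^n_{ij} = (1/τ) ∫_{t_{n-1}}^{t_n} g(t) v₀(x_i, y_j) dt`. -/
def bterm (D : Cylinder) (N Mx My : ℕ) (α : ℝ → ℝ) (v₀ : ℝ → ℝ → ℝ) (n i j : ℕ) : ℝ :=
  (1 / tau D N) * ∫ t in (time D N (n - 1))..(time D N n),
    gfun α t * v₀ (nodeX D Mx i) (nodeY D My j)

/-- The common left-hand side of the schemes,
`c₀ A δ_t U^n + ∑_{k=1}^{n-1} w̃_{n-k} A δ_t U^k - I^n (Λ U)^n` with `c₀ = 1 + w_0/2`. -/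
def schemeLHS (D : Cylinder) (N Mx My : ℕ) (α : ℝ → ℝ) (U : ℕ → ℕ → ℕ → ℝ) (n i j : ℕ) : ℝ :=
  (1 + wt D N α 0 / 2) * avg Mx My (diffT D N U n) i j
    + ∑ k ∈ Finset.Ico 1 n, wtTilde D N α (n - k) * avg Mx My (diffT D N U k) i j
    - avgPI D N α (fun m => compactLaplacian D Mx My (U m) i j) n

/-- Initial and boundary values of the discrete solution. -/
def HasInitialBoundaryValues (D : Cylinder) (N Mx My : ℕ) (u₀ : ℝ → ℝ → ℝ)
    (U : ℕ → ℕ → ℕ → ℝ) : Prop :=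
  (∀ i j, Interior Mx My i j → U 0 i j = u₀ (nodeX D Mx i) (nodeY D My j)) ∧
  (∀ n ≤ N, ∀ i j, Boundary Mx My i j → U n i j = 0)

/-- `U` solves the nonlinear compact difference scheme on the coarse grid. -/
structure IsCoarseSolution (D : Cylinder) (N Mx My : ℕ) (α f : ℝ → ℝ) (u₀ v₀ : ℝ → ℝ → ℝ)
    (U : ℕ → ℕ → ℕ → ℝ) : Prop where
  first : ∀ i j, Interior Mx My i j →
    schemeLHS D N Mx My α U 1 i j =
      lam D N α 1 1 * avg Mx My (fun p q => f (U 1 p q)) i j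
        + avg Mx My (bterm D N Mx My α v₀ 1) i j
  later : ∀ n, 2 ≤ n → n ≤ N → ∀ i j, Interior Mx My i j →
    schemeLHS D N Mx My α U n i j =
      lam D N α n n / 2 * avg Mx My (fun p q => f (U n p q)) i j
        + ∑ k ∈ Finset.Ico 1 n, lamTilde D N α n k * avg Mx My (fun p q => f (U k p q)) i j
        + avg Mx My (bterm D N Mx My α v₀ n) i j
  values : HasInitialBoundaryValues D N Mx My u₀ U

/-! ### Cubic and bicubic spline interpolation -/

/-- The matrix `½ tridiag(1, 4, 1)` of order `M - 1`; it is invertible. -/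
def splineMatrix (M : ℕ) : Matrix (Fin (M - 1)) (Fin (M - 1)) ℝ := fun i j =>
  if i = j then 2
  else if (i : ℕ) + 1 = j ∨ (j : ℕ) + 1 = i then 1 / 2 else 0

theorem splineMatrix_det_ne_zero (M : ℕ) : (splineMatrix M).det ≠ 0 := by
  apply det_ne_zero_of_sum_row_lt_diag
  intro k
  have h1 : ∀ j ∈ Finset.univ.erase k, ‖splineMatrix M k j‖ ≤
      (if (j : ℕ) = (k : ℕ) + 1 then 1 / 2 else 0)
        + (if (j : ℕ) = (k : ℕ) - 1 then 1 / 2 else 0) := by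
    intro j hj
    have hne : k ≠ j := fun h => (Finset.ne_of_mem_erase hj) h.symm
    unfold splineMatrix
    rw [if_neg hne]
    split_ifs <;> first | omega | norm_num
  have h2 : ∀ c : ℕ, (∑ j ∈ Finset.univ.erase k,
      (if (j : ℕ) = c then (1 / 2 : ℝ) else 0)) ≤ 1 / 2 := by
    intro c
    rw [← Finset.sum_filter, Finset.sum_const, nsmul_eq_mul]
    have : ((Finset.univ.erase k).filter (fun j : Fin (M - 1) => (j : ℕ) = c)).card ≤ 1 := by
      rw [Finset.card_le_one]
      intro x hx y hy
      simp only [Finset.mem_filter] at hx hy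
      exact Fin.ext (hx.2.trans hy.2.symm)
    have h3 : (((Finset.univ.erase k).filter (fun j : Fin (M - 1) => (j : ℕ) = c)).card : ℝ) ≤ 1 := by
      exact_mod_cast this
    linarith
  have h4 := Finset.sum_le_sum h1
  rw [Finset.sum_add_distrib] at h4
  have h5 := h2 ((k : ℕ) + 1)
  have h6 := h2 ((k : ℕ) - 1)
  have h7 : ‖splineMatrix M k k‖ = 2 := by simp [splineMatrix]
  rw [h7]
  linarith

/-- The right-hand side `D_i = 3 δ²w_i`, from which half of each prescribed end coefficient is
subtracted in the first and in the last row. Row `i : Fin (M - 1)` belongs to the node `i + 1`. -/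
def splineRhs (M : ℕ) (H : ℝ) (w : ℕ → ℝ) (m₀ m₁ : ℝ) : Fin (M - 1) → ℝ := fun i =>
  3 * ((w (i + 2) - 2 * w (i + 1) + w i) / H ^ 2)
    - (if (i : ℕ) = 0 then m₀ / 2 else 0) - (if (i : ℕ) + 2 = M then m₁ / 2 else 0)

/-- The spline coefficients `ℳ_0, …, ℳ_M` (the second derivatives at the nodes), with prescribed
end coefficients `ℳ_0 = m₀` and `ℳ_M = m₁`. -/
def splineCoeff (M : ℕ) (H : ℝ) (w : ℕ → ℝ) (m₀ m₁ : ℝ) (i : ℕ) : ℝ :=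
  if i = 0 then m₀
  else if h : i - 1 < M - 1 then ((splineMatrix M)⁻¹.mulVec (splineRhs M H w m₀ m₁)) ⟨i - 1, h⟩
  else m₁

/-- The cubic spline on the nodes `l + i H`, `0 ≤ i ≤ M`, with nodal values `w` and prescribed
second derivatives `m₀`, `m₁` at the two ends, evaluated at `x ∈ [l, l + M H]`. -/
def cubicSpline (l H : ℝ) (M : ℕ) (w : ℕ → ℝ) (m₀ m₁ : ℝ) (x : ℝ) : ℝ :=
  let k : ℕ := min ⌊(x - l) / H⌋₊ (M - 1)
  let xa : ℝ := l + k * H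
  let xb : ℝ := l + (k + 1) * H
  let ma : ℝ := splineCoeff M H w m₀ m₁ k
  let mb : ℝ := splineCoeff M H w m₀ m₁ (k + 1)
  ma * (xb - x) ^ 3 / (6 * H) + mb * (x - xa) ^ 3 / (6 * H)
    + (w k - ma * H ^ 2 / 6) * ((xb - x) / H) + (w (k + 1) - mb * H ^ 2 / 6) * ((x - xa) / H)

/-- The bicubic spline interpolation operator `Π_H = Π_{H,y} Π_{H,x}`, with the value `m`
prescribed for every end coefficient. -/
def bicubic (D : Cylinder) (Mx My : ℕ) (m : ℝ) (w : ℕ → ℕ → ℝ) (x y : ℝ) : ℝ :=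
  cubicSpline D.ly (stepY D My) My
    (fun j => cubicSpline D.lx (stepX D Mx) Mx (fun i => w i j) m m x) m m y

/-- Values of `Π_H U_H^n` at the nodes of the fine grid, which has `J` times as many cells in each
direction. The end coefficients are those of the second-order boundary condition of the problem:
`u = 0` on the boundary, so the differential equation, restricted to an edge of the rectangle,
says that the second normal derivative of `u` is `-f(0)` there. -/
def interpolated (D : Cylinder) (MHx MHy J : ℕ) (f : ℝ → ℝ) (UH : ℕ → ℕ → ℕ → ℝ)
    (n i j : ℕ) : ℝ :=
  bicubic D MHx MHy (-f 0) (UH n) (nodeX D (J * MHx) i) (nodeY D (J * MHy) j)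

/-- Newton linearization of `f` at `Π_H U_H^n`. -/
def newtonF (D : Cylinder) (MHx MHy J : ℕ) (f : ℝ → ℝ) (UH Uh : ℕ → ℕ → ℕ → ℝ)
    (n i j : ℕ) : ℝ :=
  f (interpolated D MHx MHy J f UH n i j)
    + deriv f (interpolated D MHx MHy J f UH n i j)
      * (Uh n i j - interpolated D MHx MHy J f UH n i j)

/-- `Uh` solves the linearized compact difference scheme on the fine grid, with
`J * MHx` by `J * MHy` cells, built from the coarse-grid function `UH`. -/
structure IsFineSolution (D : Cylinder) (N MHx MHy J : ℕ) (α f : ℝ → ℝ)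
    (u₀ v₀ : ℝ → ℝ → ℝ) (UH Uh : ℕ → ℕ → ℕ → ℝ) : Prop where
  first : ∀ i j, Interior (J * MHx) (J * MHy) i j →
    schemeLHS D N (J * MHx) (J * MHy) α Uh 1 i j =
      lam D N α 1 1 * avg (J * MHx) (J * MHy) (newtonF D MHx MHy J f UH Uh 1) i j
        + avg (J * MHx) (J * MHy) (bterm D N (J * MHx) (J * MHy) α v₀ 1) i j
  later : ∀ n, 2 ≤ n → n ≤ N → ∀ i j, Interior (J * MHx) (J * MHy) i j →
    schemeLHS D N (J * MHx) (J * MHy) α Uh n i j =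
      lam D N α n n / 2 * avg (J * MHx) (J * MHy) (newtonF D MHx MHy J f UH Uh n) i j
        + ∑ k ∈ Finset.Ico 1 n,
            lamTilde D N α n k * avg (J * MHx) (J * MHy) (fun p q => f (Uh k p q)) i j
        + avg (J * MHx) (J * MHy) (bterm D N (J * MHx) (J * MHy) α v₀ n) i j
  values : HasInitialBoundaryValues D N (J * MHx) (J * MHy) u₀ Uh

end TwoGrid

end

open Set

noncomputable section

namespace TwoGrid

/-! ### Positivity of convex Toeplitz forms -/

section Toeplitz

variable {V : Type*} [AddCommGroup V] [Module ℝ V]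

/-! Write a for ᾱ, B for the integral of β_a, and F = Δu + f(u). Convolving the equation with β_a
and integrating in time gives B * F = g * (∂_t u - ū₀), because β_a * k = g (`integrated_equation`).
The scheme is the backward difference quotient of this identity, with both convolutions replaced by
quadrature on the cells.

The kernel g is tame because α'(0) = 0. Substituting s = tz shows that g(t) is the average, with a
Beta weight in z, of Φ(tz), where Φ(s) = s^(α(0)-α(s)) / Γ(2-α(s)). Since α(0) - α(s) = O(s²), Φ' is
bounded and Φ'' has only a logarithmic singularity (`regularPart_bounds`, `exists_isKernelBound`).

Stability is an energy argument with the test functions e^1 and (e^n + e^(n-1))/2. The weights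
λ_{n,j} depend only on n - j and are second differences of a power t^(a+1), the diagonal one being
halved. Doubling the diagonal gives a nonnegative, nonincreasing, convex sequence
(`powWeight_convex`); the Toeplitz form of such a sequence is positive (`toeplitz_form_nonneg`), so
the elliptic term can be dropped. The time difference telescopes, the memory term becomes a
lower-order term with summable coefficients after summation by parts (`memOp_eq`,
`sum_abs_memCoeff_le`), and a discrete Gronwall inequality finishes (`energy_stability`). In space,
averaging and compact Laplacian are represented by sums of squares (`massForm`, `stiffForm`).

Consistency in time cannot rest on second-order bounds at each level, because ∂_t²u blows up at t =
0. Instead each residual is bounded by τ Σ_k p_{n-k} q_k, where p collects weights and increments of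
kernel moduli and q collects increments of a modulus of the first time derivatives. Such increments
telescope, so both sequences have ℓ¹ norms bounded independently of τ, and Young's inequality for
convolutions gives τ Σ_n |r_n| = O(τ²), the quantity that the stability estimate asks for
(`memory_truncation`, `product_integration_truncation`, `sum_truncBound_le`). Quadrature defects
that are not products at first sight become products by `sum_mul_backDiff`. In space, Taylor
expansion gives fourth order.

The interpolation is a natural spline in disguise. By continuity the equation holds on the closed
rectangle (`pde_closed`). At a corner both second derivatives of u and the memory term vanish, so
f(0) = 0, and then the second normal derivative vanishes on every edge (`boundary_compatibility`).
Hence the prescribed end coefficients are zero, and the spline is linear in its data, of fourth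
order, and stable in the discrete L² norm.

Both grids are instances of one estimate, `scheme_error`, in which the source Φ at the current level
only has to satisfy |f(u) - Φ| ≤ Q_f |u - U| + |ω|. On the coarse grid ω = 0. On the fine grid the
Lipschitz bound of f gives ω = 2 Q_f (u - Π_H U_H), which is controlled by the interpolation error
and the coarse error. The coarse error therefore enters linearly, which accounts for H⁴ in the
result. -/

theorem card_common_window (m k i j : ℕ) (hi : i < m) :
    ((Finset.range (m + k)).filter
      (fun p => (i ≤ p ∧ p < i + k) ∧ (j ≤ p ∧ p < j + k))).card
      = k - (max i j - min i j) := by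
  have : (Finset.range (m + k)).filter (fun p => (i ≤ p ∧ p < i + k) ∧ (j ≤ p ∧ p < j + k))
      = Finset.Ico (max i j) (min i j + k) := by
    ext p
    simp only [Finset.mem_filter, Finset.mem_range, Finset.mem_Ico]
    omega
  rw [this, Nat.card_Ico]
  omega

/-- The positive part of k - |i - j| counts the integers common to the windows [i, i + k) and [j, j
+ k). Hence the form equals Σ_p B(y_p, y_p), where y_p adds up the x_i whose window contains p.
Truncated subtraction supplies the positive part. -/
theorem triangle_form_nonneg (B : LinearMap.BilinForm ℝ V) (hs : ∀ v, 0 ≤ B v v) (x : ℕ → V)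
    (m k : ℕ) :
    0 ≤ ∑ i ∈ Finset.range m, ∑ j ∈ Finset.range m,
      ((k - (max i j - min i j) : ℕ) : ℝ) * B (x i) (x j) := by
  let y : ℕ → V := fun p => ∑ i ∈ Finset.range m, (if i ≤ p ∧ p < i + k then (1 : ℝ) else 0) • x i
  have h : ∑ p ∈ Finset.range (m + k), B (y p) (y p) =
      ∑ i ∈ Finset.range m, ∑ j ∈ Finset.range m,
      ((k - (max i j - min i j) : ℕ) : ℝ) * B (x i) (x j) := by
    have : ∀ i ∈ Finset.range m, ∀ j ∈ Finset.range m,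
        ((k - (max i j - min i j) : ℕ) : ℝ) * B (x i) (x j)
        = ∑ p ∈ Finset.range (m + k), (if i ≤ p ∧ p < i + k then (1 : ℝ) else 0) *
          ((if j ≤ p ∧ p < j + k then (1 : ℝ) else 0) * B (x i) (x j)) := by
      intro i hi j hj
      rw [← card_common_window m k i j (Finset.mem_range.1 hi)]
      rw [Finset.card_filter]
      push_cast
      rw [Finset.sum_mul]
      refine Finset.sum_congr rfl fun p _ => ?_
      by_cases h1 : i ≤ p ∧ p < i + k <;> by_cases h2 : j ≤ p ∧ p < j + k <;> simp [h1, h2]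
    rw [Finset.sum_congr rfl fun i hi => Finset.sum_congr rfl (this i hi)]
    have hp : ∀ p, B (y p) (y p) = ∑ i ∈ Finset.range m, ∑ j ∈ Finset.range m,
        (if i ≤ p ∧ p < i + k then (1 : ℝ) else 0) *
          ((if j ≤ p ∧ p < j + k then (1 : ℝ) else 0) * B (x i) (x j)) := by
      intro p
      simp only [y, map_sum, LinearMap.sum_apply, map_smul, LinearMap.smul_apply, smul_eq_mul]
      simp only [Finset.mul_sum]
      rw [Finset.sum_comm]
      exact Finset.sum_congr rfl fun i _ => Finset.sum_congr rfl fun j _ => by ring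
    rw [Finset.sum_congr rfl fun p _ => hp p, Finset.sum_comm]
    exact Finset.sum_congr rfl fun i _ => Finset.sum_comm
  rw [← h]
  exact Finset.sum_nonneg fun p _ => hs _

/-- Two summations of the second difference: a sequence is a constant plus triangles, the latter
weighted by one first difference and by the second differences. This is the discrete form of Pólya's
criterion. -/
theorem convex_seq_expansion (b : ℕ → ℝ) (m d : ℕ) (hd : d ≤ m) :
    b d = b m + ((m - d : ℕ) : ℝ) * (b m - b (m + 1))
      + ∑ l ∈ Finset.range m, ((l + 1 - d : ℕ) : ℝ) * (b l - 2 * b (l + 1) + b (l + 2)) := by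
  induction m with
  | zero =>
    obtain rfl : d = 0 := by omega
    simp
  | succ m ih =>
    rcases Nat.lt_or_ge m d with h | h
    · obtain rfl : d = m + 1 := by omega
      have : ∑ l ∈ Finset.range (m + 1),
          ((l + 1 - (m + 1) : ℕ) : ℝ) * (b l - 2 * b (l + 1) + b (l + 2)) = 0 := by
        refine Finset.sum_eq_zero fun l hl => ?_
        have : l + 1 - (m + 1) = 0 := by have := Finset.mem_range.1 hl; omega
        rw [this]; simp
      rw [this]; simp
    · rw [Finset.sum_range_succ]
      have := ih h
      push_cast [h, Nat.cast_sub h, Nat.cast_sub (Nat.le_succ_of_le h)] at this ⊢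
      linear_combination this

/-- In the triangle expansion every coefficient is nonnegative, by positivity, monotonicity and
convexity of b respectively; the constant part contributes a multiple of B(Σ x_i, Σ x_i). -/
theorem toeplitz_form_nonneg (B : LinearMap.BilinForm ℝ V) (hs : ∀ v, 0 ≤ B v v) (x : ℕ → V)
    (b : ℕ → ℝ) (h0 : ∀ i, 0 ≤ b i) (h1 : ∀ i, b (i + 1) ≤ b i)
    (h2 : ∀ i, 0 ≤ b i - 2 * b (i + 1) + b (i + 2)) (m : ℕ) :
    0 ≤ ∑ i ∈ Finset.range m, ∑ j ∈ Finset.range m, b (max i j - min i j) * B (x i) (x j) := by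
  have key : ∑ i ∈ Finset.range m, ∑ j ∈ Finset.range m, b (max i j - min i j) * B (x i) (x j)
      = b m * B (∑ i ∈ Finset.range m, x i) (∑ i ∈ Finset.range m, x i)
        + (b m - b (m + 1)) * ∑ i ∈ Finset.range m, ∑ j ∈ Finset.range m,
          ((m - (max i j - min i j) : ℕ) : ℝ) * B (x i) (x j)
        + ∑ l ∈ Finset.range m, (b l - 2 * b (l + 1) + b (l + 2)) *
          ∑ i ∈ Finset.range m, ∑ j ∈ Finset.range m,
          ((l + 1 - (max i j - min i j) : ℕ) : ℝ) * B (x i) (x j) := by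
    have e1 : ∑ l ∈ Finset.range m, (b l - 2 * b (l + 1) + b (l + 2)) *
          ∑ i ∈ Finset.range m, ∑ j ∈ Finset.range m,
          ((l + 1 - (max i j - min i j) : ℕ) : ℝ) * B (x i) (x j)
        = ∑ i ∈ Finset.range m, ∑ j ∈ Finset.range m, ∑ l ∈ Finset.range m,
          ((l + 1 - (max i j - min i j) : ℕ) : ℝ) * (b l - 2 * b (l + 1) + b (l + 2))
            * B (x i) (x j) := by
      simp only [Finset.mul_sum]
      rw [Finset.sum_comm]
      refine Finset.sum_congr rfl fun i _ => ?_
      rw [Finset.sum_comm]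
      exact Finset.sum_congr rfl fun j _ => Finset.sum_congr rfl fun l _ => by ring
    rw [e1]
    simp only [map_sum, LinearMap.sum_apply]
    rw [Finset.sum_comm (f := fun i j => (B (x j)) (x i))]
    simp only [Finset.mul_sum]
    rw [← Finset.sum_add_distrib, ← Finset.sum_add_distrib]
    refine Finset.sum_congr rfl fun i hi => ?_
    rw [← Finset.sum_add_distrib, ← Finset.sum_add_distrib]
    refine Finset.sum_congr rfl fun j hj => ?_
    have hd : max i j - min i j ≤ m := by
      have := Finset.mem_range.1 hi; have := Finset.mem_range.1 hj; omega
    rw [convex_seq_expansion b m _ hd, ← Finset.sum_mul]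
    ring
  rw [key]
  have t1 := triangle_form_nonneg B hs x m m
  have t2 := fun l : ℕ => triangle_form_nonneg B hs x m (l + 1)
  have := h1 m
  refine add_nonneg (add_nonneg (mul_nonneg (h0 m) (hs _)) (mul_nonneg (by linarith) t1)) ?_
  exact Finset.sum_nonneg fun l _ => mul_nonneg (h2 l) (t2 l)

/-- A causal convolution tested against x itself is half of a symmetric Toeplitz form, provided the
diagonal weight is half of b 0. The product integration weights have exactly this halved diagonal.
-/
theorem toeplitz_lower_nonneg (B : LinearMap.BilinForm ℝ V) (hs : ∀ v, 0 ≤ B v v)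
    (hB : ∀ v w, B v w = B w v) (x : ℕ → V)
    (b l : ℕ → ℝ) (h0 : ∀ i, 0 ≤ b i) (h1 : ∀ i, b (i + 1) ≤ b i)
    (h2 : ∀ i, 0 ≤ b i - 2 * b (i + 1) + b (i + 2))
    (hl0 : 2 * l 0 = b 0) (hl : ∀ i, 1 ≤ i → l i = b i) (m : ℕ) :
    0 ≤ ∑ n ∈ Finset.range m, ∑ j ∈ Finset.range (n + 1), l (n - j) * B (x j) (x n) := by
  have key : 2 * ∑ n ∈ Finset.range m, ∑ j ∈ Finset.range (n + 1), l (n - j) * B (x j) (x n)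
      = ∑ i ∈ Finset.range m, ∑ j ∈ Finset.range m, b (max i j - min i j) * B (x i) (x j) := by
    induction m with
    | zero => simp
    | succ m ih =>
      rw [Finset.sum_range_succ, mul_add, ih, Finset.sum_range_succ _ m]
      simp only [Finset.sum_range_succ _ m, Finset.sum_add_distrib]
      have e1 : ∀ j ∈ Finset.range m, b (max m j - min m j) * B (x m) (x j)
          = l (m - j) * B (x j) (x m) := fun j hj => by
        have := Finset.mem_range.1 hj
        rw [max_eq_left this.le, min_eq_right this.le, hB, hl _ (by omega)]
      have e2 : ∀ j ∈ Finset.range m, b (max j m - min j m) * B (x j) (x m)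
          = l (m - j) * B (x j) (x m) := fun j hj => by
        have := Finset.mem_range.1 hj
        rw [max_eq_right this.le, min_eq_left this.le, hl _ (by omega)]
      rw [Finset.sum_congr rfl e1, Finset.sum_congr rfl e2]
      simp only [max_self, min_self, Nat.sub_self, ← hl0]
      ring
  have := toeplitz_form_nonneg B hs x b h0 h1 h2 m
  linarith

end Toeplitz

/-! ### The product integration weights of a power -/

/-- Second differences of `|x|^p` at the integers. -/
def powWeight (p : ℝ) (i : ℕ) : ℝ :=
  ((i : ℝ) + 1) ^ p - 2 * (i : ℝ) ^ p + |(i : ℝ) - 1| ^ p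

/-- The only index at which the absolute value in `powWeight` matters: the reflected point -1
contributes 1. -/
theorem powWeight_zero {p : ℝ} (hp : 1 < p) : powWeight p 0 = 2 := by
  have : (0 : ℝ) ^ p = 0 := Real.zero_rpow (by linarith)
  simp [powWeight, this]; norm_num

theorem midpoint_le_of_convexOn {s : Set ℝ} {f : ℝ → ℝ} (hf : ConvexOn ℝ s f) {x y z : ℝ}
    (hx : x ∈ s) (hy : y ∈ s) (hz : x + y = 2 * z) : 2 * f z ≤ f x + f y := by
  have h : f ((1 / 2 : ℝ) • x + (1 / 2 : ℝ) • y) ≤ (1 / 2 : ℝ) • f x + (1 / 2 : ℝ) • f y :=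
    hf.2 hx hy (by norm_num) (by norm_num) (by norm_num)
  simp only [smul_eq_mul] at h
  rw [show 1 / 2 * x + 1 / 2 * y = z by linarith] at h
  linarith

/-- `(x+1)^p - 2x^p + (x-1)^p` -/
def powSecond (p x : ℝ) : ℝ := (x + 1) ^ p - 2 * x ^ p + (x - 1) ^ p

theorem powWeight_succ (p : ℝ) (i : ℕ) : powWeight p (i + 1) = powSecond p (i + 1) := by
  simp [powWeight, powSecond]

theorem powSecond_continuousOn {p : ℝ} (hp : 1 < p) : ContinuousOn (powSecond p) (Ici 1) := by
  unfold powSecond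
  have : 0 ≤ p := by linarith
  exact (((continuous_id.add continuous_const).rpow_const fun _ => Or.inr this).sub
    (continuous_const.mul (continuous_id.rpow_const fun _ => Or.inr this))).add
    ((continuous_id.sub continuous_const).rpow_const fun _ => Or.inr this) |>.continuousOn

/-- Second differencing commutes with differentiation, so signs of second differences for the
exponents p - 1 and p - 2 decide monotonicity and convexity for the exponent p. -/
theorem powSecond_hasDerivAt (p : ℝ) {x : ℝ} (hx : 1 < x) :
    HasDerivAt (powSecond p) (p * powSecond (p - 1) x) x := by
  have h1 := ((hasDerivAt_id x).add_const 1).rpow_const (p := p) (Or.inl (by simp; linarith))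
  have h2 := (hasDerivAt_id x).rpow_const (p := p) (Or.inl (by simp; linarith))
  have h3 := ((hasDerivAt_id x).sub_const 1).rpow_const (p := p) (Or.inl (by simp; linarith))
  have := (h1.sub (h2.const_mul 2)).add h3
  refine this.congr_deriv ?_
  simp only [powSecond, id]; ring

/-- Convexity of x^q on the positive half-line, since q (q - 1) ≥ 0; applied with q = p - 2. -/
theorem rpow_midpoint_le_of_neg {q : ℝ} (hq : q ≤ 0) {x : ℝ} (hx : 1 < x) :
    0 ≤ powSecond q x := by
  have hcv : ConvexOn ℝ (Ioi 0) (fun x : ℝ => x ^ q) := by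
    refine convexOn_of_deriv2_nonneg' (convex_Ioi 0) ?_ ?_ ?_
    · exact fun y hy => (Real.differentiableAt_rpow_const_of_ne q (ne_of_gt hy)).differentiableWithinAt
    · have : ∀ y ∈ Ioi (0 : ℝ), deriv (fun x : ℝ => x ^ q) y = q * y ^ (q - 1) :=
        fun y hy => Real.deriv_rpow_const _ _ 
      refine DifferentiableOn.congr (fun y hy => ?_) this
      exact ((Real.differentiableAt_rpow_const_of_ne (q - 1) (ne_of_gt hy)).const_mul q).differentiableWithinAt
    · intro y hy
      have hy : 0 < y := hy
      have : (deriv^[2] fun x : ℝ => x ^ q) y = q * (q - 1) * y ^ (q - 2) := by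
        simp only [Function.iterate_succ, Function.iterate_zero, Function.comp, id]
        have : deriv (fun x : ℝ => x ^ q) = fun y => q * y ^ (q - 1) := by
          ext y; exact Real.deriv_rpow_const _ _
        rw [this, deriv_const_mul_field, Real.deriv_rpow_const]
        ring_nf
      rw [this]
      exact mul_nonneg (by nlinarith) (Real.rpow_nonneg hy.le _)
  have := midpoint_le_of_convexOn hcv (x := x + 1) (y := x - 1) (z := x)
    (by simp; linarith) (by simp; linarith) (by ring)
  unfold powSecond; linarith

theorem powSecond_nonpos {q : ℝ} (hq0 : 0 ≤ q) (hq1 : q ≤ 1) {x : ℝ} (hx : 1 < x) :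
    powSecond q x ≤ 0 := by
  have := midpoint_le_of_convexOn (Real.concaveOn_rpow hq0 hq1).neg (x := x + 1) (y := x - 1)
    (z := x) (by simp; linarith) (by simp; linarith) (by ring)
  simp only [Pi.neg_apply] at this
  unfold powSecond; linarith

theorem powSecond_nonneg {p : ℝ} (hp : 1 ≤ p) {x : ℝ} (hx : 1 ≤ x) : 0 ≤ powSecond p x := by
  have := midpoint_le_of_convexOn (convexOn_rpow hp) (x := x + 1) (y := x - 1) (z := x)
    (by simp; linarith) (by simp; linarith) (by ring)
  unfold powSecond; linarith

theorem powSecond_antitoneOn {p : ℝ} (h1 : 1 < p) (h2 : p < 2) :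
    AntitoneOn (powSecond p) (Ici 1) := by
  refine antitoneOn_of_deriv_nonpos (convex_Ici 1) (powSecond_continuousOn h1) ?_ ?_
  · intro x hx
    rw [interior_Ici] at hx
    exact (powSecond_hasDerivAt p hx).differentiableAt.differentiableWithinAt
  · intro x hx
    rw [interior_Ici] at hx
    rw [(powSecond_hasDerivAt p hx).deriv]
    exact mul_nonpos_of_nonneg_of_nonpos (by linarith)
      (powSecond_nonpos (by linarith) (by linarith) hx)

theorem powSecond_convexOn {p : ℝ} (h1 : 1 < p) (h2 : p < 2) :
    ConvexOn ℝ (Ici 1) (powSecond p) := by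
  have hd : ∀ x ∈ interior (Ici (1 : ℝ)), HasDerivAt (deriv (powSecond p))
      (p * ((p - 1) * powSecond (p - 1 - 1) x)) x := by
    intro x hx
    rw [interior_Ici] at hx
    refine ((powSecond_hasDerivAt (p - 1) hx).const_mul p).congr_of_eventuallyEq ?_
    filter_upwards [Ioi_mem_nhds hx] with y hy
    exact (powSecond_hasDerivAt p hy).deriv
  refine convexOn_of_deriv2_nonneg (convex_Ici 1) (powSecond_continuousOn h1) ?_ ?_ ?_
  · intro x hx
    rw [interior_Ici] at hx
    exact (powSecond_hasDerivAt p hx).differentiableAt.differentiableWithinAt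
  · exact fun x hx => (hd x hx).differentiableAt.differentiableWithinAt
  · intro x hx
    simp only [Function.iterate_succ, Function.iterate_zero, Function.comp, id]
    rw [(hd x hx).deriv]
    rw [interior_Ici] at hx
    exact mul_nonneg (by linarith) (mul_nonneg (by linarith)
      (rpow_midpoint_le_of_neg (by linarith) hx))

/-- This is convexity of the weights at i = 0, where the value 2 is not covered by calculus on [1,
∞). Equality holds at p = 2. After division by 2^p, both exponentials are bounded below by their
tangents at p = 2, and the comparison of slopes reduces to 9 log(3/2) ≤ 7 log 2. -/
theorem four_mul_two_rpow_le {p : ℝ} (h2 : p ≤ 2) : 4 * (2 : ℝ) ^ p ≤ (3 : ℝ) ^ p + 7 := by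
  have e1 : (3 / 2 : ℝ) ^ p = 9 / 4 * Real.exp (Real.log (3 / 2) * (p - 2)) := by
    rw [Real.rpow_def_of_pos (by norm_num), mul_sub, Real.exp_sub,
      mul_comm (Real.log (3 / 2)) 2, ← Real.log_rpow (by norm_num), Real.exp_log (by positivity)]
    norm_num; ring
  have e2 : ((2 : ℝ) ^ p)⁻¹ = 1 / 4 * Real.exp (-Real.log 2 * (p - 2)) := by
    rw [Real.rpow_def_of_pos (by norm_num), ← Real.exp_neg,
      show -(Real.log 2 * p) = -Real.log 2 * (p - 2) + -(2 * Real.log 2) by ring, Real.exp_add,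
      ← neg_mul, mul_comm _ (Real.log 2), ← Real.rpow_def_of_pos (by norm_num : (0 : ℝ) < 2)]
    norm_num; ring
  have l1 := Real.add_one_le_exp (Real.log (3 / 2) * (p - 2))
  have l2 := Real.add_one_le_exp (-Real.log 2 * (p - 2))
  have l3 : 9 * Real.log (3 / 2) ≤ 7 * Real.log 2 := by
    have := Real.log_le_log (by norm_num : (0 : ℝ) < (3 / 2) ^ 9)
      (by norm_num : ((3 : ℝ) / 2) ^ 9 ≤ 2 ^ 7)
    rw [Real.log_pow, Real.log_pow] at this
    exact_mod_cast this
  have l4 : 4 ≤ (3 / 2 : ℝ) ^ p + 7 * ((2 : ℝ) ^ p)⁻¹ := by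
    rw [e1, e2]
    nlinarith
  have hpos : 0 < (2 : ℝ) ^ p := by positivity
  rw [Real.div_rpow (by norm_num) (by norm_num)] at l4
  have := mul_le_mul_of_nonneg_right l4 hpos.le
  field_simp at this
  linarith

theorem powWeight_nonneg {p : ℝ} (h1 : 1 < p) (i : ℕ) : 0 ≤ powWeight p i := by
  cases i with
  | zero => rw [powWeight_zero h1]; norm_num
  | succ i =>
    rw [powWeight_succ]
    exact powSecond_nonneg h1.le (by linarith [Nat.cast_nonneg (α := ℝ) i])

theorem powSecond_one {p : ℝ} (h1 : 1 < p) : powSecond p 1 = 2 ^ p - 2 := by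
  have : (0 : ℝ) ^ p = 0 := Real.zero_rpow (by linarith)
  simp [powSecond, this]; norm_num

theorem powWeight_antitone {p : ℝ} (h1 : 1 < p) (h2 : p < 2) (i : ℕ) :
    powWeight p (i + 1) ≤ powWeight p i := by
  cases i with
  | zero =>
    rw [powWeight_zero h1, powWeight_succ]
    simp only [Nat.cast_zero, zero_add, powSecond_one h1]
    have : (2 : ℝ) ^ p ≤ 2 ^ (2 : ℝ) := Real.rpow_le_rpow_of_exponent_le (by norm_num) h2.le
    norm_num at this
    linarith
  | succ i =>
    rw [powWeight_succ, powWeight_succ]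
    have := Nat.cast_nonneg (α := ℝ) i
    exact powSecond_antitoneOn h1 h2 (by simp) (by simp; linarith) (by push_cast; linarith)

theorem powWeight_convex {p : ℝ} (h1 : 1 < p) (h2 : p < 2) (i : ℕ) :
    0 ≤ powWeight p i - 2 * powWeight p (i + 1) + powWeight p (i + 2) := by
  cases i with
  | zero =>
    rw [powWeight_zero h1, powWeight_succ, powWeight_succ]
    have h := four_mul_two_rpow_le h2.le
    simp only [Nat.cast_zero, zero_add, powSecond_one h1]
    simp only [powSecond]
    norm_num
    linarith
  | succ i =>
    rw [powWeight_succ, powWeight_succ, powWeight_succ]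
    have := Nat.cast_nonneg (α := ℝ) i
    have := midpoint_le_of_convexOn (powSecond_convexOn h1 h2) (x := (i : ℝ) + 1)
      (y := (i : ℝ) + 2 + 1) (z := ((i + 1 : ℕ) : ℝ) + 1) (by simp)
      (by simp; linarith) (by push_cast; ring)
    push_cast at *
    linarith

end TwoGrid
end


noncomputable section

namespace TwoGrid

/-! ### Stability of the averaged product integration scheme -/

section Stability

variable {V : Type*} [AddCommGroup V] [Module ℝ V]

/-- The seminorm of a positive semidefinite form. -/
def formNorm (A : LinearMap.BilinForm ℝ V) (v : V) : ℝ := Real.sqrt (A v v)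

theorem formNorm_nonneg (A : LinearMap.BilinForm ℝ V) (v : V) : 0 ≤ formNorm A v :=
  Real.sqrt_nonneg _

theorem formNorm_sq {A : LinearMap.BilinForm ℝ V} (hs : ∀ v, 0 ≤ A v v) (v : V) :
    formNorm A v ^ 2 = A v v := Real.sq_sqrt (hs v)

theorem abs_form_le {A : LinearMap.BilinForm ℝ V} (hs : ∀ v, 0 ≤ A v v)
    (hA : ∀ v w, A v w = A w v) (v w : V) : |A v w| ≤ formNorm A v * formNorm A w := by
  refine abs_le_of_sq_le_sq ?_ (mul_nonneg (formNorm_nonneg A v) (formNorm_nonneg A w))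
  rw [mul_pow, formNorm_sq hs, formNorm_sq hs]
  exact A.apply_sq_le_of_symm hs ⟨fun x y => hA x y⟩ v w

/-- The values used as test functions: `e^1` and `(e^n + e^{n-1})/2` for `n ≥ 2`. -/
def midValue (e : ℕ → V) (n : ℕ) : V :=
  if n = 1 then e 1 else (1 / 2 : ℝ) • (e n + e (n - 1))

theorem formNorm_midValue_le {A : LinearMap.BilinForm ℝ V} (hs : ∀ v, 0 ≤ A v v)
    (hA : ∀ v w, A v w = A w v) (e : ℕ → V) {M : ℝ} {m n : ℕ} (h1 : 1 ≤ n) (hn : n ≤ m)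
    (hM : ∀ k ≤ m, formNorm A (e k) ≤ M) : formNorm A (midValue e n) ≤ M := by
  unfold midValue
  split_ifs with h
  · exact hM 1 (by omega)
  have hM0 : 0 ≤ M := (formNorm_nonneg A _).trans (hM n hn)
  refine abs_le_of_sq_le_sq' ?_ hM0 |>.2
  rw [formNorm_sq hs]
  have a1 := hM n hn
  have a2 := hM (n - 1) (by omega)
  have a3 := abs_le.1 (abs_form_le hs hA (e n) (e (n - 1)))
  have b1 := formNorm_sq hs (e n)
  have b2 := formNorm_sq hs (e (n - 1))
  have n1 := formNorm_nonneg A (e n)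
  have n2 := formNorm_nonneg A (e (n - 1))
  simp only [map_add, map_smul, LinearMap.add_apply, LinearMap.smul_apply, smul_eq_mul]
  rw [hA (e (n - 1)) (e n), ← b1, ← b2]
  have c1 := mul_self_le_mul_self n1 a1
  have c2 := mul_self_le_mul_self n2 a2
  have c3 := mul_le_mul a1 a2 n2 hM0
  nlinarith [a3.2]

/-- A discrete Gronwall inequality. -/
theorem discrete_gronwall {E : ℕ → ℝ} {c R : ℝ} (hc : 0 ≤ c) (m : ℕ)
    (h : ∀ n ≤ m, E n ≤ R + c * ∑ k ∈ Finset.range n, E k) :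
    ∀ n ≤ m, E n ≤ R * (1 + c) ^ n := by
  -- The induction runs on the right-hand side of the hypothesis, which dominates E n and grows at
  -- most by the factor 1 + c per step.
  have key : ∀ n ≤ m, R + c * ∑ k ∈ Finset.range n, E k ≤ R * (1 + c) ^ n := by
    intro n
    induction n with
    | zero => simp
    | succ n ih =>
      intro hn
      have h1 := ih (by omega)
      have h2 := h n (by omega)
      rw [Finset.sum_range_succ, pow_succ]
      nlinarith
  exact fun n hn => (h n hn).trans (key n hn)

/-- A(e_n - e_{n-1}, e_n + e_{n-1}) telescopes. The first step is tested with e_1 rather than with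
an average, which leaves an additional A(e_1, e_1), harmless because of its sign. -/
theorem energy_identity {A : LinearMap.BilinForm ℝ V}
    (hA : ∀ v w, A v w = A w v) (e : ℕ → V) (he : e 0 = 0) {τ : ℝ} (hτ : τ ≠ 0) (m : ℕ)
    (hm : 1 ≤ m) :
    2 * τ * ∑ n ∈ Finset.Icc 1 m, A (τ⁻¹ • (e n - e (n - 1))) (midValue e n)
      = A (e m) (e m) + A (e 1) (e 1) := by
  induction m, hm using Nat.le_induction with
  | base =>
    simp only [Finset.Icc_self, Finset.sum_singleton, midValue, he, Nat.sub_self, sub_zero,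
      if_true, map_smul, LinearMap.smul_apply, smul_eq_mul]
    field_simp
    ring
  | succ m hm ih =>
    rw [Finset.sum_Icc_succ_top (by omega), mul_add, ih, midValue, if_neg (by omega)]
    simp only [Nat.add_sub_cancel, map_smul, map_sub, map_add, LinearMap.smul_apply,
      LinearMap.sub_apply, smul_eq_mul]
    rw [hA (e m) (e (m + 1))]
    field_simp
    ring

/-- Stability: discrete energy estimate for the averaged product integration rule with a memory
term and a Lipschitz perturbation. -/
theorem energy_stability {A L : LinearMap.BilinForm ℝ V} (hs : ∀ v, 0 ≤ A v v)
    (hA : ∀ v w, A v w = A w v) (hLs : ∀ v, 0 ≤ L v v) (hL : ∀ v w, L v w = L w v)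
    (b l : ℕ → ℝ) (h0 : ∀ i, 0 ≤ b i) (h1 : ∀ i, b (i + 1) ≤ b i)
    (h2 : ∀ i, 0 ≤ b i - 2 * b (i + 1) + b (i + 2))
    (hl0 : 2 * l 0 = b 0) (hl : ∀ i, 1 ≤ i → l i = b i)
    (e : ℕ → V) (he : e 0 = 0) {τ c₀ K : ℝ} (hτ : 0 < τ) (hc : 1 / 2 ≤ c₀) (hK : 0 ≤ K)
    (hKτ : 8 * K * τ ≤ 1) (N : ℕ) (q : ℕ → ℕ → ℝ) (r : ℕ → ℝ) (hr : ∀ n, 0 ≤ r n)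
    (hq : ∀ k ≤ N, ∑ n ∈ Finset.Icc k N, q n k ≤ K) (hq0 : ∀ n k, 0 ≤ q n k)
    (heq : ∀ n, 1 ≤ n → n ≤ N →
      c₀ * A (τ⁻¹ • (e n - e (n - 1))) (midValue e n)
        + ∑ j ∈ Finset.Icc 1 n, l (n - j) * L (midValue e j) (midValue e n)
      ≤ (∑ k ∈ Finset.Icc 1 n, q n k * formNorm A (e k) + r n) * formNorm A (midValue e n)) :
    ∀ n ≤ N, formNorm A (e n) ≤
      8 * (τ * ∑ n ∈ Finset.Icc 1 N, r n) * Real.exp (8 * K * (N * τ)) := by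
  have he0 : formNorm A (e 0) = 0 := by simp [formNorm, he]
  set R := τ * ∑ n ∈ Finset.Icc 1 N, r n with hR
  have hR0 : 0 ≤ R := mul_nonneg hτ.le (Finset.sum_nonneg fun _ _ => hr _)
  -- the basic inequality
  have basic : ∀ m ≤ N, ∀ M : ℝ, (∀ k ≤ m, formNorm A (e k) ≤ M) →
      formNorm A (e m) ^ 2 ≤ 4 * (τ * K * ∑ k ∈ Finset.Icc 1 m, formNorm A (e k) + R) * M := by
    intro m hm M hM
    have hM0 : 0 ≤ M := (formNorm_nonneg A _).trans (hM 0 (by omega))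
    rcases Nat.eq_zero_or_pos m with rfl | hm1
    · rw [he0]
      simp only [Finset.Icc_eq_empty_of_lt (by norm_num : 0 < 1), Finset.sum_empty]
      have : 0 ≤ R * M := mul_nonneg hR0 hM0
      linarith
    -- Summed over n, the elliptic term is nonnegative and can be dropped.
    have pos : 0 ≤ ∑ n ∈ Finset.Icc 1 m, ∑ j ∈ Finset.Icc 1 n,
        l (n - j) * L (midValue e j) (midValue e n) := by
      have := toeplitz_lower_nonneg L hLs hL (fun i => midValue e (i + 1)) b l h0 h1 h2 hl0 hl m
      rw [Finset.range_eq_Ico] at this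
      simp only [Finset.range_eq_Ico] at this
      have e1 : ∀ F : ℕ → ℝ, ∀ k, ∑ n ∈ Finset.Icc 1 k, F n = ∑ n ∈ Finset.Ico 0 k, F (n + 1) := by
        intro F k
        rw [← Finset.Ico_succ_right_eq_Icc, Finset.sum_Ico_add' F 0 k 1]
        simp
      rw [e1]
      simp only [e1]
      simpa using this
    have s1 : ∑ n ∈ Finset.Icc 1 m, c₀ * A (τ⁻¹ • (e n - e (n - 1))) (midValue e n)
        ≤ ∑ n ∈ Finset.Icc 1 m, (∑ k ∈ Finset.Icc 1 n, q n k * formNorm A (e k) + r n) * M := by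
      have := Finset.sum_le_sum (s := Finset.Icc 1 m) fun n hn =>
        heq n (Finset.mem_Icc.1 hn).1 ((Finset.mem_Icc.1 hn).2.trans hm)
      rw [Finset.sum_add_distrib] at this
      have h3 : ∑ n ∈ Finset.Icc 1 m, (∑ k ∈ Finset.Icc 1 n, q n k * formNorm A (e k) + r n)
          * formNorm A (midValue e n) ≤
          ∑ n ∈ Finset.Icc 1 m, (∑ k ∈ Finset.Icc 1 n, q n k * formNorm A (e k) + r n) * M := by
        refine Finset.sum_le_sum fun n hn => mul_le_mul_of_nonneg_left ?_ ?_
        · exact formNorm_midValue_le hs hA e (Finset.mem_Icc.1 hn).1 (Finset.mem_Icc.1 hn).2 hM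
        · exact add_nonneg (Finset.sum_nonneg fun k _ => mul_nonneg (hq0 _ _)
            (formNorm_nonneg _ _)) (hr n)
      linarith
    rw [← Finset.mul_sum, ← Finset.sum_mul] at s1
    have s2 := energy_identity hA e he hτ.ne' m hm1
    -- Exchanging the order of summation leaves the column sums of q, which K bounds.
    have s3 : ∑ n ∈ Finset.Icc 1 m, (∑ k ∈ Finset.Icc 1 n, q n k * formNorm A (e k) + r n)
        ≤ K * ∑ k ∈ Finset.Icc 1 m, formNorm A (e k) + ∑ n ∈ Finset.Icc 1 N, r n := by
      rw [Finset.sum_add_distrib]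
      refine add_le_add ?_ (Finset.sum_le_sum_of_subset_of_nonneg
        (Finset.Icc_subset_Icc_right hm) fun _ _ _ => hr _)
      rw [Finset.sum_comm' (t' := Finset.Icc 1 m) (s' := fun k => Finset.Icc k m)
        (by intro x y; simp only [Finset.mem_Icc]; omega), Finset.mul_sum]
      refine Finset.sum_le_sum fun k hk => ?_
      rw [← Finset.sum_mul]
      refine mul_le_mul_of_nonneg_right ?_ (formNorm_nonneg _ _)
      refine le_trans ?_ (hq k ((Finset.mem_Icc.1 hk).2.trans hm))
      exact Finset.sum_le_sum_of_subset_of_nonneg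
        (Finset.Icc_subset_Icc_right hm) fun _ _ _ => hq0 _ _
    have s4 := mul_le_mul_of_nonneg_right s3 hM0
    have s5 := hs (e 1)
    have s6 := hs (e m)
    rw [formNorm_sq hs]
    set S := ∑ n ∈ Finset.Icc 1 m, A (τ⁻¹ • (e n - e (n - 1))) (midValue e n)
    have s7 : A (e m) (e m) ≤ 2 * τ * S := by linarith
    -- The sign of S is needed before c₀ may be replaced by its lower bound 1/2.
    have hS0 : 0 ≤ S := by
      by_contra hneg
      push Not at hneg
      have := mul_pos hτ (neg_pos.2 hneg)
      linarith
    have s8 : 1 / 2 * S ≤ c₀ * S := mul_le_mul_of_nonneg_right hc hS0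
    have s9 : S ≤ 2 * ((K * ∑ k ∈ Finset.Icc 1 m, formNorm A (e k)
      + ∑ n ∈ Finset.Icc 1 N, r n) * M) := by linarith
    have s10 := mul_le_mul_of_nonneg_left s9 hτ.le
    rw [hR]
    linarith
  -- running maxima
  let E : ℕ → ℝ := fun m => (Finset.range (m + 1)).sup' ⟨0, by simp⟩ fun k => formNorm A (e k)
  have hE : ∀ k m, k ≤ m → formNorm A (e k) ≤ E m := fun k m h =>
    Finset.le_sup' (fun k => formNorm A (e k)) (by simp; omega)
  have hE0 : ∀ m, 0 ≤ E m := fun m => (formNorm_nonneg A _).trans (hE 0 m (by omega))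
  -- At an index where the running maximum is attained, the basic inequality reads E² ≤ 4 (...) E.
  -- After division by E the term 4 τ K E is at most E / 2, by 8 K τ ≤ 1; absorbing it doubles the
  -- constants.
  have hEb : ∀ m ≤ N, E m ≤ 8 * R + 8 * K * τ * ∑ k ∈ Finset.range m, E k := by
    intro m hm
    obtain ⟨m', hm', hEm⟩ := Finset.exists_mem_eq_sup' (s := Finset.range (m + 1)) ⟨0, by simp⟩
      fun k => formNorm A (e k)
    have hm'' : m' ≤ m := by have := Finset.mem_range.1 hm'; omega
    change E m = _ at hEm
    have h3 := basic m' (by omega) (E m) fun k hk => hE k m (by omega)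
    rw [← hEm] at h3
    rcases (hE0 m).eq_or_lt with h4 | h4
    · rw [← h4]
      have : 0 ≤ ∑ k ∈ Finset.range m, E k := Finset.sum_nonneg fun _ _ => hE0 _
      positivity
    have h5 : E m ≤ 4 * (τ * K * ∑ k ∈ Finset.Icc 1 m', formNorm A (e k) + R) := by
      refine le_of_mul_le_mul_right ?_ h4
      linarith
    have h6 : ∑ k ∈ Finset.Icc 1 m', formNorm A (e k) ≤ ∑ k ∈ Finset.range m, E k + E m := by
      rw [← Finset.sum_range_succ]
      calc _ ≤ ∑ k ∈ Finset.range (m + 1), formNorm A (e k) :=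
            Finset.sum_le_sum_of_subset_of_nonneg (fun k hk => by
              simp only [Finset.mem_Icc, Finset.mem_range] at hk ⊢; omega)
              fun _ _ _ => formNorm_nonneg _ _
        _ ≤ _ := Finset.sum_le_sum fun k _ => hE k k le_rfl
    have h7 := mul_le_mul_of_nonneg_left h6 (mul_nonneg hτ.le hK)
    have h8 := mul_le_mul_of_nonneg_right hKτ (hE0 m)
    linarith
  intro n hn
  have h3 := discrete_gronwall (by positivity) N hEb n hn
  refine (hE n n le_rfl).trans (h3.trans ?_)
  refine mul_le_mul_of_nonneg_left ?_ (by positivity)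
  calc (1 + 8 * K * τ) ^ n ≤ Real.exp (8 * K * τ) ^ n := by
        refine pow_le_pow_left₀ (by positivity) ?_ n
        linarith [Real.add_one_le_exp (8 * K * τ)]
    _ = Real.exp (n * (8 * K * τ)) := by rw [← Real.exp_nat_mul]
    _ ≤ _ := by
      refine Real.exp_le_exp.2 ?_
      have : (n : ℝ) ≤ N := by exact_mod_cast hn
      have := mul_le_mul_of_nonneg_right this (by positivity : 0 ≤ 8 * K * τ)
      linarith

end Stability

end TwoGrid
end


noncomputable section

namespace TwoGrid

/-! ### Summation by parts in space -/

theorem sum_range_eq_Ico_of_zero {F : ℕ → ℝ} (h : F 0 = 0) (M : ℕ) :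
    ∑ i ∈ Finset.range M, F i = ∑ i ∈ Finset.Ico 1 M, F i := by
  rcases Nat.eq_zero_or_pos M with rfl | hM
  · simp
  · rw [Finset.range_eq_Ico, Finset.sum_eq_sum_Ico_succ_bot hM, h, zero_add]

theorem sum_range_succ_eq_Ico_of_zero {F : ℕ → ℝ} {M : ℕ} (h : F M = 0) :
    ∑ i ∈ Finset.range M, F (i + 1) = ∑ i ∈ Finset.Ico 1 M, F i := by
  rcases Nat.eq_zero_or_pos M with rfl | hM
  · simp
  · obtain ⟨m, rfl⟩ : ∃ m, M = m + 1 := ⟨M - 1, by omega⟩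
    rw [Finset.sum_range_succ, h, add_zero, Finset.sum_Ico_eq_sum_range]
    simp [add_comm]

/-- The stencil (1, 10, 1) is 8 times the identity plus (1, 2, 1), and (1, 2, 1) is the sum over
edges composed with its adjoint. Only b has to vanish at the ends. -/
theorem sum_avg_mul (a b : ℕ → ℝ) {M : ℕ} (h0 : b 0 = 0) (hM : b M = 0) :
    ∑ i ∈ Finset.Ico 1 M, (a (i - 1) + 10 * a i + a (i + 1)) / 12 * b i =
      (8 * ∑ i ∈ Finset.Ico 1 M, a i * b i
        + ∑ i ∈ Finset.range M, (a i + a (i + 1)) * (b i + b (i + 1))) / 12 := by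
  have e1 := sum_range_eq_Ico_of_zero (F := fun i => a i * b i) (by simp [h0]) M
  have e2 := sum_range_succ_eq_Ico_of_zero (F := fun i => a i * b i) (M := M) (by simp [hM])
  have e3 := sum_range_succ_eq_Ico_of_zero (F := fun i => a (i - 1) * b i) (M := M) (by simp [hM])
  have e4 := sum_range_eq_Ico_of_zero (F := fun i => a (i + 1) * b i) (by simp [h0]) M
  simp only [Nat.add_sub_cancel] at e3
  have e5 : ∑ i ∈ Finset.range M, (a i + a (i + 1)) * (b i + b (i + 1)) =
      ∑ i ∈ Finset.Ico 1 M, a i * b i + ∑ i ∈ Finset.Ico 1 M, a i * b i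
      + ∑ i ∈ Finset.Ico 1 M, a (i - 1) * b i + ∑ i ∈ Finset.Ico 1 M, a (i + 1) * b i := by
    rw [← e4, ← e3]
    nth_rewrite 1 [← e1]
    rw [← e2, ← Finset.sum_add_distrib, ← Finset.sum_add_distrib, ← Finset.sum_add_distrib]
    exact Finset.sum_congr rfl fun i _ => by ring
  rw [e5, Finset.mul_sum, ← Finset.sum_add_distrib, ← Finset.sum_add_distrib,
    ← Finset.sum_add_distrib, ← Finset.sum_add_distrib, Finset.sum_div]
  exact Finset.sum_congr rfl fun i _ => by ring

theorem sum_second_mul (a b : ℕ → ℝ) {M : ℕ} (h0 : b 0 = 0) (hM : b M = 0) :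
    ∑ i ∈ Finset.Ico 1 M, (a (i + 1) - 2 * a i + a (i - 1)) * b i =
      -∑ i ∈ Finset.range M, (a (i + 1) - a i) * (b (i + 1) - b i) := by
  have e1 := sum_range_eq_Ico_of_zero (F := fun i => a i * b i) (by simp [h0]) M
  have e2 := sum_range_succ_eq_Ico_of_zero (F := fun i => a i * b i) (M := M) (by simp [hM])
  have e3 := sum_range_succ_eq_Ico_of_zero (F := fun i => a (i - 1) * b i) (M := M) (by simp [hM])
  have e4 := sum_range_eq_Ico_of_zero (F := fun i => a (i + 1) * b i) (by simp [h0]) M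
  simp only [Nat.add_sub_cancel] at e3
  have e5 : ∑ i ∈ Finset.range M, (a (i + 1) - a i) * (b (i + 1) - b i) =
      ∑ i ∈ Finset.Ico 1 M, a i * b i + ∑ i ∈ Finset.Ico 1 M, a i * b i
      - ∑ i ∈ Finset.Ico 1 M, a (i - 1) * b i - ∑ i ∈ Finset.Ico 1 M, a (i + 1) * b i := by
    rw [← e4, ← e3]
    nth_rewrite 1 [← e1]
    rw [← e2, ← Finset.sum_add_distrib, ← Finset.sum_sub_distrib, ← Finset.sum_sub_distrib]
    exact Finset.sum_congr rfl fun i _ => by ring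
  rw [e5, ← Finset.sum_add_distrib, ← Finset.sum_sub_distrib, ← Finset.sum_sub_distrib,
    ← Finset.sum_neg_distrib]
  exact Finset.sum_congr rfl fun i _ => by ring

/-! ### The mass and the stiffness form -/

section Squares

variable {V : Type*} [AddCommGroup V] [Module ℝ V]

/-- The form `∑ ℓ_{ij} ⊗ ℓ_{ij}`. -/
def squareForm (s t : Finset ℕ) (ℓ : ℕ → ℕ → V →ₗ[ℝ] ℝ) : LinearMap.BilinForm ℝ V :=
  ∑ i ∈ s, ∑ j ∈ t, LinearMap.BilinForm.linMulLin (ℓ i j) (ℓ i j)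

theorem squareForm_apply (s t : Finset ℕ) (ℓ : ℕ → ℕ → V →ₗ[ℝ] ℝ) (v w : V) :
    squareForm s t ℓ v w = ∑ i ∈ s, ∑ j ∈ t, ℓ i j v * ℓ i j w := by
  simp [squareForm, LinearMap.sum_apply]

theorem squareForm_nonneg (s t : Finset ℕ) (ℓ : ℕ → ℕ → V →ₗ[ℝ] ℝ) (v : V) :
    0 ≤ squareForm s t ℓ v v := by
  rw [squareForm_apply]
  exact Finset.sum_nonneg fun _ _ => Finset.sum_nonneg fun _ _ => mul_self_nonneg _

theorem squareForm_symm (s t : Finset ℕ) (ℓ : ℕ → ℕ → V →ₗ[ℝ] ℝ) (v w : V) :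
    squareForm s t ℓ v w = squareForm s t ℓ w v := by
  simp only [squareForm_apply, mul_comm]

end Squares

/-- Evaluation of a grid function. -/
def ev (i j : ℕ) : (ℕ → ℕ → ℝ) →ₗ[ℝ] ℝ := (LinearMap.proj j) ∘ₗ (LinearMap.proj i)

@[simp] theorem ev_apply (i j : ℕ) (v : ℕ → ℕ → ℝ) : ev i j v = v i j := rfl

/-- The mass form `(A v, w)`. -/
def massForm (D : Cylinder) (Mx My : ℕ) : LinearMap.BilinForm ℝ (ℕ → ℕ → ℝ) :=
  (stepX D Mx * stepY D My / 144) •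
    ((64 : ℝ) • squareForm (Finset.Ico 1 Mx) (Finset.Ico 1 My) ev
    + (8 : ℝ) • squareForm (Finset.Ico 1 Mx) (Finset.range My) (fun i j => ev i j + ev i (j + 1))
    + (8 : ℝ) • squareForm (Finset.range Mx) (Finset.Ico 1 My) (fun i j => ev i j + ev (i + 1) j)
    + squareForm (Finset.range Mx) (Finset.range My)
        (fun i j => ev i j + ev (i + 1) j + (ev i (j + 1) + ev (i + 1) (j + 1))))

/-- The stiffness form `-(Λ v, w)`. -/
def stiffForm (D : Cylinder) (Mx My : ℕ) : LinearMap.BilinForm ℝ (ℕ → ℕ → ℝ) :=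
  (stepX D Mx * stepY D My / 12) •
    ((1 / stepX D Mx ^ 2) •
      ((8 : ℝ) • squareForm (Finset.range Mx) (Finset.Ico 1 My) (fun i j => ev (i + 1) j - ev i j)
      + squareForm (Finset.range Mx) (Finset.range My)
        (fun i j => ev (i + 1) j - ev i j + (ev (i + 1) (j + 1) - ev i (j + 1))))
    + (1 / stepY D My ^ 2) •
      ((8 : ℝ) • squareForm (Finset.Ico 1 Mx) (Finset.range My) (fun i j => ev i (j + 1) - ev i j)
      + squareForm (Finset.range Mx) (Finset.range My)
        (fun i j => ev i (j + 1) - ev i j + (ev (i + 1) (j + 1) - ev (i + 1) j))))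

theorem stepX_nonneg (D : Cylinder) (M : ℕ) : 0 ≤ stepX D M :=
  div_nonneg (sub_nonneg.2 D.hx.le) (Nat.cast_nonneg _)

theorem stepY_nonneg (D : Cylinder) (M : ℕ) : 0 ≤ stepY D M :=
  div_nonneg (sub_nonneg.2 D.hy.le) (Nat.cast_nonneg _)

theorem massForm_nonneg (D : Cylinder) (Mx My : ℕ) (v : ℕ → ℕ → ℝ) : 0 ≤ massForm D Mx My v v := by
  have := mul_nonneg (stepX_nonneg D Mx) (stepY_nonneg D My)
  simp only [massForm, LinearMap.smul_apply, LinearMap.add_apply, smul_eq_mul]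
  have a := squareForm_nonneg (Finset.Ico 1 Mx) (Finset.Ico 1 My) ev v
  have b := squareForm_nonneg (Finset.Ico 1 Mx) (Finset.range My)
    (fun i j => ev i j + ev i (j + 1)) v
  have c := squareForm_nonneg (Finset.range Mx) (Finset.Ico 1 My)
    (fun i j => ev i j + ev (i + 1) j) v
  have d := squareForm_nonneg (Finset.range Mx) (Finset.range My)
        (fun i j => ev i j + ev (i + 1) j + (ev i (j + 1) + ev (i + 1) (j + 1))) v
  exact mul_nonneg (by positivity) (by positivity)

theorem massForm_symm (D : Cylinder) (Mx My : ℕ) (v w : ℕ → ℕ → ℝ) :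
    massForm D Mx My v w = massForm D Mx My w v := by
  simp only [massForm, LinearMap.smul_apply, LinearMap.add_apply, smul_eq_mul,
    squareForm_symm _ _ _ v w]

theorem stiffForm_nonneg (D : Cylinder) (Mx My : ℕ) (v : ℕ → ℕ → ℝ) :
    0 ≤ stiffForm D Mx My v v := by
  have := mul_nonneg (stepX_nonneg D Mx) (stepY_nonneg D My)
  simp only [stiffForm, LinearMap.smul_apply, LinearMap.add_apply, smul_eq_mul]
  have a := squareForm_nonneg (Finset.range Mx) (Finset.Ico 1 My) (fun i j => ev (i + 1) j - ev i j) v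
  have b := squareForm_nonneg (Finset.range Mx) (Finset.range My)
        (fun i j => ev (i + 1) j - ev i j + (ev (i + 1) (j + 1) - ev i (j + 1))) v
  have c := squareForm_nonneg (Finset.Ico 1 Mx) (Finset.range My) (fun i j => ev i (j + 1) - ev i j) v
  have d := squareForm_nonneg (Finset.range Mx) (Finset.range My)
        (fun i j => ev i (j + 1) - ev i j + (ev (i + 1) (j + 1) - ev (i + 1) j)) v
  exact mul_nonneg (by positivity) (by positivity)

theorem stiffForm_symm (D : Cylinder) (Mx My : ℕ) (v w : ℕ → ℕ → ℝ) :
    stiffForm D Mx My v w = stiffForm D Mx My w v := by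
  simp only [stiffForm, LinearMap.smul_apply, LinearMap.add_apply, smul_eq_mul,
    squareForm_symm _ _ _ v w]

/-- `w` vanishes off the interior indices. -/
def VanishesOff (Mx My : ℕ) (w : ℕ → ℕ → ℝ) : Prop := ∀ i j, ¬ Interior Mx My i j → w i j = 0

theorem VanishesOff.left {Mx My : ℕ} {w : ℕ → ℕ → ℝ} (h : VanishesOff Mx My w) (j : ℕ) :
    w 0 j = 0 := h _ _ (by unfold Interior; omega)

theorem VanishesOff.right {Mx My : ℕ} {w : ℕ → ℕ → ℝ} (h : VanishesOff Mx My w) (j : ℕ) :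
    w Mx j = 0 := h _ _ (by unfold Interior; omega)

theorem VanishesOff.bottom {Mx My : ℕ} {w : ℕ → ℕ → ℝ} (h : VanishesOff Mx My w) (i : ℕ) :
    w i 0 = 0 := h _ _ (by unfold Interior; omega)

theorem VanishesOff.top {Mx My : ℕ} {w : ℕ → ℕ → ℝ} (h : VanishesOff Mx My w) (i : ℕ) :
    w i My = 0 := h _ _ (by unfold Interior; omega)

theorem avgX_of_interior {Mx i : ℕ} (v : ℕ → ℕ → ℝ) (j : ℕ) (hi : i ∈ Finset.Ico 1 Mx) :
    avgX Mx v i j = (v (i - 1) j + 10 * v i j + v (i + 1) j) / 12 := by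
  have := Finset.mem_Ico.1 hi
  rw [avgX, if_neg (by omega)]

theorem avgY_of_interior {My j : ℕ} (v : ℕ → ℕ → ℝ) (i : ℕ) (hj : j ∈ Finset.Ico 1 My) :
    avgY My v i j = (v i (j - 1) + 10 * v i j + v i (j + 1)) / 12 := by
  have := Finset.mem_Ico.1 hj
  rw [avgY, if_neg (by omega)]

/-- The one-dimensional identity is used in x and then in y, whence the weights 64, 8, 8, 1. Only
the test function w must vanish off the interior; v is arbitrary. -/
theorem sum_avg_eq_massForm (D : Cylinder) {Mx My : ℕ} (v : ℕ → ℕ → ℝ) {w : ℕ → ℕ → ℝ}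
    (hw : VanishesOff Mx My w) :
    stepX D Mx * stepY D My *
      ∑ i ∈ Finset.Ico 1 Mx, ∑ j ∈ Finset.Ico 1 My, avg Mx My v i j * w i j
      = massForm D Mx My v w := by
  have e1 : ∑ i ∈ Finset.Ico 1 Mx, ∑ j ∈ Finset.Ico 1 My, avg Mx My v i j * w i j =
      ∑ j ∈ Finset.Ico 1 My, (8 * ∑ i ∈ Finset.Ico 1 Mx, avgY My v i j * w i j
        + ∑ i ∈ Finset.range Mx, (avgY My v i j + avgY My v (i + 1) j) * (w i j + w (i + 1) j))
          / 12 := by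
    rw [Finset.sum_comm]
    refine Finset.sum_congr rfl fun j _ => ?_
    rw [← sum_avg_mul (fun i => avgY My v i j) (fun i => w i j) (hw.left j) (hw.right j)]
    exact Finset.sum_congr rfl fun i hi => by rw [avg, avgX_of_interior _ _ hi]
  have e2 : ∀ i, ∑ j ∈ Finset.Ico 1 My, avgY My v i j * w i j =
      (8 * ∑ j ∈ Finset.Ico 1 My, v i j * w i j
        + ∑ j ∈ Finset.range My, (v i j + v i (j + 1)) * (w i j + w i (j + 1))) / 12 := fun i => by
    rw [← sum_avg_mul _ _ (hw.bottom i) (hw.top i)]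
    exact Finset.sum_congr rfl fun j hj => by rw [avgY_of_interior _ _ hj]
  have e3 : ∀ i, ∑ j ∈ Finset.Ico 1 My, (avgY My v i j + avgY My v (i + 1) j)
        * (w i j + w (i + 1) j) =
      (8 * ∑ j ∈ Finset.Ico 1 My, (v i j + v (i + 1) j) * (w i j + w (i + 1) j)
        + ∑ j ∈ Finset.range My, (v i j + v (i + 1) j + (v i (j + 1) + v (i + 1) (j + 1)))
          * (w i j + w (i + 1) j + (w i (j + 1) + w (i + 1) (j + 1)))) / 12 := fun i => by
    rw [← sum_avg_mul (fun j => v i j + v (i + 1) j) (fun j => w i j + w (i + 1) j)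
      (by simp [hw.bottom]) (by simp [hw.top])]
    exact Finset.sum_congr rfl fun j hj => by
      rw [avgY_of_interior _ _ hj, avgY_of_interior _ _ hj]; ring
  rw [e1, ← Finset.sum_div, Finset.sum_add_distrib, ← Finset.mul_sum, Finset.sum_comm,
    Finset.sum_comm (s := Finset.Ico 1 My) (t := Finset.range Mx),
    Finset.sum_congr rfl fun i _ => e2 i, Finset.sum_congr rfl fun i _ => e3 i,
    ← Finset.sum_div, ← Finset.sum_div, Finset.sum_add_distrib, Finset.sum_add_distrib,
    ← Finset.mul_sum, ← Finset.mul_sum]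
  simp only [massForm, LinearMap.smul_apply, LinearMap.add_apply, smul_eq_mul, squareForm_apply,
    ev_apply]
  ring

theorem sum_compactLaplacian_eq_stiffForm (D : Cylinder) {Mx My : ℕ} (v : ℕ → ℕ → ℝ)
    {w : ℕ → ℕ → ℝ} (hw : VanishesOff Mx My w) :
    stepX D Mx * stepY D My *
      ∑ i ∈ Finset.Ico 1 Mx, ∑ j ∈ Finset.Ico 1 My, compactLaplacian D Mx My v i j * w i j
      = -stiffForm D Mx My v w := by
  have x1 : ∀ i, ∑ j ∈ Finset.Ico 1 My, avgY My (secondX D Mx v) i j * w i j =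
      (8 * ∑ j ∈ Finset.Ico 1 My, secondX D Mx v i j * w i j
        + ∑ j ∈ Finset.range My, (secondX D Mx v i j + secondX D Mx v i (j + 1))
          * (w i j + w i (j + 1))) / 12 := fun i => by
    rw [← sum_avg_mul _ _ (hw.bottom i) (hw.top i)]
    exact Finset.sum_congr rfl fun j hj => by rw [avgY_of_interior _ _ hj]
  have x2 : ∀ j, ∑ i ∈ Finset.Ico 1 Mx, secondX D Mx v i j * w i j =
      -(1 / stepX D Mx ^ 2) * ∑ i ∈ Finset.range Mx,
        (v (i + 1) j - v i j) * (w (i + 1) j - w i j) := fun j => by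
    have := sum_second_mul (fun i => v i j) (fun i => w i j) (hw.left j) (hw.right j)
    rw [neg_mul, ← mul_neg, ← this, Finset.mul_sum]
    exact Finset.sum_congr rfl fun i _ => by rw [secondX]; ring
  have x3 : ∀ j, ∑ i ∈ Finset.Ico 1 Mx, (secondX D Mx v i j + secondX D Mx v i (j + 1))
        * (w i j + w i (j + 1)) =
      -(1 / stepX D Mx ^ 2) * ∑ i ∈ Finset.range Mx,
        (v (i + 1) j - v i j + (v (i + 1) (j + 1) - v i (j + 1)))
          * (w (i + 1) j - w i j + (w (i + 1) (j + 1) - w i (j + 1))) := fun j => by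
    have := sum_second_mul (fun i => v i j + v i (j + 1)) (fun i => w i j + w i (j + 1))
      (M := Mx) (by simp [hw.left]) (by simp [hw.right])
    simp only [add_sub_add_comm] at this
    rw [neg_mul, ← mul_neg, ← this, Finset.mul_sum]
    exact Finset.sum_congr rfl fun i _ => by rw [secondX, secondX]; ring
  have y1 : ∀ j, ∑ i ∈ Finset.Ico 1 Mx, avgX Mx (secondY D My v) i j * w i j =
      (8 * ∑ i ∈ Finset.Ico 1 Mx, secondY D My v i j * w i j
        + ∑ i ∈ Finset.range Mx, (secondY D My v i j + secondY D My v (i + 1) j)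
          * (w i j + w (i + 1) j)) / 12 := fun j => by
    rw [← sum_avg_mul (fun i => secondY D My v i j) (fun i => w i j) (hw.left j) (hw.right j)]
    exact Finset.sum_congr rfl fun i hi => by rw [avgX_of_interior _ _ hi]
  have y2 : ∀ i, ∑ j ∈ Finset.Ico 1 My, secondY D My v i j * w i j =
      -(1 / stepY D My ^ 2) * ∑ j ∈ Finset.range My,
        (v i (j + 1) - v i j) * (w i (j + 1) - w i j) := fun i => by
    have := sum_second_mul (fun j => v i j) (fun j => w i j) (hw.bottom i) (hw.top i)
    rw [neg_mul, ← mul_neg, ← this, Finset.mul_sum]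
    exact Finset.sum_congr rfl fun j _ => by rw [secondY]; ring
  have y3 : ∀ i, ∑ j ∈ Finset.Ico 1 My, (secondY D My v i j + secondY D My v (i + 1) j)
        * (w i j + w (i + 1) j) =
      -(1 / stepY D My ^ 2) * ∑ j ∈ Finset.range My,
        (v i (j + 1) - v i j + (v (i + 1) (j + 1) - v (i + 1) j))
          * (w i (j + 1) - w i j + (w (i + 1) (j + 1) - w (i + 1) j)) := fun i => by
    have := sum_second_mul (fun j => v i j + v (i + 1) j) (fun j => w i j + w (i + 1) j)
      (M := My) (by simp [hw.bottom]) (by simp [hw.top])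
    simp only [add_sub_add_comm] at this
    rw [neg_mul, ← mul_neg, ← this, Finset.mul_sum]
    exact Finset.sum_congr rfl fun i _ => by rw [secondY, secondY]; ring
  have e : ∑ i ∈ Finset.Ico 1 Mx, ∑ j ∈ Finset.Ico 1 My, compactLaplacian D Mx My v i j * w i j
      = ∑ i ∈ Finset.Ico 1 Mx, ∑ j ∈ Finset.Ico 1 My, avgY My (secondX D Mx v) i j * w i j
        + ∑ j ∈ Finset.Ico 1 My, ∑ i ∈ Finset.Ico 1 Mx,
          avgX Mx (secondY D My v) i j * w i j := by
    rw [Finset.sum_comm (s := Finset.Ico 1 My), ← Finset.sum_add_distrib]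
    refine Finset.sum_congr rfl fun i _ => ?_
    rw [← Finset.sum_add_distrib]
    exact Finset.sum_congr rfl fun j _ => by rw [compactLaplacian]; ring
  rw [e, Finset.sum_congr rfl fun i _ => x1 i, Finset.sum_congr rfl fun i _ => y1 i,
    ← Finset.sum_div, ← Finset.sum_div, Finset.sum_add_distrib, Finset.sum_add_distrib,
    ← Finset.mul_sum, ← Finset.mul_sum,
    Finset.sum_comm (s := Finset.Ico 1 Mx) (t := Finset.Ico 1 My),
    Finset.sum_comm (s := Finset.Ico 1 Mx) (t := Finset.range My),
    Finset.sum_congr rfl fun i _ => x2 i, Finset.sum_congr rfl fun i _ => x3 i,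
    Finset.sum_comm (s := Finset.Ico 1 My) (t := Finset.Ico 1 Mx),
    Finset.sum_comm (s := Finset.Ico 1 My) (t := Finset.range Mx),
    Finset.sum_congr rfl fun i _ => y2 i, Finset.sum_congr rfl fun i _ => y3 i,
    ← Finset.mul_sum, ← Finset.mul_sum, ← Finset.mul_sum, ← Finset.mul_sum]
  simp only [stiffForm, LinearMap.smul_apply, LinearMap.add_apply, smul_eq_mul, squareForm_apply,
    ev_apply, LinearMap.sub_apply]
  rw [Finset.sum_comm (s := Finset.Ico 1 My) (t := Finset.range Mx),
    Finset.sum_comm (s := Finset.range My) (t := Finset.range Mx)]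
  ring

/-! ### The discrete L² norm and its equivalence with the mass norm. -/

theorem gridNorm_nonneg (D : Cylinder) (Mx My : ℕ) (v : ℕ → ℕ → ℝ) : 0 ≤ gridNorm D Mx My v :=
  Real.sqrt_nonneg _

theorem gridNorm_sq (D : Cylinder) (Mx My : ℕ) (v : ℕ → ℕ → ℝ) :
    gridNorm D Mx My v ^ 2 = stepX D Mx * stepY D My *
      ∑ i ∈ Finset.Ico 1 Mx, ∑ j ∈ Finset.Ico 1 My, v i j ^ 2 :=
  Real.sq_sqrt (mul_nonneg (mul_nonneg (stepX_nonneg _ _) (stepY_nonneg _ _))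
    (Finset.sum_nonneg fun _ _ => Finset.sum_nonneg fun _ _ => sq_nonneg _))

/-- Only the first group of squares in the mass form is kept; its weight is 64/144 = (2/3)². -/
theorem gridNorm_le_massNorm (D : Cylinder) (Mx My : ℕ) (v : ℕ → ℕ → ℝ) :
    gridNorm D Mx My v ≤ 3 / 2 * formNorm (massForm D Mx My) v := by
  refine abs_le_of_sq_le_sq' ?_ (mul_nonneg (by norm_num) (formNorm_nonneg _ _)) |>.2
  rw [mul_pow, formNorm_sq (massForm_nonneg D Mx My), gridNorm_sq]
  have := mul_nonneg (stepX_nonneg D Mx) (stepY_nonneg D My)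
  simp only [massForm, LinearMap.smul_apply, LinearMap.add_apply, smul_eq_mul]
  have b := mul_nonneg this (squareForm_nonneg (Finset.Ico 1 Mx) (Finset.range My)
    (fun i j => ev i j + ev i (j + 1)) v)
  have c := mul_nonneg this (squareForm_nonneg (Finset.range Mx) (Finset.Ico 1 My)
    (fun i j => ev i j + ev (i + 1) j) v)
  have d := mul_nonneg this (squareForm_nonneg (Finset.range Mx) (Finset.range My)
        (fun i j => ev i j + ev (i + 1) j + (ev i (j + 1) + ev (i + 1) (j + 1))) v)
  rw [squareForm_apply (Finset.Ico 1 Mx) (Finset.Ico 1 My)]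
  simp only [ev_apply, ← sq] at *
  linarith

theorem sum_pair_sq_le (a : ℕ → ℝ) {M : ℕ} (h0 : a 0 = 0) (hM : a M = 0) :
    ∑ i ∈ Finset.range M, (a i + a (i + 1)) ^ 2 ≤ 4 * ∑ i ∈ Finset.Ico 1 M, a i ^ 2 := by
  have e1 := sum_range_eq_Ico_of_zero (F := fun i => a i ^ 2) (by simp [h0]) M
  have e2 := sum_range_succ_eq_Ico_of_zero (F := fun i => a i ^ 2) (M := M) (by simp [hM])
  have : ∑ i ∈ Finset.range M, (a i + a (i + 1)) ^ 2
      ≤ ∑ i ∈ Finset.range M, (2 * a i ^ 2 + 2 * a (i + 1) ^ 2) :=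
    Finset.sum_le_sum fun i _ => by nlinarith [sq_nonneg (a i - a (i + 1))]
  rw [Finset.sum_add_distrib, ← Finset.mul_sum, ← Finset.mul_sum, e1, e2] at this
  linarith

/-- Each passage from nodes to edge sums costs a factor 4, and 64 + 8·4 + 8·4 + 16 = 144. -/
theorem massNorm_le_gridNorm (D : Cylinder) {Mx My : ℕ} {v : ℕ → ℕ → ℝ}
    (hv : VanishesOff Mx My v) : formNorm (massForm D Mx My) v ≤ gridNorm D Mx My v := by
  refine abs_le_of_sq_le_sq' ?_ (gridNorm_nonneg D Mx My v) |>.2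
  rw [formNorm_sq (massForm_nonneg D Mx My), gridNorm_sq]
  have hh := mul_nonneg (stepX_nonneg D Mx) (stepY_nonneg D My)
  simp only [massForm, LinearMap.smul_apply, LinearMap.add_apply, smul_eq_mul, squareForm_apply,
    ev_apply, ← sq]
  set S := ∑ i ∈ Finset.Ico 1 Mx, ∑ j ∈ Finset.Ico 1 My, v i j ^ 2 with hS
  have b : ∑ i ∈ Finset.Ico 1 Mx, ∑ j ∈ Finset.range My, (v i j + v i (j + 1)) ^ 2 ≤ 4 * S := by
    rw [hS, Finset.mul_sum]
    exact Finset.sum_le_sum fun i _ => sum_pair_sq_le _ (hv.bottom i) (hv.top i)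
  have c : ∑ i ∈ Finset.range Mx, ∑ j ∈ Finset.Ico 1 My, (v i j + v (i + 1) j) ^ 2 ≤ 4 * S := by
    rw [hS, Finset.sum_comm, Finset.sum_comm (s := Finset.Ico 1 Mx), Finset.mul_sum]
    exact Finset.sum_le_sum fun j _ => sum_pair_sq_le (fun i => v i j) (hv.left j) (hv.right j)
  have d : ∑ i ∈ Finset.range Mx, ∑ j ∈ Finset.range My,
      (v i j + v (i + 1) j + (v i (j + 1) + v (i + 1) (j + 1))) ^ 2 ≤ 4 * (4 * S) := by
    refine le_trans ?_ (mul_le_mul_of_nonneg_left c (by norm_num))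
    rw [Finset.mul_sum]
    exact Finset.sum_le_sum fun i _ => sum_pair_sq_le (fun j => v i j + v (i + 1) j)
      (by simp [hv.bottom]) (by simp [hv.top])
  have := mul_le_mul_of_nonneg_left (by linarith :
    64 * S + 8 * ∑ i ∈ Finset.Ico 1 Mx, ∑ j ∈ Finset.range My, (v i j + v i (j + 1)) ^ 2
    + 8 * ∑ i ∈ Finset.range Mx, ∑ j ∈ Finset.Ico 1 My, (v i j + v (i + 1) j) ^ 2
    + ∑ i ∈ Finset.range Mx, ∑ j ∈ Finset.range My,
      (v i j + v (i + 1) j + (v i (j + 1) + v (i + 1) (j + 1))) ^ 2 ≤ 144 * S) hh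
  linarith

theorem gridNorm_mono (D : Cylinder) {Mx My : ℕ} {v w : ℕ → ℕ → ℝ}
    (h : ∀ i j, Interior Mx My i j → |v i j| ≤ |w i j|) :
    gridNorm D Mx My v ≤ gridNorm D Mx My w := by
  refine Real.sqrt_le_sqrt (mul_le_mul_of_nonneg_left ?_
    (mul_nonneg (stepX_nonneg D Mx) (stepY_nonneg D My)))
  refine Finset.sum_le_sum fun i hi => Finset.sum_le_sum fun j hj => sq_le_sq.2 (h i j ?_)
  rw [Finset.mem_Ico] at hi hj
  exact ⟨⟨hi.1, hi.2⟩, hj.1, hj.2⟩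

theorem gridNorm_smul (D : Cylinder) (Mx My : ℕ) (c : ℝ) (v : ℕ → ℕ → ℝ) :
    gridNorm D Mx My (fun i j => c * v i j) = |c| * gridNorm D Mx My v := by
  rw [gridNorm, gridNorm, ← Real.sqrt_sq_eq_abs, ← Real.sqrt_mul (sq_nonneg c)]
  congr 1
  simp only [mul_pow, ← Finset.mul_sum]
  ring

theorem abs_sum_mul_le_gridNorm (D : Cylinder) (Mx My : ℕ) (v w : ℕ → ℕ → ℝ) :
    |stepX D Mx * stepY D My * ∑ i ∈ Finset.Ico 1 Mx, ∑ j ∈ Finset.Ico 1 My, v i j * w i j|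
      ≤ gridNorm D Mx My v * gridNorm D Mx My w := by
  refine abs_le_of_sq_le_sq ?_ (mul_nonneg (gridNorm_nonneg D Mx My v) (gridNorm_nonneg D Mx My w))
  rw [mul_pow, mul_pow (gridNorm D Mx My v), gridNorm_sq, gridNorm_sq]
  have := Finset.sum_mul_sq_le_sq_mul_sq (Finset.Ico 1 Mx ×ˢ Finset.Ico 1 My)
    (fun p => v p.1 p.2) (fun p => w p.1 p.2)
  rw [Finset.sum_product, Finset.sum_product, Finset.sum_product] at this
  have := mul_le_mul_of_nonneg_left this (sq_nonneg (stepX D Mx * stepY D My))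
  simp only at this
  linarith

theorem gridNorm_add_le (D : Cylinder) (Mx My : ℕ) (v w : ℕ → ℕ → ℝ) :
    gridNorm D Mx My (fun i j => v i j + w i j) ≤ gridNorm D Mx My v + gridNorm D Mx My w := by
  have nv := gridNorm_nonneg D Mx My v
  have nw := gridNorm_nonneg D Mx My w
  refine abs_le_of_sq_le_sq' ?_ (add_nonneg nv nw) |>.2
  have h := (abs_le.1 (abs_sum_mul_le_gridNorm D Mx My v w)).2
  rw [add_sq, gridNorm_sq, gridNorm_sq, gridNorm_sq]
  have : ∑ i ∈ Finset.Ico 1 Mx, ∑ j ∈ Finset.Ico 1 My, (v i j + w i j) ^ 2 =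
      ∑ i ∈ Finset.Ico 1 Mx, ∑ j ∈ Finset.Ico 1 My, v i j ^ 2
      + 2 * ∑ i ∈ Finset.Ico 1 Mx, ∑ j ∈ Finset.Ico 1 My, v i j * w i j
      + ∑ i ∈ Finset.Ico 1 Mx, ∑ j ∈ Finset.Ico 1 My, w i j ^ 2 := by
    rw [Finset.mul_sum, ← Finset.sum_add_distrib, ← Finset.sum_add_distrib]
    refine Finset.sum_congr rfl fun i _ => ?_
    rw [Finset.mul_sum, ← Finset.sum_add_distrib, ← Finset.sum_add_distrib]
    exact Finset.sum_congr rfl fun j _ => by ring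
  rw [this]
  linarith

/-- Source of the constant Q_L: the cells fill the rectangle, so the mesh weights add up to at most
its area Q_L². -/
theorem gridNorm_le_of_bound (D : Cylinder) {Mx My : ℕ} {v : ℕ → ℕ → ℝ} {c : ℝ}
    (hx : 1 ≤ Mx) (hy : 1 ≤ My) (hc : 0 ≤ c) (h : ∀ i j, Interior Mx My i j → |v i j| ≤ c) :
    gridNorm D Mx My v ≤ Real.sqrt ((D.rx - D.lx) * (D.ry - D.ly)) * c := by
  refine abs_le_of_sq_le_sq' ?_ (mul_nonneg (Real.sqrt_nonneg _) hc) |>.2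
  have hD := mul_nonneg (sub_nonneg.2 D.hx.le) (sub_nonneg.2 D.hy.le)
  rw [mul_pow, Real.sq_sqrt hD, gridNorm_sq]
  have hx' : (0 : ℝ) < Mx := by exact_mod_cast hx
  have hy' : (0 : ℝ) < My := by exact_mod_cast hy
  have h1 : ∑ i ∈ Finset.Ico 1 Mx, ∑ j ∈ Finset.Ico 1 My, v i j ^ 2 ≤ Mx * (My * c ^ 2) := by
    calc _ ≤ ∑ i ∈ Finset.Ico 1 Mx, ∑ j ∈ Finset.Ico 1 My, c ^ 2 := by
          refine Finset.sum_le_sum fun i hi => Finset.sum_le_sum fun j hj => ?_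
          rw [Finset.mem_Ico] at hi hj
          exact sq_le_sq' (by linarith [(abs_le.1 (h i j ⟨⟨hi.1, hi.2⟩, hj.1, hj.2⟩)).1])
            (abs_le.1 (h i j ⟨⟨hi.1, hi.2⟩, hj.1, hj.2⟩)).2
      _ ≤ _ := by
        simp only [Finset.sum_const, Nat.card_Ico, nsmul_eq_mul]
        have a1 : ((Mx - 1 : ℕ) : ℝ) ≤ Mx := by exact_mod_cast Nat.sub_le _ _
        have a2 : ((My - 1 : ℕ) : ℝ) ≤ My := by exact_mod_cast Nat.sub_le _ _
        gcongr
  refine (mul_le_mul_of_nonneg_left h1 (mul_nonneg (stepX_nonneg D Mx) (stepY_nonneg D My))).trans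
    (le_of_eq ?_)
  rw [stepX, stepY]
  field_simp

end TwoGrid
end


noncomputable section

namespace TwoGrid

/-! ### Taylor expansion and compact differences -/

/-- Taylor's inequality for a chain of functions each of which is the derivative of the
preceding one. -/
theorem taylor_chain_bound {a b C : ℝ} (n : ℕ) : ∀ (φ : ℕ → ℝ → ℝ),
    (∀ k < n, ∀ x ∈ Icc a b, HasDerivWithinAt (φ k) (φ (k + 1) x) (Icc a b) x) →
    (∀ x ∈ Icc a b, |φ n x| ≤ C) → ∀ x ∈ Icc a b,
    |φ 0 x - ∑ k ∈ Finset.range n, φ k a * (x - a) ^ k / (k.factorial : ℝ)|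
      ≤ C * (x - a) ^ n / (n.factorial : ℝ) := by
  induction n with
  | zero => intro φ _ h x hx; simpa using h x hx
  | succ n ih =>
    intro φ hd hC
    have h1 := ih (fun k => φ (k + 1)) (fun k hk => hd (k + 1) (by omega)) hC
    have dp : ∀ x, HasDerivAt
        (fun x => ∑ k ∈ Finset.range (n + 1), φ k a * (x - a) ^ k / (k.factorial : ℝ))
        (∑ k ∈ Finset.range n, φ (k + 1) a * (x - a) ^ k / (k.factorial : ℝ)) x := by
      intro x
      simp only [Finset.sum_range_succ' _ n]
      have : HasDerivAt (fun x => ∑ k ∈ Finset.range n,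
          φ (k + 1) a * (x - a) ^ (k + 1) / ((k + 1).factorial : ℝ))
          (∑ k ∈ Finset.range n, φ (k + 1) a * (x - a) ^ k / (k.factorial : ℝ)) x := by
        refine HasDerivAt.fun_sum fun k _ => ?_
        have := ((((hasDerivAt_id x).sub_const a).pow (k + 1)).const_mul (φ (k + 1) a)).div_const
          ((k + 1).factorial : ℝ)
        refine this.congr_deriv ?_
        simp only [Nat.factorial_succ, id, Nat.add_sub_cancel]
        have : (k.factorial : ℝ) ≠ 0 := by positivity
        push_cast
        field_simp
      simpa using this
    have hB : ∀ x, HasDerivAt (fun x => C * (x - a) ^ (n + 1) / ((n + 1).factorial : ℝ))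
        (C * (x - a) ^ n / (n.factorial : ℝ)) x := by
      intro x
      have := ((((hasDerivAt_id x).sub_const a).pow (n + 1)).const_mul C).div_const
          ((n + 1).factorial : ℝ)
      refine this.congr_deriv ?_
      simp only [Nat.factorial_succ, id, Nat.add_sub_cancel]
      have : (n.factorial : ℝ) ≠ 0 := by positivity
      push_cast
      field_simp
    have hF : ∀ x ∈ Icc a b, HasDerivWithinAt
        (fun x => φ 0 x - ∑ k ∈ Finset.range (n + 1), φ k a * (x - a) ^ k / (k.factorial : ℝ))
        (φ 1 x - ∑ k ∈ Finset.range n, φ (k + 1) a * (x - a) ^ k / (k.factorial : ℝ))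
        (Icc a b) x := fun x hx => (hd 0 (by omega) x hx).sub (dp x).hasDerivWithinAt
    intro x hx
    -- The induction hypothesis, applied to the shifted chain, bounds the derivative of the
    -- remainder; the comparison principle integrates that bound.
    refine image_norm_le_of_norm_deriv_right_le_deriv_boundary (a := a) (b := b)
      (fun x hx => (hF x hx).continuousWithinAt)
      (fun x hx => (hF x (Ico_subset_Icc_self hx)).mono_of_mem_nhdsWithin (Icc_mem_nhdsGE_of_mem hx))
      ?_ hB (fun x hx => h1 x (Ico_subset_Icc_self hx)) hx
    simp [Finset.sum_range_succ' _ n]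

theorem abs_mul_le_of_abs_le {x c B : ℝ} (h : |x| ≤ B) (hc : 0 ≤ c) :
    -(c * B) ≤ c * x ∧ c * x ≤ c * B :=
  ⟨by nlinarith [(abs_le.1 h).1], by nlinarith [(abs_le.1 h).2]⟩

/-- Truncation error of the fourth-order compact second difference. -/
theorem compact_truncation {a h C : ℝ} (hh : 0 < h) {φ : ℕ → ℝ → ℝ}
    (hd : ∀ k < 6, ∀ x ∈ Icc a (a + 2 * h),
      HasDerivWithinAt (φ k) (φ (k + 1) x) (Icc a (a + 2 * h)) x)
    (hC : ∀ x ∈ Icc a (a + 2 * h), |φ 6 x| ≤ C) :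
    |(φ 2 a + 10 * φ 2 (a + h) + φ 2 (a + 2 * h)) / 12
      - (φ 0 (a + 2 * h) - 2 * φ 0 (a + h) + φ 0 a) / h ^ 2| ≤ C * h ^ 4 := by
  have m1 : a + h ∈ Icc a (a + 2 * h) := ⟨by linarith, by linarith⟩
  have m2 : a + 2 * h ∈ Icc a (a + 2 * h) := ⟨by linarith, by linarith⟩
  have t1 := taylor_chain_bound 6 φ hd hC _ m1
  have t2 := taylor_chain_bound 6 φ hd hC _ m2
  -- The second derivatives are expanded as chains of their own about the left node. After
  -- multiplication by h² the Taylor polynomials cancel, and the remaining multiples of C h⁶ add up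
  -- to less than C h⁶.
  have t3 := taylor_chain_bound 4 (fun k => φ (k + 2)) (fun k hk => hd (k + 2) (by omega)) hC _ m1
  have t4 := taylor_chain_bound 4 (fun k => φ (k + 2)) (fun k hk => hd (k + 2) (by omega)) hC _ m2
  simp only [Finset.sum_range_succ, Finset.sum_range_zero, Nat.factorial, add_sub_cancel_left]
    at t1 t2 t3 t4
  norm_num at t1 t2 t3 t4
  have hC0 : 0 ≤ C := (abs_nonneg _).trans (hC _ m1)
  have h2 : 0 < h ^ 2 := by positivity
  rw [← mul_le_mul_iff_of_pos_right h2]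
  nth_rewrite 2 [← abs_of_pos h2]
  rw [← abs_mul, sub_mul, div_mul_cancel₀ _ h2.ne']
  have s3 := abs_mul_le_of_abs_le t3 h2.le
  have s4 := abs_mul_le_of_abs_le t4 h2.le
  rw [abs_le] at t1 t2 ⊢
  have hh6 : 0 ≤ C * h ^ 6 := by positivity
  constructor <;> linarith [t1.1, t1.2, t2.1, t2.2, s3.1, s3.2, s4.1, s4.2]

/-- Residual of the exact nodal second derivatives in one row of the spline system. The Taylor
remainders add up to (17/4) C h², rounded up to 5 C h². -/
theorem spline_truncation {a h C : ℝ} (hh : 0 < h) {φ : ℕ → ℝ → ℝ}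
    (hd : ∀ k < 4, ∀ x ∈ Icc a (a + 2 * h),
      HasDerivWithinAt (φ k) (φ (k + 1) x) (Icc a (a + 2 * h)) x)
    (hC : ∀ x ∈ Icc a (a + 2 * h), |φ 4 x| ≤ C) :
    |3 * ((φ 0 (a + 2 * h) - 2 * φ 0 (a + h) + φ 0 a) / h ^ 2)
      - (φ 2 a / 2 + 2 * φ 2 (a + h) + φ 2 (a + 2 * h) / 2)| ≤ 5 * C * h ^ 2 := by
  have m1 : a + h ∈ Icc a (a + 2 * h) := ⟨by linarith, by linarith⟩
  have m2 : a + 2 * h ∈ Icc a (a + 2 * h) := ⟨by linarith, by linarith⟩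
  have t1 := taylor_chain_bound 4 φ hd hC _ m1
  have t2 := taylor_chain_bound 4 φ hd hC _ m2
  have t3 := taylor_chain_bound 2 (fun k => φ (k + 2)) (fun k hk => hd (k + 2) (by omega)) hC _ m1
  have t4 := taylor_chain_bound 2 (fun k => φ (k + 2)) (fun k hk => hd (k + 2) (by omega)) hC _ m2
  simp only [Finset.sum_range_succ, Finset.sum_range_zero, Nat.factorial, add_sub_cancel_left]
    at t1 t2 t3 t4
  norm_num at t1 t2 t3 t4
  have hC0 : 0 ≤ C := (abs_nonneg _).trans (hC _ m1)
  have h2 : 0 < h ^ 2 := by positivity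
  rw [← mul_le_mul_iff_of_pos_right h2]
  nth_rewrite 2 [← abs_of_pos h2]
  rw [← abs_mul, sub_mul, mul_assoc, div_mul_cancel₀ _ h2.ne']
  have s3 := abs_mul_le_of_abs_le t3 h2.le
  have s4 := abs_mul_le_of_abs_le t4 h2.le
  rw [abs_le] at t1 t2 ⊢
  have hh6 : 0 ≤ C * h ^ 4 := by positivity
  constructor <;> linarith [t1.1, t1.2, t2.1, t2.2, s3.1, s3.2, s4.1, s4.2]

/-! ### Cubic splines with vanishing end coefficients -/

/-- The cubic on one cell with prescribed end values and end second derivatives. -/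
def cellCubic (H w₀ w₁ m₀ m₁ θ : ℝ) : ℝ :=
  m₀ * (H - θ) ^ 3 / (6 * H) + m₁ * θ ^ 3 / (6 * H)
    + (w₀ - m₀ * H ^ 2 / 6) * ((H - θ) / H) + (w₁ - m₁ * H ^ 2 / 6) * (θ / H)

/-- In the local coordinate s the cubic is the linear interpolant corrected by the end second
derivatives with the shape functions s - s³ and (1-s) - (1-s)³, both with values in [0, 1]. The
bounds on a cell are read off from this form. -/
theorem cellCubic_eq {H : ℝ} (hH : 0 < H) (w₀ w₁ m₀ m₁ s : ℝ) :
    cellCubic H w₀ w₁ m₀ m₁ (s * H) = (1 - s) * w₀ + s * w₁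
      - H ^ 2 / 6 * (((1 - s) - (1 - s) ^ 3) * m₀ + (s - s ^ 3) * m₁) := by
  rw [cellCubic]
  field_simp
  ring

theorem sub_cube_bounds {s : ℝ} (h0 : 0 ≤ s) (h1 : s ≤ 1) : 0 ≤ s - s ^ 3 ∧ s - s ^ 3 ≤ 1 := by
  constructor
  · nlinarith [mul_nonneg h0 (sub_nonneg.2 h1), mul_nonneg h0 h0]
  · nlinarith [pow_nonneg h0 3]

theorem exists_cell_coordinate {H θ : ℝ} (hH : 0 < H) (h0 : 0 ≤ θ) (h1 : θ ≤ H) :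
    ∃ s, 0 ≤ s ∧ s ≤ 1 ∧ θ = s * H :=
  ⟨θ / H, div_nonneg h0 hH.le, (div_le_one hH).2 h1, by field_simp⟩

theorem abs_cellCubic_le {H W m w₀ w₁ m₀ m₁ θ : ℝ} (hH : 0 < H) (h0 : 0 ≤ θ) (h1 : θ ≤ H)
    (hw₀ : |w₀| ≤ W) (hw₁ : |w₁| ≤ W) (hm₀ : |m₀| ≤ m) (hm₁ : |m₁| ≤ m) :
    |cellCubic H w₀ w₁ m₀ m₁ θ| ≤ W + H ^ 2 / 3 * m := by
  obtain ⟨s, hs0, hs1, rfl⟩ := exists_cell_coordinate hH h0 h1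
  rw [cellCubic_eq hH]
  obtain ⟨b1, b2⟩ := sub_cube_bounds hs0 hs1
  obtain ⟨b3, b4⟩ := sub_cube_bounds (sub_nonneg.2 hs1) (by linarith : 1 - s ≤ 1)
  have hm : 0 ≤ m := (abs_nonneg _).trans hm₀
  have a1 := abs_mul_le_of_abs_le hw₀ (sub_nonneg.2 hs1)
  have a2 := abs_mul_le_of_abs_le hw₁ hs0
  have a3 := abs_mul_le_of_abs_le hm₀ b3
  have a4 := abs_mul_le_of_abs_le hm₁ b1
  have a5 := mul_le_mul_of_nonneg_right b4 hm
  have a6 := mul_le_mul_of_nonneg_right b2 hm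
  have a7 : |((1 - s) - (1 - s) ^ 3) * m₀ + (s - s ^ 3) * m₁| ≤ 2 * m := by
    rw [abs_le]; constructor <;> linarith
  have a8 := abs_mul_le_of_abs_le a7 (by positivity : 0 ≤ H ^ 2 / 6)
  rw [abs_le]; constructor <;> linarith

theorem cellCubic_sq_le {H w₀ w₁ m₀ m₁ θ : ℝ} (hH : 0 < H) (h0 : 0 ≤ θ) (h1 : θ ≤ H) :
    cellCubic H w₀ w₁ m₀ m₁ θ ^ 2 ≤
      4 * (w₀ ^ 2 + w₁ ^ 2) + H ^ 4 / 9 * (m₀ ^ 2 + m₁ ^ 2) := by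
  obtain ⟨s, hs0, hs1, rfl⟩ := exists_cell_coordinate hH h0 h1
  rw [cellCubic_eq hH]
  obtain ⟨b1, b2⟩ := sub_cube_bounds hs0 hs1
  obtain ⟨b3, b4⟩ := sub_cube_bounds (sub_nonneg.2 hs1) (by linarith : 1 - s ≤ 1)
  have key : ∀ c x : ℝ, 0 ≤ c → c ≤ 1 → (c * x) ^ 2 ≤ x ^ 2 := by
    intro c x hc0 hc1
    rw [mul_pow]
    exact mul_le_of_le_one_left (sq_nonneg x) (by nlinarith)
  have k1 := key (1 - s) w₀ (by linarith) (by linarith)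
  have k2 := key s w₁ hs0 hs1
  have k3 := key _ (H ^ 2 / 6 * m₀) b3 b4
  have k4 := key _ (H ^ 2 / 6 * m₁) b1 b2
  set A := (1 - s) * w₀
  set B := s * w₁
  set P := ((1 - s) - (1 - s) ^ 3) * (H ^ 2 / 6 * m₀)
  set Q := (s - s ^ 3) * (H ^ 2 / 6 * m₁)
  have : A + B - H ^ 2 / 6 * (((1 - s) - (1 - s) ^ 3) * m₀ + (s - s ^ 3) * m₁) = A + B - P - Q := by
    ring
  rw [this]
  have : (A + B - P - Q) ^ 2 ≤ 4 * (A ^ 2 + B ^ 2 + P ^ 2 + Q ^ 2) := by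
    nlinarith [sq_nonneg (A - B), sq_nonneg (A + P), sq_nonneg (A + Q), sq_nonneg (B + P),
      sq_nonneg (B + Q), sq_nonneg (P - Q)]
  nlinarith

theorem cellCubic_sub (H w₀ w₁ m₀ m₁ v₀ v₁ n₀ n₁ θ : ℝ) :
    cellCubic H w₀ w₁ m₀ m₁ θ - cellCubic H v₀ v₁ n₀ n₁ θ
      = cellCubic H (w₀ - v₀) (w₁ - v₁) (m₀ - n₀) (m₁ - n₁) θ := by
  simp only [cellCubic]; ring

/-- With exact end values and exact end second derivatives the cell cubic reproduces polynomials of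
degree three, so only Taylor remainders at a survive. -/
theorem cellCubic_truncation {a H C θ : ℝ} (hH : 0 < H) (h0 : 0 ≤ θ) (h1 : θ ≤ H)
    {φ : ℕ → ℝ → ℝ}
    (hd : ∀ k < 4, ∀ x ∈ Icc a (a + H), HasDerivWithinAt (φ k) (φ (k + 1) x) (Icc a (a + H)) x)
    (hC : ∀ x ∈ Icc a (a + H), |φ 4 x| ≤ C) :
    |cellCubic H (φ 0 a) (φ 0 (a + H)) (φ 2 a) (φ 2 (a + H)) θ - φ 0 (a + θ)| ≤ C * H ^ 4 := by
  have m1 : a + θ ∈ Icc a (a + H) := ⟨by linarith, by linarith⟩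
  have m2 : a + H ∈ Icc a (a + H) := ⟨by linarith, by linarith⟩
  have t1 := taylor_chain_bound 4 φ hd hC _ m1
  have t2 := taylor_chain_bound 4 φ hd hC _ m2
  have t4 := taylor_chain_bound 2 (fun k => φ (k + 2)) (fun k hk => hd (k + 2) (by omega)) hC _ m2
  have hC0 : 0 ≤ C := (abs_nonneg _).trans (hC _ m1)
  have hθ : C * θ ^ 4 ≤ C * H ^ 4 := by gcongr
  obtain ⟨s, hs0, hs1, rfl⟩ := exists_cell_coordinate hH h0 h1
  rw [cellCubic_eq hH]
  simp only [Finset.sum_range_succ, Finset.sum_range_zero, Nat.factorial, add_sub_cancel_left]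
    at t1 t2 t4
  norm_num at t1 t2 t4
  obtain ⟨b1, b2⟩ := sub_cube_bounds hs0 hs1
  have c0 : 0 ≤ H ^ 2 / 6 * (s - s ^ 3) := mul_nonneg (by positivity) b1
  have s2 := abs_mul_le_of_abs_le t2 hs0
  have s4 := abs_mul_le_of_abs_le t4 c0
  have u2 : s * (C * H ^ 4 / 24) ≤ C * H ^ 4 / 24 :=
    mul_le_of_le_one_left (by positivity) hs1
  have u4 : H ^ 2 / 6 * (s - s ^ 3) * (C * H ^ 2 / 2) ≤ C * H ^ 4 / 12 := by
    have : (s - s ^ 3) * (C * H ^ 4 / 12) ≤ C * H ^ 4 / 12 :=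
      mul_le_of_le_one_left (by positivity) b2
    linarith
  have hh6 : 0 ≤ C * H ^ 4 := by positivity
  rw [abs_le] at t1 ⊢
  constructor <;> linarith [t1.1, t1.2, s2.1, s2.2, s4.1, s4.2]

/-- The matrix equation read row by row. In the first and last rows the neighbour missing from the
matrix is an end coefficient, which is zero here, so all rows have the same form. -/
theorem spline_system {M : ℕ} (H : ℝ) (w : ℕ → ℝ) {i : ℕ} (h1 : 1 ≤ i) (hM : i + 1 ≤ M) :
    splineCoeff M H w 0 0 (i - 1) / 2 + 2 * splineCoeff M H w 0 0 i
      + splineCoeff M H w 0 0 (i + 1) / 2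
      = 3 * ((w (i + 1) - 2 * w i + w (i - 1)) / H ^ 2) := by
  set y := splineCoeff M H w 0 0 with hy
  have hy0 : y 0 = 0 := by simp [hy, splineCoeff]
  have hyM : y M = 0 := by simp [hy, splineCoeff]
  have hx : ∀ j : Fin (M - 1), ((splineMatrix M)⁻¹.mulVec (splineRhs M H w 0 0)) j = y (j + 1) := by
    intro j
    simp [hy, splineCoeff]
  have hsol : (splineMatrix M).mulVec ((splineMatrix M)⁻¹.mulVec (splineRhs M H w 0 0))
      = splineRhs M H w 0 0 := by
    rw [Matrix.mulVec_mulVec, Matrix.mul_nonsing_inv _ (isUnit_iff_ne_zero.2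
      (splineMatrix_det_ne_zero M)), Matrix.one_mulVec]
  have hrow := congrFun hsol ⟨i - 1, by omega⟩
  rw [Matrix.mulVec, dotProduct] at hrow
  simp only [hx, splineRhs, splineMatrix, Fin.ext_iff] at hrow
  rw [Fin.sum_univ_eq_sum_range (fun j => (if i - 1 = j then (2 : ℝ) else
    if i - 1 + 1 = j ∨ j + 1 = i - 1 then 1 / 2 else 0) * y (j + 1)) (M - 1)] at hrow
  -- Matrix index j belongs to node j + 1. As i - 2 is truncated subtraction, the guard 2 ≤ i
  -- removes a spurious left neighbour in the first row.
  have split : ∀ j ∈ Finset.range (M - 1), (if i - 1 = j then (2 : ℝ) else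
      if i - 1 + 1 = j ∨ j + 1 = i - 1 then 1 / 2 else 0) * y (j + 1)
      = (if i - 1 = j then 2 * y (j + 1) else 0) + ((if i = j then y (j + 1) / 2 else 0)
        + (if i - 2 = j then (if 2 ≤ i then y (j + 1) / 2 else 0) else 0)) := by
    intro j _
    split_ifs <;> first | omega | ring
  rw [Finset.sum_congr rfl split, Finset.sum_add_distrib, Finset.sum_add_distrib,
    Finset.sum_ite_eq, Finset.sum_ite_eq, Finset.sum_ite_eq] at hrow
  have e1 : i - 1 + 1 = i := by omega
  have e2 : i - 1 + 2 = i + 1 := by omega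
  rw [if_pos (by simp; omega), e1, e2] at hrow
  have r1 : (if i ∈ Finset.range (M - 1) then y (i + 1) / 2 else 0) = y (i + 1) / 2 := by
    split_ifs with h
    · rfl
    · have : i + 1 = M := by simp at h; omega
      rw [this, hyM]; simp
  have r2 : (if i - 2 ∈ Finset.range (M - 1) then if 2 ≤ i then y (i - 2 + 1) / 2 else 0 else 0)
      = y (i - 1) / 2 := by
    rw [if_pos (by simp; omega)]
    split_ifs with h
    · rw [show i - 2 + 1 = i - 1 by omega]
    · rw [show i - 1 = 0 by omega, hy0]; simp
  rw [r1, r2] at hrow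
  simp only [zero_div, ite_self, sub_zero] at hrow
  linarith

theorem splineCoeff_zero (M : ℕ) (H : ℝ) (w : ℕ → ℝ) : splineCoeff M H w 0 0 0 = 0 := by
  simp [splineCoeff]

theorem splineCoeff_last (M : ℕ) (H : ℝ) (w : ℕ → ℝ) : splineCoeff M H w 0 0 M = 0 := by
  simp [splineCoeff]

/-- Maximum principle for the spline system. -/
theorem abs_le_of_spline_system {M : ℕ} {y : ℕ → ℝ} {B : ℝ} (hB : 0 ≤ B) (h0 : y 0 = 0)
    (hM : y M = 0)
    (h : ∀ i, 1 ≤ i → i + 1 ≤ M → |y (i - 1) / 2 + 2 * y i + y (i + 1) / 2| ≤ B) :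
    ∀ i ≤ M, |y i| ≤ B := by
  obtain ⟨k, hk, hmax⟩ := Finset.exists_max_image (Finset.range (M + 1)) (fun i => |y i|)
    ⟨0, by simp⟩
  have hk' : k ≤ M := by have := Finset.mem_range.1 hk; omega
  suffices hkB : |y k| ≤ B from fun i hi => (hmax i (by simp; omega)).trans hkB
  rcases Nat.eq_zero_or_pos k with rfl | hk0
  · simpa [h0] using hB
  rcases Nat.lt_or_ge k M with hkM | hkM
  -- At an index of largest modulus the diagonal entry 2 exceeds the two off-diagonal halves by 1,
  -- which leaves |y k| ≤ B.
  · have a1 := hmax (k - 1) (by simp; omega)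
    have a2 := hmax (k + 1) (by simp; omega)
    have a3 := abs_le.1 (h k hk0 hkM)
    have a4 := abs_le.1 a1
    have a5 := abs_le.1 a2
    rcases abs_cases (y k) with ⟨h5, _⟩ | ⟨h5, _⟩ <;> linarith
  · obtain rfl : k = M := le_antisymm hk' hkM
    simpa [hM] using hB

/-- Discrete `L²` stability of the spline system. -/
theorem sum_sq_le_of_spline_system {M : ℕ} {y d : ℕ → ℝ} (h0 : y 0 = 0) (hM : y M = 0)
    (h : ∀ i, 1 ≤ i → i + 1 ≤ M → y (i - 1) / 2 + 2 * y i + y (i + 1) / 2 = d i) :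
    ∑ i ∈ Finset.Ico 1 M, y i ^ 2 ≤ ∑ i ∈ Finset.Ico 1 M, d i ^ 2 := by
  have e1 := sum_range_eq_Ico_of_zero (F := fun i => y i ^ 2) (by simp [h0]) M
  have e2 := sum_range_succ_eq_Ico_of_zero (F := fun i => y i ^ 2) (M := M) (by simp [hM])
  have e3 := sum_range_succ_eq_Ico_of_zero (F := fun i => y (i - 1) * y i) (M := M) (by simp [hM])
  have e4 := sum_range_eq_Ico_of_zero (F := fun i => y (i + 1) * y i) (by simp [h0]) M
  simp only [Nat.add_sub_cancel] at e3
  -- As a quadratic form, ½ tridiag(1, 4, 1) is the identity plus half of this sum, hence coercive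
  -- with constant 1; then 2 d y ≤ d² + y² concludes.
  have p : 0 ≤ ∑ i ∈ Finset.range M, (y i + y (i + 1)) ^ 2 :=
    Finset.sum_nonneg fun _ _ => sq_nonneg _
  have e5 : ∑ i ∈ Finset.range M, (y i + y (i + 1)) ^ 2 = ∑ i ∈ Finset.range M, y i ^ 2
      + ∑ i ∈ Finset.range M, y (i + 1) ^ 2 + ∑ i ∈ Finset.range M, y i * y (i + 1)
      + ∑ i ∈ Finset.range M, y (i + 1) * y i := by
    rw [← Finset.sum_add_distrib, ← Finset.sum_add_distrib, ← Finset.sum_add_distrib]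
    exact Finset.sum_congr rfl fun i _ => by ring
  have e6 : ∑ i ∈ Finset.Ico 1 M, d i * y i = 1 / 2 * ∑ i ∈ Finset.Ico 1 M, y (i - 1) * y i
      + 2 * ∑ i ∈ Finset.Ico 1 M, y i ^ 2 + 1 / 2 * ∑ i ∈ Finset.Ico 1 M, y (i + 1) * y i := by
    rw [Finset.mul_sum, Finset.mul_sum, Finset.mul_sum, ← Finset.sum_add_distrib,
      ← Finset.sum_add_distrib]
    refine Finset.sum_congr rfl fun i hi => ?_
    rw [Finset.mem_Ico] at hi
    rw [← h i hi.1 hi.2]; ring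
  have e7 : ∑ i ∈ Finset.Ico 1 M, 2 * (d i * y i) ≤
      ∑ i ∈ Finset.Ico 1 M, (d i ^ 2 + y i ^ 2) :=
    Finset.sum_le_sum fun i _ => by nlinarith [sq_nonneg (d i - y i)]
  rw [← Finset.mul_sum, Finset.sum_add_distrib] at e7
  linarith

theorem abs_splineCoeff_le {M : ℕ} {H W : ℝ} (hH : 0 < H) {w : ℕ → ℝ} (hW : 0 ≤ W)
    (hw : ∀ i ≤ M, |w i| ≤ W) : ∀ i ≤ M, |splineCoeff M H w 0 0 i| ≤ 12 * W / H ^ 2 := by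
  refine abs_le_of_spline_system (by positivity) (splineCoeff_zero _ _ _)
    (splineCoeff_last _ _ _) fun i h1 h2 => ?_
  rw [spline_system H w h1 h2, abs_le]
  have a1 := abs_le.1 (hw (i + 1) h2)
  have a2 := abs_le.1 (hw i (by omega))
  have a3 := abs_le.1 (hw (i - 1) (by omega))
  have : 0 < H ^ 2 := by positivity
  constructor
  · rw [← mul_div_assoc, neg_le_iff_add_nonneg, ← add_div]
    exact div_nonneg (by linarith) this.le
  · rw [← mul_div_assoc]
    exact div_le_div_of_nonneg_right (by linarith) this.le

/-- An inverse estimate. The right-hand side obeys 9 (p - 2q + r)² ≤ 54 (p² + q² + r²), and each of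
the three shifted sums is at most the sum of w², so 162 = 3·54. -/
theorem sum_splineCoeff_sq_le {M : ℕ} {H : ℝ} (hH : 0 < H) {w : ℕ → ℝ} (h0 : w 0 = 0)
    (hM : w M = 0) :
    H ^ 4 * ∑ i ∈ Finset.Ico 1 M, splineCoeff M H w 0 0 i ^ 2
      ≤ 162 * ∑ i ∈ Finset.Ico 1 M, w i ^ 2 := by
  have h1 := sum_sq_le_of_spline_system (M := M) (splineCoeff_zero M H w) (splineCoeff_last M H w)
    (fun i h1 h2 => spline_system H w h1 h2)
  have e1 := sum_range_eq_Ico_of_zero (F := fun i => w i ^ 2) (by simp [h0]) M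
  have e2 := sum_range_succ_eq_Ico_of_zero (F := fun i => w i ^ 2) (M := M) (by simp [hM])
  have g1 : ∑ i ∈ Finset.Ico 1 M, w (i + 1) ^ 2 ≤ ∑ i ∈ Finset.Ico 1 M, w i ^ 2 := by
    rw [← e2]
    exact Finset.sum_le_sum_of_subset_of_nonneg (fun i hi => by simp at hi ⊢; omega)
      fun _ _ _ => sq_nonneg _
  have g2 : ∑ i ∈ Finset.Ico 1 M, w (i - 1) ^ 2 ≤ ∑ i ∈ Finset.Ico 1 M, w i ^ 2 := by
    rw [← e1, Finset.sum_Ico_eq_sum_range]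
    simp only [Nat.add_sub_cancel_left]
    exact Finset.sum_le_sum_of_subset_of_nonneg (fun i hi => by simp at hi ⊢; omega)
      fun _ _ _ => sq_nonneg _
  have h3 : ∑ i ∈ Finset.Ico 1 M, (3 * ((w (i + 1) - 2 * w i + w (i - 1)) / H ^ 2)) ^ 2
      ≤ ∑ i ∈ Finset.Ico 1 M, 54 / H ^ 4 * (w (i + 1) ^ 2 + w i ^ 2 + w (i - 1) ^ 2) := by
    refine Finset.sum_le_sum fun i _ => ?_
    have : (3 * ((w (i + 1) - 2 * w i + w (i - 1)) / H ^ 2)) ^ 2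
        = 9 / H ^ 4 * (w (i + 1) - 2 * w i + w (i - 1)) ^ 2 := by field_simp; ring
    rw [this, show 54 / H ^ 4 = 9 / H ^ 4 * 6 by ring, mul_assoc]
    refine mul_le_mul_of_nonneg_left ?_ (by positivity)
    nlinarith [sq_nonneg (2 * w (i + 1) + w i), sq_nonneg (w (i + 1) - w (i - 1)),
      sq_nonneg (w i + 2 * w (i - 1))]
  rw [← Finset.mul_sum, Finset.sum_add_distrib, Finset.sum_add_distrib] at h3
  have h4 := mul_le_mul_of_nonneg_left (h1.trans h3) (by positivity : 0 ≤ H ^ 4)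
  rw [← mul_assoc, mul_div_cancel₀ _ (by positivity : H ^ 4 ≠ 0)] at h4
  linarith

/-- The cell containing `x` and the local form of the spline. -/
theorem cubicSpline_eq_cellCubic {l H : ℝ} {M : ℕ} (w : ℕ → ℝ) {x : ℝ} {k : ℕ}
    (hk : min ⌊(x - l) / H⌋₊ (M - 1) = k) :
    cubicSpline l H M w 0 0 x = cellCubic H (w k) (w (k + 1)) (splineCoeff M H w 0 0 k)
      (splineCoeff M H w 0 0 (k + 1)) (x - l - k * H) := by
  simp only [cubicSpline, hk, cellCubic]
  have : l + ((k : ℝ) + 1) * H - x = H - (x - l - k * H) := by ring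
  rw [this, show x - (l + k * H) = x - l - k * H by ring]

theorem exists_cell {l H : ℝ} {M : ℕ} (hH : 0 < H) (hM : 1 ≤ M) {x : ℝ} (hx0 : l ≤ x)
    (hx1 : x ≤ l + M * H) : ∃ k, k + 1 ≤ M ∧ min ⌊(x - l) / H⌋₊ (M - 1) = k ∧
      0 ≤ x - l - k * H ∧ x - l - k * H ≤ H := by
  refine ⟨min ⌊(x - l) / H⌋₊ (M - 1), by omega, rfl, ?_, ?_⟩
  · have h1 := Nat.floor_le (div_nonneg (sub_nonneg.2 hx0) hH.le)
    rw [le_div_iff₀ hH] at h1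
    have h2 : ((min ⌊(x - l) / H⌋₊ (M - 1) : ℕ) : ℝ) ≤ (⌊(x - l) / H⌋₊ : ℝ) := by
      exact_mod_cast min_le_left _ _
    have := mul_le_mul_of_nonneg_right h2 hH.le
    linarith
  · rcases le_total ⌊(x - l) / H⌋₊ (M - 1) with h | h
    · rw [min_eq_left h]
      have h1 := (Nat.lt_floor_add_one ((x - l) / H)).le
      rw [div_le_iff₀ hH] at h1
      linarith
    · rw [min_eq_right h, Nat.cast_sub hM]
      push_cast
      linarith

/-- Here 5 = 1 + 12/3: the coefficients are at most 12 W / H², and a cell adds a third of H² times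
their size. -/
theorem abs_cubicSpline_le {l H W : ℝ} {M : ℕ} (hH : 0 < H) (hM : 1 ≤ M) {w : ℕ → ℝ}
    (hW : 0 ≤ W) (hw : ∀ i ≤ M, |w i| ≤ W) {x : ℝ} (hx0 : l ≤ x) (hx1 : x ≤ l + M * H) :
    |cubicSpline l H M w 0 0 x| ≤ 5 * W := by
  obtain ⟨k, hkM, hk, h0, h1⟩ := exists_cell hH hM hx0 hx1
  rw [cubicSpline_eq_cellCubic w hk]
  have hc := abs_splineCoeff_le hH hW hw
  refine (abs_cellCubic_le hH h0 h1 (hw k (by omega)) (hw _ hkM) (hc k (by omega))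
    (hc _ hkM)).trans (le_of_eq ?_)
  field_simp
  ring

theorem cubicSpline_sub {l H : ℝ} {M : ℕ} (v w : ℕ → ℝ) (x : ℝ) :
    cubicSpline l H M v 0 0 x - cubicSpline l H M w 0 0 x
      = cubicSpline l H M (fun i => v i - w i) 0 0 x := by
  have hr : splineRhs M H (fun i => v i - w i) 0 0 = splineRhs M H v 0 0 - splineRhs M H w 0 0 := by
    ext i
    simp only [splineRhs, Pi.sub_apply, zero_div, ite_self]
    ring
  have hc : ∀ i, splineCoeff M H (fun i => v i - w i) 0 0 i
      = splineCoeff M H v 0 0 i - splineCoeff M H w 0 0 i := by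
    intro i
    simp only [splineCoeff, hr, Matrix.mulVec_sub]
    split_ifs <;> simp
  simp only [cubicSpline, hc]
  ring

theorem cubicSpline_congr {l H : ℝ} {M : ℕ} (hM : 1 ≤ M) {v w : ℕ → ℝ}
    (h : ∀ i ≤ M, v i = w i) (x : ℝ) : cubicSpline l H M v 0 0 x = cubicSpline l H M w 0 0 x := by
  have hr : splineRhs M H v 0 0 = splineRhs M H w 0 0 := by
    ext i
    have := i.2
    rw [splineRhs, splineRhs, h _ (by omega), h _ (by omega), h _ (by omega)]
  have hc : ∀ i, splineCoeff M H v 0 0 i = splineCoeff M H w 0 0 i := by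
    intro i
    simp only [splineCoeff, hr]
  simp only [cubicSpline, hc]
  rw [h _ (by omega), h _ (by omega)]

/-- The fine node i lies in the coarse cell i / J, so each coarse cell receives J fine nodes. -/
theorem floor_node {H : ℝ} (hH : 0 < H) (l : ℝ) {J : ℕ} (hJ : 0 < J) (i : ℕ) :
    ⌊(l + i * (H / J) - l) / H⌋₊ = i / J := by
  have hJ' : (0 : ℝ) < J := by exact_mod_cast hJ
  have : (l + i * (H / J) - l) / H = (i : ℝ) / J := by field_simp; ring
  rw [this, Nat.floor_div_natCast, Nat.floor_natCast]

/-- Values at the coarse nodes. -/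
theorem cubicSpline_first {l H : ℝ} {M : ℕ} (hH : 0 < H) (w : ℕ → ℝ) :
    cubicSpline l H M w 0 0 l = w 0 := by
  have hk : min ⌊(l - l) / H⌋₊ (M - 1) = 0 := by simp
  rw [cubicSpline_eq_cellCubic w hk]
  have : l - l - ((0 : ℕ) : ℝ) * H = 0 * H := by simp
  rw [this, cellCubic_eq hH]
  ring

theorem cubicSpline_last {l H : ℝ} {M : ℕ} (hH : 0 < H) (hM : 1 ≤ M) (w : ℕ → ℝ) :
    cubicSpline l H M w 0 0 (l + M * H) = w M := by
  have hk : min ⌊(l + M * H - l) / H⌋₊ (M - 1) = M - 1 := by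
    have : (l + M * H - l) / H = M := by field_simp; ring
    rw [this, Nat.floor_natCast]; omega
  rw [cubicSpline_eq_cellCubic w hk]
  have : l + M * H - l - ((M - 1 : ℕ) : ℝ) * H = 1 * H := by
    rw [Nat.cast_sub hM]; push_cast; ring
  rw [this, cellCubic_eq hH, Nat.sub_add_cancel hM]
  ring

/-- Interpolation error of the natural spline for a function with vanishing second derivative at
the end points. -/
theorem cubicSpline_error {l H C : ℝ} {M : ℕ} (hH : 0 < H) (hM : 1 ≤ M) {φ : ℕ → ℝ → ℝ}
    (hd : ∀ k < 4, ∀ x ∈ Icc l (l + M * H),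
      HasDerivWithinAt (φ k) (φ (k + 1) x) (Icc l (l + M * H)) x)
    (hC : ∀ x ∈ Icc l (l + M * H), |φ 4 x| ≤ C) (hl : φ 2 l = 0) (hr : φ 2 (l + M * H) = 0)
    {w : ℕ → ℝ} (hw : ∀ i ≤ M, w i = φ 0 (l + i * H)) {x : ℝ} (hx0 : l ≤ x)
    (hx1 : x ≤ l + M * H) :
    |cubicSpline l H M w 0 0 x - φ 0 x| ≤ 3 * C * H ^ 4 := by
  have hMr : (1 : ℝ) ≤ M := by exact_mod_cast hM
  have hC0 : 0 ≤ C := (abs_nonneg _).trans (hC x ⟨hx0, hx1⟩)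
  have hsub : ∀ {i n : ℕ}, i + n ≤ M →
      Icc (l + i * H) (l + i * H + n * H) ⊆ Icc l (l + M * H) := by
    intro i n hin
    have h3 : ((i : ℝ) + n) ≤ M := by exact_mod_cast hin
    have h4 := mul_le_mul_of_nonneg_right h3 hH.le
    exact Icc_subset_Icc (le_add_of_nonneg_right (by positivity)) (by linarith)
  -- The coefficient errors solve the spline system with the truncation residual on the right and
  -- vanish at both ends, where φ'' is zero, so the maximum principle applies.
  have herr : ∀ i ≤ M, |splineCoeff M H w 0 0 i - φ 2 (l + i * H)| ≤ 5 * C * H ^ 2 := by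
    refine abs_le_of_spline_system (y := fun i => splineCoeff M H w 0 0 i - φ 2 (l + i * H))
      (by positivity) (by simp [splineCoeff_zero, hl])
      (by simp [splineCoeff_last, hr]) fun i h1 h2 => ?_
    obtain ⟨j, rfl⟩ : ∃ j, i = j + 1 := ⟨i - 1, by omega⟩
    have hs := hsub (show j + 2 ≤ M by omega)
    have h3 := spline_truncation (a := l + j * H) (h := H) (C := C) hH (φ := φ)
      (fun k hk x hx => (hd k hk x (hs (by simpa using hx))).mono (by simpa using hs))
      (fun x hx => hC x (hs (by simpa using hx)))
    have h4 := spline_system H w h1 h2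
    rw [hw _ (by omega), hw _ (by omega), hw _ (by omega)] at h4
    simp only [Nat.add_sub_cancel] at h4 ⊢
    rw [show l + ((j + 1 + 1 : ℕ) : ℝ) * H = l + j * H + 2 * H by push_cast; ring,
      show l + ((j + 1 : ℕ) : ℝ) * H = l + j * H + H by push_cast; ring] at *
    rw [← h4] at h3
    refine le_trans (le_of_eq ?_) h3
    congr 1; ring
  obtain ⟨k, hkM, hk, h0, h1⟩ := exists_cell hH hM hx0 hx1
  rw [cubicSpline_eq_cellCubic w hk]
  set θ := x - l - k * H with hθ
  have hs := hsub hkM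
  have h2 := cellCubic_truncation (a := l + k * H) (C := C) hH h0 h1 (φ := φ)
      (fun k hk x hx => (hd k hk x (hs (by simpa using hx))).mono (by simpa using hs))
      (fun x hx => hC x (hs (by simpa using hx)))
  have ex : l + k * H + θ = x := by rw [hθ]; ring
  have ek : l + k * H + H = l + ((k + 1 : ℕ) : ℝ) * H := by push_cast; ring
  rw [ex, ek, ← hw k (by omega), ← hw (k + 1) hkM] at h2
  -- The spline differs from the cubic with exact second derivatives by at most (H²/3)(5 C H²); with
  -- the error C H⁴ of that cubic this makes 8/3 ≤ 3.
  have h3 := abs_cellCubic_le (w₀ := 0) (w₁ := 0) (W := 0) hH h0 h1 (by simp) (by simp)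
    (herr k (by omega)) (herr (k + 1) hkM)
  have h4 := cellCubic_sub H (w k) (w (k + 1)) (splineCoeff M H w 0 0 k)
    (splineCoeff M H w 0 0 (k + 1)) (w k) (w (k + 1)) (φ 2 (l + k * H))
    (φ 2 (l + ((k + 1 : ℕ) : ℝ) * H)) θ
  rw [sub_self, sub_self] at h4
  rw [← h4] at h3
  have hp : 0 ≤ C * H ^ 4 := by positivity
  rw [abs_le] at h2 h3 ⊢
  constructor <;> linarith [h2.1, h2.2, h3.1, h3.2]

theorem sum_range_mul_div (F : ℕ → ℝ) {J : ℕ} (hJ : 0 < J) (M : ℕ) :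
    ∑ i ∈ Finset.range (J * M), F (i / J) = J * ∑ k ∈ Finset.range M, F k := by
  induction M with
  | zero => simp
  | succ M ih =>
    rw [Nat.mul_succ, Finset.sum_range_add, ih, Finset.sum_range_succ, mul_add]
    congr 1
    rw [Finset.sum_congr rfl fun i hi => by
      rw [Nat.mul_add_div hJ, Nat.div_eq_of_lt (Finset.mem_range.1 hi), add_zero]]
    simp

/-- Discrete `L²` stability of spline interpolation from a coarse grid to a finer grid. -/
theorem sum_cubicSpline_sq_le {l H : ℝ} {M J : ℕ} (hH : 0 < H) (hM : 1 ≤ M) (hJ : 0 < J)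
    {w : ℕ → ℝ} (h0 : w 0 = 0) (hwM : w M = 0) :
    ∑ i ∈ Finset.Ico 1 (J * M), cubicSpline l H M w 0 0 (l + i * (H / J)) ^ 2
      ≤ J * (44 * ∑ i ∈ Finset.Ico 1 M, w i ^ 2) := by
  set m := splineCoeff M H w 0 0 with hm
  have hJ' : (0 : ℝ) < J := by exact_mod_cast hJ
  have hle : ∀ i ∈ Finset.range (J * M), cubicSpline l H M w 0 0 (l + i * (H / J)) ^ 2 ≤
      (fun k => 4 * (w k ^ 2 + w (k + 1) ^ 2) + H ^ 4 / 9 * (m k ^ 2 + m (k + 1) ^ 2)) (i / J) := by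
    intro i hi
    have hi' := Finset.mem_range.1 hi
    have hx1 : l + i * (H / J) ≤ l + M * H := by
      have : (i : ℝ) ≤ J * M := by exact_mod_cast hi'.le
      have := mul_le_mul_of_nonneg_right this (by positivity : 0 ≤ H / J)
      have e : (J : ℝ) * M * (H / J) = M * H := by field_simp
      linarith
    obtain ⟨k, hkM, hk, a0, a1⟩ := exists_cell (x := l + i * (H / J)) hH hM
      (le_add_of_nonneg_right (by positivity)) hx1
    have hk2 : i / J = k := by
      rw [floor_node hH l hJ] at hk
      have : i / J < M := Nat.div_lt_of_lt_mul hi'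
      omega
    rw [hk2, cubicSpline_eq_cellCubic w hk]
    exact cellCubic_sq_le hH a0 a1
  have h1 : ∑ i ∈ Finset.Ico 1 (J * M), cubicSpline l H M w 0 0 (l + i * (H / J)) ^ 2
      ≤ ∑ i ∈ Finset.range (J * M), cubicSpline l H M w 0 0 (l + i * (H / J)) ^ 2 :=
    Finset.sum_le_sum_of_subset_of_nonneg (fun i hi => by simp at hi ⊢; omega)
      fun _ _ _ => sq_nonneg _
  refine h1.trans ((Finset.sum_le_sum hle).trans ?_)
  -- Grouping fine nodes by coarse cells produces the factor J. Each nodal value and each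
  -- coefficient belongs to at most two cells, whence 44 = 2·4 + 2·162/9.
  rw [sum_range_mul_div (fun k => 4 * (w k ^ 2 + w (k + 1) ^ 2)
    + H ^ 4 / 9 * (m k ^ 2 + m (k + 1) ^ 2)) hJ]
  refine mul_le_mul_of_nonneg_left ?_ hJ'.le
  have e1 := sum_range_eq_Ico_of_zero (F := fun i => w i ^ 2) (by simp [h0]) M
  have e2 := sum_range_succ_eq_Ico_of_zero (F := fun i => w i ^ 2) (M := M) (by simp [hwM])
  have e3 := sum_range_eq_Ico_of_zero (F := fun i => m i ^ 2)
    (by simp [hm, splineCoeff_zero]) M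
  have e4 := sum_range_succ_eq_Ico_of_zero (F := fun i => m i ^ 2) (M := M)
    (by simp [hm, splineCoeff_last])
  rw [Finset.sum_add_distrib, ← Finset.mul_sum, ← Finset.mul_sum, Finset.sum_add_distrib,
    Finset.sum_add_distrib, e1, e2, e3, e4]
  have := sum_splineCoeff_sq_le (M := M) hH h0 hwM
  rw [← hm] at this
  linarith

end TwoGrid
end


noncomputable section

namespace TwoGrid

/-! ### The regular part of the Abel kernel -/

/-- The reciprocal of the Gamma function. -/
def gammaInv (x : ℝ) : ℝ := (Real.Gamma x)⁻¹

/-- 1/Γ is entire, hence smooth on the real line also across the poles of Γ; this gives bounds on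
all of [0, 1], where 2 - α takes its values. -/
theorem gammaInv_contDiff (n : ℕ∞) : ContDiff ℝ n gammaInv := by
  have h1 : ContDiff ℂ n (fun s : ℂ => (Complex.Gamma s)⁻¹) :=
    Complex.differentiable_one_div_Gamma.contDiff
  have h2 : ContDiff ℝ n (fun x : ℝ => Complex.reCLM ((Complex.Gamma (Complex.ofRealCLM x))⁻¹)) :=
    Complex.reCLM.contDiff.comp ((h1.restrict_scalars ℝ).comp Complex.ofRealCLM.contDiff)
  have e : gammaInv = fun x : ℝ =>
      Complex.reCLM ((Complex.Gamma (Complex.ofRealCLM x))⁻¹) := by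
    ext x
    simp only [gammaInv, Complex.ofRealCLM_apply, Complex.Gamma_ofReal, Complex.reCLM_apply]
    rw [← Complex.ofReal_inv, Complex.ofReal_re]
  rw [e]
  exact h2

theorem gammaInv_bounds : ∃ K : ℝ, 0 ≤ K ∧ ∀ x ∈ Icc (0 : ℝ) 1,
    |gammaInv x| ≤ K ∧ |deriv gammaInv x| ≤ K ∧ |deriv (deriv gammaInv) x| ≤ K := by
  have h2 := gammaInv_contDiff 2
  have c1 : Continuous (deriv gammaInv) := h2.continuous_deriv (by norm_num)
  have c2 : Continuous (deriv (deriv gammaInv)) := by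
    have := h2.continuous_iteratedDeriv 2 (by norm_num)
    rwa [iteratedDeriv_succ, iteratedDeriv_one] at this
  obtain ⟨K0, h0⟩ := isCompact_Icc.exists_bound_of_continuousOn (s := Icc (0 : ℝ) 1)
    h2.continuous.continuousOn
  obtain ⟨K1, h1⟩ := isCompact_Icc.exists_bound_of_continuousOn (s := Icc (0 : ℝ) 1) c1.continuousOn
  obtain ⟨K2, h2⟩ := isCompact_Icc.exists_bound_of_continuousOn (s := Icc (0 : ℝ) 1) c2.continuousOn
  refine ⟨max 0 (max K0 (max K1 K2)), le_max_left _ _, fun x hx => ⟨?_, ?_, ?_⟩⟩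
  · exact (h0 x hx).trans (by simp)
  · exact (h1 x hx).trans (by simp)
  · exact (h2 x hx).trans (by simp)

theorem gammaInv_hasDerivAt (x : ℝ) : HasDerivAt gammaInv (deriv gammaInv x) x :=
  ((gammaInv_contDiff 1).differentiable (by norm_num) x).hasDerivAt

theorem deriv_gammaInv_hasDerivAt (x : ℝ) :
    HasDerivAt (deriv gammaInv) (deriv (deriv gammaInv) x) x := by
  have := (gammaInv_contDiff 2).differentiable_iteratedDeriv 1 (by norm_num) x
  rw [iteratedDeriv_one] at this
  exact this.hasDerivAt

/-- `Φ(s) = s^(α(0)-α(s)) / Γ(2-α(s))`, so that `k(s) = s^(1-α(0)) Φ(s)`. -/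
def regularPart (α : ℝ → ℝ) (s : ℝ) : ℝ :=
  Real.exp ((α 0 - α s) * Real.log s) * gammaInv (2 - α s)

theorem abelKernel_eq (α : ℝ → ℝ) {s : ℝ} (hs : 0 < s) :
    abelKernel α s = s ^ (1 - α 0) * regularPart α s := by
  rw [abelKernel, regularPart, gammaInv, div_eq_mul_inv, ← mul_assoc, mul_comm (α 0 - α s),
    ← Real.rpow_def_of_pos hs, ← Real.rpow_add hs]
  congr 3; ring

/-- From α'(0) = 0 and the bound for α'', the mean value inequality applied twice gives α' = O(s)
and α(0) - α(s) = O(s²). These orders of vanishing compensate the factors log s, 1/s and 1/s² in the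
derivatives of Φ. -/
theorem exponent_bounds {T : ℝ} {α : ℝ → ℝ} (hα : IsAdmissibleExponent T α) (hT : 0 < T) :
    ∃ (Q : ℝ) (a₁ a₂ : ℝ → ℝ), 0 ≤ Q ∧ ContinuousOn α (Icc 0 T) ∧
      (∀ s ∈ Icc 0 T, |α 0 - α s| ≤ Q * s ^ 2 ∧ |a₁ s| ≤ Q * s ∧ |a₂ s| ≤ Q) ∧
      ∀ s ∈ Ioo 0 T, HasDerivAt α (a₁ s) s ∧ HasDerivAt a₁ (a₂ s) s := by
  obtain ⟨Q, hQ⟩ := hα.bound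
  have h0 : (0 : ℝ) ∈ Icc 0 T := ⟨le_rfl, hT.le⟩
  have hQ0 : 0 ≤ Q := le_trans (by positivity) (hQ 0 h0)
  set I := Icc (0 : ℝ) T
  have hu : UniqueDiffOn ℝ I := uniqueDiffOn_Icc hT
  have hder : ∀ k < 3, ∀ s ∈ I, HasDerivWithinAt (iteratedDerivWithin k α I)
      (iteratedDerivWithin (k + 1) α I s) I s := by
    intro k hk s hs
    rw [iteratedDerivWithin_succ]
    exact (hα.diff k hk s hs).hasDerivWithinAt
  have hb2 : ∀ s ∈ I, |iteratedDerivWithin 2 α I s| ≤ Q := fun s hs =>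
    le_trans (by
      have h1 := abs_nonneg (iteratedDerivWithin 1 α I s)
      have h3 := abs_nonneg (iteratedDerivWithin 3 α I s)
      linarith) (hQ s hs)
  have hb1 : ∀ s ∈ I, |iteratedDerivWithin 1 α I s| ≤ Q * s := by
    intro s hs
    have := Convex.norm_image_sub_le_of_norm_hasDerivWithin_le (hder 1 (by norm_num)) hb2
      (convex_Icc 0 T) h0 hs
    rw [hα.deriv_zero, sub_zero, sub_zero, Real.norm_eq_abs, Real.norm_eq_abs,
      abs_of_nonneg hs.1] at this
    exact this
  have hd0 := hder 0 (by norm_num)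
  rw [iteratedDerivWithin_zero] at hd0
  refine ⟨Q, iteratedDerivWithin 1 α I, iteratedDerivWithin 2 α I, hQ0,
    fun s hs => (hd0 s hs).continuousWithinAt, fun s hs => ⟨?_, hb1 s hs, hb2 s hs⟩, fun s hs => ?_⟩
  · have hsub : Icc 0 s ⊆ I := Icc_subset_Icc_right hs.2
    have := Convex.norm_image_sub_le_of_norm_hasDerivWithin_le (C := Q * s)
      (fun x hx => (hd0 x (hsub hx)).mono hsub)
      (fun x hx => (hb1 x (hsub hx)).trans (mul_le_mul_of_nonneg_left hx.2 hQ0))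
      (convex_Icc 0 s) (left_mem_Icc.2 hs.1) (right_mem_Icc.2 hs.1)
    rw [sub_zero, Real.norm_eq_abs, Real.norm_eq_abs, abs_of_nonneg hs.1, abs_sub_comm] at this
    linarith
  · have hn : I ∈ nhds s := Icc_mem_nhds hs.1 hs.2
    exact ⟨(hd0 s (Ioo_subset_Icc_self hs)).hasDerivAt hn,
      (hder 1 (by norm_num) s (Ioo_subset_Icc_self hs)).hasDerivAt hn⟩

theorem mul_abs_log_le {T s : ℝ} (hs0 : 0 < s) (hsT : s ≤ T) : s * |Real.log s| ≤ 1 + T ^ 2 := by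
  rcases le_total s 1 with h | h
  · have := (Real.abs_log_mul_self_lt s hs0 h).le
    rw [abs_mul, abs_of_pos hs0] at this
    nlinarith [sq_nonneg T]
  · rw [abs_of_nonneg (Real.log_nonneg h)]
    have := Real.log_le_self hs0.le
    nlinarith

/-- Continuity of the regular part up to the end points. -/
theorem regularPart_continuousOn {T : ℝ} {α : ℝ → ℝ} (hα : IsAdmissibleExponent T α)
    (hT : 0 < T) : ContinuousOn (regularPart α) (Icc 0 T) := by
  obtain ⟨Q, a₁, a₂, hQ, hc, hb, hd⟩ := exponent_bounds hα hT
  have hX : ContinuousOn (fun s => (α 0 - α s) * Real.log s) (Icc 0 T) := by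
    intro s hs
    rcases hs.1.eq_or_lt with rfl | h
    · rw [ContinuousWithinAt]
      simp only [sub_self, zero_mul]
      refine squeeze_zero_norm' (a := fun s => Q * (1 + T ^ 2) * s) ?_ ?_
      · filter_upwards [self_mem_nhdsWithin] with x hx
        rcases hx.1.eq_or_lt with rfl | h0
        · simp
        · rw [Real.norm_eq_abs, abs_mul]
          have h1 := mul_le_mul_of_nonneg_right (hb x hx).1 (abs_nonneg (Real.log x))
          have h2 := mul_le_mul_of_nonneg_left (mul_abs_log_le h0 hx.2) (mul_nonneg hQ h0.le)
          linarith
      · have : Filter.Tendsto (fun s : ℝ => Q * (1 + T ^ 2) * s) (nhds 0)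
            (nhds (Q * (1 + T ^ 2) * 0)) := (continuous_const.mul continuous_id).tendsto 0
        rw [mul_zero] at this
        exact this.mono_left nhdsWithin_le_nhds
    · exact (continuousWithinAt_const.sub (hc s hs)).mul
        (Real.continuousAt_log h.ne').continuousWithinAt
  exact hX.rexp.mul ((gammaInv_contDiff 0).continuous.comp_continuousOn (continuousOn_const.sub hc))

theorem regularPart_bounds {T : ℝ} {α : ℝ → ℝ} (hα : IsAdmissibleExponent T α) (hT : 0 < T) :
    ∃ K : ℝ, 0 ≤ K ∧ (∀ s ∈ Icc 0 T, |regularPart α s| ≤ K) ∧ ∀ s ∈ Ioo 0 T,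
      DifferentiableAt ℝ (regularPart α) s ∧ |deriv (regularPart α) s| ≤ K ∧
      DifferentiableAt ℝ (deriv (regularPart α)) s ∧
      |deriv (deriv (regularPart α)) s| ≤ K * (|Real.log s| + 1) := by
  obtain ⟨Q, a₁, a₂, hQ, hc, hb, hd⟩ := exponent_bounds hα hT
  obtain ⟨R, hR0, hR⟩ := gammaInv_bounds
  obtain ⟨K0, hK0⟩ := isCompact_Icc.exists_bound_of_continuousOn (regularPart_continuousOn hα hT)
  set E : ℝ → ℝ := fun s => Real.exp ((α 0 - α s) * Real.log s)
  -- q is the logarithmic derivative of E. It is bounded, because s |log s| is bounded and α(0) -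
  -- α(s) = O(s²); its derivative q₁ keeps the one uncompensated logarithm, from α'' log s.
  set q : ℝ → ℝ := fun s => -a₁ s * Real.log s + (α 0 - α s) / s
  set q₁ : ℝ → ℝ := fun s => -a₂ s * Real.log s - 2 * a₁ s / s - (α 0 - α s) / s ^ 2
  set ρ : ℝ → ℝ := fun s => gammaInv (2 - α s)
  set ρ₁ : ℝ → ℝ := fun s => -deriv gammaInv (2 - α s) * a₁ s
  set ρ₂ : ℝ → ℝ := fun s => deriv (deriv gammaInv) (2 - α s) * a₁ s ^ 2
    - deriv gammaInv (2 - α s) * a₂ s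
  have dE : ∀ s ∈ Ioo 0 T, HasDerivAt E (E s * q s) s := by
    intro s hs
    have := (((hd s hs).1.const_sub (α 0)).mul (Real.hasDerivAt_log hs.1.ne')).exp
    exact this.congr_deriv (by simp only [E, q]; rfl)
  have dq : ∀ s ∈ Ioo 0 T, HasDerivAt q (q₁ s) s := by
    intro s hs
    have hs0 := hs.1.ne'
    have h1 := (hd s hs).2.neg.mul (Real.hasDerivAt_log hs0)
    have h2 := ((hd s hs).1.const_sub (α 0)).div (hasDerivAt_id s) hs0
    refine (h1.add h2).congr_deriv ?_
    simp only [q₁, Pi.neg_apply, id]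
    field_simp
    ring
  have dρ : ∀ s ∈ Ioo 0 T, HasDerivAt ρ (ρ₁ s) s := by
    intro s hs
    have := (gammaInv_hasDerivAt (2 - α s)).comp s ((hd s hs).1.const_sub 2)
    exact this.congr_deriv (by simp only [ρ₁]; ring)
  have dρ₁ : ∀ s ∈ Ioo 0 T, HasDerivAt ρ₁ (ρ₂ s) s := by
    intro s hs
    have := ((deriv_gammaInv_hasDerivAt (2 - α s)).comp s ((hd s hs).1.const_sub 2)).neg.mul
      (hd s hs).2
    refine this.congr_deriv ?_
    simp only [ρ₂, Pi.neg_apply, Function.comp]; ring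
  have hΦ : regularPart α = fun s => E s * ρ s := rfl
  have d1 : ∀ s ∈ Ioo 0 T, HasDerivAt (regularPart α) (E s * (q s * ρ s + ρ₁ s)) s := by
    intro s hs
    rw [hΦ]
    exact ((dE s hs).mul (dρ s hs)).congr_deriv (by ring)
  have d2 : ∀ s ∈ Ioo 0 T, HasDerivAt (deriv (regularPart α))
      (E s * (q s * (q s * ρ s + ρ₁ s) + (q₁ s * ρ s + q s * ρ₁ s + ρ₂ s))) s := by
    intro s hs
    have h1 := (dE s hs).mul (((dq s hs).mul (dρ s hs)).add (dρ₁ s hs))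
    refine (h1.congr_deriv ?_).congr_of_eventuallyEq ?_
    · simp only [Pi.add_apply, Pi.mul_apply]; ring
    · filter_upwards [Ioo_mem_nhds hs.1 hs.2] with x hx
      exact (d1 x hx).deriv
  -- bounds
  set S := 1 + T ^ 2 with hS
  set KE := Real.exp (Q * T * S)
  set Kq := Q * S + Q * T
  set K1 := R * (Q * T)
  set K2 := R * (Q * T) ^ 2 + R * Q
  have hT0 := hT.le
  have hS0 : 0 ≤ S := by positivity
  have bE : ∀ s ∈ Ioo 0 T, |E s| ≤ KE := by
    intro s hs
    rw [abs_of_pos (Real.exp_pos _)]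
    refine Real.exp_le_exp.2 ((le_abs_self _).trans ?_)
    rw [abs_mul]
    have h1 := mul_le_mul_of_nonneg_right (hb s (Ioo_subset_Icc_self hs)).1
      (abs_nonneg (Real.log s))
    have h2 := mul_le_mul_of_nonneg_left (mul_abs_log_le hs.1 hs.2.le) (mul_nonneg hQ hs.1.le)
    have h3 := mul_le_mul_of_nonneg_right (mul_le_mul_of_nonneg_left hs.2.le hQ) hS0
    linarith
  have bq : ∀ s ∈ Ioo 0 T, |q s| ≤ Kq := by
    intro s hs
    obtain ⟨b0, b1, b2⟩ := hb s (Ioo_subset_Icc_self hs)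
    refine (abs_add_le _ _).trans (add_le_add ?_ ?_)
    · rw [abs_mul, abs_neg]
      have h1 := mul_le_mul_of_nonneg_right b1 (abs_nonneg (Real.log s))
      have h2 := mul_le_mul_of_nonneg_left (mul_abs_log_le hs.1 hs.2.le) hQ
      linarith
    · rw [abs_div, abs_of_pos hs.1, div_le_iff₀ hs.1]
      have := mul_le_mul_of_nonneg_right (mul_le_mul_of_nonneg_left hs.2.le hQ) hs.1.le
      linarith
  have bq₁ : ∀ s ∈ Ioo 0 T, |q₁ s| ≤ 3 * Q * (|Real.log s| + 1) := by
    intro s hs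
    obtain ⟨b0, b1, b2⟩ := hb s (Ioo_subset_Icc_self hs)
    have c1 : |-a₂ s * Real.log s| ≤ Q * |Real.log s| := by
      rw [abs_mul, abs_neg]; exact mul_le_mul_of_nonneg_right b2 (abs_nonneg _)
    have c2 : |2 * a₁ s / s| ≤ 2 * Q := by
      rw [abs_div, abs_of_pos hs.1, div_le_iff₀ hs.1, abs_mul, abs_two]; linarith
    have c3 : |(α 0 - α s) / s ^ 2| ≤ Q := by
      rw [abs_div, abs_of_pos (pow_pos hs.1 2), div_le_iff₀ (pow_pos hs.1 2)]; exact b0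
    have c4 := abs_sub (-a₂ s * Real.log s - 2 * a₁ s / s) ((α 0 - α s) / s ^ 2)
    have c5 := abs_sub (-a₂ s * Real.log s) (2 * a₁ s / s)
    have := mul_nonneg hQ (abs_nonneg (Real.log s))
    simp only [q₁]
    linarith
  have hmem : ∀ s ∈ Ioo 0 T, 2 - α s ∈ Icc (0 : ℝ) 1 := by
    intro s hs
    have := hα.range s (Ioo_subset_Icc_self hs)
    constructor <;> linarith
  have ba : ∀ s ∈ Ioo 0 T, |a₁ s| ≤ Q * T := fun s hs =>
    (hb s (Ioo_subset_Icc_self hs)).2.1.trans (mul_le_mul_of_nonneg_left hs.2.le hQ)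
  have bρ : ∀ s ∈ Ioo 0 T, |ρ s| ≤ R := fun s hs => (hR _ (hmem s hs)).1
  have bρ₁ : ∀ s ∈ Ioo 0 T, |ρ₁ s| ≤ K1 := by
    intro s hs
    simp only [ρ₁]
    rw [abs_mul, abs_neg]
    exact mul_le_mul (hR _ (hmem s hs)).2.1 (ba s hs) (abs_nonneg _) hR0
  have bρ₂ : ∀ s ∈ Ioo 0 T, |ρ₂ s| ≤ K2 := by
    intro s hs
    refine (abs_sub _ _).trans (add_le_add ?_ ?_)
    · rw [abs_mul, abs_pow]
      exact mul_le_mul (hR _ (hmem s hs)).2.2 (pow_le_pow_left₀ (abs_nonneg _) (ba s hs) 2)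
        (by positivity) hR0
    · rw [abs_mul]
      exact mul_le_mul (hR _ (hmem s hs)).2.1 (hb s (Ioo_subset_Icc_self hs)).2.2
        (abs_nonneg _) hR0
  have hKq : 0 ≤ Kq := by positivity
  have hK1 : 0 ≤ K1 := by positivity
  have hK2 : 0 ≤ K2 := by positivity
  have hKE : 0 ≤ KE := (Real.exp_pos _).le
  have bsum : ∀ s ∈ Ioo 0 T, |q s * ρ s + ρ₁ s| ≤ Kq * R + K1 := by
    intro s hs
    refine (abs_add_le _ _).trans (add_le_add ?_ (bρ₁ s hs))
    rw [abs_mul]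
    exact mul_le_mul (bq s hs) (bρ s hs) (abs_nonneg _) hKq
  set A := KE * (Kq * R + K1)
  set B := KE * (Kq * (Kq * R + K1) + (3 * Q * R + Kq * K1 + K2))
  have hA : 0 ≤ A := by positivity
  have hB : 0 ≤ B := by positivity
  have hK00 : 0 ≤ K0 := (norm_nonneg _).trans (hK0 0 ⟨le_rfl, hT0⟩)
  refine ⟨K0 + A + B, by positivity, fun s hs => (hK0 s hs).trans (by linarith), fun s hs =>
    ⟨(d1 s hs).differentiableAt, ?_, (d2 s hs).differentiableAt, ?_⟩⟩
  · rw [(d1 s hs).deriv, abs_mul]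
    exact (mul_le_mul (bE s hs) (bsum s hs) (abs_nonneg _) hKE).trans (by linarith)
  · rw [(d2 s hs).deriv, abs_mul]
    set L := |Real.log s| + 1 with hL
    have hL1 : 1 ≤ L := by have := abs_nonneg (Real.log s); linarith
    have e1 : |q s * (q s * ρ s + ρ₁ s)| ≤ Kq * (Kq * R + K1) := by
      rw [abs_mul]
      exact mul_le_mul (bq s hs) (bsum s hs) (abs_nonneg _) hKq
    have e2 : |q₁ s * ρ s| ≤ 3 * Q * L * R := by
      rw [abs_mul]
      exact mul_le_mul (bq₁ s hs) (bρ s hs) (abs_nonneg _) (by positivity)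
    have e3 : |q s * ρ₁ s| ≤ Kq * K1 := by
      rw [abs_mul]
      exact mul_le_mul (bq s hs) (bρ₁ s hs) (abs_nonneg _) hKq
    have e4 := abs_add_le (q s * (q s * ρ s + ρ₁ s)) (q₁ s * ρ s + q s * ρ₁ s + ρ₂ s)
    have e5 := abs_add_le (q₁ s * ρ s + q s * ρ₁ s) (ρ₂ s)
    have e6 := abs_add_le (q₁ s * ρ s) (q s * ρ₁ s)
    have e7 := bρ₂ s hs
    have e8 : |q s * (q s * ρ s + ρ₁ s) + (q₁ s * ρ s + q s * ρ₁ s + ρ₂ s)|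
        ≤ (Kq * (Kq * R + K1) + (3 * Q * R + Kq * K1 + K2)) * L := by
      have f1 := mul_le_mul_of_nonneg_left hL1 (by positivity : 0 ≤ Kq * (Kq * R + K1))
      have f2 := mul_le_mul_of_nonneg_left hL1 (by positivity : 0 ≤ Kq * K1)
      have f3 := mul_le_mul_of_nonneg_left hL1 hK2
      linarith
    have e9 := mul_le_mul (bE s hs) e8 (abs_nonneg _) hKE
    have : 0 ≤ (K0 + A) * L := by positivity
    calc _ ≤ _ := e9
      _ = B * L := by simp only [B]; ring
      _ ≤ _ := by linarith

/-! ### The generalized identity function -/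

/-- The weight of the Beta integral. -/
def betaWeight (a z : ℝ) : ℝ := (1 - z) ^ (a - 1) * z ^ (-a) / Real.Gamma a

theorem betaWeight_nonneg {a : ℝ} (ha : 0 < a) {z : ℝ} (h0 : 0 ≤ z) (h1 : z ≤ 1) :
    0 ≤ betaWeight a z :=
  div_nonneg (mul_nonneg (Real.rpow_nonneg (sub_nonneg.2 h1) _) (Real.rpow_nonneg h0 _))
    (Real.Gamma_pos_of_pos ha).le

theorem betaWeight_eq_re (a : ℝ) {z : ℝ} (h0 : 0 ≤ z) (h1 : z ≤ 1) :
    betaWeight a z = ((z : ℂ) ^ (((1 - a : ℝ) : ℂ) - 1) * (1 - (z : ℂ)) ^ ((a : ℂ) - 1)).re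
      / Real.Gamma a := by
  have e1 : (z : ℂ) ^ (((1 - a : ℝ) : ℂ) - 1) = ((z ^ (-a) : ℝ) : ℂ) := by
    rw [Complex.ofReal_cpow h0]; push_cast; congr 1; ring
  have e2 : (1 - (z : ℂ)) ^ ((a : ℂ) - 1) = (((1 - z) ^ (a - 1) : ℝ) : ℂ) := by
    rw [Complex.ofReal_cpow (sub_nonneg.2 h1)]; push_cast; rfl
  rw [e1, e2, ← Complex.ofReal_mul, Complex.ofReal_re, betaWeight, mul_comm]

theorem betaWeight_intervalIntegrable {a : ℝ} (ha0 : 0 < a) (ha1 : a < 1) :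
    IntervalIntegrable (betaWeight a) MeasureTheory.volume 0 1 := by
  have h := Complex.betaIntegral_convergent (u := ((1 - a : ℝ) : ℂ)) (v := (a : ℂ))
    (by simpa using ha1) (by simpa using ha0)
  rw [intervalIntegrable_iff] at h ⊢
  refine MeasureTheory.Integrable.congr (h.re.div_const (Real.Gamma a)) ?_
  refine (MeasureTheory.ae_restrict_iff' measurableSet_uIoc).2 (Filter.Eventually.of_forall ?_)
  intro z hz
  rw [uIoc_of_le zero_le_one] at hz
  exact (betaWeight_eq_re a hz.1.le hz.2).symm

/-- The Beta integral with parameters 1 - a and a, whose sum is 1, so the denominator Γ(1) drops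
out. -/
theorem integral_betaWeight {a : ℝ} (ha0 : 0 < a) (ha1 : a < 1) :
    ∫ z in (0 : ℝ)..1, betaWeight a z = Real.Gamma (1 - a) := by
  have h := Complex.betaIntegral_convergent (u := ((1 - a : ℝ) : ℂ)) (v := (a : ℂ))
    (by simpa using ha1) (by simpa using ha0)
  have hb := ProbabilityTheory.beta_eq_betaIntegralReal (1 - a) a (by linarith) ha0
  rw [ProbabilityTheory.beta, sub_add_cancel, Real.Gamma_one, div_one, Complex.betaIntegral] at hb
  have hre := intervalIntegral.intervalIntegral_re h
  rw [intervalIntegral.integral_congr (g := fun z : ℝ =>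
    ((z : ℂ) ^ (((1 - a : ℝ) : ℂ) - 1) * (1 - (z : ℂ)) ^ ((a : ℂ) - 1)).re / Real.Gamma a)]
  · rw [intervalIntegral.integral_div, div_eq_iff (Real.Gamma_pos_of_pos ha0).ne', hb]
    exact hre
  · intro z hz
    rw [uIcc_of_le zero_le_one] at hz
    exact betaWeight_eq_re a hz.1 hz.2

/-- In s = t z the powers of t cancel: t · t^(a-1) · t^(-a) = 1. All dependence on t then sits in
Φ(t z), so g can be differentiated under the integral. At t = 0 the formula gives Γ(1-a)/Γ(1-a), the
prescribed value 1. -/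
theorem gfun_eq_integral {a : ℝ} {α : ℝ → ℝ} (ha0 : 0 < a) (ha1 : a < 1)
    (h0 : α 0 = 1 + a) {t : ℝ} (ht : 0 ≤ t) :
    gfun α t = ∫ z in (0 : ℝ)..1, betaWeight a z * regularPart α (t * z) := by
  rw [gfun]
  have hg := (Real.Gamma_pos_of_pos (by linarith : 0 < 1 - a)).ne'
  split_ifs with h
  · subst h
    simp only [zero_mul]
    rw [intervalIntegral.integral_mul_const, integral_betaWeight ha0 ha1, regularPart, gammaInv, h0]
    rw [sub_self, zero_mul, Real.exp_zero, one_mul, show 2 - (1 + a) = 1 - a by ring,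
      mul_inv_cancel₀ hg]
  · have ht : 0 < t := lt_of_le_of_ne ht (Ne.symm h)
    have := intervalIntegral.mul_integral_comp_mul_left (a := 0) (b := 1)
      (f := fun s => beta (α 0 - 1) (t - s) * abelKernel α s) t
    rw [mul_zero, mul_one] at this
    rw [← this, ← intervalIntegral.integral_const_mul]
    refine intervalIntegral.integral_congr fun z hz => ?_
    rw [uIcc_of_le zero_le_one] at hz
    rcases hz.1.eq_or_lt with rfl | hz0
    -- At z = 0 both integrands vanish, since zero to a nonzero power is zero by convention.
    · rw [mul_zero, abelKernel, betaWeight, h0, Real.zero_rpow (by linarith),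
        Real.zero_rpow (by linarith)]
      simp
    · rw [abelKernel_eq α (mul_pos ht hz0), beta, betaWeight, h0,
        show t - t * z = t * (1 - z) by ring, Real.mul_rpow ht.le (sub_nonneg.2 hz.2),
        Real.mul_rpow ht.le hz0.le, show 1 - (1 + a) = -a by ring,
        show 1 + a - 1 = a by ring]
      have e : t * (t ^ (a - 1) * t ^ (-a)) = 1 := by
        rw [← Real.rpow_add ht, show a - 1 + -a = -1 by ring, Real.rpow_neg_one,
          mul_inv_cancel₀ ht.ne']
      calc _ = (t * (t ^ (a - 1) * t ^ (-a))) * ((1 - z) ^ (a - 1) * z ^ (-a) / Real.Gamma a)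
            * regularPart α (t * z) := by ring
        _ = _ := by rw [e, one_mul]

end TwoGrid
end


/-! ### Continuity and derivative bounds of g. -/

noncomputable section

namespace TwoGrid

theorem betaWeight_mul_intervalIntegrable {a : ℝ} (ha0 : 0 < a) (ha1 : a < 1) {f : ℝ → ℝ}
    (hf : MeasureTheory.AEStronglyMeasurable f (MeasureTheory.volume.restrict (uIoc 0 1)))
    {K : ℝ} (hK : ∀ z ∈ Ioc (0 : ℝ) 1, |f z| ≤ K) :
    IntervalIntegrable (fun z => betaWeight a z * f z) MeasureTheory.volume 0 1 := by
  have h := betaWeight_intervalIntegrable ha0 ha1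
  rw [intervalIntegrable_iff] at h ⊢
  refine h.mul_bdd (c := K) hf ?_
  refine (MeasureTheory.ae_restrict_iff' measurableSet_uIoc).2 (Filter.Eventually.of_forall ?_)
  intro z hz
  rw [uIoc_of_le zero_le_one] at hz
  exact hK z hz

theorem regularPart_comp_continuousOn {T : ℝ} {α : ℝ → ℝ} (hα : IsAdmissibleExponent T α)
    (hT : 0 < T) {t : ℝ} (ht : t ∈ Icc 0 T) :
    ContinuousOn (fun z => regularPart α (t * z)) (Icc 0 1) := by
  refine (regularPart_continuousOn hα hT).comp (continuous_const.mul continuous_id).continuousOn ?_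
  intro z hz
  exact ⟨mul_nonneg ht.1 hz.1, (mul_le_of_le_one_right ht.1 hz.2).trans ht.2⟩

theorem mul_mem_Icc {T t z : ℝ} (ht : t ∈ Icc 0 T) (hz : z ∈ Ioc (0 : ℝ) 1) : t * z ∈ Icc 0 T :=
  ⟨mul_nonneg ht.1 hz.1.le, (mul_le_of_le_one_right ht.1 hz.2).trans ht.2⟩

theorem mul_mem_Ioo {T t z : ℝ} (ht : t ∈ Ioo 0 T) (hz : z ∈ Ioc (0 : ℝ) 1) : t * z ∈ Ioo 0 T :=
  ⟨mul_pos ht.1 hz.1, (mul_le_of_le_one_right ht.1.le hz.2).trans_lt ht.2⟩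

theorem aestronglyMeasurable_regularPart {T : ℝ} {α : ℝ → ℝ} (hα : IsAdmissibleExponent T α)
    (hT : 0 < T) {t : ℝ} (ht : t ∈ Icc 0 T) :
    MeasureTheory.AEStronglyMeasurable (fun z => regularPart α (t * z))
      (MeasureTheory.volume.restrict (uIoc 0 1)) := by
  rw [uIoc_of_le zero_le_one]
  exact ((regularPart_comp_continuousOn hα hT ht).mono Ioc_subset_Icc_self).aestronglyMeasurable
    measurableSet_Ioc

theorem gfun_continuousOn {T a : ℝ} {α : ℝ → ℝ} (ha0 : 0 < a) (ha1 : a < 1) (hT : 0 < T)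
    (hα : IsAdmissibleExponent T α) (h0 : α 0 = 1 + a) : ContinuousOn (gfun α) (Icc 0 T) := by
  obtain ⟨K, hK0, hK, -⟩ := regularPart_bounds hα hT
  have hw := betaWeight_intervalIntegrable ha0 ha1
  have key : ContinuousOn (fun t => ∫ z in (0 : ℝ)..1, betaWeight a z * regularPart α (t * z))
      (Icc 0 T) := by
    intro t ht
    refine intervalIntegral.continuousWithinAt_of_dominated_interval
      (bound := fun z => ‖betaWeight a z‖ * K) ?_ ?_ (hw.norm.mul_const K) ?_
    · filter_upwards [self_mem_nhdsWithin] with x hx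
      exact (intervalIntegrable_iff.1 (betaWeight_mul_intervalIntegrable ha0 ha1
        (aestronglyMeasurable_regularPart hα hT hx)
        (fun z hz => hK _ (mul_mem_Icc hx hz)))).aestronglyMeasurable
    · filter_upwards [self_mem_nhdsWithin] with x hx
      refine Filter.Eventually.of_forall fun z hz => ?_
      rw [uIoc_of_le zero_le_one] at hz
      rw [norm_mul]
      exact mul_le_mul_of_nonneg_left (hK _ (mul_mem_Icc hx hz)) (norm_nonneg _)
    · refine Filter.Eventually.of_forall fun z hz => ?_
      rw [uIoc_of_le zero_le_one] at hz
      refine continuousWithinAt_const.mul ?_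
      exact ((regularPart_continuousOn hα hT).comp
        (continuous_id.mul continuous_const).continuousOn (fun x hx => mul_mem_Icc hx hz)) t ht
  exact key.congr fun t ht => gfun_eq_integral ha0 ha1 h0 ht.1

/-- Each derivative in t of Φ(t z) brings out a factor z. The logarithm of t z splits into log t +
log z, and z |log z| ≤ 1 removes the second part, so only |ln t| remains in the bound of g''. -/
theorem exists_isKernelBound {T a : ℝ} {α : ℝ → ℝ} (ha0 : 0 < a) (ha1 : a < 1) (hT : 0 < T)
    (hα : IsAdmissibleExponent T α) (h0 : α 0 = 1 + a) : ∃ Qg, IsKernelBound T α Qg := by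
  obtain ⟨K, hK0, hK, hd⟩ := regularPart_bounds hα hT
  obtain ⟨G, hG⟩ := isCompact_Icc.exists_bound_of_continuousOn
    (gfun_continuousOn ha0 ha1 hT hα h0)
  have hw := betaWeight_intervalIntegrable ha0 ha1
  set W := ∫ z in (0 : ℝ)..1, betaWeight a z
  have hwn : ∀ z ∈ Ioc (0 : ℝ) 1, 0 ≤ betaWeight a z := fun z hz =>
    betaWeight_nonneg ha0 hz.1.le hz.2
  have hW0 : 0 ≤ W := intervalIntegral.integral_nonneg zero_le_one fun z hz =>
    betaWeight_nonneg ha0 hz.1 hz.2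
  have measW := (intervalIntegrable_iff.1 hw).aestronglyMeasurable
  have meas1 : ∀ t : ℝ, MeasureTheory.AEStronglyMeasurable
      (fun z => betaWeight a z * (z * deriv (regularPart α) (t * z)))
      (MeasureTheory.volume.restrict (uIoc 0 1)) := fun t =>
    measW.mul (measurable_id.mul ((measurable_deriv _).comp
      (measurable_const.mul measurable_id))).aestronglyMeasurable
  have meas2 : ∀ t : ℝ, MeasureTheory.AEStronglyMeasurable
      (fun z => betaWeight a z * (z * (z * deriv (deriv (regularPart α)) (t * z))))
      (MeasureTheory.volume.restrict (uIoc 0 1)) := fun t =>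
    measW.mul (measurable_id.mul (measurable_id.mul ((measurable_deriv _).comp
      (measurable_const.mul measurable_id)))).aestronglyMeasurable
  have b1 : ∀ t ∈ Ioo 0 T, ∀ z ∈ Ioc (0 : ℝ) 1,
      |betaWeight a z * (z * deriv (regularPart α) (t * z))| ≤ betaWeight a z * K := by
    intro t ht z hz
    rw [abs_mul, abs_of_nonneg (hwn z hz), abs_mul, abs_of_pos hz.1]
    refine mul_le_mul_of_nonneg_left ?_ (hwn z hz)
    have := (hd _ (mul_mem_Ioo ht hz)).2.1
    nlinarith [hz.1, hz.2, abs_nonneg (deriv (regularPart α) (t * z))]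
  have b2 : ∀ t ∈ Ioo 0 T, ∀ z ∈ Ioc (0 : ℝ) 1,
      |betaWeight a z * (z * (z * deriv (deriv (regularPart α)) (t * z)))|
        ≤ betaWeight a z * (K * (|Real.log t| + 2)) := by
    intro t ht z hz
    rw [abs_mul, abs_of_nonneg (hwn z hz), abs_mul, abs_mul, abs_of_pos hz.1]
    refine mul_le_mul_of_nonneg_left ?_ (hwn z hz)
    have h1 := (hd _ (mul_mem_Ioo ht hz)).2.2.2
    rw [Real.log_mul ht.1.ne' hz.1.ne'] at h1
    have h2 := abs_add_le (Real.log t) (Real.log z)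
    have h3 := (Real.abs_log_mul_self_lt z hz.1 hz.2).le
    rw [abs_mul, abs_of_pos hz.1] at h3
    have h4 := abs_nonneg (Real.log t)
    have h5 := abs_nonneg (deriv (deriv (regularPart α)) (t * z))
    have h6 : |deriv (deriv (regularPart α)) (t * z)| ≤
        K * (|Real.log t| + |Real.log z| + 1) :=
      h1.trans (mul_le_mul_of_nonneg_left (by linarith) hK0)
    have h7 : z * |deriv (deriv (regularPart α)) (t * z)| ≤ K * (|Real.log t| + 2) := by
      refine (mul_le_mul_of_nonneg_left h6 hz.1.le).trans ?_
      have : z * (|Real.log t| + |Real.log z| + 1) ≤ |Real.log t| + 2 := by nlinarith [hz.1, hz.2]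
      have := mul_le_mul_of_nonneg_left this hK0
      linarith
    exact (mul_le_of_le_one_left (mul_nonneg hz.1.le h5) hz.2).trans h7
  have D1 : ∀ t ∈ Ioo 0 T, HasDerivAt (gfun α)
      (∫ z in (0 : ℝ)..1, betaWeight a z * (z * deriv (regularPart α) (t * z))) t := by
    intro t ht
    have := (intervalIntegral.hasDerivAt_integral_of_dominated_loc_of_deriv_le
      (F := fun t z => betaWeight a z * regularPart α (t * z))
      (F' := fun t z => betaWeight a z * (z * deriv (regularPart α) (t * z)))
      (bound := fun z => betaWeight a z * K)
      (Ioo_mem_nhds ht.1 ht.2) ?_ ?_ (meas1 t) ?_ (hw.mul_const K) ?_).2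
    · refine this.congr_of_eventuallyEq ?_
      filter_upwards [Ioo_mem_nhds ht.1 ht.2] with x hx
      exact gfun_eq_integral ha0 ha1 h0 hx.1.le
    · filter_upwards [Ioo_mem_nhds ht.1 ht.2] with x hx
      exact measW.mul (aestronglyMeasurable_regularPart hα hT (Ioo_subset_Icc_self hx))
    · exact betaWeight_mul_intervalIntegrable ha0 ha1
        (aestronglyMeasurable_regularPart hα hT (Ioo_subset_Icc_self ht))
        (fun z hz => hK _ (mul_mem_Icc (Ioo_subset_Icc_self ht) hz))
    · refine Filter.Eventually.of_forall fun z hz x hx => ?_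
      rw [uIoc_of_le zero_le_one] at hz
      exact b1 x hx z hz
    · refine Filter.Eventually.of_forall fun z hz x hx => ?_
      rw [uIoc_of_le zero_le_one] at hz
      have h1 := (hd _ (mul_mem_Ioo hx hz)).1.hasDerivAt
      have h2 := h1.comp x ((hasDerivAt_id x).mul_const z)
      exact (h2.const_mul (betaWeight a z)).congr_deriv (by ring)
  have D2 : ∀ t ∈ Ioo 0 T, HasDerivAt (deriv (gfun α))
      (∫ z in (0 : ℝ)..1, betaWeight a z * (z * (z * deriv (deriv (regularPart α)) (t * z)))) t := by
    intro t ht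
    -- The bound for Φ'' is not uniform near 0, so the domination is local: on (t/2, T) the
    -- logarithm is at most L.
    set L := |Real.log (t / 2)| + |Real.log T| with hL
    have hlog : ∀ x ∈ Ioo (t / 2) T, |Real.log x| ≤ L := by
      intro x hx
      have hx0 : 0 < x := by linarith [hx.1, ht.1]
      have l1 := Real.log_le_log (by linarith [ht.1]) hx.1.le
      have l2 := Real.log_le_log hx0 hx.2.le
      rw [abs_le]
      constructor
      · linarith [neg_abs_le (Real.log (t / 2)), abs_nonneg (Real.log T)]
      · linarith [le_abs_self (Real.log T), abs_nonneg (Real.log (t / 2))]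
    have hsub : Ioo (t / 2) T ⊆ Ioo 0 T := Ioo_subset_Ioo_left (by linarith [ht.1])
    have hn : Ioo (t / 2) T ∈ nhds t := Ioo_mem_nhds (by linarith [ht.1]) ht.2
    have := (intervalIntegral.hasDerivAt_integral_of_dominated_loc_of_deriv_le
      (F := fun t z => betaWeight a z * (z * deriv (regularPart α) (t * z)))
      (F' := fun t z => betaWeight a z * (z * (z * deriv (deriv (regularPart α)) (t * z))))
      (bound := fun z => betaWeight a z * (K * (L + 2))) hn
      (Filter.Eventually.of_forall meas1) ?_ (meas2 t) ?_ (hw.mul_const _) ?_).2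
    · refine this.congr_of_eventuallyEq ?_
      filter_upwards [Ioo_mem_nhds ht.1 ht.2] with x hx
      exact (D1 x hx).deriv
    · refine (hw.mul_const K).mono_fun (meas1 t) ?_
      refine (MeasureTheory.ae_restrict_iff' measurableSet_uIoc).2
        (Filter.Eventually.of_forall fun z hz => ?_)
      rw [uIoc_of_le zero_le_one] at hz
      exact (b1 t ht z hz).trans (le_abs_self _)
    · refine Filter.Eventually.of_forall fun z hz x hx => ?_
      rw [uIoc_of_le zero_le_one] at hz
      refine (b2 x (hsub hx) z hz).trans ?_
      refine mul_le_mul_of_nonneg_left (mul_le_mul_of_nonneg_left ?_ hK0) (hwn z hz)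
      linarith [hlog x hx]
    · refine Filter.Eventually.of_forall fun z hz x hx => ?_
      rw [uIoc_of_le zero_le_one] at hz
      have h1 := (hd _ (mul_mem_Ioo (hsub hx) hz)).2.2.1.hasDerivAt
      have h2 := h1.comp x ((hasDerivAt_id x).mul_const z)
      exact ((h2.const_mul z).const_mul (betaWeight a z)).congr_deriv (by ring)
  have hbound : ∀ (f : ℝ → ℝ) (M : ℝ), (∀ z ∈ Ioc (0 : ℝ) 1, |f z| ≤ betaWeight a z * M) →
      |∫ z in (0 : ℝ)..1, f z| ≤ W * M := by
    intro f M hf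
    rw [← intervalIntegral.integral_mul_const, ← Real.norm_eq_abs]
    exact intervalIntegral.norm_integral_le_of_norm_le zero_le_one
      (Filter.Eventually.of_forall fun z hz => hf z hz) (hw.mul_const M)
  have hG0 : 0 ≤ G := (norm_nonneg _).trans (hG 0 ⟨le_rfl, hT.le⟩)
  have hWK : 0 ≤ W * K := mul_nonneg hW0 hK0
  refine ⟨G + 2 * (W * K), fun t ht => (hG t ht).trans (by linarith), fun t ht =>
    ⟨(D1 t ht).differentiableAt, ?_⟩, fun t ht => ⟨(D2 t ht).differentiableAt, ?_⟩⟩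
  · rw [(D1 t ht).deriv]
    exact (hbound _ K (b1 t ht)).trans (by linarith)
  · rw [(D2 t ht).deriv]
    refine (hbound _ _ (b2 t ht)).trans ?_
    have := abs_nonneg (Real.log t)
    nlinarith [mul_nonneg hWK this, mul_nonneg hG0 this]

end TwoGrid
end


/-! ### Volterra convolutions and the time-integrated equation. -/

noncomputable section

namespace TwoGrid

open MeasureTheory in
/-- Fubini's theorem on a triangle, for iterated Volterra convolutions. -/
theorem volterra_fubini {t : ℝ} (ht : 0 ≤ t) {p q φ : ℝ → ℝ} (hp : ContinuousOn p (Icc 0 t))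
    (hq : IntegrableOn q (Ioc 0 t)) (hφ : IntegrableOn φ (Ioc 0 t)) :
    ∫ s in (0 : ℝ)..t, p (t - s) * ∫ r in (0 : ℝ)..s, q (s - r) * φ r
      = ∫ r in (0 : ℝ)..t, φ r * ∫ σ in (0 : ℝ)..(t - r), p (t - r - σ) * q σ := by
  -- Extension by zero replaces the triangle by the whole plane. There the integrand is the
  -- convolution integrand of two integrable functions times a bounded factor, hence integrable on
  -- the product.
  set p' := (Icc 0 t).indicator p with hp'
  set q' := (Ioc 0 t).indicator q with hq'
  set φ' := (Ioc 0 t).indicator φ with hφ'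
  have iq : Integrable q' := hq.integrable_indicator measurableSet_Ioc
  have iφ : Integrable φ' := hφ.integrable_indicator measurableSet_Ioc
  have h1 : Integrable (fun z : ℝ × ℝ => φ' z.2 * q' (z.1 - z.2)) (volume.prod volume) :=
    iφ.convolution_integrand (ContinuousLinearMap.mul ℝ ℝ) iq
  obtain ⟨C, hC⟩ := isCompact_Icc.exists_bound_of_continuousOn hp
  have mp : AEStronglyMeasurable p' volume :=
    (aestronglyMeasurable_indicator_iff measurableSet_Icc).2
      (hp.aestronglyMeasurable measurableSet_Icc)
  have bp : ∀ x, ‖p' x‖ ≤ max C 0 := by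
    intro x
    by_cases hx : x ∈ Icc 0 t
    · rw [hp', indicator_of_mem hx]; exact (hC x hx).trans (le_max_left _ _)
    · rw [hp', indicator_of_notMem hx, norm_zero]; exact le_max_right _ _
  have h2 : Integrable (fun z : ℝ × ℝ => p' (t - z.1) * (φ' z.2 * q' (z.1 - z.2)))
      (volume.prod volume) := by
    refine h1.bdd_mul (c := max C 0) ?_ (Filter.Eventually.of_forall fun z => bp _)
    have : AEStronglyMeasurable (fun s => p' (t - s)) volume :=
      mp.comp_measurePreserving (Measure.measurePreserving_sub_left volume t)
    exact this.comp_fst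
  have swap := integral_integral_swap (f := fun s r => p' (t - s) * (φ' r * q' (s - r))) h2
  have left : ∀ s, ∫ r, p' (t - s) * (φ' r * q' (s - r))
      = (Ioc 0 t).indicator (fun s => p (t - s) * ∫ r in (0 : ℝ)..s, q (s - r) * φ r) s := by
    intro s
    rw [integral_const_mul]
    by_cases hs : s ∈ Ioc 0 t
    · rw [indicator_of_mem hs, hp', indicator_of_mem (show t - s ∈ Icc 0 t from
        ⟨by linarith [hs.2], by linarith [hs.1]⟩)]
      congr 1
      -- The endpoint r = s is discarded as a null set, because q' vanishes at 0.
      rw [intervalIntegral.integral_of_le hs.1.le, integral_Ioc_eq_integral_Ioo,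
        ← integral_indicator measurableSet_Ioo]
      congr 1
      ext r
      by_cases hr : r ∈ Ioo 0 s
      · rw [indicator_of_mem hr, hφ', hq',
          indicator_of_mem (show r ∈ Ioc 0 t from ⟨hr.1, hr.2.le.trans hs.2⟩),
          indicator_of_mem (show s - r ∈ Ioc 0 t from
            ⟨by linarith [hr.2], by linarith [hr.1, hs.2]⟩), mul_comm]
      · rw [indicator_of_notMem hr]
        by_cases h0 : 0 < r
        · have : s - r ∉ Ioc 0 t := fun h => hr ⟨h0, by linarith [h.1]⟩
          rw [hq', indicator_of_notMem this, mul_zero]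
        · rw [hφ', indicator_of_notMem (fun h => h0 h.1), zero_mul]
    · rw [indicator_of_notMem hs]
      by_cases h0 : 0 < s
      · rw [hp', indicator_of_notMem, zero_mul]
        exact fun h => hs ⟨h0, by linarith [h.1]⟩
      · have : (fun r => φ' r * q' (s - r)) = fun _ => 0 := by
          ext r
          by_cases hr : 0 < r
          · have : s - r ∉ Ioc 0 t := fun h => by linarith [h.1]
            rw [hq', indicator_of_notMem this, mul_zero]
          · rw [hφ', indicator_of_notMem (fun h => hr h.1), zero_mul]
        rw [this, integral_zero, mul_zero]
  have right : ∀ r, ∫ s, p' (t - s) * (φ' r * q' (s - r))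
      = (Ioc 0 t).indicator (fun r => φ r * ∫ σ in (0 : ℝ)..(t - r), p (t - r - σ) * q σ) r := by
    intro r
    by_cases hr : r ∈ Ioc 0 t
    · rw [indicator_of_mem hr]
      have e : ∀ s, p' (t - s) * (φ' r * q' (s - r)) = φ r * (p' (t - s) * q' (s - r)) := by
        intro s
        rw [hφ', indicator_of_mem hr]; ring
      simp only [e]
      rw [integral_const_mul]
      congr 1
      have e2 := intervalIntegral.integral_comp_sub_right (a := r) (b := t)
        (fun σ => p (t - r - σ) * q σ) r
      rw [sub_self] at e2
      rw [← e2, intervalIntegral.integral_of_le hr.2, ← integral_indicator measurableSet_Ioc]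
      congr 1
      ext s
      by_cases hs : s ∈ Ioc r t
      · rw [indicator_of_mem hs, hp', hq', indicator_of_mem (show t - s ∈ Icc 0 t from
          ⟨by linarith [hs.2], by linarith [hs.1, hr.1]⟩), indicator_of_mem
          (show s - r ∈ Ioc 0 t from ⟨by linarith [hs.1], by linarith [hs.2, hr.1]⟩)]
        congr 2; ring
      · rw [indicator_of_notMem hs]
        by_cases h0 : r < s
        · rw [hp', indicator_of_notMem (fun h => hs ⟨h0, by linarith [h.1]⟩), zero_mul]
        · rw [hq', indicator_of_notMem (fun h => h0 (by linarith [h.1])), mul_zero]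
    · rw [indicator_of_notMem hr, hφ', indicator_of_notMem hr]
      simp
  simp only [left, right] at swap
  rw [integral_indicator measurableSet_Ioc, integral_indicator measurableSet_Ioc,
    ← intervalIntegral.integral_of_le ht, ← intervalIntegral.integral_of_le ht] at swap
  exact swap

/-! ### Fractional powers -/

/-- `B(x) = x^a / Γ(a+1)`, the integral of `β_a`. -/
def betaInt (a x : ℝ) : ℝ := x ^ a / Real.Gamma (a + 1)

/-- `x^(a+1) / Γ(a+2)`, the second integral of `β_a`. -/
def betaInt₂ (a x : ℝ) : ℝ := x ^ (a + 1) / Real.Gamma (a + 2)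

theorem beta_intervalIntegrable {a : ℝ} (ha : 0 < a) (x y : ℝ) :
    IntervalIntegrable (beta a) MeasureTheory.volume x y :=
  (intervalIntegral.intervalIntegrable_rpow' (by linarith)).div_const _

theorem integral_beta {a : ℝ} (ha : 0 < a) (x y : ℝ) :
    ∫ s in x..y, beta a s = betaInt a y - betaInt a x := by
  have hg := (Real.Gamma_pos_of_pos ha).ne'
  simp only [beta, betaInt]
  rw [intervalIntegral.integral_div, integral_rpow (Or.inl (by linarith)), sub_add_cancel,
    Real.Gamma_add_one ha.ne']
  field_simp

theorem integral_betaInt {a : ℝ} (ha : 0 < a) (x y : ℝ) :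
    ∫ s in x..y, betaInt a s = betaInt₂ a y - betaInt₂ a x := by
  have hg := (Real.Gamma_pos_of_pos (by linarith : 0 < a + 1)).ne'
  simp only [betaInt, betaInt₂]
  rw [intervalIntegral.integral_div, integral_rpow (Or.inl (by linarith)),
    show a + 2 = a + 1 + 1 by ring, Real.Gamma_add_one (s := a + 1) (by linarith)]
  field_simp

theorem betaInt_continuous {a : ℝ} (ha : 0 < a) : Continuous (betaInt a) :=
  (continuous_id.rpow_const fun _ => Or.inr ha.le).div_const _

theorem betaInt_zero {a : ℝ} (ha : 0 < a) : betaInt a 0 = 0 := by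
  rw [betaInt, Real.zero_rpow ha.ne', zero_div]

theorem betaInt₂_zero {a : ℝ} (ha : 0 < a) : betaInt₂ a 0 = 0 := by
  rw [betaInt₂, Real.zero_rpow (by linarith), zero_div]

theorem betaInt_mono {a : ℝ} (ha : 0 < a) {x y : ℝ} (hx : 0 ≤ x) (hxy : x ≤ y) :
    betaInt a x ≤ betaInt a y :=
  div_le_div_of_nonneg_right (Real.rpow_le_rpow hx hxy ha.le)
    (Real.Gamma_pos_of_pos (by linarith)).le

theorem betaInt_nonneg {a : ℝ} (ha : 0 < a) {x : ℝ} (hx : 0 ≤ x) : 0 ≤ betaInt a x :=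
  div_nonneg (Real.rpow_nonneg hx _) (Real.Gamma_pos_of_pos (by linarith)).le

theorem abelKernel_integrableOn {T a : ℝ} {α : ℝ → ℝ} (ha1 : a < 1) (hT : 0 < T)
    (hα : IsAdmissibleExponent T α) (h0 : α 0 = 1 + a) :
    MeasureTheory.IntegrableOn (abelKernel α) (Ioc 0 T) := by
  have h1 : IntervalIntegrable (fun s : ℝ => s ^ (-a)) MeasureTheory.volume 0 T :=
    intervalIntegral.intervalIntegrable_rpow' (by linarith)
  have h2 := h1.mul_continuousOn (g := regularPart α)
    (by rw [uIcc_of_le hT.le]; exact regularPart_continuousOn hα hT)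
  rw [intervalIntegrable_iff_integrableOn_Ioc_of_le hT.le] at h2
  refine h2.congr_fun (fun s hs => ?_) measurableSet_Ioc
  rw [abelKernel_eq α hs.1, h0]
  simp

theorem integrableOn_of_rpow_bound {T a C : ℝ} (ha : 0 < a) (hT : 0 ≤ T) {φ : ℝ → ℝ}
    (hc : ContinuousOn φ (Ioc 0 T)) (hb : ∀ t ∈ Ioc 0 T, |φ t| ≤ C * t ^ (a - 1)) :
    MeasureTheory.IntegrableOn φ (Ioc 0 T) := by
  have h1 : IntervalIntegrable (fun s : ℝ => C * s ^ (a - 1)) MeasureTheory.volume 0 T :=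
    (intervalIntegral.intervalIntegrable_rpow' (by linarith)).const_mul C
  rw [intervalIntegrable_iff_integrableOn_Ioc_of_le hT] at h1
  refine MeasureTheory.Integrable.mono' h1 (hc.aestronglyMeasurable measurableSet_Ioc) ?_
  exact (MeasureTheory.ae_restrict_iff' measurableSet_Ioc).2 (Filter.Eventually.of_forall hb)

/-- Associativity of convolution: 1 * (β_a * k) = (1 * β_a) * k, and 1 * β_a is `betaInt`. -/
theorem integral_gfun {T a : ℝ} {α : ℝ → ℝ} (ha0 : 0 < a) (ha1 : a < 1) (hT : 0 < T)
    (hα : IsAdmissibleExponent T α) (h0 : α 0 = 1 + a) {x : ℝ} (hx : x ∈ Icc 0 T) :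
    ∫ s in (0 : ℝ)..x, gfun α s = ∫ r in (0 : ℝ)..x, betaInt a (x - r) * abelKernel α r := by
  have hk : MeasureTheory.IntegrableOn (abelKernel α) (Ioc 0 x) :=
    (abelKernel_integrableOn ha1 hT hα h0).mono_set (Ioc_subset_Ioc_right hx.2)
  have hb : MeasureTheory.IntegrableOn (beta a) (Ioc 0 x) :=
    (intervalIntegrable_iff_integrableOn_Ioc_of_le hx.1).1 (beta_intervalIntegrable ha0 0 x)
  have := volterra_fubini hx.1 (p := fun _ => 1) continuousOn_const hb hk
  simp only [one_mul] at this
  have e1 : ∫ s in (0 : ℝ)..x, gfun α s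
      = ∫ s in (0 : ℝ)..x, ∫ r in (0 : ℝ)..s, beta a (s - r) * abelKernel α r := by
    rw [intervalIntegral.integral_of_le hx.1, intervalIntegral.integral_of_le hx.1]
    refine MeasureTheory.setIntegral_congr_fun measurableSet_Ioc fun s hs => ?_
    simp only [gfun, if_neg hs.1.ne', h0, add_sub_cancel_left]
  rw [e1, this]
  refine intervalIntegral.integral_congr fun r _ => ?_
  rw [integral_beta ha0, betaInt_zero ha0, sub_zero, mul_comm]

/-- The equation after convolution with `β_a` and integration in time. -/
theorem integrated_equation {T a C : ℝ} {α v₁ v₂ F : ℝ → ℝ} (ha0 : 0 < a) (ha1 : a < 1)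
    (hT : 0 < T) (hα : IsAdmissibleExponent T α) (h0 : α 0 = 1 + a)
    (hv₁ : ContinuousOn v₁ (Icc 0 T)) (hd : ∀ t ∈ Ioo 0 T, HasDerivAt v₁ (v₂ t) t)
    (hv₂ : ContinuousOn v₂ (Ioc 0 T)) (hb : ∀ t ∈ Ioc 0 T, |v₂ t| ≤ C * t ^ (a - 1))
    (hF : ∀ t ∈ Ioc 0 T, ∫ s in (0 : ℝ)..t, abelKernel α (t - s) * v₂ s = F t)
    {t : ℝ} (ht : t ∈ Icc 0 T) :
    ∫ s in (0 : ℝ)..t, betaInt a (t - s) * F s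
      = ∫ s in (0 : ℝ)..t, gfun α (t - s) * (v₁ s - v₁ 0) := by
  have hsub : Ioc 0 t ⊆ Ioc 0 T := Ioc_subset_Ioc_right ht.2
  have hk := (abelKernel_integrableOn ha1 hT hα h0).mono_set hsub
  have hi := integrableOn_of_rpow_bound ha0 hT.le hv₂ hb
  have hi2 := hi.mono_set hsub
  -- Both sides become convolutions with v₂, of kernels B * k and 1 * g, which agree by
  -- `integral_gfun`. The unit kernel enters because v₁ - v₁(0) is the integral of v₂.
  have s1 := volterra_fubini ht.1 (betaInt_continuous ha0).continuousOn hk hi2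
  have s2 := volterra_fubini ht.1 (q := fun _ => 1)
    ((gfun_continuousOn ha0 ha1 hT hα h0).mono (Icc_subset_Icc_right ht.2))
    (by simp) hi2
  have e1 : ∫ s in (0 : ℝ)..t, betaInt a (t - s) * F s = ∫ s in (0 : ℝ)..t, betaInt a (t - s)
      * ∫ r in (0 : ℝ)..s, abelKernel α (s - r) * v₂ r := by
    rw [intervalIntegral.integral_of_le ht.1, intervalIntegral.integral_of_le ht.1]
    refine MeasureTheory.setIntegral_congr_fun measurableSet_Ioc fun s hs => ?_
    simp only [hF s (hsub hs)]
  have e2 : ∫ s in (0 : ℝ)..t, gfun α (t - s) * (v₁ s - v₁ 0) = ∫ s in (0 : ℝ)..t, gfun α (t - s)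
      * ∫ r in (0 : ℝ)..s, 1 * v₂ r := by
    refine intervalIntegral.integral_congr fun s hs => ?_
    rw [uIcc_of_le ht.1] at hs
    have hsT : s ≤ T := hs.2.trans ht.2
    simp only [one_mul]
    rw [intervalIntegral.integral_eq_sub_of_hasDerivAt_of_le hs.1
      (hv₁.mono (Icc_subset_Icc_right hsT)) (fun x hx => hd x ⟨hx.1, hx.2.trans_le hsT⟩)]
    exact (intervalIntegrable_iff_integrableOn_Ioc_of_le hs.1).2
      (hi.mono_set (Ioc_subset_Ioc_right hsT))
  rw [e1, e2, s1, s2]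
  refine intervalIntegral.integral_congr fun r hr => ?_
  rw [uIcc_of_le ht.1] at hr
  simp only [mul_one]
  congr 1
  rw [← integral_gfun ha0 ha1 hT hα h0 ⟨by linarith [hr.2], by linarith [hr.1, ht.2]⟩,
    intervalIntegral.integral_comp_sub_left (fun x => gfun α x)]
  simp

/-! ### The weights of the averaged product integration rule -/

/-- The weights `λ_{n,n-i}`. -/
def lamSeq (a τ : ℝ) (i : ℕ) : ℝ :=
  if i = 0 then betaInt₂ a τ / τ
  else (betaInt₂ a ((i + 1) * τ) - 2 * betaInt₂ a (i * τ) + betaInt₂ a ((i - 1) * τ)) / τ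

theorem tau_pos (D : Cylinder) {N : ℕ} (hN : 1 ≤ N) : 0 < tau D N :=
  div_pos D.hT (by exact_mod_cast hN)

/-- On a uniform mesh the double integral depends on n - j alone. For j < n the minimum is t_j, and
the weight is a second difference of the second antiderivative of β_a; for j = n the minimum is t
itself, and a single term is left. -/
theorem lam_eq_lamSeq (D : Cylinder) {N : ℕ} (hN : 1 ≤ N) {a : ℝ} {α : ℝ → ℝ} (ha : 0 < a)
    (h0 : α 0 = 1 + a) {n j : ℕ} (h1 : 1 ≤ j) (hjn : j ≤ n) :
    lam D N α n j = lamSeq a (tau D N) (n - j) := by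
  have hτ := tau_pos D hN
  set τ := tau D N with hτd
  obtain ⟨j, rfl⟩ : ∃ j', j = j' + 1 := ⟨j - 1, by omega⟩
  obtain ⟨i, rfl⟩ : ∃ i, n = j + 1 + i := ⟨n - (j + 1), by omega⟩
  have inner : ∀ x y t : ℝ, ∫ s in x..y, beta a (t - s) = betaInt a (t - x) - betaInt a (t - y) := by
    intro x y t
    rw [intervalIntegral.integral_comp_sub_left (fun s => beta a s), integral_beta ha]
  have outer : ∀ x y c : ℝ, ∫ t in x..y, betaInt a (t - c)
      = betaInt₂ a (y - c) - betaInt₂ a (x - c) := by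
    intro x y c
    rw [intervalIntegral.integral_comp_sub_right (fun s => betaInt a s), integral_betaInt ha]
  have ii : ∀ x y c : ℝ, IntervalIntegrable (fun t => betaInt a (t - c))
      MeasureTheory.volume x y := fun x y c =>
    ((betaInt_continuous ha).comp (continuous_id.sub continuous_const)).intervalIntegrable _ _
  simp only [lam, time, h0, add_sub_cancel_left, inner, ← hτd, Nat.add_sub_cancel]
  rcases Nat.eq_zero_or_pos i with rfl | hi
  · rw [add_zero, Nat.add_sub_cancel]
    have hle : (j : ℝ) * τ ≤ ((j + 1 : ℕ) : ℝ) * τ := by push_cast; nlinarith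
    have : ∫ t in (j : ℝ) * τ..((j + 1 : ℕ) : ℝ) * τ,
        (betaInt a (t - j * τ) - betaInt a (t - min t (((j + 1 : ℕ) : ℝ) * τ)))
        = ∫ t in (j : ℝ) * τ..((j + 1 : ℕ) : ℝ) * τ, betaInt a (t - j * τ) := by
      refine intervalIntegral.integral_congr fun t ht => ?_
      rw [uIcc_of_le hle] at ht
      rw [min_eq_left ht.2, sub_self, betaInt_zero ha, sub_zero]
    rw [this, outer, sub_self, betaInt₂_zero ha, sub_zero, lamSeq, if_pos (by omega)]
    rw [show ((j + 1 : ℕ) : ℝ) * τ - j * τ = τ by push_cast; ring]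
    ring
  · have e1 : j + 1 + i - 1 = j + i := by omega
    have e2 : j + 1 + i - (j + 1) = i := by omega
    rw [e1, e2]
    have hle : ((j + i : ℕ) : ℝ) * τ ≤ ((j + 1 + i : ℕ) : ℝ) * τ := by push_cast; nlinarith
    have hle2 : ((j + 1 : ℕ) : ℝ) * τ ≤ ((j + i : ℕ) : ℝ) * τ :=
      mul_le_mul_of_nonneg_right (by exact_mod_cast (by omega : j + 1 ≤ j + i)) hτ.le
    have : ∫ t in ((j + i : ℕ) : ℝ) * τ..((j + 1 + i : ℕ) : ℝ) * τ,
        (betaInt a (t - j * τ) - betaInt a (t - min t (((j + 1 : ℕ) : ℝ) * τ)))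
        = ∫ t in ((j + i : ℕ) : ℝ) * τ..((j + 1 + i : ℕ) : ℝ) * τ,
          (betaInt a (t - j * τ) - betaInt a (t - ((j + 1 : ℕ) : ℝ) * τ)) := by
      refine intervalIntegral.integral_congr fun t ht => ?_
      rw [uIcc_of_le hle] at ht
      rw [min_eq_right (hle2.trans ht.1)]
    rw [this, intervalIntegral.integral_sub (ii _ _ _) (ii _ _ _), outer, outer, lamSeq,
      if_neg (by omega)]
    push_cast
    rw [show ((j : ℝ) + 1 + i) * τ - j * τ = (i + 1) * τ by ring,
      show ((j : ℝ) + i) * τ - j * τ = i * τ by ring,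
      show ((j : ℝ) + 1 + i) * τ - (j + 1) * τ = i * τ by ring,
      show ((j : ℝ) + i) * τ - (j + 1) * τ = (i - 1) * τ by ring]
    ring

/-- At lag 0 the weight is half of the second difference of |x|^(a+1), which is the diagonal that
`toeplitz_lower_nonneg` requires. -/
theorem lamSeq_eq_powWeight {a τ : ℝ} (ha : 0 < a) (hτ : 0 < τ) (i : ℕ) :
    lamSeq a τ i = (if i = 0 then 1 / 2 else 1) *
      (τ ^ a / Real.Gamma (a + 2) * powWeight (a + 1) i) := by
  have hτa : τ ^ (a + 1) = τ ^ a * τ := by rw [Real.rpow_add hτ, Real.rpow_one]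
  rcases Nat.eq_zero_or_pos i with rfl | hi
  · rw [lamSeq, if_pos rfl, if_pos rfl, powWeight_zero (by linarith), betaInt₂, hτa]
    field_simp
  · have hi' : (1 : ℝ) ≤ i := by exact_mod_cast hi
    rw [lamSeq, if_neg hi.ne', if_neg hi.ne', powWeight, abs_of_nonneg (by linarith)]
    simp only [betaInt₂]
    rw [Real.mul_rpow (by linarith) hτ.le, Real.mul_rpow (by linarith) hτ.le,
      Real.mul_rpow (by linarith) hτ.le, hτa]
    field_simp

theorem lamSeq_nonneg {a τ : ℝ} (ha : 0 < a) (hτ : 0 < τ) (i : ℕ) : 0 ≤ lamSeq a τ i := by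
  rw [lamSeq_eq_powWeight ha hτ]
  have h1 := powWeight_nonneg (p := a + 1) (by linarith) i
  have h2 := (Real.Gamma_pos_of_pos (by linarith : 0 < a + 2))
  have h3 := Real.rpow_nonneg hτ.le a
  exact mul_nonneg (by split_ifs <;> norm_num) (by positivity)

/-- The integral of `B` over a cell. -/
def cellInt (a τ : ℝ) (i : ℕ) : ℝ := betaInt₂ a ((i + 1) * τ) - betaInt₂ a (i * τ)

theorem tau_mul_lamSeq_zero {a τ : ℝ} (ha : 0 < a) (hτ : 0 < τ) :
    τ * lamSeq a τ 0 = cellInt a τ 0 := by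
  rw [lamSeq, if_pos rfl, cellInt]
  simp only [Nat.cast_zero, zero_add, one_mul, zero_mul, betaInt₂_zero ha, sub_zero]
  field_simp

theorem tau_mul_lamSeq_succ {a τ : ℝ} (hτ : 0 < τ) (i : ℕ) :
    τ * lamSeq a τ (i + 1) = cellInt a τ (i + 1) - cellInt a τ i := by
  rw [lamSeq, if_neg (by omega), cellInt, cellInt]
  push_cast
  rw [show (i : ℝ) + 1 - 1 = i by ring]
  field_simp
  ring

theorem tau_mul_sum_lamSeq {a τ : ℝ} (ha : 0 < a) (hτ : 0 < τ) (m : ℕ) :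
    τ * ∑ i ∈ Finset.range (m + 1), lamSeq a τ i = cellInt a τ m := by
  induction m with
  | zero => simpa using tau_mul_lamSeq_zero ha hτ
  | succ m ih => rw [Finset.sum_range_succ, mul_add, ih, tau_mul_lamSeq_succ hτ]; ring

theorem cellInt_eq_integral {a : ℝ} (ha : 0 < a) (τ : ℝ) (i : ℕ) :
    cellInt a τ i = ∫ s in (i * τ)..((i + 1) * τ), betaInt a s := by
  rw [integral_betaInt ha, cellInt]

theorem cellInt_le {a τ : ℝ} (ha : 0 < a) (hτ : 0 < τ) (i : ℕ) :
    cellInt a τ i ≤ τ * betaInt a ((i + 1) * τ) := by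
  have hle : (i : ℝ) * τ ≤ (i + 1) * τ := by nlinarith
  rw [cellInt_eq_integral ha]
  have := intervalIntegral.integral_mono_on hle
    ((betaInt_continuous ha).intervalIntegrable _ _)
    (continuous_const.intervalIntegrable (μ := MeasureTheory.volume) _ _)
    (g := fun _ => betaInt a ((i + 1) * τ))
    (fun s hs => betaInt_mono ha ((mul_nonneg (Nat.cast_nonneg i) hτ.le).trans hs.1) hs.2)
  rw [intervalIntegral.integral_const, smul_eq_mul] at this
  linarith

/-- τ times the sum of the weights telescopes to the integral of the increasing function B over the
last cell, at most τ B(T). -/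
theorem sum_lamSeq_le {a τ T : ℝ} (ha : 0 < a) (hτ : 0 < τ) {m : ℕ} (hm : m * τ ≤ T) :
    ∑ i ∈ Finset.range m, lamSeq a τ i ≤ betaInt a T := by
  have hT : 0 ≤ T := (mul_nonneg (Nat.cast_nonneg m) hτ.le).trans hm
  rcases Nat.eq_zero_or_pos m with rfl | hpos
  · simpa using betaInt_nonneg ha hT
  obtain ⟨k, rfl⟩ : ∃ k, m = k + 1 := ⟨m - 1, by omega⟩
  have h1 := tau_mul_sum_lamSeq ha hτ k
  have h2 := cellInt_le ha hτ k
  push_cast at hm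
  have h3 := betaInt_mono ha (by positivity) hm
  have h4 := mul_le_mul_of_nonneg_left h3 hτ.le
  refine le_of_mul_le_mul_left ?_ hτ
  linarith

end TwoGrid
end


noncomputable section

namespace TwoGrid

/-! ### Differences of discrete convolutions -/

/-- Backward difference of a sequence, with the convention `x (-1) = 0`. -/
def backDiff (x : ℕ → ℝ) : ℕ → ℝ
  | 0 => x 0
  | k + 1 => x (k + 1) - x k

/-- Summation by parts in a causal convolution; the convention of value zero before index 0 absorbs
the boundary terms. It moves the difference from quadrature errors onto slopes in time, whose
increments are summable. -/
theorem sum_mul_backDiff (d E : ℕ → ℝ) (n : ℕ) :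
    ∑ k ∈ Finset.range (n + 1), d k * backDiff E (n - k)
      = ∑ k ∈ Finset.range (n + 1), backDiff d k * E (n - k) := by
  have key : ∑ k ∈ Finset.range n, d k * E (n - k) + d n * E 0
      = ∑ k ∈ Finset.range n, d (k + 1) * E (n - (k + 1)) + d 0 * E n := by
    have h1 := Finset.sum_range_succ (fun k => d k * E (n - k)) n
    have h2 := Finset.sum_range_succ' (fun k => d k * E (n - k)) n
    simp only [Nat.sub_self, Nat.sub_zero] at h1 h2
    rw [← h1, ← h2]
  rw [Finset.sum_range_succ, Finset.sum_range_succ' (fun k => backDiff d k * E (n - k))]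
  have e1 : ∑ k ∈ Finset.range n, d k * backDiff E (n - k)
      = ∑ k ∈ Finset.range n, d k * E (n - k)
        - ∑ k ∈ Finset.range n, d k * E (n - (k + 1)) := by
    rw [← Finset.sum_sub_distrib]
    refine Finset.sum_congr rfl fun k hk => ?_
    rw [Finset.mem_range] at hk
    obtain ⟨i, rfl⟩ : ∃ i, n = k + (i + 1) := ⟨n - k - 1, by omega⟩
    rw [show k + (i + 1) - k = i + 1 by omega, show k + (i + 1) - (k + 1) = i by omega, backDiff]
    ring
  have e2 : ∑ k ∈ Finset.range n, backDiff d (k + 1) * E (n - (k + 1))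
      = ∑ k ∈ Finset.range n, d (k + 1) * E (n - (k + 1))
        - ∑ k ∈ Finset.range n, d k * E (n - (k + 1)) := by
    rw [← Finset.sum_sub_distrib]
    exact Finset.sum_congr rfl fun k _ => by rw [backDiff]; ring
  rw [e1, e2, Nat.sub_self, Nat.sub_zero, backDiff, backDiff]
  linarith

/-- The kernel of the backward difference of a convolution, on the cell at distance `i`. -/
def lagKernel (τ : ℝ) (G : ℝ → ℝ) : ℕ → ℝ → ℝ
  | 0, σ => G (τ - σ)
  | i + 1, σ => G ((i + 1 + 1 : ℕ) * τ - σ) - G ((i + 1 : ℕ) * τ - σ)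

theorem continuousOn_cell_left {T τ : ℝ} (hτ : 0 ≤ τ) {G : ℝ → ℝ} (hG : ContinuousOn G (Icc 0 T))
    {i : ℕ} (hi : ((i + 1 : ℕ) : ℝ) * τ ≤ T) :
    ContinuousOn (fun σ => G ((i + 1 : ℕ) * τ - σ)) (Icc 0 τ) := by
  refine hG.comp (by fun_prop) fun σ hσ => ?_
  have : 0 ≤ (i : ℝ) * τ := by positivity
  push_cast at hi ⊢
  exact ⟨by nlinarith [hσ.1, hσ.2], by nlinarith [hσ.1, hσ.2]⟩

theorem continuousOn_cell_right {T τ : ℝ} (hτ : 0 ≤ τ) {φ : ℝ → ℝ}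
    (hφ : ContinuousOn φ (Icc 0 T)) {k : ℕ} (hk : ((k + 1 : ℕ) : ℝ) * τ ≤ T) :
    ContinuousOn (fun σ => φ (k * τ + σ)) (Icc 0 τ) := by
  refine hφ.comp (by fun_prop) fun σ hσ => ?_
  have : 0 ≤ (k : ℝ) * τ := by positivity
  push_cast at hk
  exact ⟨by nlinarith [hσ.1, hσ.2], by nlinarith [hσ.1, hσ.2]⟩

theorem lagKernel_continuousOn {T τ : ℝ} (hτ : 0 ≤ τ) {G : ℝ → ℝ} (hG : ContinuousOn G (Icc 0 T))
    {i : ℕ} (hi : ((i + 1 : ℕ) : ℝ) * τ ≤ T) : ContinuousOn (lagKernel τ G i) (Icc 0 τ) := by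
  cases i with
  | zero =>
    have := continuousOn_cell_left hτ hG hi
    simp only [zero_add, Nat.cast_one, one_mul] at this
    exact this
  | succ i =>
    have h2 : ((i + 1 : ℕ) : ℝ) * τ ≤ T := by push_cast at hi ⊢; nlinarith
    exact (continuousOn_cell_left hτ hG hi).sub (continuousOn_cell_left hτ hG h2)

theorem convolution_split {T τ : ℝ} (hτ : 0 ≤ τ) {G φ : ℝ → ℝ} (hG : ContinuousOn G (Icc 0 T))
    (hφ : ContinuousOn φ (Icc 0 T)) {n : ℕ} (hn : (n : ℝ) * τ ≤ T) :
    ∫ s in (0 : ℝ)..(n * τ), G (n * τ - s) * φ s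
      = ∑ k ∈ Finset.range n, ∫ σ in (0 : ℝ)..τ, G ((n - k : ℕ) * τ - σ) * φ (k * τ + σ) := by
  have hle : ∀ k : ℕ, k ≤ n → (k : ℝ) * τ ≤ n * τ := fun k hk =>
    mul_le_mul_of_nonneg_right (by exact_mod_cast hk) hτ
  have hcont : ContinuousOn (fun s => G (n * τ - s) * φ s) (Icc 0 (n * τ)) := by
    refine ContinuousOn.mul (hG.comp (by fun_prop) fun s hs => ⟨by linarith [hs.2], by
      linarith [hs.1]⟩) (hφ.mono (Icc_subset_Icc_right hn))
  have h1 := intervalIntegral.sum_integral_adjacent_intervals (a := fun k : ℕ => (k : ℝ) * τ)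
    (n := n) (f := fun s => G (n * τ - s) * φ s) (μ := MeasureTheory.volume) (by
      intro k hk
      refine (hcont.mono ?_).intervalIntegrable
      rw [uIcc_of_le (by push_cast; nlinarith)]
      exact Icc_subset_Icc (by positivity) (hle _ hk))
  simp only [Nat.cast_zero, zero_mul] at h1
  rw [← h1]
  refine Finset.sum_congr rfl fun k hk => ?_
  rw [Finset.mem_range] at hk
  have h2 := intervalIntegral.integral_comp_add_left (a := 0) (b := τ)
    (fun s => G (n * τ - s) * φ s) (k * τ)
  rw [add_zero] at h2
  rw [show ((k + 1 : ℕ) : ℝ) * τ = k * τ + τ by push_cast; ring, ← h2]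
  congr 1
  ext σ
  rw [Nat.cast_sub hk.le]
  congr 2
  ring

/-- Both convolutions are cut along the cells of φ. On a common cell the kernels subtract; on the
newest cell, at lag 0, only the first convolution contributes. -/
theorem convolution_backward_difference {T τ : ℝ} (hτ : 0 ≤ τ) {G φ : ℝ → ℝ}
    (hG : ContinuousOn G (Icc 0 T)) (hφ : ContinuousOn φ (Icc 0 T)) {n : ℕ}
    (hn : ((n + 1 : ℕ) : ℝ) * τ ≤ T) :
    (∫ s in (0 : ℝ)..((n + 1 : ℕ) * τ), G ((n + 1 : ℕ) * τ - s) * φ s)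
        - ∫ s in (0 : ℝ)..(n * τ), G (n * τ - s) * φ s
      = ∑ k ∈ Finset.range (n + 1),
          ∫ σ in (0 : ℝ)..τ, lagKernel τ G (n - k) σ * φ (k * τ + σ) := by
  have hle : ∀ k : ℕ, k ≤ n + 1 → (k : ℝ) * τ ≤ T := fun k hk =>
    (mul_le_mul_of_nonneg_right (by exact_mod_cast hk) hτ).trans hn
  rw [convolution_split hτ hG hφ hn, convolution_split hτ hG hφ (hle n (by omega)),
    Finset.sum_range_succ, Finset.sum_range_succ _ n, add_sub_right_comm,
    ← Finset.sum_sub_distrib]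
  congr 1
  · refine Finset.sum_congr rfl fun k hk => ?_
    rw [Finset.mem_range] at hk
    obtain ⟨i, rfl⟩ : ∃ i, n = k + (i + 1) := ⟨n - k - 1, by omega⟩
    rw [show k + (i + 1) + 1 - k = i + 1 + 1 by omega, show k + (i + 1) - k = i + 1 by omega,
      ← intervalIntegral.integral_sub]
    · congr 1
      ext σ
      simp only [lagKernel]
      ring
    · refine ContinuousOn.intervalIntegrable ?_
      rw [uIcc_of_le hτ]
      exact (continuousOn_cell_left hτ hG (hle _ (by omega))).mul
        (continuousOn_cell_right hτ hφ (hle _ (by omega)))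
    · refine ContinuousOn.intervalIntegrable ?_
      rw [uIcc_of_le hτ]
      exact (continuousOn_cell_left hτ hG (hle _ (by omega))).mul
        (continuousOn_cell_right hτ hφ (hle _ (by omega)))
  · rw [Nat.sub_self, show n + 1 - n = 1 by omega]
    simp [lagKernel]

/-! ### Quadrature errors on one cell -/

/-- As d is the mean of φ, the difference equals the integral of (A - c)(φ - d): a product of two
oscillations. -/
theorem abs_integral_mul_sub_mean_le {τ c d α β : ℝ} (hτ : 0 ≤ τ) {A φ : ℝ → ℝ}
    (hA : ContinuousOn A (Icc 0 τ)) (hφ : ContinuousOn φ (Icc 0 τ))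
    (hd : ∫ σ in (0 : ℝ)..τ, φ σ = τ * d) (h1 : ∀ σ ∈ Icc 0 τ, |A σ - c| ≤ α)
    (h2 : ∀ σ ∈ Icc 0 τ, |φ σ - d| ≤ β) :
    |(∫ σ in (0 : ℝ)..τ, A σ * φ σ) - d * ∫ σ in (0 : ℝ)..τ, A σ| ≤ τ * (α * β) := by
  rw [← uIcc_of_le hτ] at hA hφ
  have e : (∫ σ in (0 : ℝ)..τ, A σ * φ σ) - d * (∫ σ in (0 : ℝ)..τ, A σ)
      = ∫ σ in (0 : ℝ)..τ, (A σ - c) * (φ σ - d) := by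
    have : ∀ σ, (A σ - c) * (φ σ - d) = (A σ * φ σ - d * A σ) - (c * φ σ - c * d) :=
      fun σ => by ring
    simp only [this]
    rw [intervalIntegral.integral_sub, intervalIntegral.integral_sub,
      intervalIntegral.integral_sub, intervalIntegral.integral_const_mul,
      intervalIntegral.integral_const_mul, hd, intervalIntegral.integral_const]
    · simp; ring
    · exact (hφ.intervalIntegrable).const_mul _
    · simp
    · exact (hA.mul hφ).intervalIntegrable
    · exact hA.intervalIntegrable.const_mul _
    · exact ((hA.mul hφ).sub (continuousOn_const.mul hA)).intervalIntegrable
    · exact ((continuousOn_const.mul hφ).sub continuousOn_const).intervalIntegrable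
  rw [e]
  have := intervalIntegral.norm_integral_le_of_norm_le_const (a := 0) (b := τ) (C := α * β)
    (f := fun σ => (A σ - c) * (φ σ - d)) (by
      intro σ hσ
      rw [uIoc_of_le hτ] at hσ
      have hm : σ ∈ Icc 0 τ := ⟨hσ.1.le, hσ.2⟩
      rw [norm_mul, Real.norm_eq_abs, Real.norm_eq_abs]
      exact mul_le_mul (h1 σ hm) (h2 σ hm) (abs_nonneg _) ((abs_nonneg _).trans (h1 σ hm)))
  rw [Real.norm_eq_abs, sub_zero, abs_of_nonneg hτ] at this
  linarith

theorem abs_integral_mul_sub_affine_le {τ p D ε : ℝ} (hτ : 0 ≤ τ) {A φ : ℝ → ℝ}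
    (hA : ContinuousOn A (Icc 0 τ)) (hφ : ContinuousOn φ (Icc 0 τ))
    (hA0 : ∀ σ ∈ Icc 0 τ, 0 ≤ A σ) (h : ∀ σ ∈ Icc 0 τ, |φ σ - (p + D * (σ - τ / 2))| ≤ ε) :
    |(∫ σ in (0 : ℝ)..τ, A σ * φ σ) - (p * (∫ σ in (0 : ℝ)..τ, A σ)
        + D * ∫ σ in (0 : ℝ)..τ, A σ * (σ - τ / 2))| ≤ ε * ∫ σ in (0 : ℝ)..τ, A σ := by
  have hu := uIcc_of_le hτ
  rw [← hu] at hA hφ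
  have hl : ContinuousOn (fun σ => A σ * (σ - τ / 2)) (uIcc 0 τ) := hA.mul (by fun_prop)
  have e : (∫ σ in (0 : ℝ)..τ, A σ * φ σ) - (p * (∫ σ in (0 : ℝ)..τ, A σ)
        + D * ∫ σ in (0 : ℝ)..τ, A σ * (σ - τ / 2))
      = ∫ σ in (0 : ℝ)..τ, A σ * (φ σ - (p + D * (σ - τ / 2))) := by
    have : ∀ σ, A σ * (φ σ - (p + D * (σ - τ / 2)))
        = A σ * φ σ - (p * A σ + D * (A σ * (σ - τ / 2))) := fun σ => by ring
    simp only [this]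
    rw [intervalIntegral.integral_sub, intervalIntegral.integral_add,
      intervalIntegral.integral_const_mul, intervalIntegral.integral_const_mul]
    · exact hA.intervalIntegrable.const_mul _
    · exact hl.intervalIntegrable.const_mul _
    · exact (hA.mul hφ).intervalIntegrable
    · exact ((continuousOn_const.mul hA).add (continuousOn_const.mul hl)).intervalIntegrable
  rw [e, ← intervalIntegral.integral_const_mul]
  refine (intervalIntegral.abs_integral_le_integral_abs hτ).trans
    (intervalIntegral.integral_mono_on hτ ?_ ?_ ?_)
  · exact (hA.mul (hφ.sub (by fun_prop))).abs.intervalIntegrable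
  · exact hA.intervalIntegrable.const_mul _
  · intro σ hσ
    rw [abs_mul, abs_of_nonneg (hA0 σ hσ), mul_comm]
    exact mul_le_mul_of_nonneg_right (h σ hσ) (hA0 σ hσ)

/-- Error of linear interpolation in terms of the oscillation of the derivative. -/
theorem abs_sub_linear_interpolation_le {x y ω : ℝ} (hxy : x < y) {φ φ' : ℝ → ℝ}
    (hc : ContinuousOn φ (Icc x y)) (hd : ∀ s ∈ Ioo x y, HasDerivAt φ (φ' s) s)
    (hω : ∀ s ∈ Ioo x y, ∀ r ∈ Ioo x y, |φ' s - φ' r| ≤ ω) {s : ℝ} (hs : s ∈ Icc x y) :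
    |φ s - ((φ x + φ y) / 2 + (φ y - φ x) / (y - x) * (s - (x + y) / 2))| ≤ (y - x) * ω := by
  have hpos : 0 < y - x := by linarith
  obtain ⟨η, hη, e1⟩ := exists_hasDerivAt_eq_slope φ φ' hxy hc hd
  have hω0 : 0 ≤ ω := (abs_nonneg _).trans (hω η hη η hη)
  have e : φ s - ((φ x + φ y) / 2 + (φ y - φ x) / (y - x) * (s - (x + y) / 2))
      = φ s - φ x - φ' η * (s - x) := by
    rw [e1]; field_simp; ring
  rw [e]
  rcases hs.1.eq_or_lt with rfl | hlt
  · simp; positivity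
  obtain ⟨ξ, hξ, e2⟩ := exists_hasDerivAt_eq_slope φ φ' hlt
    (hc.mono (Icc_subset_Icc_right hs.2)) (fun r hr => hd r ⟨hr.1, hr.2.trans_le hs.2⟩)
  have e3 : φ s - φ x = φ' ξ * (s - x) := by
    rw [e2]; field_simp [(sub_pos.2 hlt).ne']
  rw [e3, ← sub_mul, abs_mul, abs_of_pos (sub_pos.2 hlt), mul_comm]
  exact mul_le_mul (by linarith [hs.2]) (hω ξ ⟨hξ.1, hξ.2.trans_le hs.2⟩ η hη) (abs_nonneg _)
    hpos.le

theorem integral_linear_centered (τ : ℝ) : ∫ σ in (0 : ℝ)..τ, (σ - τ / 2) = 0 := by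
  rw [intervalIntegral.integral_sub (by simp) (by simp), integral_id,
    intervalIntegral.integral_const]
  simp; ring

/-- Young's inequality for ℓ¹ sequences. It bounds the accumulated truncation error although single
levels near t = 0 need not be of second order. -/
theorem sum_convolution_le {p q : ℕ → ℝ} (hp : ∀ i, 0 ≤ p i) (hq : ∀ i, 0 ≤ q i) (N : ℕ) :
    ∑ n ∈ Finset.range N, ∑ k ∈ Finset.range (n + 1), p (n - k) * q k
      ≤ (∑ i ∈ Finset.range N, p i) * ∑ k ∈ Finset.range N, q k := by
  rw [Finset.sum_comm' (t' := Finset.range N) (s' := fun k => Finset.Ico k N) (by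
    intro n k; simp only [Finset.mem_range, Finset.mem_Ico]; omega), mul_comm, Finset.sum_mul]
  refine Finset.sum_le_sum fun k hk => ?_
  rw [← Finset.sum_mul, mul_comm]
  refine mul_le_mul_of_nonneg_left ?_ (hq k)
  rw [Finset.sum_Ico_eq_sum_range]
  refine le_trans (Finset.sum_le_sum (g := p) fun i _ => by
    rw [Nat.add_sub_cancel_left]) ?_
  exact Finset.sum_le_sum_of_subset_of_nonneg (Finset.range_mono (Nat.sub_le _ _))
    fun i _ _ => hp i

end TwoGrid

end

noncomputable section

namespace TwoGrid

/-! ### Moduli of continuity -/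

/-- `ψ(x) = x + x^a`. -/
def timeModulus (a x : ℝ) : ℝ := x + x ^ a

theorem timeModulus_mono {a : ℝ} (ha : 0 < a) {x y : ℝ} (hx : 0 ≤ x) (hxy : x ≤ y) :
    timeModulus a x ≤ timeModulus a y :=
  add_le_add hxy (Real.rpow_le_rpow hx hxy ha.le)

theorem timeModulus_zero {a : ℝ} (ha : 0 < a) : timeModulus a 0 = 0 := by
  rw [timeModulus, Real.zero_rpow ha.ne', add_zero]

/-- `v` is continuously differentiable on `[0, T]`, and its derivative `v₁` is bounded by `K` and
has the modulus of continuity `K (ψ(y) - ψ(x))`. -/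
structure HasTimeModulus (T a K : ℝ) (v v₁ : ℝ → ℝ) : Prop where
  cont : ContinuousOn v (Icc 0 T)
  deriv : ∀ t ∈ Ioo 0 T, HasDerivAt v (v₁ t) t
  cont₁ : ContinuousOn v₁ (Icc 0 T)
  bound : ∀ t ∈ Icc 0 T, |v₁ t| ≤ K
  modulus : ∀ x y, 0 ≤ x → x ≤ y → y ≤ T →
    |v₁ y - v₁ x| ≤ K * (timeModulus a y - timeModulus a x)

theorem HasTimeModulus.osc {T a K : ℝ} {v v₁ : ℝ → ℝ} (h : HasTimeModulus T a K v v₁) (ha : 0 < a)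
    (hK : 0 ≤ K) {x y s r : ℝ} (hx : 0 ≤ x) (hy : y ≤ T) (hs : s ∈ Icc x y) (hr : r ∈ Icc x y) :
    |v₁ s - v₁ r| ≤ K * (timeModulus a y - timeModulus a x) := by
  have hs1 := timeModulus_mono ha hx hs.1
  have hs2 := timeModulus_mono ha (hx.trans hs.1) hs.2
  have hr1 := timeModulus_mono ha hx hr.1
  have hr2 := timeModulus_mono ha (hx.trans hr.1) hr.2
  rcases le_total s r with hsr | hsr
  · rw [abs_sub_comm]
    exact (h.modulus s r (hx.trans hs.1) hsr (hr.2.trans hy)).trans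
      (mul_le_mul_of_nonneg_left (by linarith) hK)
  · exact (h.modulus r s (hx.trans hr.1) hsr (hs.2.trans hy)).trans
      (mul_le_mul_of_nonneg_left (by linarith) hK)

/-- Data of a kernel `g` whose derivative `g'` is bounded and has a monotone modulus `Γ`. -/
structure HasKernelModulus (T Qg : ℝ) (Γ g g' : ℝ → ℝ) : Prop where
  cont : ContinuousOn g (Icc 0 T)
  deriv : ∀ t ∈ Ioo 0 T, HasDerivAt g (g' t) t
  bound : ∀ t ∈ Ioo 0 T, |g' t| ≤ Qg
  mono : MonotoneOn Γ (Icc 0 T)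
  modulus : ∀ x y, 0 < x → x ≤ y → y < T → |g' y - g' x| ≤ Γ y - Γ x

theorem HasKernelModulus.osc {T Qg : ℝ} {Γ g g' : ℝ → ℝ} (h : HasKernelModulus T Qg Γ g g')
    {x y s r : ℝ} (hx : 0 ≤ x) (hy : y ≤ T) (hs : s ∈ Ioo x y) (hr : r ∈ Ioo x y) :
    |g' s - g' r| ≤ Γ y - Γ x := by
  have hT : ∀ z, z ∈ Icc x y → z ∈ Icc 0 T := fun z hz => ⟨hx.trans hz.1, hz.2.trans hy⟩
  have hxy := (hs.1.trans hs.2).le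
  have mx := hT x ⟨le_rfl, hxy⟩
  have my := hT y ⟨hxy, le_rfl⟩
  have ms := hT s ⟨hs.1.le, hs.2.le⟩
  have mr := hT r ⟨hr.1.le, hr.2.le⟩
  have hs1 := h.mono mx ms hs.1.le
  have hs2 := h.mono ms my hs.2.le
  have hr1 := h.mono mx mr hr.1.le
  have hr2 := h.mono mr my hr.2.le
  rcases le_total s r with hsr | hsr
  · rw [abs_sub_comm]
    exact (h.modulus s r (by linarith [hs.1]) hsr (hr.2.trans_le hy)).trans (by linarith)
  · exact (h.modulus r s (by linarith [hr.1]) hsr (hs.2.trans_le hy)).trans (by linarith)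

/-- A modulus of continuity of `g'`. -/
def kernelModulus (T Qg x : ℝ) : ℝ := 6 * Qg * (1 + T) * Real.sqrt x

theorem IsKernelBound.nonneg {T Qg : ℝ} {α : ℝ → ℝ} (hT : 0 < T) (h : IsKernelBound T α Qg) :
    0 ≤ Qg := (abs_nonneg _).trans (h.g_le 0 ⟨le_rfl, hT.le⟩)

/-- √s |log √s| is bounded, so the logarithm is dominated by s^(-1/2), whose antiderivative, a
multiple of √s, is the form of `kernelModulus`. -/
theorem log_weight_le {T s : ℝ} (hs : 0 < s) (hsT : s ≤ T) :
    |Real.log s| + 1 ≤ 3 * (1 + T) / Real.sqrt s := by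
  have hsq := Real.sqrt_pos.2 hs
  rw [le_div_iff₀ hsq]
  have h1 := mul_abs_log_le hsq (Real.sqrt_le_sqrt hsT)
  rw [Real.sq_sqrt (hs.le.trans hsT), Real.log_sqrt hs.le, abs_div, abs_two] at h1
  have h2 : Real.sqrt s ≤ 1 + T := by
    nlinarith [Real.sq_sqrt hs.le, sq_nonneg (Real.sqrt s - 1)]
  nlinarith

theorem IsKernelBound.hasKernelModulus {T a Qg : ℝ} {α : ℝ → ℝ} (ha0 : 0 < a) (ha1 : a < 1)
    (hT : 0 < T) (hα : IsAdmissibleExponent T α) (h0 : α 0 = 1 + a) (h : IsKernelBound T α Qg) :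
    HasKernelModulus T Qg (kernelModulus T Qg) (gfun α) (deriv (gfun α)) := by
  have hQ := h.nonneg hT
  refine ⟨gfun_continuousOn ha0 ha1 hT hα h0, fun t ht => (h.g_diff t ht).1.hasDerivAt,
    fun t ht => (h.g_diff t ht).2, fun x _ y _ hxy =>
      mul_le_mul_of_nonneg_left (Real.sqrt_le_sqrt hxy) (by positivity), ?_⟩
  -- The derivative 3 Qg (1+T)/√s of the modulus dominates |g''|, so modulus ± g' is nondecreasing;
  -- the two signs give the two halves of the estimate.
  have key : ∀ c : ℝ, |c| = 1 → MonotoneOn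
      (fun s => kernelModulus T Qg s + c * deriv (gfun α) s) (Ioo 0 T) := by
    intro c hc
    have hd : ∀ s ∈ Ioo 0 T, HasDerivAt (fun s => kernelModulus T Qg s + c * deriv (gfun α) s)
        (6 * Qg * (1 + T) * (1 / (2 * Real.sqrt s)) + c * deriv (deriv (gfun α)) s) s := by
      intro s hs
      exact ((Real.hasDerivAt_sqrt hs.1.ne').const_mul _).add
        ((h.g_diff2 s hs).1.hasDerivAt.const_mul c)
    refine monotoneOn_of_deriv_nonneg (convex_Ioo 0 T)
      (fun s hs => (hd s hs).continuousAt.continuousWithinAt)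
      (fun s hs => (hd s (interior_subset hs)).differentiableAt.differentiableWithinAt) ?_
    intro s hs
    have hs := interior_subset hs
    rw [(hd s hs).deriv]
    have h1 := (h.g_diff2 s hs).2.trans (mul_le_mul_of_nonneg_left (log_weight_le hs.1 hs.2.le) hQ)
    have h2 : |c * deriv (deriv (gfun α)) s| = |deriv (deriv (gfun α)) s| := by
      rw [abs_mul, hc, one_mul]
    have h3 := neg_abs_le (c * deriv (deriv (gfun α)) s)
    have h4 : 6 * Qg * (1 + T) * (1 / (2 * Real.sqrt s)) = Qg * (3 * (1 + T) / Real.sqrt s) := by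
      have := (Real.sqrt_pos.2 hs.1).ne'
      field_simp; ring
    linarith
  intro x y hx hxy hy
  have hxm : x ∈ Ioo 0 T := ⟨hx, hxy.trans_lt hy⟩
  have hym : y ∈ Ioo 0 T := ⟨hx.trans_le hxy, hy⟩
  have k1 := key 1 (by simp) hxm hym hxy
  have k2 := key (-1) (by simp) hxm hym hxy
  simp only at k1 k2
  rw [abs_le]
  constructor <;> linarith

/-! ### Truncation errors in time -/

/-- The weights of the quadrature for the memory term: `c₀` and `w̃_i`. -/
def memWeight (τ : ℝ) (g : ℝ → ℝ) : ℕ → ℝ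
  | 0 => (g 0 + g τ) / 2
  | i + 1 => (g ((i + 1 + 1 : ℕ) * τ) - g (i * τ)) / 2

/-- The error of the trapezoidal rule on the cell `i`. -/
def trapezoidError (τ : ℝ) (g : ℝ → ℝ) (i : ℕ) : ℝ :=
  (∫ σ in (0 : ℝ)..τ, g ((i + 1 : ℕ) * τ - σ)) - τ * ((g (i * τ) + g ((i + 1 : ℕ) * τ)) / 2)

/-- Majorant of the oscillation in time of the solution around the cell `k`. -/
def oscBound (a K τ : ℝ) (k : ℕ) : ℝ :=
  (if k ≤ 1 then K else 0)
    + K * (timeModulus a ((k + 1 : ℕ) * τ) - timeModulus a ((k - 1 : ℕ) * τ))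

/-- Oscillation of the kernel across two neighbouring cells. -/
def kernelOsc (Qg τ : ℝ) (Γ : ℝ → ℝ) : ℕ → ℝ
  | 0 => Qg
  | i + 1 => Γ ((i + 1 + 1 : ℕ) * τ) - Γ (i * τ)

/-- c₀ and w̃_i are the trapezoidal values of these cell integrals. The defect is a difference of
trapezoidal errors on consecutive cells, ready for summation by parts. -/
theorem integral_lagKernel {T τ : ℝ} (hτ : 0 ≤ τ) {g : ℝ → ℝ} (hg : ContinuousOn g (Icc 0 T))
    {i : ℕ} (hi : ((i + 1 : ℕ) : ℝ) * τ ≤ T) :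
    ∫ σ in (0 : ℝ)..τ, lagKernel τ g i σ
      = τ * memWeight τ g i + backDiff (trapezoidError τ g) i := by
  cases i with
  | zero => simp [lagKernel, memWeight, backDiff, trapezoidError]
  | succ i =>
    have h2 : ((i + 1 : ℕ) : ℝ) * τ ≤ T := by push_cast at hi ⊢; nlinarith
    simp only [lagKernel, memWeight, backDiff, trapezoidError]
    rw [intervalIntegral.integral_sub]
    · ring
    · exact ContinuousOn.intervalIntegrable (by
        rw [uIcc_of_le hτ]; exact continuousOn_cell_left hτ hg hi)
    · exact ContinuousOn.intervalIntegrable (by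
        rw [uIcc_of_le hτ]; exact continuousOn_cell_left hτ hg h2)

/-- The linear interpolant integrates to the trapezoidal value, its centred part having mean zero;
the interpolation error is τ times the oscillation of g' on the cell. -/
theorem abs_trapezoidError_le {T Qg τ : ℝ} (hτ : 0 < τ) {Γ g g' : ℝ → ℝ}
    (h : HasKernelModulus T Qg Γ g g') {i : ℕ} (hi : ((i + 1 : ℕ) : ℝ) * τ ≤ T) :
    |trapezoidError τ g i| ≤ τ ^ 2 * (Γ ((i + 1 : ℕ) * τ) - Γ (i * τ)) := by
  have hi0 : 0 ≤ (i : ℝ) * τ := by positivity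
  have hxy : (i : ℝ) * τ < (i + 1 : ℕ) * τ := by push_cast; nlinarith
  have hlen : ((i + 1 : ℕ) : ℝ) * τ - i * τ = τ := by push_cast; ring
  set x := (i : ℝ) * τ
  set y := ((i + 1 : ℕ) : ℝ) * τ
  have key := abs_integral_mul_sub_affine_le (τ := τ) (p := (g x + g y) / 2)
    (D := -((g y - g x) / τ)) (ε := τ * (Γ y - Γ x)) hτ.le (A := fun _ => 1)
    (φ := fun σ => g (y - σ)) continuousOn_const (continuousOn_cell_left hτ.le h.cont hi)
    (fun _ _ => zero_le_one) (by
      intro σ hσ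
      have := abs_sub_linear_interpolation_le hxy (h.cont.mono (Icc_subset_Icc hi0 hi))
        (fun s hs => h.deriv s ⟨hi0.trans_lt hs.1, hs.2.trans_le hi⟩)
        (fun s hs r hr => h.osc hi0 hi hs hr) (s := y - σ)
        ⟨by linarith [hσ.2], by linarith [hσ.1]⟩
      rw [hlen] at this
      convert this using 2
      field_simp
      have : x = y - τ := by linarith
      rw [this]
      ring)
  simp only [one_mul, integral_linear_centered, mul_zero, add_zero,
    intervalIntegral.integral_const, sub_zero, smul_eq_mul, mul_one] at key
  rw [trapezoidError]
  convert key using 1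
  · congr 1; ring
  · ring

theorem oscBound_nonneg {a K τ : ℝ} (ha : 0 < a) (hK : 0 ≤ K) (hτ : 0 ≤ τ) (k : ℕ) :
    0 ≤ oscBound a K τ k := by
  have h1 := timeModulus_mono ha (x := ((k - 1 : ℕ) : ℝ) * τ) (y := (k + 1 : ℕ) * τ)
    (by positivity) (mul_le_mul_of_nonneg_right (by exact_mod_cast (by omega)) hτ)
  have h2 : 0 ≤ K * (timeModulus a ((k + 1 : ℕ) * τ) - timeModulus a ((k - 1 : ℕ) * τ)) :=
    mul_nonneg hK (by linarith)
  rw [oscBound]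
  split_ifs <;> linarith

theorem le_oscBound {a K τ : ℝ} (ha : 0 < a) (hK : 0 ≤ K) (hτ : 0 ≤ τ) (k : ℕ) :
    K * (timeModulus a ((k + 1 : ℕ) * τ) - timeModulus a (k * τ)) ≤ oscBound a K τ k := by
  have h1 := timeModulus_mono ha (x := ((k - 1 : ℕ) : ℝ) * τ) (y := k * τ)
    (by positivity) (mul_le_mul_of_nonneg_right (by exact_mod_cast (by omega)) hτ)
  have h2 := mul_le_mul_of_nonneg_left h1 hK
  rw [oscBound]
  split_ifs <;> linarith

/-- The extra K pays for start-up effects that are not increments of a modulus: the slope sequence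
jumps from its conventional value 0 at cell 0 (memory term) or cell 1 (product rule), and the
product rule takes a constant on cell 0. With two such cells the sum stays bounded. -/
theorem const_le_oscBound {a K τ : ℝ} (ha : 0 < a) (hK : 0 ≤ K) (hτ : 0 ≤ τ) {k : ℕ}
    (hk : k ≤ 1) : K ≤ oscBound a K τ k := by
  have h1 := timeModulus_mono ha (x := ((k - 1 : ℕ) : ℝ) * τ) (y := (k + 1 : ℕ) * τ)
    (by positivity) (mul_le_mul_of_nonneg_right (by exact_mod_cast (by omega)) hτ)
  have h2 := mul_nonneg hK (sub_nonneg.2 h1)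
  rw [oscBound, if_pos hk]
  linarith

theorem HasTimeModulus.slope {T a K τ : ℝ} {v v₁ : ℝ → ℝ} (h : HasTimeModulus T a K v v₁)
    (hτ : 0 < τ) {k : ℕ} (hk : ((k + 1 : ℕ) : ℝ) * τ ≤ T) :
    ∃ η ∈ Icc ((k : ℝ) * τ) ((k + 1 : ℕ) * τ),
      (v ((k + 1 : ℕ) * τ) - v (k * τ)) / τ = v₁ η := by
  have h0 : 0 ≤ (k : ℝ) * τ := by positivity
  have hxy : (k : ℝ) * τ < (k + 1 : ℕ) * τ := by push_cast; nlinarith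
  obtain ⟨η, hη, e⟩ := exists_hasDerivAt_eq_slope v v₁ hxy (h.cont.mono (Icc_subset_Icc h0 hk))
    (fun s hs => h.deriv s ⟨h0.trans_lt hs.1, hs.2.trans_le hk⟩)
  refine ⟨η, ⟨hη.1.le, hη.2.le⟩, ?_⟩
  rw [e]
  congr 1
  push_cast; ring

theorem HasTimeModulus.abs_slope_le {T a K τ : ℝ} {v v₁ : ℝ → ℝ} (h : HasTimeModulus T a K v v₁)
    (hτ : 0 < τ) {k : ℕ} (hk : ((k + 1 : ℕ) : ℝ) * τ ≤ T) :
    |(v ((k + 1 : ℕ) * τ) - v (k * τ)) / τ| ≤ K := by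
  obtain ⟨η, hη, e⟩ := h.slope hτ hk
  rw [e]
  exact h.bound η ⟨le_trans (by positivity) hη.1, hη.2.trans hk⟩

theorem HasTimeModulus.abs_slope_sub_le {T a K τ : ℝ} {v v₁ : ℝ → ℝ}
    (h : HasTimeModulus T a K v v₁) (ha : 0 < a) (hK : 0 ≤ K) (hτ : 0 < τ) {k : ℕ}
    (hk : ((k + 1 + 1 : ℕ) : ℝ) * τ ≤ T) :
    |(v ((k + 1 + 1 : ℕ) * τ) - v ((k + 1 : ℕ) * τ)) / τ - (v ((k + 1 : ℕ) * τ) - v (k * τ)) / τ|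
      ≤ oscBound a K τ (k + 1) := by
  have l1 : ((k + 1 : ℕ) : ℝ) * τ ≤ (k + 1 + 1 : ℕ) * τ := by push_cast; nlinarith
  have l2 : (k : ℝ) * τ ≤ (k + 1 : ℕ) * τ := by push_cast; nlinarith
  obtain ⟨η, hη, e⟩ := h.slope hτ hk
  obtain ⟨ξ, hξ, e2⟩ := h.slope hτ (l1.trans hk)
  rw [e, e2]
  refine (h.osc ha hK (x := k * τ) (by positivity) hk ⟨l2.trans hη.1, hη.2⟩
    ⟨hξ.1, hξ.2.trans l1⟩).trans ?_
  rw [oscBound, Nat.add_sub_cancel]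
  split_ifs <;> linarith

/-- At lag 0 the kernel is g itself and varies by at most τ sup |g'|. At a positive lag it is a
difference of g over one cell, so its variation is τ times the oscillation of g' across two cells.
-/
theorem abs_lagKernel_sub_le {T Qg τ : ℝ} (hτ : 0 < τ) {Γ g g' : ℝ → ℝ}
    (h : HasKernelModulus T Qg Γ g g') {i : ℕ} (hi : ((i + 1 : ℕ) : ℝ) * τ ≤ T) {σ : ℝ}
    (hσ : σ ∈ Icc 0 τ) :
    |lagKernel τ g i σ - lagKernel τ g i 0| ≤ τ * kernelOsc Qg τ Γ i := by
  rcases hσ.1.eq_or_lt with rfl | hlt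
  · rw [sub_self, abs_zero]
    refine mul_nonneg hτ.le ?_
    cases i with
    | zero =>
      simp only [zero_add, Nat.cast_one, one_mul] at hi
      exact (abs_nonneg _).trans (h.bound (τ / 2) ⟨by linarith, by linarith⟩)
    | succ i =>
      have hle : (i : ℝ) * τ ≤ (i + 1 + 1 : ℕ) * τ := by push_cast; nlinarith
      have h0 : 0 ≤ (i : ℝ) * τ := by positivity
      exact sub_nonneg.2 (h.mono ⟨h0, hle.trans hi⟩ ⟨h0.trans hle, hi⟩ hle)
  have mvt : ∀ j : ℕ, ((j + 1 : ℕ) : ℝ) * τ ≤ T →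
      ∃ ξ ∈ Ioo ((j : ℝ) * τ) ((j + 1 : ℕ) * τ),
        g ((j + 1 : ℕ) * τ) - g ((j + 1 : ℕ) * τ - σ) = σ * g' ξ := by
    intro j hj
    have h0 : 0 ≤ (j : ℝ) * τ := by positivity
    have hlen : ((j + 1 : ℕ) : ℝ) * τ - j * τ = τ := by push_cast; ring
    obtain ⟨ξ, hξ, e⟩ := exists_hasDerivAt_eq_slope g g'
      (show ((j + 1 : ℕ) : ℝ) * τ - σ < (j + 1 : ℕ) * τ by linarith)
      (h.cont.mono (Icc_subset_Icc (by linarith [hσ.2]) hj))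
      (fun s hs => h.deriv s ⟨by linarith [hs.1, hσ.2], hs.2.trans_le hj⟩)
    refine ⟨ξ, ⟨by linarith [hξ.1, hσ.2], hξ.2⟩, ?_⟩
    rw [e, sub_sub_cancel]
    field_simp
  cases i with
  | zero =>
    obtain ⟨ξ, hξ, e⟩ := mvt 0 hi
    simp only [zero_add, Nat.cast_one, one_mul, Nat.cast_zero, zero_mul] at e hξ hi
    simp only [lagKernel, kernelOsc, sub_zero]
    rw [abs_sub_comm, e, abs_mul, abs_of_pos hlt]
    exact mul_le_mul hσ.2 (h.bound ξ ⟨hξ.1, hξ.2.trans_le hi⟩) (abs_nonneg _) hτ.le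
  | succ i =>
    have l1 : ((i + 1 : ℕ) : ℝ) * τ ≤ (i + 1 + 1 : ℕ) * τ := by push_cast; nlinarith
    have l2 : (i : ℝ) * τ ≤ (i + 1 : ℕ) * τ := by push_cast; nlinarith
    obtain ⟨ξ, hξ, e⟩ := mvt (i + 1) hi
    obtain ⟨η, hη, e2⟩ := mvt i (l1.trans hi)
    simp only [lagKernel, kernelOsc, sub_zero]
    have : g ((i + 1 + 1 : ℕ) * τ - σ) - g ((i + 1 : ℕ) * τ - σ)
        - (g ((i + 1 + 1 : ℕ) * τ) - g ((i + 1 : ℕ) * τ)) = σ * (g' η - g' ξ) := by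
      linarith
    rw [this, abs_mul, abs_of_pos hlt]
    exact mul_le_mul hσ.2 (h.osc (x := i * τ) (by positivity) hi ⟨hη.1, hη.2.trans_le l1⟩
      ⟨l2.trans_lt hξ.1, hξ.2⟩) (abs_nonneg _) hτ.le

/-- Truncation error of the quadrature for the memory term. -/
theorem memory_truncation {T Qg a K τ : ℝ} (ha : 0 < a) (hK : 0 ≤ K) (hτ : 0 < τ)
    {Γ g g' v v₁ : ℝ → ℝ} (hg : HasKernelModulus T Qg Γ g g') (hv : HasTimeModulus T a K v v₁)
    {n : ℕ} (hn : ((n + 1 : ℕ) : ℝ) * τ ≤ T) :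
    |τ * ∑ k ∈ Finset.range (n + 1),
          memWeight τ g (n - k) * ((v ((k + 1 : ℕ) * τ) - v (k * τ)) / τ)
        - ((∫ s in (0 : ℝ)..((n + 1 : ℕ) * τ), g ((n + 1 : ℕ) * τ - s) * v₁ s)
          - ∫ s in (0 : ℝ)..(n * τ), g (n * τ - s) * v₁ s)|
      ≤ τ ^ 2 * ∑ k ∈ Finset.range (n + 1), (kernelOsc Qg τ Γ (n - k)
          + (Γ ((n - k + 1 : ℕ) * τ) - Γ ((n - k : ℕ) * τ))) * oscBound a K τ k := by
  have hle : ∀ k : ℕ, k ≤ n + 1 → (k : ℝ) * τ ≤ T := fun k hk =>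
    (mul_le_mul_of_nonneg_right (by exact_mod_cast hk) hτ.le).trans hn
  set d : ℕ → ℝ := fun k => (v ((k + 1 : ℕ) * τ) - v (k * τ)) / τ with hd
  set E := trapezoidError τ g with hE
  rw [convolution_backward_difference hτ.le hg.cont hv.cont₁ hn]
  -- The error consists of a covariance of kernel and v₁ on each cell and of the trapezoidal defect,
  -- whose backward difference is moved onto the slopes d. Each part is τ² times a product of two
  -- increments.
  have split : τ * ∑ k ∈ Finset.range (n + 1), memWeight τ g (n - k) * d k
      - ∑ k ∈ Finset.range (n + 1), ∫ σ in (0 : ℝ)..τ, lagKernel τ g (n - k) σ * v₁ (k * τ + σ)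
      = -∑ k ∈ Finset.range (n + 1),
          ((∫ σ in (0 : ℝ)..τ, lagKernel τ g (n - k) σ * v₁ (k * τ + σ))
            - d k * (∫ σ in (0 : ℝ)..τ, lagKernel τ g (n - k) σ) + backDiff d k * E (n - k)) := by
    rw [Finset.sum_add_distrib, Finset.sum_sub_distrib, ← sum_mul_backDiff, Finset.mul_sum]
    have : ∑ k ∈ Finset.range (n + 1), d k * (∫ σ in (0 : ℝ)..τ, lagKernel τ g (n - k) σ)
        = ∑ k ∈ Finset.range (n + 1), τ * (memWeight τ g (n - k) * d k)
          + ∑ k ∈ Finset.range (n + 1), d k * backDiff E (n - k) := by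
      rw [← Finset.sum_add_distrib]
      refine Finset.sum_congr rfl fun k hk => ?_
      rw [integral_lagKernel hτ.le hg.cont (hle _ (by omega))]
      ring
    rw [this]
    ring
  rw [split, abs_neg, Finset.mul_sum]
  refine (Finset.abs_sum_le_sum_abs _ _).trans (Finset.sum_le_sum fun k hk => ?_)
  rw [Finset.mem_range] at hk
  have hkT : ((k + 1 : ℕ) : ℝ) * τ ≤ T := hle _ (by omega)
  have hiT : ((n - k + 1 : ℕ) : ℝ) * τ ≤ T := hle _ (by omega)
  have hlen : ((k + 1 : ℕ) : ℝ) * τ = k * τ + τ := by push_cast; ring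
  have h0 : 0 ≤ (k : ℝ) * τ := by positivity
  have mean : ∫ σ in (0 : ℝ)..τ, v₁ (k * τ + σ) = τ * d k := by
    have e1 := intervalIntegral.integral_comp_add_left (a := 0) (b := τ) v₁ (k * τ)
    rw [add_zero, ← hlen] at e1
    have hxy : (k : ℝ) * τ ≤ (k + 1 : ℕ) * τ := by rw [hlen]; linarith
    rw [e1, intervalIntegral.integral_eq_sub_of_hasDerivAt_of_le hxy
      (hv.cont.mono (Icc_subset_Icc h0 hkT))
      (fun s hs => hv.deriv s ⟨h0.trans_lt hs.1, hs.2.trans_le hkT⟩)]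
    · simp only [hd]; field_simp
    · refine (hv.cont₁.mono ?_).intervalIntegrable
      rw [uIcc_of_le hxy]
      exact Icc_subset_Icc h0 hkT
  have b1 := abs_integral_mul_sub_mean_le hτ.le (lagKernel_continuousOn hτ.le hg.cont hiT)
    (continuousOn_cell_right hτ.le hv.cont₁ hkT) mean
    (fun σ hσ => abs_lagKernel_sub_le hτ hg hiT hσ)
    (β := oscBound a K τ k) (by
      intro σ hσ
      obtain ⟨η, hη, e⟩ := hv.slope hτ hkT
      simp only [hd]
      rw [e]
      exact (hv.osc ha hK h0 hkT ⟨by linarith [hσ.1], by linarith [hσ.2]⟩ hη).trans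
        (le_oscBound ha hK hτ.le k))
  have b2 := abs_trapezoidError_le hτ hg hiT
  have b3 : |backDiff d k| ≤ oscBound a K τ k := by
    cases k with
    | zero => exact (hv.abs_slope_le hτ hkT).trans (const_le_oscBound ha hK hτ.le (by omega))
    | succ k => exact hv.abs_slope_sub_le ha hK hτ hkT
  refine (abs_add_le _ _).trans ?_
  rw [abs_mul]
  have b4 := mul_le_mul b3 b2 (abs_nonneg _) (oscBound_nonneg ha hK hτ.le k)
  calc _ ≤ _ := add_le_add b1 b4
    _ = _ := by push_cast; ring

/-! ### The averaged product integration rule -/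

/-- The node values entering the averaged product integration rule. -/
def piValue (τ : ℝ) (F : ℝ → ℝ) (k : ℕ) : ℝ :=
  if k = 0 then F τ else (F (k * τ) + F ((k + 1 : ℕ) * τ)) / 2

/-- The slopes of the interpolant underlying the averaged product integration rule. -/
def piSlope (τ : ℝ) (F : ℝ → ℝ) (k : ℕ) : ℝ :=
  if k = 0 then 0 else (F ((k + 1 : ℕ) * τ) - F (k * τ)) / τ

/-- First moments of the integrated kernel. -/
def betaMoment (a τ : ℝ) (i : ℕ) : ℝ :=
  ∫ σ in (0 : ℝ)..τ, betaInt a ((i + 1 : ℕ) * τ - σ) * (σ - τ / 2)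

theorem integral_lagKernel_betaInt {a τ : ℝ} (ha : 0 < a) (hτ : 0 < τ) (i : ℕ) :
    ∫ σ in (0 : ℝ)..τ, lagKernel τ (betaInt a) i σ = τ * lamSeq a τ i := by
  have hc := betaInt_continuous ha
  have cell : ∀ j : ℕ, ∫ σ in (0 : ℝ)..τ, betaInt a ((j + 1 : ℕ) * τ - σ) = cellInt a τ j := by
    intro j
    rw [intervalIntegral.integral_comp_sub_left (fun x => betaInt a x), cellInt_eq_integral ha]
    congr 1 <;> (push_cast; ring)
  cases i with
  | zero => 
    rw [tau_mul_lamSeq_zero ha hτ, ← cell]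
    simp [lagKernel]
  | succ i =>
    simp only [lagKernel]
    rw [intervalIntegral.integral_sub, cell, cell, tau_mul_lamSeq_succ hτ]
    all_goals exact (hc.comp (by fun_prop)).intervalIntegrable _ _

theorem integral_lagKernel_betaInt_moment {a τ : ℝ} (ha : 0 < a) (i : ℕ) :
    ∫ σ in (0 : ℝ)..τ, lagKernel τ (betaInt a) i σ * (σ - τ / 2)
      = backDiff (betaMoment a τ) i := by
  have hc := betaInt_continuous ha
  cases i with
  | zero => simp [lagKernel, backDiff, betaMoment]
  | succ i =>
    simp only [lagKernel, backDiff, betaMoment, sub_mul]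
    rw [intervalIntegral.integral_sub]
    all_goals exact (Continuous.mul (hc.comp (by fun_prop)) (by fun_prop)).intervalIntegrable _ _

theorem lagKernel_betaInt_nonneg {a τ σ : ℝ} (ha : 0 < a) (i : ℕ) (hσ : σ ∈ Icc 0 τ) :
    0 ≤ lagKernel τ (betaInt a) i σ := by
  cases i with
  | zero => exact betaInt_nonneg ha (by linarith [hσ.2])
  | succ i =>
    have hτ : 0 ≤ τ := hσ.1.trans hσ.2
    have : 0 ≤ (i : ℝ) * τ := by positivity
    refine sub_nonneg.2 (betaInt_mono ha ?_ ?_) <;> push_cast <;> nlinarith [hσ.2]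

/-- The weight σ - τ/2 has mean zero, so the value of B at the left end of the cell can be
subtracted. -/
theorem abs_betaMoment_le {a τ : ℝ} (ha : 0 < a) (hτ : 0 < τ) (i : ℕ) :
    |betaMoment a τ i| ≤ τ ^ 2 * (betaInt a ((i + 1 : ℕ) * τ) - betaInt a (i * τ)) := by
  have hc := betaInt_continuous ha
  have := abs_integral_mul_sub_mean_le (d := 0) (c := betaInt a (i * τ)) hτ.le
    (α := betaInt a ((i + 1 : ℕ) * τ) - betaInt a (i * τ)) (β := τ)
    (A := fun σ => betaInt a ((i + 1 : ℕ) * τ - σ)) (φ := fun σ => σ - τ / 2)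
    (hc.comp (by fun_prop)).continuousOn (by fun_prop)
    (by rw [integral_linear_centered, mul_zero]) (by
      intro σ hσ
      have h0 : 0 ≤ (i : ℝ) * τ := by positivity
      have hlen : ((i + 1 : ℕ) : ℝ) * τ = i * τ + τ := by push_cast; ring
      have h1 := betaInt_mono ha h0 (show (i : ℝ) * τ ≤ (i + 1 : ℕ) * τ - σ by linarith [hσ.2])
      have h2 := betaInt_mono ha (show 0 ≤ ((i + 1 : ℕ) : ℝ) * τ - σ by linarith [hσ.2])
        (show ((i + 1 : ℕ) : ℝ) * τ - σ ≤ (i + 1 : ℕ) * τ by linarith [hσ.1])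
      rw [abs_of_nonneg (by linarith)]
      linarith) (by
      intro σ hσ
      rw [sub_zero, abs_le]
      constructor <;> linarith [hσ.1, hσ.2])
  rw [zero_mul, sub_zero] at this
  exact this.trans_eq (by ring)

/-- Truncation error of the averaged product integration rule. -/
theorem product_integration_truncation {T a K τ : ℝ} (ha : 0 < a) (hK : 0 ≤ K) (hτ : 0 < τ)
    {F F₁ : ℝ → ℝ} (hF : HasTimeModulus T a K F F₁) {n : ℕ} (hn : ((n + 1 : ℕ) : ℝ) * τ ≤ T) :
    |τ * ∑ k ∈ Finset.range (n + 1), lamSeq a τ (n - k) * piValue τ F k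
        - ((∫ s in (0 : ℝ)..((n + 1 : ℕ) * τ), betaInt a ((n + 1 : ℕ) * τ - s) * F s)
          - ∫ s in (0 : ℝ)..(n * τ), betaInt a (n * τ - s) * F s)|
      ≤ τ ^ 2 * ∑ k ∈ Finset.range (n + 1), (lamSeq a τ (n - k)
          + (betaInt a ((n - k + 1 : ℕ) * τ) - betaInt a ((n - k : ℕ) * τ)))
            * oscBound a K τ k := by
  have hle : ∀ k : ℕ, k ≤ n + 1 → (k : ℝ) * τ ≤ T := fun k hk =>
    (mul_le_mul_of_nonneg_right (by exact_mod_cast hk) hτ.le).trans hn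
  have hB : ContinuousOn (betaInt a) (Icc 0 T) := (betaInt_continuous ha).continuousOn
  set p := piValue τ F with hp
  set d := piSlope τ F with hd
  set P := betaMoment a τ with hP
  rw [convolution_backward_difference hτ.le hB hF.cont hn]
  -- The rule uses only the averages p, whereas F is close to p + d (σ - τ/2). The omitted slopes
  -- multiply first moments of the kernel, which are backward differences of `betaMoment`, so
  -- summation by parts applies again.
  have split : τ * ∑ k ∈ Finset.range (n + 1), lamSeq a τ (n - k) * p k
      - ∑ k ∈ Finset.range (n + 1), ∫ σ in (0 : ℝ)..τ,
          lagKernel τ (betaInt a) (n - k) σ * F (k * τ + σ)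
      = -∑ k ∈ Finset.range (n + 1),
          ((∫ σ in (0 : ℝ)..τ, lagKernel τ (betaInt a) (n - k) σ * F (k * τ + σ))
            - (p k * (∫ σ in (0 : ℝ)..τ, lagKernel τ (betaInt a) (n - k) σ)
              + d k * ∫ σ in (0 : ℝ)..τ, lagKernel τ (betaInt a) (n - k) σ * (σ - τ / 2))
            + backDiff d k * P (n - k)) := by
    rw [Finset.sum_add_distrib, Finset.sum_sub_distrib, ← sum_mul_backDiff, Finset.mul_sum]
    have : ∑ k ∈ Finset.range (n + 1),
          (p k * (∫ σ in (0 : ℝ)..τ, lagKernel τ (betaInt a) (n - k) σ)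
              + d k * ∫ σ in (0 : ℝ)..τ, lagKernel τ (betaInt a) (n - k) σ * (σ - τ / 2))
        = ∑ k ∈ Finset.range (n + 1), τ * (lamSeq a τ (n - k) * p k)
          + ∑ k ∈ Finset.range (n + 1), d k * backDiff P (n - k) := by
      rw [← Finset.sum_add_distrib]
      refine Finset.sum_congr rfl fun k hk => ?_
      rw [integral_lagKernel_betaInt ha hτ, integral_lagKernel_betaInt_moment ha]
      ring
    rw [this]
    ring
  rw [split, abs_neg, Finset.mul_sum]
  refine (Finset.abs_sum_le_sum_abs _ _).trans (Finset.sum_le_sum fun k hk => ?_)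
  rw [Finset.mem_range] at hk
  have hkT : ((k + 1 : ℕ) : ℝ) * τ ≤ T := hle _ (by omega)
  have hiT : ((n - k + 1 : ℕ) : ℝ) * τ ≤ T := hle _ (by omega)
  have hlen : ((k + 1 : ℕ) : ℝ) * τ = k * τ + τ := by push_cast; ring
  have h0 : 0 ≤ (k : ℝ) * τ := by positivity
  have hxy : (k : ℝ) * τ < (k + 1 : ℕ) * τ := by rw [hlen]; linarith
  have b1 := abs_integral_mul_sub_affine_le (p := p k) (D := d k) (ε := τ * oscBound a K τ k)
    hτ.le (lagKernel_continuousOn hτ.le hB hiT) (continuousOn_cell_right hτ.le hF.cont hkT)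
    (fun σ hσ => lagKernel_betaInt_nonneg ha _ hσ) (by
      intro σ hσ
      rcases Nat.eq_zero_or_pos k with rfl | hk0
      · simp only [hp, hd, piValue, piSlope, if_true, zero_mul, add_zero, Nat.cast_zero, zero_add]
        rw [zero_add, Nat.cast_one, one_mul] at hkT
        have c0 := const_le_oscBound ha hK hτ.le (k := 0) (by omega)
        refine le_trans ?_ (mul_le_mul_of_nonneg_left c0 hτ.le)
        rcases hσ.2.eq_or_lt with rfl | hlt
        · simp; positivity
        obtain ⟨ξ, hξ, e⟩ := exists_hasDerivAt_eq_slope F F₁ hlt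
          (hF.cont.mono (Icc_subset_Icc hσ.1 hkT))
          (fun s hs => hF.deriv s ⟨hσ.1.trans_lt hs.1, hs.2.trans_le hkT⟩)
        have e2 : F τ - F σ = F₁ ξ * (τ - σ) := by
          rw [e]; field_simp [(sub_pos.2 hlt).ne']
        rw [abs_sub_comm, e2, abs_mul, abs_of_pos (sub_pos.2 hlt), mul_comm]
        exact mul_le_mul (by linarith [hσ.1]) (hF.bound ξ ⟨hσ.1.trans hξ.1.le,
          hξ.2.le.trans hkT⟩) (abs_nonneg _) hτ.le
      · simp only [hp, hd, piValue, piSlope, if_neg hk0.ne']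
        have := abs_sub_linear_interpolation_le hxy (hF.cont.mono (Icc_subset_Icc h0 hkT))
          (fun s hs => hF.deriv s ⟨h0.trans_lt hs.1, hs.2.trans_le hkT⟩)
          (fun s hs r hr => hF.osc ha hK h0 hkT (Ioo_subset_Icc_self hs) (Ioo_subset_Icc_self hr))
          (s := k * τ + σ) ⟨by linarith [hσ.1], by linarith [hσ.2]⟩
        have el : ((k + 1 : ℕ) : ℝ) * τ - k * τ = τ := by rw [hlen]; ring
        rw [el] at this
        refine le_trans (le_of_eq ?_) (this.trans
          (mul_le_mul_of_nonneg_left (le_oscBound ha hK hτ.le k) hτ.le))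
        congr 4
        rw [hlen]; ring)
  have b2 := abs_betaMoment_le ha hτ (n - k)
  have b3 : |backDiff d k| ≤ oscBound a K τ k := by
    rcases k with _ | _ | k
    · simpa [backDiff, hd, piSlope] using oscBound_nonneg ha hK hτ.le 0
    · have := (hF.abs_slope_le hτ hkT).trans (const_le_oscBound ha hK hτ.le (k := 0 + 1) le_rfl)
      simpa [backDiff, hd, piSlope] using this
    · have := hF.abs_slope_sub_le ha hK hτ (k := k + 1) hkT
      simpa only [backDiff, hd, piSlope, Nat.add_eq_zero_iff, one_ne_zero, and_false, if_false]
        using this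
  refine (abs_add_le _ _).trans ?_
  rw [abs_mul]
  rw [integral_lagKernel_betaInt ha hτ] at b1
  rw [integral_lagKernel_betaInt ha hτ]
  have b4 := mul_le_mul b3 b2 (abs_nonneg _) (oscBound_nonneg ha hK hτ.le k)
  calc _ ≤ _ := add_le_add b1 b4
    _ = _ := by ring

end TwoGrid

end

noncomputable section

namespace TwoGrid

/-! ### The time-stepping operators -/

/-- The discrete memory operator applied to a sequence. -/
def memOp (τ : ℝ) (g : ℝ → ℝ) (x : ℕ → ℝ) (n : ℕ) : ℝ :=
  ∑ k ∈ Finset.Icc 1 n, memWeight τ g (n - k) * ((x k - x (k - 1)) / τ)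

/-- The averaged product integration operator applied to a sequence. -/
def piOp (a τ : ℝ) (x : ℕ → ℝ) (n : ℕ) : ℝ :=
  ∑ k ∈ Finset.Icc 1 n, lamSeq a τ (n - k) * midValue x k

theorem sum_Icc_one_eq_range (F : ℕ → ℝ) (n : ℕ) :
    ∑ k ∈ Finset.Icc 1 n, F k = ∑ k ∈ Finset.range n, F (k + 1) := by
  rw [Finset.range_eq_Ico, Finset.sum_Ico_add' F 0 n 1, zero_add]
  rfl

theorem midValue_one {V : Type*} [AddCommGroup V] [Module ℝ V] (e : ℕ → V) : midValue e 1 = e 1 :=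
  if_pos rfl

theorem midValue_real (x : ℕ → ℝ) {n : ℕ} (hn : n ≠ 1) : midValue x n = (x n + x (n - 1)) / 2 := by
  rw [midValue, if_neg hn, smul_eq_mul]; ring

theorem avgPI_eq_piOp (D : Cylinder) {N : ℕ} (hN : 1 ≤ N) {a : ℝ} {α : ℝ → ℝ} (ha : 0 < a)
    (h0 : α 0 = 1 + a) (x : ℕ → ℝ) {n : ℕ} (hn : 1 ≤ n) :
    avgPI D N α x n = piOp a (tau D N) x n := by
  rw [avgPI, piOp, ← Finset.insert_Icc_add_one_left_eq_Icc hn, Finset.sum_insert (by simp),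
    midValue_one, lam_eq_lamSeq D hN ha h0 le_rfl hn]
  congr 1
  refine Finset.sum_congr rfl fun j hj => ?_
  rw [Finset.mem_Icc] at hj
  rw [lam_eq_lamSeq D hN ha h0 (by omega) hj.2, midValue_real x (by omega)]

theorem wtTilde_eq_memWeight (D : Cylinder) (N : ℕ) (α : ℝ → ℝ) {i : ℕ} (hi : 1 ≤ i) :
    wtTilde D N α i = memWeight (tau D N) (gfun α) i := by
  obtain ⟨i, rfl⟩ : ∃ j, i = j + 1 := ⟨i - 1, by omega⟩
  simp only [wtTilde, if_neg (Nat.succ_ne_zero i), wt, time, memWeight, Nat.add_sub_cancel]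
  ring

theorem gfun_zero (α : ℝ → ℝ) : gfun α 0 = 1 := if_pos rfl

/-- Because g(0) = 1, the coefficient c₀ is the trapezoidal weight (g(0) + g(τ))/2. -/
theorem c0_eq_memWeight (D : Cylinder) (N : ℕ) (α : ℝ → ℝ) :
    1 + wt D N α 0 / 2 = memWeight (tau D N) (gfun α) 0 := by
  rw [wt, time, time, memWeight]
  simp only [zero_add, Nat.cast_one, one_mul, Nat.cast_zero, zero_mul, gfun_zero]
  ring

theorem avg_diffT (D : Cylinder) (N Mx My : ℕ) (U : ℕ → ℕ → ℕ → ℝ) (n i j : ℕ) :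
    avg Mx My (diffT D N U n) i j
      = (avg Mx My (U n) i j - avg Mx My (U (n - 1)) i j) / tau D N := by
  simp only [avg, avgX, avgY, diffT]
  split_ifs <;> ring

theorem schemeLHS_eq (D : Cylinder) {N : ℕ} (hN : 1 ≤ N) (Mx My : ℕ) {a : ℝ} {α : ℝ → ℝ}
    (ha : 0 < a) (h0 : α 0 = 1 + a) (U : ℕ → ℕ → ℕ → ℝ) {n : ℕ} (hn : 1 ≤ n) (i j : ℕ) :
    schemeLHS D N Mx My α U n i j
      = memOp (tau D N) (gfun α) (fun m => avg Mx My (U m) i j) n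
        - piOp a (tau D N) (fun m => compactLaplacian D Mx My (U m) i j) n := by
  rw [schemeLHS, avgPI_eq_piOp D hN ha h0 _ hn, memOp, c0_eq_memWeight]
  congr 1
  obtain ⟨m, rfl⟩ : ∃ m, n = m + 1 := ⟨n - 1, by omega⟩
  rw [Finset.sum_Icc_succ_top (by omega), Nat.sub_self, avg_diffT, add_comm]
  refine congrArg₂ (· + ·) ?_ rfl
  refine Finset.sum_congr rfl fun k hk => ?_
  rw [Finset.mem_Icc] at hk
  rw [avg_diffT, wtTilde_eq_memWeight D N α (by omega)]

/-- The coefficient of the `k`-th value in the averaged product integration operator. -/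
theorem piOp_eq_source (D : Cylinder) {N : ℕ} (hN : 1 ≤ N) {a : ℝ} {α : ℝ → ℝ} (ha : 0 < a)
    (h0 : α 0 = 1 + a) (x : ℕ → ℝ) {n : ℕ} (hn : 2 ≤ n) :
    lam D N α n n / 2 * x n + ∑ k ∈ Finset.Ico 1 n, lamTilde D N α n k * x k
      = piOp a (tau D N) x n := by
  rw [← avgPI_eq_piOp D hN ha h0 x (by omega : 1 ≤ n), avgPI]
  have key : ∀ m, ∑ k ∈ Finset.Ico 1 (m + 2), lamTilde D N α n k * x k
      = lam D N α n 1 * x 1 + ∑ j ∈ Finset.Icc 2 (m + 2), lam D N α n j * ((x j + x (j - 1)) / 2)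
        - lam D N α n (m + 2) / 2 * x (m + 2) := by
    intro m
    induction m with
    | zero => simp [lamTilde]; ring
    | succ m ih =>
      rw [Finset.sum_Ico_succ_top (by omega), ih, show m + 1 + 2 = m + 2 + 1 by ring,
        Finset.sum_Icc_succ_top (show 2 ≤ m + 2 + 1 by omega), lamTilde, if_neg (by omega), Nat.add_sub_cancel]
      ring
  obtain ⟨m, rfl⟩ : ∃ m, n = m + 2 := ⟨n - 2, by omega⟩
  rw [key]
  ring

/-! ### Node-wise consistency in time -/

/-- The weights in the majorant of the truncation error. -/
def truncWeight (a Qg T τ : ℝ) (i : ℕ) : ℝ :=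
  kernelOsc Qg τ (kernelModulus T Qg) i
    + (kernelModulus T Qg ((i + 1 : ℕ) * τ) - kernelModulus T Qg (i * τ))
    + (lamSeq a τ i + (betaInt a ((i + 1 : ℕ) * τ) - betaInt a (i * τ)))

/-- The majorant of the truncation error in time. -/
def truncBound (a K Qg T τ : ℝ) (n : ℕ) : ℝ :=
  τ * ∑ k ∈ Finset.range n, truncWeight a Qg T τ (n - 1 - k) * oscBound a K τ k

theorem kernelModulus_mono {T Qg : ℝ} (hT : 0 ≤ T) (hQ : 0 ≤ Qg) {x y : ℝ} (hxy : x ≤ y) :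
    kernelModulus T Qg x ≤ kernelModulus T Qg y :=
  mul_le_mul_of_nonneg_left (Real.sqrt_le_sqrt hxy) (by positivity)

theorem kernelModulus_nonneg {T Qg : ℝ} (hT : 0 ≤ T) (hQ : 0 ≤ Qg) (x : ℝ) :
    0 ≤ kernelModulus T Qg x := by
  rw [kernelModulus]; positivity

theorem kernelOsc_nonneg {T Qg τ : ℝ} (hT : 0 ≤ T) (hQ : 0 ≤ Qg) (hτ : 0 ≤ τ) (i : ℕ) :
    0 ≤ kernelOsc Qg τ (kernelModulus T Qg) i := by
  cases i with
  | zero => exact hQ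
  | succ i =>
    exact sub_nonneg.2 (kernelModulus_mono hT hQ
      (mul_le_mul_of_nonneg_right (by exact_mod_cast (by omega)) hτ))

theorem truncWeight_nonneg {a Qg T τ : ℝ} (ha : 0 < a) (hT : 0 ≤ T) (hQ : 0 ≤ Qg) (hτ : 0 < τ)
    (i : ℕ) : 0 ≤ truncWeight a Qg T τ i := by
  have hle : (i : ℝ) * τ ≤ (i + 1 : ℕ) * τ := by push_cast; nlinarith
  have h1 := kernelOsc_nonneg hT hQ hτ.le i
  have h2 := kernelModulus_mono hT hQ hle
  have h3 := lamSeq_nonneg ha hτ i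
  have h4 := betaInt_mono ha (by positivity) hle
  rw [truncWeight]
  linarith

theorem truncBound_nonneg {a K Qg T τ : ℝ} (ha : 0 < a) (hK : 0 ≤ K) (hT : 0 ≤ T) (hQ : 0 ≤ Qg)
    (hτ : 0 < τ) (n : ℕ) : 0 ≤ truncBound a K Qg T τ n :=
  mul_nonneg hτ.le (Finset.sum_nonneg fun k _ =>
    mul_nonneg (truncWeight_nonneg ha hT hQ hτ _) (oscBound_nonneg ha hK hτ.le k))

theorem sum_forward_two (x : ℕ → ℝ) (N : ℕ) :
    ∑ k ∈ Finset.range N, (x (k + 1) - x (k - 1)) = x N + x (N - 1) - 2 * x 0 := by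
  induction N with
  | zero => simp; ring
  | succ N ih => rw [Finset.sum_range_succ, ih, Nat.add_sub_cancel]; ring

theorem sum_step_two (x : ℕ → ℝ) (N : ℕ) :
    ∑ k ∈ Finset.range N, (x (k + 1 + 1) - x k) = x (N + 1) + x N - x 1 - x 0 := by
  induction N with
  | zero => simp
  | succ N ih => rw [Finset.sum_range_succ, ih]; ring

theorem sum_step_three (x : ℕ → ℝ) (N : ℕ) :
    ∑ k ∈ Finset.range N, (x (k + 3) - x k) = x (N + 2) + x (N + 1) + x N - x 2 - x 1 - x 0 := by
  induction N with
  | zero => simp; ring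
  | succ N ih => rw [Finset.sum_range_succ, ih]; ring

/-- Apart from the lag-zero term Qg and the weights λ, all pieces are increments of monotone
functions and telescope; the bound does not depend on τ. -/
theorem sum_truncWeight_le {a Qg T τ : ℝ} (ha : 0 < a) (hT : 0 ≤ T) (hQ : 0 ≤ Qg) (hτ : 0 < τ)
    {N : ℕ} (hN : N * τ ≤ T) :
    ∑ i ∈ Finset.range N, truncWeight a Qg T τ i
      ≤ Qg + 3 * kernelModulus T Qg T + 2 * betaInt a T := by
  have hΓ : ∀ k : ℕ, k ≤ N → kernelModulus T Qg (k * τ) ≤ kernelModulus T Qg T := fun k hk =>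
    kernelModulus_mono hT hQ
      ((mul_le_mul_of_nonneg_right (by exact_mod_cast hk) hτ.le).trans hN)
  have hΓ0 : ∀ k : ℕ, 0 ≤ kernelModulus T Qg (k * τ) := fun k => kernelModulus_nonneg hT hQ _
  have s1 : ∑ i ∈ Finset.range N, kernelOsc Qg τ (kernelModulus T Qg) i
      ≤ Qg + 2 * kernelModulus T Qg T := by
    rcases N with _ | N
    · have := kernelModulus_nonneg hT hQ T
      simp; linarith
    · rw [Finset.sum_range_succ']
      have := sum_step_two (fun k => kernelModulus T Qg (k * τ)) N
      simp only [kernelOsc]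
      rw [this]
      linarith [hΓ (N + 1) le_rfl, hΓ N (by omega), hΓ0 1, hΓ0 0]
  have s2 := Finset.sum_range_sub (fun k : ℕ => kernelModulus T Qg (k * τ)) N
  have s3 := Finset.sum_range_sub (fun k : ℕ => betaInt a (k * τ)) N
  have s4 := sum_lamSeq_le ha hτ hN
  have s5 := betaInt_mono ha (by positivity) hN
  have s6 : 0 ≤ betaInt a (((0 : ℕ) : ℝ) * τ) := betaInt_nonneg ha (by positivity)
  simp only [truncWeight, Finset.sum_add_distrib]
  rw [s2, s3]
  linarith [hΓ N le_rfl, hΓ0 0]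

theorem sum_oscBound_le {a K T τ : ℝ} (ha : 0 < a) (hK : 0 ≤ K) (hτ : 0 < τ) {N : ℕ}
    (hN : N * τ ≤ T) :
    ∑ k ∈ Finset.range N, oscBound a K τ k ≤ 2 * K + 2 * (K * timeModulus a T) := by
  have hψ : ∀ k : ℕ, k ≤ N → timeModulus a (k * τ) ≤ timeModulus a T := fun k hk =>
    timeModulus_mono ha (by positivity)
      ((mul_le_mul_of_nonneg_right (by exact_mod_cast hk) hτ.le).trans hN)
  have s1 : ∑ k ∈ Finset.range N, (if k ≤ 1 then K else 0) ≤ 2 * K := by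
    rw [← Finset.sum_filter, Finset.sum_const, nsmul_eq_mul]
    refine mul_le_mul_of_nonneg_right ?_ hK
    have : ((Finset.range N).filter (fun k => k ≤ 1)).card ≤ (Finset.range 2).card :=
      Finset.card_le_card fun k hk => by
        simp only [Finset.mem_filter, Finset.mem_range] at hk ⊢; omega
    rw [Finset.card_range] at this
    exact_mod_cast this
  have s2 := sum_forward_two (fun k => timeModulus a (k * τ)) N
  simp only [oscBound, Finset.sum_add_distrib, ← Finset.mul_sum]
  rw [s2]
  have h1 := hψ N le_rfl
  have h2 := hψ (N - 1) (by omega)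
  have h3 : timeModulus a (((0 : ℕ) : ℝ) * τ) = 0 := by
    rw [Nat.cast_zero, zero_mul, timeModulus_zero ha]
  rw [h3]
  have := mul_le_mul_of_nonneg_left (add_le_add h1 h2) hK
  linarith

/-- The accumulated truncation error in time is of second order. -/
theorem sum_truncBound_le {a K Qg T τ : ℝ} (ha : 0 < a) (hK : 0 ≤ K) (hT : 0 ≤ T) (hQ : 0 ≤ Qg)
    (hτ : 0 < τ) {N : ℕ} (hN : N * τ ≤ T) :
    τ * ∑ n ∈ Finset.Icc 1 N, truncBound a K Qg T τ n
      ≤ (Qg + 3 * kernelModulus T Qg T + 2 * betaInt a T)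
        * (2 * K + 2 * (K * timeModulus a T)) * τ ^ 2 := by
  have h1 := sum_convolution_le (truncWeight_nonneg ha hT hQ hτ) (oscBound_nonneg ha hK hτ.le) N
  have h2 := mul_le_mul (sum_truncWeight_le ha hT hQ hτ hN) (sum_oscBound_le ha hK hτ hN)
    (Finset.sum_nonneg fun k _ => oscBound_nonneg ha hK hτ.le k)
    (by have := kernelModulus_nonneg hT hQ T; have := betaInt_nonneg ha hT; positivity)
  rw [sum_Icc_one_eq_range]
  simp only [truncBound, Nat.add_sub_cancel, ← Finset.mul_sum]
  have h3 := mul_le_mul_of_nonneg_left (h1.trans h2) (sq_nonneg τ)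
  linarith

/-- Consistency in time of the scheme at one node of the grid. -/
theorem node_truncation {T Qg a C K τ : ℝ} {α : ℝ → ℝ} (ha0 : 0 < a) (ha1 : a < 1) (hT : 0 < T)
    (hα : IsAdmissibleExponent T α) (h0 : α 0 = 1 + a) (hg : IsKernelBound T α Qg)
    {v v₁ v₂ F F₁ : ℝ → ℝ} (hK : 0 ≤ K) (hv : HasTimeModulus T a K v v₁)
    (hF : HasTimeModulus T a K F F₁) (hd : ∀ t ∈ Ioo 0 T, HasDerivAt v₁ (v₂ t) t)
    (hv₂ : ContinuousOn v₂ (Ioc 0 T)) (hb : ∀ t ∈ Ioc 0 T, |v₂ t| ≤ C * t ^ (a - 1))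
    (hE : ∀ t ∈ Ioc 0 T, ∫ s in (0 : ℝ)..t, abelKernel α (t - s) * v₂ s = F t)
    (hτ : 0 < τ) {n : ℕ} (hn1 : 1 ≤ n) (hn : (n : ℝ) * τ ≤ T) :
    |memOp τ (gfun α) (fun m => v (m * τ)) n - piOp a τ (fun m => F (m * τ)) n
        - (1 / τ) * ∫ t in ((n - 1 : ℕ) * τ)..(n * τ), gfun α t * v₁ 0|
      ≤ truncBound a K Qg T τ n := by
  obtain ⟨n, rfl⟩ : ∃ m, n = m + 1 := ⟨n - 1, by omega⟩
  have hker := hg.hasKernelModulus ha0 ha1 hT hα h0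
  have hn' : (n : ℝ) * τ ≤ T := le_trans (by push_cast; nlinarith) hn
  have m1 := memory_truncation ha0 hK hτ hker hv hn
  have m2 := product_integration_truncation ha0 hK hτ hF hn
  -- The integrated equation with the initial velocity separated. Over one time step the last
  -- integral has the increment τ b^n.
  have vol : ∀ t ∈ Icc 0 T, ∫ s in (0 : ℝ)..t, betaInt a (t - s) * F s
      = (∫ s in (0 : ℝ)..t, gfun α (t - s) * v₁ s) - ∫ s in (0 : ℝ)..t, gfun α s * v₁ 0 := by
    intro t ht
    have hgt : ContinuousOn (fun s => gfun α (t - s)) (uIcc 0 t) := by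
      rw [uIcc_of_le ht.1]
      exact hker.cont.comp (by fun_prop) fun s hs => ⟨by linarith [hs.2], by linarith [hs.1, ht.2]⟩
    have hvt : ContinuousOn v₁ (uIcc 0 t) := by
      rw [uIcc_of_le ht.1]
      exact hv.cont₁.mono (Icc_subset_Icc_right ht.2)
    rw [integrated_equation ha0 ha1 hT hα h0 hv.cont₁ hd hv₂ hb hE ht]
    have i1 : IntervalIntegrable (fun s => gfun α (t - s) * v₁ s) MeasureTheory.volume 0 t :=
      (hgt.mul hvt).intervalIntegrable
    have i2 : IntervalIntegrable (fun s => gfun α (t - s) * v₁ 0) MeasureTheory.volume 0 t :=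
      (hgt.mul continuousOn_const).intervalIntegrable
    simp only [mul_sub]
    rw [intervalIntegral.integral_sub i1 i2]
    congr 1
    have := intervalIntegral.integral_comp_sub_left (a := 0) (b := t)
      (fun s => gfun α s * v₁ 0) t
    rwa [sub_self, sub_zero] at this
  rw [vol _ ⟨by positivity, hn⟩, vol _ ⟨by positivity, hn'⟩] at m2
  have gint : ∀ x y : ℝ, x ∈ Icc 0 T → y ∈ Icc 0 T →
      IntervalIntegrable (fun s => gfun α s * v₁ 0) MeasureTheory.volume x y := by
    intro x y hx hy
    refine ContinuousOn.intervalIntegrable ?_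
    exact (hker.cont.mono (uIcc_subset_Icc hx hy)).mul continuousOn_const
  have hdiff := intervalIntegral.integral_interval_sub_left
    (gint 0 ((n + 1 : ℕ) * τ) ⟨le_rfl, hT.le⟩ ⟨by positivity, hn⟩)
    (gint 0 (n * τ) ⟨le_rfl, hT.le⟩ ⟨by positivity, hn'⟩)
  have e1 : memOp τ (gfun α) (fun m => v (m * τ)) (n + 1) = ∑ k ∈ Finset.range (n + 1),
      memWeight τ (gfun α) (n - k) * ((v ((k + 1 : ℕ) * τ) - v (k * τ)) / τ) := by
    rw [memOp, sum_Icc_one_eq_range]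
    exact Finset.sum_congr rfl fun k _ => by rw [Nat.add_sub_cancel, Nat.add_sub_add_right]
  have e2 : piOp a τ (fun m => F (m * τ)) (n + 1) = ∑ k ∈ Finset.range (n + 1),
      lamSeq a τ (n - k) * piValue τ F k := by
    rw [piOp, sum_Icc_one_eq_range]
    refine Finset.sum_congr rfl fun k _ => ?_
    rw [Nat.add_sub_add_right, piValue]
    congr 1
    rcases Nat.eq_zero_or_pos k with rfl | hk
    · rw [zero_add, midValue_one, if_pos rfl, Nat.cast_one, one_mul]
    · rw [midValue_real _ (by omega), if_neg hk.ne', Nat.add_sub_cancel]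
      ring
  rw [e1, e2, Nat.add_sub_cancel, ← hdiff]
  have key := (abs_sub _ _).trans (add_le_add m1 m2)
  rw [← mul_add, ← Finset.sum_add_distrib] at key
  have hb : τ * truncBound a K Qg T τ (n + 1) = τ ^ 2 * ∑ k ∈ Finset.range (n + 1),
      truncWeight a Qg T τ (n - k) * oscBound a K τ k := by
    rw [truncBound, Nat.add_sub_cancel]; ring
  refine le_of_mul_le_mul_left ?_ hτ
  rw [hb, ← abs_of_pos hτ, ← abs_mul, abs_of_pos hτ]
  convert key using 1
  · congr 1
    generalize (∫ t in (0 : ℝ)..((n + 1 : ℕ) * τ), gfun α t * v₁ 0) = I₁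
    generalize (∫ t in (0 : ℝ)..(n * τ), gfun α t * v₁ 0) = I₂
    generalize (∫ t in (0 : ℝ)..((n + 1 : ℕ) * τ), gfun α ((n + 1 : ℕ) * τ - t) * v₁ t) = I₃
    generalize (∫ t in (0 : ℝ)..(n * τ), gfun α (n * τ - t) * v₁ t) = I₄
    rw [mul_sub, ← mul_assoc, mul_one_div_cancel hτ.ne']
    ring
  · congr 1
    refine Finset.sum_congr rfl fun k _ => ?_
    rw [truncWeight]; ring

/-! ### Summation by parts of the memory operator -/

/-- Coefficients of the memory operator after summation by parts, for `i ≥ 1`. -/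
def memCoeff (τ : ℝ) (g : ℝ → ℝ) (i : ℕ) : ℝ :=
  backDiff (fun k => if k = 0 then 0 else memWeight τ g k) i / τ

/-- The lag-zero weight keeps the time difference, which carries the energy. In all other terms the
difference is moved onto the weights, leaving a perturbation in the values x k that Gronwall can
absorb. -/
theorem memOp_eq (τ : ℝ) (g : ℝ → ℝ) {x : ℕ → ℝ} (hx : x 0 = 0) {n : ℕ} (hn : 1 ≤ n) :
    memOp τ g x n = memWeight τ g 0 * ((x n - x (n - 1)) / τ)
      + ∑ k ∈ Finset.Icc 1 n, memCoeff τ g (n - k) * x k := by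
  set w : ℕ → ℝ := fun k => if k = 0 then 0 else memWeight τ g k with hw
  obtain ⟨n, rfl⟩ : ∃ m, n = m + 1 := ⟨n - 1, by omega⟩
  have e1 : memOp τ g x (n + 1) = memWeight τ g 0 * ((x (n + 1) - x n) / τ)
      + ∑ k ∈ Finset.range (n + 1), w (n - k) * ((x (k + 1) - x k) / τ) := by
    rw [memOp, sum_Icc_one_eq_range, Finset.sum_range_succ, Finset.sum_range_succ _ n, add_comm]
    have h0 : w (n - n) = 0 := by simp [hw]
    rw [h0, zero_mul, add_zero, Nat.sub_self, Nat.add_sub_cancel]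
    congr 1
    refine Finset.sum_congr rfl fun k hk => ?_
    rw [Finset.mem_range] at hk
    rw [Nat.add_sub_cancel, Nat.add_sub_add_right, hw]
    simp only
    rw [if_neg (by omega)]
  have e2 := sum_mul_backDiff x w (n + 1)
  rw [Finset.sum_range_succ' (fun k => x k * backDiff w (n + 1 - k)),
    Finset.sum_range_succ' (fun k => backDiff x k * w (n + 1 - k)), hx] at e2
  have hb : ∀ k, backDiff x (k + 1) = x (k + 1) - x k := fun _ => rfl
  have hb0 : backDiff x 0 = 0 := hx
  simp only [hb, hb0, zero_mul, add_zero, Nat.add_sub_add_right] at e2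
  rw [e1, Nat.add_sub_cancel, sum_Icc_one_eq_range]
  congr 1
  have e3 : ∑ k ∈ Finset.range (n + 1), memCoeff τ g (n + 1 - (k + 1)) * x (k + 1)
      = (∑ k ∈ Finset.range (n + 1), x (k + 1) * backDiff w (n - k)) / τ := by
    rw [Finset.sum_div]
    refine Finset.sum_congr rfl fun k _ => ?_
    rw [memCoeff, Nat.add_sub_add_right]; ring
  rw [e3, e2, Finset.sum_div]
  exact Finset.sum_congr rfl fun k _ => by ring

theorem HasKernelModulus.slope {T Qg τ : ℝ} {Γ g g' : ℝ → ℝ} (h : HasKernelModulus T Qg Γ g g')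
    (hτ : 0 < τ) {k : ℕ} (hk : ((k + 1 : ℕ) : ℝ) * τ ≤ T) :
    ∃ η ∈ Ioo ((k : ℝ) * τ) ((k + 1 : ℕ) * τ), g ((k + 1 : ℕ) * τ) - g (k * τ) = τ * g' η := by
  have h0 : 0 ≤ (k : ℝ) * τ := by positivity
  have hxy : (k : ℝ) * τ < (k + 1 : ℕ) * τ := by push_cast; nlinarith
  obtain ⟨η, hη, e⟩ := exists_hasDerivAt_eq_slope g g' hxy (h.cont.mono (Icc_subset_Icc h0 hk))
    (fun s hs => h.deriv s ⟨h0.trans_lt hs.1, hs.2.trans_le hk⟩)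
  refine ⟨η, hη, ?_⟩
  have : ((k + 1 : ℕ) : ℝ) * τ - k * τ = τ := by push_cast; ring
  rw [e, this]
  field_simp

/-- At lag 1 the coefficient is a mean of two values of g'. At lag i + 2 it is half the difference
of two values of g' within three cells, bounded by an increment of the modulus; these telescope to
three end values. -/
theorem sum_abs_memCoeff_le {T Qg τ : ℝ} {g g' : ℝ → ℝ} (hT : 0 ≤ T) (hQ : 0 ≤ Qg) (hτ : 0 < τ)
    (h : HasKernelModulus T Qg (kernelModulus T Qg) g g') {N : ℕ} (hN : N * τ ≤ T) :
    ∑ i ∈ Finset.range N, |memCoeff τ g i| ≤ Qg + 3 * kernelModulus T Qg T := by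
  have hle : ∀ k : ℕ, k ≤ N → (k : ℝ) * τ ≤ T := fun k hk =>
    (mul_le_mul_of_nonneg_right (by exact_mod_cast hk) hτ.le).trans hN
  have hΓ : ∀ k : ℕ, k ≤ N → kernelModulus T Qg (k * τ) ≤ kernelModulus T Qg T := fun k hk =>
    kernelModulus_mono hT hQ (hle k hk)
  have hΓ0 : ∀ k : ℕ, 0 ≤ kernelModulus T Qg (k * τ) := fun k => kernelModulus_nonneg hT hQ _
  have hΓT := kernelModulus_nonneg hT hQ T
  have c0 : memCoeff τ g 0 = 0 := by simp [memCoeff, backDiff]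
  have bd : ∀ k : ℕ, ∀ η ∈ Ioo ((k : ℝ) * τ) ((k + 1 : ℕ) * τ), k + 1 ≤ N → |g' η| ≤ Qg := by
    intro k η hη hk
    have : 0 ≤ (k : ℝ) * τ := by positivity
    exact h.bound η ⟨by linarith [hη.1], hη.2.trans_le (hle _ hk)⟩
  rcases N with _ | _ | N
  · simp; linarith
  · simp [c0]; linarith
  rw [Finset.sum_range_succ', c0, abs_zero, add_zero]
  have c1 : 2 ≤ N + 1 + 1 → |memCoeff τ g 1| ≤ Qg := by
    intro _
    obtain ⟨η, hη, e1⟩ := h.slope hτ (k := 0) (hle _ (by omega))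
    obtain ⟨ξ, hξ, e2⟩ := h.slope hτ (k := 1) (hle _ (by omega))
    have e : memCoeff τ g 1 = (g' η + g' ξ) / 2 := by
      simp only [memCoeff, backDiff, memWeight, if_true, sub_zero, zero_add, one_ne_zero, if_false]
      rw [div_eq_iff hτ.ne']
      norm_num at e1 e2 ⊢
      linarith
    rw [e, abs_div, abs_two]
    have := abs_add_le (g' η) (g' ξ)
    have := bd _ η hη (by omega)
    have := bd _ ξ hξ (by omega)
    linarith
  have c2 : ∀ i, i + 3 ≤ N + 1 + 1 → |memCoeff τ g (i + 2)|
      ≤ kernelModulus T Qg ((i + 3 : ℕ) * τ) - kernelModulus T Qg (i * τ) := by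
    intro i hi
    obtain ⟨η, hη, e1⟩ := h.slope hτ (k := i) (hle _ (by omega))
    obtain ⟨ξ, hξ, e2⟩ := h.slope hτ (k := i + 2) (hle _ (by omega))
    have e : memCoeff τ g (i + 2) = (g' ξ - g' η) / 2 := by
      simp only [memCoeff, backDiff, memWeight, Nat.add_eq_zero_iff, one_ne_zero, and_false,
        if_false]
      rw [div_eq_iff hτ.ne', show i + 1 + 1 + 1 = i + 2 + 1 by ring,
        show i + 1 + 1 = i + 2 by ring]
      linarith
    have m1 := mul_le_mul_of_nonneg_right
      (show ((i + 1 : ℕ) : ℝ) ≤ ((i + 3 : ℕ) : ℝ) by exact_mod_cast (by omega)) hτ.le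
    have m2 := mul_le_mul_of_nonneg_right
      (show ((i : ℕ) : ℝ) ≤ ((i + 2 : ℕ) : ℝ) by exact_mod_cast (by omega)) hτ.le
    have := h.osc (x := i * τ) (by positivity) (hle (i + 3) hi) (s := ξ) (r := η)
      ⟨m2.trans_lt hξ.1, hξ.2⟩ ⟨hη.1, hη.2.trans_le m1⟩
    rw [e, abs_div, abs_two]
    have := abs_nonneg (g' ξ - g' η)
    linarith
  rw [Finset.sum_range_succ']
  have s := Finset.sum_le_sum (s := Finset.range N)
    (f := fun i => |memCoeff τ g (i + 1 + 1)|)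
    fun i hi => c2 i (by rw [Finset.mem_range] at hi; omega)
  have s3 := sum_step_three (fun k => kernelModulus T Qg (k * τ)) N
  rw [s3] at s
  have := c1 (by omega)
  rw [zero_add]
  linarith [hΓ (N + 2) (by omega), hΓ (N + 1) (by omega), hΓ N (by omega), hΓ0 0, hΓ0 1, hΓ0 2]

/-- The leading coefficient of the memory operator stays away from zero for small time steps. -/
theorem half_le_memWeight_zero {T Qg τ : ℝ} {Γ : ℝ → ℝ} {α g' : ℝ → ℝ} (hτ : 0 < τ) (hτT : τ ≤ T)
    (h : HasKernelModulus T Qg Γ (gfun α) g') (hQτ : Qg * τ ≤ 1) :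
    1 / 2 ≤ memWeight τ (gfun α) 0 := by
  obtain ⟨η, hη, e⟩ := h.slope hτ (k := 0) (by simpa using hτT)
  have hb := h.bound η (by
    simp only [zero_add, Nat.cast_one, one_mul, Nat.cast_zero, zero_mul] at hη
    exact ⟨hη.1, hη.2.trans_le hτT⟩)
  simp only [zero_add, Nat.cast_one, one_mul, Nat.cast_zero, zero_mul, gfun_zero] at e
  rw [memWeight, gfun_zero]
  have h1 := (abs_le.1 hb).1
  have h2 := mul_le_mul_of_nonneg_left h1 hτ.le
  linarith

end TwoGrid

end

noncomputable section

namespace TwoGrid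

open Filter Topology

/-! ### One-variable calculus on closed intervals -/

theorem iteratedDerivWithin_eq_zero_of_eqOn {s : Set ℝ} {f : ℝ → ℝ} (h : ∀ x ∈ s, f x = 0) (n : ℕ)
    {x : ℝ} (hx : x ∈ s) : iteratedDerivWithin n f s x = 0 := by
  rw [iteratedDerivWithin_congr (g := fun _ => 0) h hx, iteratedDerivWithin_const, ite_self]

theorem hasDerivWithinAt_iteratedDerivWithin {l r : ℝ} (hlr : l < r) {φ : ℝ → ℝ} {n k : ℕ}
    (h : ContDiffOn ℝ n φ (Icc l r)) (hk : k < n) {x : ℝ} (hx : x ∈ Icc l r) :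
    HasDerivWithinAt (iteratedDerivWithin k φ (Icc l r))
      (iteratedDerivWithin (k + 1) φ (Icc l r) x) (Icc l r) x := by
  rw [iteratedDerivWithin_succ]
  exact (h.differentiableOn_iteratedDerivWithin (by exact_mod_cast hk) (uniqueDiffOn_Icc hlr) x
    hx).hasDerivWithinAt

theorem hasDerivAt_iteratedDerivWithin {T : ℝ} {v : ℝ → ℝ} {n k : ℕ}
    (h : ContDiffOn ℝ n v (Ioc 0 T)) (hk : k < n) {t : ℝ} (ht : t ∈ Ioo 0 T) :
    HasDerivAt (iteratedDerivWithin k v (Icc 0 T))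
      (iteratedDerivWithin (k + 1) v (Icc 0 T) t) t := by
  have hT : 0 < T := ht.1.trans ht.2
  have h1 : ContDiffWithinAt ℝ n v (Icc 0 T) t :=
    (h.contDiffAt (Ioc_mem_nhds ht.1 ht.2)).contDiffWithinAt
  have hm := Ioo_subset_Icc_self ht
  have h2 := h1.differentiableWithinAt_iteratedDerivWithin (m := k) (by exact_mod_cast hk)
    (by rw [insert_eq_of_mem hm]; exact uniqueDiffOn_Icc hT)
  rw [iteratedDerivWithin_succ]
  exact h2.hasDerivWithinAt.hasDerivAt (Icc_mem_nhds ht.1 ht.2)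

theorem abs_le_of_continuousOn {T K : ℝ} (hT : 0 < T) {v : ℝ → ℝ} (hc : ContinuousOn v (Icc 0 T))
    (h : ∀ t ∈ Ioc 0 T, |v t| ≤ K) : ∀ t ∈ Icc 0 T, |v t| ≤ K := by
  intro t ht
  rcases ht.1.eq_or_lt with rfl | h0
  · have h1 : Tendsto (fun s => |v s|) (𝓝[Ioc 0 T] 0) (𝓝 |v 0|) :=
      ((hc 0 ht).mono Ioc_subset_Icc_self).abs
    have : (𝓝[Ioc 0 T] (0 : ℝ)).NeBot := by
      rw [nhdsWithin_Ioc_eq_nhdsGT hT]; infer_instance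
    exact le_of_tendsto h1 (eventually_mem_nhdsWithin.mono h)
  · exact h t ⟨h0, ht.2⟩

/-- C t^(a-1) is the derivative of (C/a) t^a, so (C/a) t^a ± v' is nondecreasing on [0, T], although
v'' is only controlled for t > 0. -/
theorem hasTimeModulus_of_bounds {T a C : ℝ} (ha : 0 < a) (hT : 0 < T) (hC : 0 ≤ C) {v : ℝ → ℝ}
    (h1 : ContDiffOn ℝ 1 v (Icc 0 T)) (h2 : ContDiffOn ℝ 2 v (Ioc 0 T))
    (b1 : ∀ t ∈ Ioc 0 T, |iteratedDerivWithin 1 v (Icc 0 T) t| ≤ C * (1 + t ^ a))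
    (b2 : ∀ t ∈ Ioc 0 T, |iteratedDerivWithin 2 v (Icc 0 T) t| ≤ C * t ^ (a - 1)) :
    HasTimeModulus T a (C * (1 + T ^ a) + C / a) v (iteratedDerivWithin 1 v (Icc 0 T)) := by
  have hCa : 0 ≤ C / a := by positivity
  have hc1 : ContinuousOn (iteratedDerivWithin 1 v (Icc 0 T)) (Icc 0 T) :=
    h1.continuousOn_iteratedDerivWithin le_rfl (uniqueDiffOn_Icc hT)
  have hd : ∀ t ∈ Ioo 0 T, HasDerivAt (iteratedDerivWithin 1 v (Icc 0 T))
      (iteratedDerivWithin 2 v (Icc 0 T) t) t := fun t ht =>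
    hasDerivAt_iteratedDerivWithin (n := 2) h2 (by norm_num) ht
  refine ⟨h1.continuousOn, fun t ht => ?_, hc1, ?_, ?_⟩
  · have := hasDerivAt_iteratedDerivWithin (n := 2) (k := 0) h2 (by norm_num) ht
    rwa [iteratedDerivWithin_zero] at this
  · refine abs_le_of_continuousOn hT hc1 fun t ht => (b1 t ht).trans ?_
    have := Real.rpow_le_rpow ht.1.le ht.2 ha.le
    have := mul_le_mul_of_nonneg_left (add_le_add_right this 1) hC
    linarith
  · have key : ∀ c : ℝ, |c| = 1 → MonotoneOn
        (fun s => C / a * s ^ a + c * iteratedDerivWithin 1 v (Icc 0 T) s) (Icc 0 T) := by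
      intro c hc
      have hds : ∀ s ∈ Ioo 0 T, HasDerivAt
          (fun s => C / a * s ^ a + c * iteratedDerivWithin 1 v (Icc 0 T) s)
          (C / a * (a * s ^ (a - 1)) + c * iteratedDerivWithin 2 v (Icc 0 T) s) s := fun s hs =>
        ((Real.hasDerivAt_rpow_const (Or.inl hs.1.ne')).const_mul _).add ((hd s hs).const_mul c)
      refine monotoneOn_of_deriv_nonneg (convex_Icc 0 T) ?_ ?_ ?_
      · exact (continuousOn_const.mul (continuousOn_id.rpow_const fun _ _ => Or.inr ha.le)).add
          (continuousOn_const.mul hc1)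
      · intro s hs
        rw [interior_Icc] at hs
        exact (hds s hs).differentiableAt.differentiableWithinAt
      · intro s hs
        rw [interior_Icc] at hs
        rw [(hds s hs).deriv]
        have e1 := b2 s (Ioo_subset_Ioc_self hs)
        have e2 : |c * iteratedDerivWithin 2 v (Icc 0 T) s|
            = |iteratedDerivWithin 2 v (Icc 0 T) s| := by rw [abs_mul, hc, one_mul]
        have e3 := neg_abs_le (c * iteratedDerivWithin 2 v (Icc 0 T) s)
        have e4 : C / a * (a * s ^ (a - 1)) = C * s ^ (a - 1) := by field_simp
        linarith
    intro x y hx hxy hy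
    have hxm : x ∈ Icc 0 T := ⟨hx, hxy.trans hy⟩
    have hym : y ∈ Icc 0 T := ⟨hx.trans hxy, hy⟩
    have k1 := key 1 (by simp) hxm hym hxy
    have k2 := key (-1) (by simp) hxm hym hxy
    simp only at k1 k2
    have hxa := Real.rpow_le_rpow hx hxy ha.le
    have hT1 : 0 ≤ C * (1 + T ^ a) := by positivity
    have e1 : C / a * (y ^ a - x ^ a) ≤ (C * (1 + T ^ a) + C / a)
        * (timeModulus a y - timeModulus a x) := by
      refine mul_le_mul (by linarith) ?_ (by linarith) (by linarith)
      rw [timeModulus, timeModulus]; linarith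
    refine le_trans ?_ e1
    rw [abs_le]
    constructor <;> linarith

theorem HasTimeModulus.mono {T a K K' : ℝ} (ha : 0 < a) {v v₁ : ℝ → ℝ}
    (h : HasTimeModulus T a K v v₁) (hK : K ≤ K') : HasTimeModulus T a K' v v₁ :=
  ⟨h.cont, h.deriv, h.cont₁, fun t ht => (h.bound t ht).trans hK, fun x y hx hxy hy =>
    (h.modulus x y hx hxy hy).trans (mul_le_mul_of_nonneg_right hK
      (sub_nonneg.2 (timeModulus_mono ha hx hxy)))⟩

theorem HasTimeModulus.add {T a K L : ℝ} {v v₁ w w₁ : ℝ → ℝ} (hv : HasTimeModulus T a K v v₁)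
    (hw : HasTimeModulus T a L w w₁) :
    HasTimeModulus T a (K + L) (fun t => v t + w t) (fun t => v₁ t + w₁ t) :=
  ⟨hv.cont.add hw.cont, fun t ht => (hv.deriv t ht).add (hw.deriv t ht), hv.cont₁.add hw.cont₁,
    fun t ht => (abs_add_le _ _).trans (add_le_add (hv.bound t ht) (hw.bound t ht)),
    fun x y hx hxy hy => by
      have h1 := hv.modulus x y hx hxy hy
      have h2 := hw.modulus x y hx hxy hy
      have h3 := abs_add_le (v₁ y - v₁ x) (w₁ y - w₁ x)
      rw [show v₁ y + w₁ y - (v₁ x + w₁ x) = v₁ y - v₁ x + (w₁ y - w₁ x) by ring, add_mul]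
      linarith⟩

/-- In f'(v) v' the increment of f'(v) is at most Qf2 K (y - x). The linear term in the modulus x +
x^a is there to dominate it. -/
theorem hasTimeModulus_comp {T a K C Qf Qf2 : ℝ} (ha : 0 < a) (hK : 0 ≤ K) (hQf2 : 0 ≤ Qf2)
    {f v v₁ : ℝ → ℝ} (hv : HasTimeModulus T a K v v₁) (hf : ContDiff ℝ 2 f)
    (hb : ∀ t ∈ Icc 0 T, |v t| ≤ C) (h1 : ∀ x, |deriv f x| ≤ Qf)
    (h2 : ∀ x, |x| ≤ C → |deriv (deriv f) x| ≤ Qf2) :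
    HasTimeModulus T a (Qf * K + Qf2 * K * K) (fun t => f (v t))
      (fun t => deriv f (v t) * v₁ t) := by
  have hQf : 0 ≤ Qf := (abs_nonneg _).trans (h1 0)
  have hf' : ContDiff ℝ 1 (deriv f) :=
    (contDiff_succ_iff_deriv.1 (show ContDiff ℝ (1 + 1) f by rwa [one_add_one_eq_two])).2.2
  have hfd : Differentiable ℝ f := hf.differentiable two_ne_zero
  refine ⟨hfd.continuous.comp_continuousOn hv.cont, fun t ht =>
    (hfd _).hasDerivAt.comp t (hv.deriv t ht),
    (hf'.continuous.comp_continuousOn hv.cont).mul hv.cont₁, fun t ht => ?_,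
    fun x y hx hxy hy => ?_⟩
  · rw [abs_mul]
    have := mul_le_mul (h1 (v t)) (hv.bound t ht) (abs_nonneg _) hQf
    have : 0 ≤ Qf2 * K * K := by positivity
    linarith
  · have hxm : x ∈ Icc 0 T := ⟨hx, hxy.trans hy⟩
    have hym : y ∈ Icc 0 T := ⟨hx.trans hxy, hy⟩
    have lip : |deriv f (v y) - deriv f (v x)| ≤ Qf2 * |v y - v x| := by
      have := (convex_Icc (-C) C).norm_image_sub_le_of_norm_deriv_le (f := deriv f) (C := Qf2)
        (fun z _ => hf'.differentiable one_ne_zero z)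
        (fun z hz => h2 z (abs_le.2 hz)) (abs_le.1 (hb x hxm)) (abs_le.1 (hb y hym))
      simpa using this
    have lipv : |v y - v x| ≤ K * (y - x) := by
      rcases hxy.eq_or_lt with rfl | hlt
      · simp
      obtain ⟨ξ, hξ, e⟩ := exists_hasDerivAt_eq_slope v v₁ hlt
        (hv.cont.mono (Icc_subset_Icc hx hy))
        (fun s hs => hv.deriv s ⟨hx.trans_lt hs.1, hs.2.trans_le hy⟩)
      have e2 : v y - v x = v₁ ξ * (y - x) := by
        rw [e]; field_simp [(sub_pos.2 hlt).ne']
      rw [e2, abs_mul, abs_of_pos (sub_pos.2 hlt)]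
      exact mul_le_mul_of_nonneg_right (hv.bound ξ ⟨hx.trans hξ.1.le, hξ.2.le.trans hy⟩)
        (by linarith)
    have hψ : y - x ≤ timeModulus a y - timeModulus a x := by
      have := Real.rpow_le_rpow hx hxy ha.le
      rw [timeModulus, timeModulus]; linarith
    have e : deriv f (v y) * v₁ y - deriv f (v x) * v₁ x
        = deriv f (v y) * (v₁ y - v₁ x) + (deriv f (v y) - deriv f (v x)) * v₁ x := by ring
    rw [e]
    refine (abs_add_le _ _).trans ?_
    rw [abs_mul, abs_mul]
    have t1 := mul_le_mul (h1 (v y)) (hv.modulus x y hx hxy hy) (abs_nonneg _) hQf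
    have t2 : |deriv f (v y) - deriv f (v x)|
        ≤ Qf2 * (K * (timeModulus a y - timeModulus a x)) :=
      lip.trans (mul_le_mul_of_nonneg_left
        (lipv.trans (mul_le_mul_of_nonneg_left hψ hK)) hQf2)
    have t3 := mul_le_mul t2 (hv.bound x hxm) (abs_nonneg _) ((abs_nonneg _).trans t2)
    linarith

/-! ### The equation on the closed rectangle -/

theorem abs_abelKernel_le {T a : ℝ} {α : ℝ → ℝ} (ha0 : 0 < a) (hT : 0 < T)
    (hα : IsAdmissibleExponent T α) (h0 : α 0 = 1 + a) :
    ∃ K, 0 ≤ K ∧ ∀ s ∈ Icc 0 T, |abelKernel α s| ≤ K * s ^ (-a) := by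
  obtain ⟨K, hK0, hK, -⟩ := regularPart_bounds hα hT
  refine ⟨K, hK0, fun s hs => ?_⟩
  rcases hs.1.eq_or_lt with rfl | hlt
  · rw [abelKernel, h0, Real.zero_rpow (by linarith), zero_div, abs_zero]
    exact mul_nonneg hK0 (Real.rpow_nonneg le_rfl _)
  · rw [abelKernel_eq α hlt, h0, abs_mul, abs_of_nonneg (Real.rpow_nonneg hs.1 _), mul_comm,
      show 1 - (1 + a) = -a by ring]
    exact mul_le_mul_of_nonneg_right (hK s hs) (Real.rpow_nonneg hs.1 _)

/-- An integrable majorant for a product of two endpoint singularities: on either side of t/2 one of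
the factors is bounded by its value there. -/
theorem rpow_mul_rpow_le {a t s : ℝ} (ha0 : 0 < a) (ha1 : a < 1) (ht : 0 < t) (hs0 : 0 < s)
    (hst : s ≤ t) :
    (t - s) ^ (-a) * s ^ (a - 1)
      ≤ (t / 2) ^ (a - 1) * (t - s) ^ (-a) + (t / 2) ^ (-a) * s ^ (a - 1) := by
  have p1 : 0 ≤ (t - s) ^ (-a) := Real.rpow_nonneg (by linarith) _
  have p2 : 0 ≤ s ^ (a - 1) := Real.rpow_nonneg hs0.le _
  have p3 : 0 ≤ (t / 2) ^ (-a) := Real.rpow_nonneg (by linarith) _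
  have p4 : 0 ≤ (t / 2) ^ (a - 1) := Real.rpow_nonneg (by linarith) _
  rcases le_total s (t / 2) with h | h
  · have := Real.rpow_le_rpow_of_nonpos (z := -a) (by linarith) (show t / 2 ≤ t - s by linarith)
      (by linarith)
    nlinarith
  · have := Real.rpow_le_rpow_of_nonpos (z := a - 1) (by linarith) h (by linarith)
    nlinarith

theorem mem_closure_Omega (D : Cylinder) {p : ℝ × ℝ} (hp : p ∈ D.OmegaBar) :
    p ∈ closure D.Omega := by
  rw [Cylinder.Omega, closure_prod_eq, closure_Ioo D.hx.ne, closure_Ioo D.hy.ne]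
  exact hp

theorem Omega_subset (D : Cylinder) : D.Omega ⊆ D.OmegaBar :=
  prod_mono Ioo_subset_Icc_self Ioo_subset_Icc_self

theorem JointlyContinuous.at_time {D : Cylinder} {I : Set ℝ} {v : ℝ → ℝ → ℝ → ℝ}
    (h : JointlyContinuous D I v) {t : ℝ} (ht : t ∈ I) {p : ℝ × ℝ} (hp : p ∈ D.OmegaBar) :
    Tendsto (fun q : ℝ × ℝ => v q.1 q.2 t) (𝓝[D.Omega] p) (𝓝 (v p.1 p.2 t)) := by
  have h1 : ContinuousOn (fun q : ℝ × ℝ => v q.1 q.2 t) D.OmegaBar :=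
    ContinuousOn.comp (g := fun p : (ℝ × ℝ) × ℝ => v p.1.1 p.1.2 p.2) (f := fun q => (q, t)) h
      (by fun_prop) fun q hq => ⟨hq, ht⟩
  exact (h1 p hp).mono (Omega_subset D)

theorem JointlyContinuous.at_point {D : Cylinder} {I : Set ℝ} {v : ℝ → ℝ → ℝ → ℝ}
    (h : JointlyContinuous D I v) {x y : ℝ} (hp : (x, y) ∈ D.OmegaBar) :
    ContinuousOn (fun t => v x y t) I :=
  ContinuousOn.comp (g := fun p : (ℝ × ℝ) × ℝ => v p.1.1 p.1.2 p.2) (f := fun t => ((x, y), t)) h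
      (by fun_prop) fun _ ht => ⟨hp, ht⟩

/-- The differential equation extends by continuity to the closed rectangle. -/
theorem pde_closed {D : Cylinder} {a C : ℝ} {α f : ℝ → ℝ} {u₀ v₀ : ℝ → ℝ → ℝ}
    {u : ℝ → ℝ → ℝ → ℝ} (ha0 : 0 < a) (ha1 : a < 1) (hα : IsAdmissibleExponent D.T α)
    (h0 : α 0 = 1 + a) (hf : Continuous f) (hsol : IsSolution D α f u₀ v₀ u)
    (hreg : IsRegular D (α 0) C u) {x y t : ℝ} (hp : (x, y) ∈ D.OmegaBar) (ht : t ∈ Ioc 0 D.T) :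
    ∫ s in (0 : ℝ)..t, abelKernel α (t - s) * pdt D 2 u x y s
      = pdx D 2 u x y t + pdy D 2 u x y t + f (u x y t) := by
  have htc : t ∈ Icc 0 D.T := Ioc_subset_Icc_self ht
  have hsub : Ioc 0 t ⊆ Ioc 0 D.T := Ioc_subset_Ioc_right ht.2
  obtain ⟨K, hK0, hK⟩ := abs_abelKernel_le ha0 D.hT hα h0
  have : (𝓝[D.Omega] ((x, y) : ℝ × ℝ)).NeBot := mem_closure_iff_nhdsWithin_neBot.1 (mem_closure_Omega D hp)
  have rhs : Tendsto (fun q : ℝ × ℝ => pdx D 2 u q.1 q.2 t + pdy D 2 u q.1 q.2 t + f (u q.1 q.2 t))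
      (𝓝[D.Omega] (x, y)) (𝓝 (pdx D 2 u x y t + pdy D 2 u x y t + f (u x y t))) :=
    ((hreg.cont_xx.at_time htc hp).add (hreg.cont_yy.at_time htc hp)).add
      ((hf.tendsto _).comp (hreg.cont.at_time htc hp))
  have measK : MeasureTheory.AEStronglyMeasurable (fun s => abelKernel α (t - s))
      (MeasureTheory.volume.restrict (uIoc 0 t)) := by
    have h1 := (abelKernel_integrableOn ha1 D.hT hα h0).mono_set hsub
    have h2 := ((intervalIntegrable_iff_integrableOn_Ioc_of_le ht.1.le).2 h1).comp_sub_left t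
    rw [sub_self, sub_zero] at h2
    exact (intervalIntegrable_iff.1 h2.symm).aestronglyMeasurable
  have lhs : Tendsto (fun q : ℝ × ℝ => ∫ s in (0 : ℝ)..t, abelKernel α (t - s) * pdt D 2 u q.1 q.2 s)
      (𝓝[D.Omega] (x, y)) (𝓝 (∫ s in (0 : ℝ)..t, abelKernel α (t - s) * pdt D 2 u x y s)) := by
    -- The dominating function does not depend on the point of the rectangle, since the constants K
    -- and C are uniform there.
    refine intervalIntegral.tendsto_integral_filter_of_dominated_convergence
      (fun s => K * C * ((t / 2) ^ (a - 1) * (t - s) ^ (-a) + (t / 2) ^ (-a) * s ^ (a - 1)))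
      ?_ ?_ ?_ ?_
    · filter_upwards [self_mem_nhdsWithin] with q hq
      refine measK.mul ?_
      rw [uIoc_of_le ht.1.le]
      exact ((hreg.cont_tt.at_point (Omega_subset D hq)).mono hsub).aestronglyMeasurable
        measurableSet_Ioc
    · filter_upwards [self_mem_nhdsWithin] with q hq
      refine Eventually.of_forall fun s hs => ?_
      rw [uIoc_of_le ht.1.le] at hs
      have b := (hreg.bound q.1 q.2 s (Omega_subset D hq) (hsub hs)).2.2.2.2.2.2.2.2.1
      rw [h0, show 1 + a - 2 = a - 1 by ring] at b
      have k := hK (t - s) ⟨by linarith [hs.2], by linarith [hs.1, ht.2]⟩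
      have hC0 : 0 ≤ C :=
        (abs_nonneg _).trans (hreg.bound q.1 q.2 s (Omega_subset D hq) (hsub hs)).1
      rw [Real.norm_eq_abs, abs_mul]
      refine (mul_le_mul k b (abs_nonneg _) ((abs_nonneg _).trans k)).trans ?_
      have := mul_le_mul_of_nonneg_left (rpow_mul_rpow_le ha0 ha1 ht.1 hs.1 hs.2)
        (mul_nonneg hK0 hC0)
      linarith
    · have i1 : IntervalIntegrable (fun s : ℝ => (t - s) ^ (-a)) MeasureTheory.volume 0 t := by
        have := (intervalIntegral.intervalIntegrable_rpow' (a := 0) (b := t)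
          (show -1 < -a by linarith)).comp_sub_left t
        rw [sub_self, sub_zero] at this
        exact this.symm
      have i2 : IntervalIntegrable (fun s : ℝ => s ^ (a - 1)) MeasureTheory.volume 0 t :=
        intervalIntegral.intervalIntegrable_rpow' (by linarith)
      exact ((i1.const_mul _).add (i2.const_mul _)).const_mul _
    · refine Eventually.of_forall fun s hs => ?_
      rw [uIoc_of_le ht.1.le] at hs
      exact (hreg.cont_tt.at_time (hsub hs) hp).const_mul _
  refine tendsto_nhds_unique lhs (rhs.congr' ?_)
  filter_upwards [self_mem_nhdsWithin] with q hq
  have := hsol.pde q.1 q.2 t hq ht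
  linarith

theorem mem_boundary_x (D : Cylinder) {x y : ℝ} (hx : x = D.lx ∨ x = D.rx)
    (hy : y ∈ Icc D.ly D.ry) : (x, y) ∈ D.OmegaBar \ D.Omega := by
  have := D.hx
  refine ⟨⟨?_, hy⟩, fun h => ?_⟩
  · rcases hx with rfl | rfl
    · exact ⟨le_rfl, this.le⟩
    · exact ⟨this.le, le_rfl⟩
  · rcases hx with rfl | rfl
    · exact lt_irrefl _ h.1.1
    · exact lt_irrefl _ h.1.2

theorem mem_boundary_y (D : Cylinder) {x y : ℝ} (hx : x ∈ Icc D.lx D.rx)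
    (hy : y = D.ly ∨ y = D.ry) : (x, y) ∈ D.OmegaBar \ D.Omega := by
  have := D.hy
  refine ⟨⟨hx, ?_⟩, fun h => ?_⟩
  · rcases hy with rfl | rfl
    · exact ⟨le_rfl, this.le⟩
    · exact ⟨this.le, le_rfl⟩
  · rcases hy with rfl | rfl
    · exact lt_irrefl _ h.2.1
    · exact lt_irrefl _ h.2.2

/-- Compatibility conditions on the boundary implied by the regularity of the solution. -/
theorem boundary_compatibility {D : Cylinder} {a C : ℝ} {α f : ℝ → ℝ} {u₀ v₀ : ℝ → ℝ → ℝ}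
    {u : ℝ → ℝ → ℝ → ℝ} (ha0 : 0 < a) (ha1 : a < 1) (hα : IsAdmissibleExponent D.T α)
    (h0 : α 0 = 1 + a) (hf : Continuous f) (hsol : IsSolution D α f u₀ v₀ u)
    (hreg : IsRegular D (α 0) C u) :
    f 0 = 0 ∧
    (∀ x y t, x = D.lx ∨ x = D.rx → y ∈ Icc D.ly D.ry → t ∈ Ioc 0 D.T → pdx D 2 u x y t = 0) ∧
    (∀ x y t, x ∈ Icc D.lx D.rx → y = D.ly ∨ y = D.ry → t ∈ Ioc 0 D.T → pdy D 2 u x y t = 0) := by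
  -- On the boundary u vanishes at all times, hence so do its time derivatives and the memory
  -- integral.
  have bd : ∀ x y t, (x, y) ∈ D.OmegaBar \ D.Omega → t ∈ Ioc 0 D.T →
      pdx D 2 u x y t + pdy D 2 u x y t + f 0 = 0 := by
    intro x y t hp ht
    have := pde_closed ha0 ha1 hα h0 hf hsol hreg hp.1 ht
    rw [hsol.boundary x y t hp (Ioc_subset_Icc_self ht)] at this
    rw [← this]
    have z : ∀ s ∈ uIcc 0 t, abelKernel α (t - s) * pdt D 2 u x y s = 0 := by
      intro s hs
      rw [uIcc_of_le ht.1.le] at hs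
      rw [pdt, iteratedDerivWithin_eq_zero_of_eqOn (fun r hr => hsol.boundary x y r hp hr) 2
        ⟨hs.1, hs.2.trans ht.2⟩, mul_zero]
    rw [intervalIntegral.integral_congr (g := fun _ => 0) z]
    simp
  have tx : ∀ x y t, x ∈ Icc D.lx D.rx → y = D.ly ∨ y = D.ry → t ∈ Ioc 0 D.T →
      pdx D 2 u x y t = 0 := fun x y t hx hy ht =>
    iteratedDerivWithin_eq_zero_of_eqOn
      (fun ξ hξ => hsol.boundary ξ y t (mem_boundary_y D hξ hy) (Ioc_subset_Icc_self ht)) 2 hx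
  have ty : ∀ x y t, x = D.lx ∨ x = D.rx → y ∈ Icc D.ly D.ry → t ∈ Ioc 0 D.T →
      pdy D 2 u x y t = 0 := fun x y t hx hy ht =>
    iteratedDerivWithin_eq_zero_of_eqOn
      (fun η hη => hsol.boundary x η t (mem_boundary_x D hx hη) (Ioc_subset_Icc_self ht)) 2 hy
  have hlx : D.lx ∈ Icc D.lx D.rx := ⟨le_rfl, D.hx.le⟩
  have hly : D.ly ∈ Icc D.ly D.ry := ⟨le_rfl, D.hy.le⟩
  have hTm : D.T ∈ Ioc 0 D.T := ⟨D.hT, le_rfl⟩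
  -- At a corner both second derivatives are tangential to an edge on which u = 0, so the equation
  -- reduces to f(0) = 0.
  have f0 : f 0 = 0 := by
    have := bd D.lx D.ly D.T (mem_boundary_x D (Or.inl rfl) hly) hTm
    rwa [tx _ _ _ hlx (Or.inl rfl) hTm, ty _ _ _ (Or.inl rfl) hly hTm, zero_add, zero_add] at this
  refine ⟨f0, fun x y t hx hy ht => ?_, fun x y t hx hy ht => ?_⟩
  · have := bd x y t (mem_boundary_x D hx hy) ht
    rwa [ty x y t hx hy ht, f0, add_zero, add_zero] at this
  · have := bd x y t (mem_boundary_y D hx hy) ht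
    rwa [tx x y t hx hy ht, f0, zero_add, add_zero] at this

/-! ### Consistency in time at the nodes of a grid -/

/-- The bound for the first time derivatives. -/
def timeConst (a C T : ℝ) : ℝ := C * (1 + T ^ a) + C / a

/-- The bound for the time derivative of `Δu + f(u)`. -/
def sourceConst (a C T Qf Qf2 : ℝ) : ℝ :=
  timeConst a C T + timeConst a C T
    + (Qf * timeConst a C T + Qf2 * timeConst a C T * timeConst a C T)

theorem timeConst_nonneg {a C T : ℝ} (ha : 0 < a) (hC : 0 ≤ C) (hT : 0 ≤ T) :
    0 ≤ timeConst a C T := by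
  have := Real.rpow_nonneg hT a
  rw [timeConst]; positivity

theorem sourceConst_nonneg {a C T Qf Qf2 : ℝ} (ha : 0 < a) (hC : 0 ≤ C) (hT : 0 ≤ T)
    (hQf : 0 ≤ Qf) (hQf2 : 0 ≤ Qf2) : 0 ≤ sourceConst a C T Qf Qf2 := by
  have := timeConst_nonneg ha hC hT
  rw [sourceConst]; positivity

theorem IsRegular.nonneg {D : Cylinder} {α₀ C : ℝ} {u : ℝ → ℝ → ℝ → ℝ}
    (h : IsRegular D α₀ C u) : 0 ≤ C :=
  (abs_nonneg _).trans (h.bound D.lx D.ly D.T ⟨⟨le_rfl, D.hx.le⟩, le_rfl, D.hy.le⟩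
    ⟨D.hT, le_rfl⟩).1

theorem pointwise_consistency {D : Cylinder} {a C Qg Qf Qf2 : ℝ} {α f : ℝ → ℝ}
    {u₀ v₀ : ℝ → ℝ → ℝ} {u : ℝ → ℝ → ℝ → ℝ} (ha0 : 0 < a) (ha1 : a < 1)
    (hα : IsAdmissibleExponent D.T α) (h0 : α 0 = 1 + a) (hg : IsKernelBound D.T α Qg)
    (hf : ContDiff ℝ 2 f) (hf1 : ∀ v, |deriv f v| ≤ Qf)
    (hf2 : ∀ v, |v| ≤ C → |deriv (deriv f) v| ≤ Qf2) (hsol : IsSolution D α f u₀ v₀ u)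
    (hreg : IsRegular D (α 0) C u) {τ : ℝ} (hτ : 0 < τ) {n : ℕ} (hn1 : 1 ≤ n)
    (hn : (n : ℝ) * τ ≤ D.T) {x y : ℝ} (hp : (x, y) ∈ D.OmegaBar) :
    |memOp τ (gfun α) (fun m => u x y (m * τ)) n
        - piOp a τ (fun m => pdx D 2 u x y (m * τ) + pdy D 2 u x y (m * τ) + f (u x y (m * τ))) n
        - (1 / τ) * ∫ t in ((n - 1 : ℕ) * τ)..(n * τ), gfun α t * v₀ x y|
      ≤ truncBound a (sourceConst a C D.T Qf Qf2) Qg D.T τ n := by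
  have hC := hreg.nonneg
  have hQf : 0 ≤ Qf := (abs_nonneg _).trans (hf1 0)
  have hQf2 : 0 ≤ Qf2 := (abs_nonneg _).trans (hf2 0 (by simpa using hC))
  have hK := timeConst_nonneg ha0 hC D.hT.le
  have e1 : α 0 - 1 = a := by rw [h0]; ring
  have e2 : α 0 - 2 = a - 1 := by rw [h0]; ring
  have B : ∀ t ∈ Ioc 0 D.T, _ := fun t ht => hreg.bound x y t hp ht
  simp only [e1, e2] at B
  have hc := hreg.cont.at_point hp
  have mu : HasTimeModulus D.T a (timeConst a C D.T) (fun t => u x y t) (fun t => pdt D 1 u x y t) :=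
    hasTimeModulus_of_bounds ha0 D.hT hC (hreg.diff_t x y hp).1
      ((hreg.diff_t x y hp).2.of_le (by norm_num)) (fun t ht => (B t ht).2.2.2.2.2.1)
      (fun t ht => (B t ht).2.2.2.2.2.2.2.2.1)
  have mxx : HasTimeModulus D.T a (timeConst a C D.T) (fun t => pdx D 2 u x y t)
      (fun t => pdt D 1 (pdx D 2 u) x y t) :=
    hasTimeModulus_of_bounds ha0 D.hT hC (hreg.diff_t_xx x y hp).1
      (hreg.diff_t_xx x y hp).2 (fun t ht => (B t ht).2.2.2.2.2.2.1)
      (fun t ht => (B t ht).2.2.2.2.2.2.2.2.2.2.1)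
  have myy : HasTimeModulus D.T a (timeConst a C D.T) (fun t => pdy D 2 u x y t)
      (fun t => pdt D 1 (pdy D 2 u) x y t) :=
    hasTimeModulus_of_bounds ha0 D.hT hC (hreg.diff_t_yy x y hp).1
      (hreg.diff_t_yy x y hp).2 (fun t ht => (B t ht).2.2.2.2.2.2.2.1)
      (fun t ht => (B t ht).2.2.2.2.2.2.2.2.2.2.2)
  have mf := hasTimeModulus_comp ha0 hK hQf2 mu hf (abs_le_of_continuousOn D.hT hc fun t ht => (B t ht).1) hf1 hf2
  have hle : timeConst a C D.T ≤ sourceConst a C D.T Qf Qf2 := by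
    have : 0 ≤ Qf * timeConst a C D.T + Qf2 * timeConst a C D.T * timeConst a C D.T := by
      positivity
    rw [sourceConst]; linarith
  have hd : ∀ t ∈ Ioo 0 D.T, HasDerivAt (fun t => pdt D 1 u x y t) (pdt D 2 u x y t) t :=
    fun t ht => hasDerivAt_iteratedDerivWithin (n := 3) (hreg.diff_t x y hp).2 (by norm_num) ht
  have key := node_truncation ha0 ha1 D.hT hα h0 hg
    (sourceConst_nonneg ha0 hC D.hT.le hQf hQf2) (mu.mono ha0 hle) ((mxx.add myy).add mf)
    hd (hreg.cont_tt.at_point hp) (fun t ht => (B t ht).2.2.2.2.2.2.2.2.1)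
    (fun t ht => pde_closed ha0 ha1 hα h0 hf.continuous hsol hreg hp ht) hτ hn1 hn
  rw [hsol.init_deriv x y hp] at key
  exact key

end TwoGrid

end

noncomputable section

namespace TwoGrid

/-! ### Linearity of the discrete operators -/

/-- Compact averaging at a node as a linear functional. -/
def avgAt (Mx My i j : ℕ) : (ℕ → ℕ → ℝ) →ₗ[ℝ] ℝ where
  toFun v := avg Mx My v i j
  map_add' v w := by
    simp only [avg, avgX, avgY, Pi.add_apply]
    split_ifs <;> ring
  map_smul' c v := by
    simp only [avg, avgX, avgY, Pi.smul_apply, smul_eq_mul, RingHom.id_apply]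
    split_ifs <;> ring

theorem avgAt_apply (Mx My i j : ℕ) (v : ℕ → ℕ → ℝ) : avgAt Mx My i j v = avg Mx My v i j := rfl

/-- The compact Laplacian at a node as a linear functional. -/
def compactLaplacianAt (D : Cylinder) (Mx My i j : ℕ) : (ℕ → ℕ → ℝ) →ₗ[ℝ] ℝ where
  toFun v := compactLaplacian D Mx My v i j
  map_add' v w := by
    simp only [compactLaplacian, avgX, avgY, secondX, secondY, Pi.add_apply]
    split_ifs <;> ring
  map_smul' c v := by
    simp only [compactLaplacian, avgX, avgY, secondX, secondY, Pi.smul_apply, smul_eq_mul,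
      RingHom.id_apply]
    split_ifs <;> ring

/-- The discrete inner product with a fixed grid function. -/
def pairing (D : Cylinder) (Mx My : ℕ) (w : ℕ → ℕ → ℝ) : (ℕ → ℕ → ℝ) →ₗ[ℝ] ℝ :=
  (stepX D Mx * stepY D My) • ∑ i ∈ Finset.Ico 1 Mx, ∑ j ∈ Finset.Ico 1 My, w i j • ev i j

theorem pairing_apply (D : Cylinder) (Mx My : ℕ) (v w : ℕ → ℕ → ℝ) :
    pairing D Mx My w v
      = stepX D Mx * stepY D My *
        ∑ i ∈ Finset.Ico 1 Mx, ∑ j ∈ Finset.Ico 1 My, v i j * w i j := by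
  simp [pairing, LinearMap.sum_apply, mul_comm]

theorem pairing_congr (D : Cylinder) {Mx My : ℕ} {v v' : ℕ → ℕ → ℝ} (w : ℕ → ℕ → ℝ)
    (h : ∀ i j, Interior Mx My i j → v i j = v' i j) :
    pairing D Mx My w v = pairing D Mx My w v' := by
  rw [pairing_apply, pairing_apply]
  congr 1
  refine Finset.sum_congr rfl fun i hi => Finset.sum_congr rfl fun j hj => ?_
  rw [Finset.mem_Ico] at hi hj
  rw [h i j ⟨⟨hi.1, hi.2⟩, hj.1, hj.2⟩]

theorem pairing_avg (D : Cylinder) {Mx My : ℕ} (v : ℕ → ℕ → ℝ) {w : ℕ → ℕ → ℝ}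
    (hw : VanishesOff Mx My w) :
    pairing D Mx My w (fun i j => avg Mx My v i j) = massForm D Mx My v w := by
  rw [pairing_apply, sum_avg_eq_massForm D v hw]

theorem pairing_compactLaplacian (D : Cylinder) {Mx My : ℕ} (v : ℕ → ℕ → ℝ) {w : ℕ → ℕ → ℝ}
    (hw : VanishesOff Mx My w) :
    pairing D Mx My w (fun i j => compactLaplacian D Mx My v i j) = -stiffForm D Mx My v w := by
  rw [pairing_apply, sum_compactLaplacian_eq_stiffForm D v hw]

theorem pairing_le (D : Cylinder) (Mx My : ℕ) (v w : ℕ → ℕ → ℝ) :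
    pairing D Mx My w v ≤ gridNorm D Mx My v * (3 / 2 * formNorm (massForm D Mx My) w) := by
  rw [pairing_apply]
  exact ((le_abs_self _).trans (abs_sum_mul_le_gridNorm D Mx My v w)).trans
    (mul_le_mul_of_nonneg_left (gridNorm_le_massNorm D Mx My w) (gridNorm_nonneg D Mx My v))

theorem map_midValue {V W : Type*} [AddCommGroup V] [Module ℝ V] [AddCommGroup W] [Module ℝ W]
    (T : V →ₗ[ℝ] W) (X : ℕ → V) (k : ℕ) : T (midValue X k) = midValue (fun m => T (X m)) k := by
  unfold midValue
  split_ifs <;> simp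

theorem map_memOp (T : (ℕ → ℕ → ℝ) →ₗ[ℝ] ℝ) (τ : ℝ) (g : ℝ → ℝ) (X : ℕ → ℕ → ℕ → ℝ) (n : ℕ) :
    T (fun i j => memOp τ g (fun m => X m i j) n) = memOp τ g (fun m => T (X m)) n := by
  have e : (fun i j => memOp τ g (fun m => X m i j) n)
      = ∑ k ∈ Finset.Icc 1 n, (memWeight τ g (n - k) * τ⁻¹) • (X k - X (k - 1)) := by
    ext i j
    simp only [memOp, Finset.sum_apply, Pi.smul_apply, Pi.sub_apply, smul_eq_mul]
    exact Finset.sum_congr rfl fun k _ => by ring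
  rw [e, map_sum, memOp]
  refine Finset.sum_congr rfl fun k _ => ?_
  rw [map_smul, map_sub, smul_eq_mul]
  ring

theorem map_piOp (T : (ℕ → ℕ → ℝ) →ₗ[ℝ] ℝ) (a τ : ℝ) (X : ℕ → ℕ → ℕ → ℝ) (n : ℕ) :
    T (fun i j => piOp a τ (fun m => X m i j) n) = piOp a τ (fun m => T (X m)) n := by
  have e : (fun i j => piOp a τ (fun m => X m i j) n)
      = ∑ k ∈ Finset.Icc 1 n, lamSeq a τ (n - k) • midValue X k := by
    ext i j
    simp only [piOp, Finset.sum_apply, Pi.smul_apply, smul_eq_mul]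
    refine Finset.sum_congr rfl fun k _ => ?_
    congr 1
    exact (map_midValue (ev i j) X k).symm
  rw [e, map_sum, piOp]
  refine Finset.sum_congr rfl fun k _ => ?_
  rw [map_smul, smul_eq_mul, map_midValue]

theorem memOp_sub (τ : ℝ) (g : ℝ → ℝ) (x y : ℕ → ℝ) (n : ℕ) :
    memOp τ g (fun m => x m - y m) n = memOp τ g x n - memOp τ g y n := by
  rw [memOp, memOp, memOp, ← Finset.sum_sub_distrib]
  exact Finset.sum_congr rfl fun k _ => by ring

theorem piOp_sub (a τ : ℝ) (x y : ℕ → ℝ) (n : ℕ) :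
    piOp a τ (fun m => x m - y m) n = piOp a τ x n - piOp a τ y n := by
  rw [piOp, piOp, piOp, ← Finset.sum_sub_distrib]
  refine Finset.sum_congr rfl fun k _ => ?_
  unfold midValue
  split_ifs <;> simp <;> ring

theorem piOp_add (a τ : ℝ) (x y : ℕ → ℝ) (n : ℕ) :
    piOp a τ (fun m => x m + y m) n = piOp a τ x n + piOp a τ y n := by
  rw [piOp, piOp, piOp, ← Finset.sum_add_distrib]
  refine Finset.sum_congr rfl fun k _ => ?_
  unfold midValue
  split_ifs <;> simp <;> ring

theorem memOp_congr {τ : ℝ} {g : ℝ → ℝ} {x y : ℕ → ℝ} {n : ℕ} (h : ∀ m ≤ n, x m = y m) :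
    memOp τ g x n = memOp τ g y n := by
  refine Finset.sum_congr rfl fun k hk => ?_
  rw [Finset.mem_Icc] at hk
  rw [h k hk.2, h (k - 1) (by omega)]

theorem piOp_congr {a τ : ℝ} {x y : ℕ → ℝ} {n : ℕ} (h : ∀ m, 1 ≤ m → m ≤ n → x m = y m) :
    piOp a τ x n = piOp a τ y n := by
  refine Finset.sum_congr rfl fun k hk => ?_
  rw [Finset.mem_Icc] at hk
  congr 1
  unfold midValue
  split_ifs with h1
  · exact h 1 le_rfl (by omega)
  · rw [h k hk.1 hk.2, h (k - 1) (by omega) (by omega)]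

/-! ### Bounds for the averaged product integration operator -/

/-- Sum of two consecutive weights. -/
def lamPair (a τ : ℝ) (i : ℕ) : ℝ := lamSeq a τ i + if i = 0 then 0 else lamSeq a τ (i - 1)

theorem lamPair_nonneg {a τ : ℝ} (ha : 0 < a) (hτ : 0 < τ) (i : ℕ) : 0 ≤ lamPair a τ i := by
  have := lamSeq_nonneg ha hτ i
  have := lamSeq_nonneg ha hτ (i - 1)
  rw [lamPair]
  split_ifs <;> linarith

theorem sum_lamPair_le {a τ T : ℝ} (ha : 0 < a) (hτ : 0 < τ) {m : ℕ} (hm : m * τ ≤ T) :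
    ∑ i ∈ Finset.range m, lamPair a τ i ≤ 2 * betaInt a T := by
  have h1 := sum_lamSeq_le ha hτ hm
  have h2 : ∑ i ∈ Finset.range m, (if i = 0 then 0 else lamSeq a τ (i - 1))
      ≤ ∑ i ∈ Finset.range m, lamSeq a τ i := by
    rcases m with _ | m
    · simp
    · rw [Finset.sum_range_succ', Finset.sum_range_succ (fun i => lamSeq a τ i)]
      have := lamSeq_nonneg ha hτ m
      simp only [Nat.add_eq_zero_iff, one_ne_zero, and_false, if_false, if_true,
        Nat.add_sub_cancel]
      linarith
  simp only [lamPair, Finset.sum_add_distrib]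
  linarith

/-- The node value k occurs in the averages k and k + 1, that is, at lags n - k and n - k - 1.
Dropping the factor 1/2 treats the first average, which is x 1 alone, in the same way. -/
theorem abs_piOp_le {a τ : ℝ} (ha : 0 < a) (hτ : 0 < τ) {x y : ℕ → ℝ} {n : ℕ}
    (h : ∀ k, 1 ≤ k → k ≤ n → |x k| ≤ y k) :
    |piOp a τ x n| ≤ ∑ k ∈ Finset.Icc 1 n, lamPair a τ (n - k) * y k := by
  have hy : ∀ k, 1 ≤ k → k ≤ n → 0 ≤ y k := fun k h1 h2 => (abs_nonneg _).trans (h k h1 h2)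
  set z : ℕ → ℝ := fun k => if k ≤ 1 then 0 else y (k - 1) with hz
  have s1 : |piOp a τ x n| ≤ ∑ k ∈ Finset.Icc 1 n, lamSeq a τ (n - k) * (y k + z k) := by
    refine (Finset.abs_sum_le_sum_abs _ _).trans (Finset.sum_le_sum fun k hk => ?_)
    rw [Finset.mem_Icc] at hk
    rw [abs_mul, abs_of_nonneg (lamSeq_nonneg ha hτ _)]
    refine mul_le_mul_of_nonneg_left ?_ (lamSeq_nonneg ha hτ _)
    rcases hk.1.eq_or_lt with rfl | h1
    · rw [midValue_one, hz]
      simpa using h 1 le_rfl hk.2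
    · rw [midValue_real x (by omega), hz]
      simp only [if_neg (show ¬ k ≤ 1 by omega)]
      have h2 := h k hk.1 hk.2
      have h3 := h (k - 1) (by omega) (by omega)
      rw [abs_div, abs_two]
      have := abs_add_le (x k) (x (k - 1))
      have := hy k hk.1 hk.2
      have := hy (k - 1) (by omega) (by omega)
      linarith
  refine s1.trans_eq ?_
  simp only [mul_add, lamPair, add_mul, Finset.sum_add_distrib]
  congr 1
  rcases n with _ | n
  · simp
  rw [sum_Icc_one_eq_range, sum_Icc_one_eq_range, Finset.sum_range_succ', Finset.sum_range_succ _ n]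
  have e0 : z (0 + 1) = 0 := by simp [hz]
  rw [e0, mul_zero, Nat.sub_self, if_pos rfl, zero_mul]
  congr 1
  refine Finset.sum_congr rfl fun k hk => ?_
  rw [Finset.mem_range] at hk
  have e1 : z (k + 1 + 1) = y (k + 1) := by simp [hz]
  rw [e1, if_neg (by omega)]
  congr 2

theorem abs_piOp_le_const {a τ T c : ℝ} (ha : 0 < a) (hτ : 0 < τ) (hc : 0 ≤ c) {x : ℕ → ℝ} {n : ℕ}
    (hn : n * τ ≤ T) (h : ∀ k, 1 ≤ k → k ≤ n → |x k| ≤ c) :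
    |piOp a τ x n| ≤ 2 * betaInt a T * c := by
  refine (abs_piOp_le ha hτ (y := fun _ => c) h).trans ?_
  rw [← Finset.sum_mul]
  refine mul_le_mul_of_nonneg_right ?_ hc
  rw [sum_Icc_one_eq_range]
  refine le_trans (le_of_eq ?_) (sum_lamPair_le ha hτ hn)
  rw [← Finset.sum_range_reflect]
  refine Finset.sum_congr rfl fun k hk => ?_
  rw [Finset.mem_range] at hk
  congr 1
  omega

/-! ### Interior parts of grid functions -/

open Classical in
/-- The grid function agreeing with `v` at the interior indices and vanishing elsewhere. -/
def interiorPart (Mx My : ℕ) (v : ℕ → ℕ → ℝ) (i j : ℕ) : ℝ := if Interior Mx My i j then v i j else 0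

theorem interiorPart_of {Mx My i j : ℕ} (v : ℕ → ℕ → ℝ) (h : Interior Mx My i j) :
    interiorPart Mx My v i j = v i j := if_pos h

theorem vanishesOff_interiorPart (Mx My : ℕ) (v : ℕ → ℕ → ℝ) :
    VanishesOff Mx My (interiorPart Mx My v) := fun _ _ h => if_neg h

/-- Grid functions may take arbitrary values at indices beyond the grid. Passing to the interior
part removes these without changing anything on a grid with zero boundary values. -/
theorem interiorPart_eq {Mx My : ℕ} {v : ℕ → ℕ → ℝ} (h : ∀ i j, Boundary Mx My i j → v i j = 0)
    {i j : ℕ} (hi : i ≤ Mx) (hj : j ≤ My) : interiorPart Mx My v i j = v i j := by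
  by_cases hI : Interior Mx My i j
  · exact if_pos hI
  · rw [interiorPart, if_neg hI, h i j ⟨⟨hi, hj⟩, hI⟩]

theorem avg_congr {Mx My i j : ℕ} {v w : ℕ → ℕ → ℝ} (h : ∀ p ≤ Mx, ∀ q ≤ My, v p q = w p q)
    (hI : Interior Mx My i j) : avg Mx My v i j = avg Mx My w i j := by
  obtain ⟨⟨i1, i2⟩, j1, j2⟩ := hI
  have k : ∀ p ≤ Mx, avgY My v p j = avgY My w p j := fun p hp => by
    rw [avgY, avgY, h p hp (j - 1) (by omega), h p hp j (by omega), h p hp (j + 1) (by omega)]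
  rw [avg, avg, avgX, avgX, k (i - 1) (by omega), k i (by omega), k (i + 1) (by omega)]

theorem compactLaplacian_congr (D : Cylinder) {Mx My i j : ℕ} {v w : ℕ → ℕ → ℝ}
    (h : ∀ p ≤ Mx, ∀ q ≤ My, v p q = w p q) (hI : Interior Mx My i j) :
    compactLaplacian D Mx My v i j = compactLaplacian D Mx My w i j := by
  obtain ⟨⟨i1, i2⟩, j1, j2⟩ := hI
  have k1 : ∀ q ≤ My, secondX D Mx v i q = secondX D Mx w i q := fun q hq => by
    rw [secondX, secondX, h _ (by omega) q hq, h _ (by omega) q hq, h _ (by omega) q hq]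
  have k2 : ∀ p ≤ Mx, secondY D My v p j = secondY D My w p j := fun p hp => by
    rw [secondY, secondY, h p hp _ (by omega), h p hp _ (by omega), h p hp _ (by omega)]
  rw [compactLaplacian, compactLaplacian, avgX, avgX, avgY, avgY, k1 (j - 1) (by omega),
    k1 j (by omega), k1 (j + 1) (by omega), k2 (i - 1) (by omega), k2 i (by omega),
    k2 (i + 1) (by omega)]

theorem abs_average_le {x y z c : ℝ} (hx : |x| ≤ c) (hy : |y| ≤ c) (hz : |z| ≤ c) :
    |(x + 10 * y + z) / 12| ≤ c := by
  rw [abs_le] at *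
  constructor <;> linarith

theorem abs_avg_le {Mx My i j : ℕ} {v : ℕ → ℕ → ℝ} {c : ℝ}
    (h : ∀ p ≤ Mx, ∀ q ≤ My, |v p q| ≤ c) (hI : Interior Mx My i j) : |avg Mx My v i j| ≤ c := by
  obtain ⟨⟨i1, i2⟩, j1, j2⟩ := hI
  have k : ∀ p ≤ Mx, |avgY My v p j| ≤ c := fun p hp => by
    rw [avgY, if_neg (by omega)]
    exact abs_average_le (h p hp _ (by omega)) (h p hp _ (by omega)) (h p hp _ (by omega))
  rw [avg, avgX, if_neg (by omega)]
  exact abs_average_le (k _ (by omega)) (k _ (by omega)) (k _ (by omega))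

theorem avg_eq_avgY_avgX (Mx My : ℕ) (v : ℕ → ℕ → ℝ) (i j : ℕ) :
    avg Mx My v i j = avgY My (avgX Mx v) i j := by
  simp only [avg, avgX, avgY]
  split_ifs <;> ring

/-! ### Truncation error of the compact Laplacian -/

theorem stepX_pos (D : Cylinder) {M : ℕ} (hM : 1 ≤ M) : 0 < stepX D M :=
  div_pos (sub_pos.2 D.hx) (by exact_mod_cast hM)

theorem stepY_pos (D : Cylinder) {M : ℕ} (hM : 1 ≤ M) : 0 < stepY D M :=
  div_pos (sub_pos.2 D.hy) (by exact_mod_cast hM)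

theorem mul_stepX (D : Cylinder) {M : ℕ} (hM : 1 ≤ M) : M * stepX D M = D.rx - D.lx := by
  have : (M : ℝ) ≠ 0 := by positivity
  rw [stepX]; field_simp

theorem mul_stepY (D : Cylinder) {M : ℕ} (hM : 1 ≤ M) : M * stepY D M = D.ry - D.ly := by
  have : (M : ℝ) ≠ 0 := by positivity
  rw [stepY]; field_simp

theorem nodeX_mem (D : Cylinder) {M i : ℕ} (hM : 1 ≤ M) (hi : i ≤ M) :
    nodeX D M i ∈ Icc D.lx D.rx := by
  have h0 := stepX_nonneg D M
  have h1 := mul_stepX D hM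
  have h2 := mul_le_mul_of_nonneg_right (show (i : ℝ) ≤ M by exact_mod_cast hi) h0
  have h3 : 0 ≤ (i : ℝ) * stepX D M := by positivity
  rw [nodeX]
  constructor <;> linarith

theorem nodeY_mem (D : Cylinder) {M j : ℕ} (hM : 1 ≤ M) (hj : j ≤ M) :
    nodeY D M j ∈ Icc D.ly D.ry := by
  have h0 := stepY_nonneg D M
  have h1 := mul_stepY D hM
  have h2 := mul_le_mul_of_nonneg_right (show (j : ℝ) ≤ M by exact_mod_cast hj) h0
  have h3 : 0 ≤ (j : ℝ) * stepY D M := by positivity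
  rw [nodeY]
  constructor <;> linarith

theorem nodeX_zero (D : Cylinder) (M : ℕ) : nodeX D M 0 = D.lx := by simp [nodeX]

theorem nodeY_zero (D : Cylinder) (M : ℕ) : nodeY D M 0 = D.ly := by simp [nodeY]

theorem nodeX_last (D : Cylinder) {M : ℕ} (hM : 1 ≤ M) : nodeX D M M = D.rx := by
  rw [nodeX, mul_stepX D hM]; ring

theorem nodeY_last (D : Cylinder) {M : ℕ} (hM : 1 ≤ M) : nodeY D M M = D.ry := by
  rw [nodeY, mul_stepY D hM]; ring

theorem node_mem_boundary (D : Cylinder) {Mx My i j : ℕ} (hMx : 1 ≤ Mx) (hMy : 1 ≤ My)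
    (hB : Boundary Mx My i j) : (nodeX D Mx i, nodeY D My j) ∈ D.OmegaBar \ D.Omega := by
  obtain ⟨⟨hi, hj⟩, hI⟩ := hB
  have : i = 0 ∨ i = Mx ∨ j = 0 ∨ j = My := by unfold Interior at hI; omega
  rcases this with rfl | rfl | rfl | rfl
  · exact mem_boundary_x D (Or.inl (nodeX_zero D Mx)) (nodeY_mem D hMy hj)
  · exact mem_boundary_x D (Or.inr (nodeX_last D hMx)) (nodeY_mem D hMy hj)
  · exact mem_boundary_y D (nodeX_mem D hMx hi) (Or.inl (nodeY_zero D My))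
  · exact mem_boundary_y D (nodeX_mem D hMx hi) (Or.inr (nodeY_last D hMy))

theorem IsRegular.chain_x {D : Cylinder} {α₀ C : ℝ} {u : ℝ → ℝ → ℝ → ℝ} (h : IsRegular D α₀ C u)
    {y t : ℝ} (hy : y ∈ Icc D.ly D.ry) (ht : t ∈ Icc 0 D.T) {k : ℕ} (hk : k < 6) {x : ℝ}
    (hx : x ∈ Icc D.lx D.rx) :
    HasDerivWithinAt (fun x => pdx D k u x y t) (pdx D (k + 1) u x y t) (Icc D.lx D.rx) x :=
  hasDerivWithinAt_iteratedDerivWithin (n := 6) D.hx (h.diff_x y hy t ht) hk hx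

theorem IsRegular.chain_y {D : Cylinder} {α₀ C : ℝ} {u : ℝ → ℝ → ℝ → ℝ} (h : IsRegular D α₀ C u)
    {x t : ℝ} (hx : x ∈ Icc D.lx D.rx) (ht : t ∈ Icc 0 D.T) {k : ℕ} (hk : k < 6) {y : ℝ}
    (hy : y ∈ Icc D.ly D.ry) :
    HasDerivWithinAt (fun y => pdy D k u x y t) (pdy D (k + 1) u x y t) (Icc D.ly D.ry) y :=
  hasDerivWithinAt_iteratedDerivWithin (n := 6) D.hy (h.diff_y x hx t ht) hk hy

theorem pdx_zero (D : Cylinder) (u : ℝ → ℝ → ℝ → ℝ) (x y t : ℝ) : pdx D 0 u x y t = u x y t := by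
  rw [pdx, iteratedDerivWithin_zero]

theorem pdy_zero (D : Cylinder) (u : ℝ → ℝ → ℝ → ℝ) (x y t : ℝ) : pdy D 0 u x y t = u x y t := by
  rw [pdy, iteratedDerivWithin_zero]

theorem compact_truncation_x {D : Cylinder} {α₀ C : ℝ} {u : ℝ → ℝ → ℝ → ℝ}
    (h : IsRegular D α₀ C u) {M i : ℕ} (h1 : 1 ≤ i) (h2 : i + 1 ≤ M) {y t : ℝ}
    (hy : y ∈ Icc D.ly D.ry) (ht : t ∈ Ioc 0 D.T) :
    |(u (nodeX D M (i + 1)) y t - 2 * u (nodeX D M i) y t + u (nodeX D M (i - 1)) y t)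
          / stepX D M ^ 2
        - (pdx D 2 u (nodeX D M (i - 1)) y t + 10 * pdx D 2 u (nodeX D M i) y t
          + pdx D 2 u (nodeX D M (i + 1)) y t) / 12| ≤ C * stepX D M ^ 4 := by
  have hM : 1 ≤ M := by omega
  obtain ⟨i, rfl⟩ : ∃ k, i = k + 1 := ⟨i - 1, by omega⟩
  have e1 : nodeX D M (i + 1) = nodeX D M i + stepX D M := by rw [nodeX, nodeX]; push_cast; ring
  have e2 : nodeX D M (i + 1 + 1) = nodeX D M i + 2 * stepX D M := by
    rw [nodeX, nodeX]; push_cast; ring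
  have hsub : Icc (nodeX D M i) (nodeX D M i + 2 * stepX D M) ⊆ Icc D.lx D.rx := by
    rw [← e2]
    exact Icc_subset_Icc (nodeX_mem D hM (by omega)).1 (nodeX_mem D hM h2).2
  have := compact_truncation (φ := fun k x => pdx D k u x y t) (stepX_pos D hM)
    (fun k hk x hx => (h.chain_x hy (Ioc_subset_Icc_self ht) hk (hsub hx)).mono hsub)
    (fun x hx => (h.bound x y t ⟨hsub hx, hy⟩ ht).2.2.2.1)
  simp only [pdx_zero] at this
  rw [Nat.add_sub_cancel, e1, e2, abs_sub_comm]
  exact this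

theorem compact_truncation_y {D : Cylinder} {α₀ C : ℝ} {u : ℝ → ℝ → ℝ → ℝ}
    (h : IsRegular D α₀ C u) {M j : ℕ} (h1 : 1 ≤ j) (h2 : j + 1 ≤ M) {x t : ℝ}
    (hx : x ∈ Icc D.lx D.rx) (ht : t ∈ Ioc 0 D.T) :
    |(u x (nodeY D M (j + 1)) t - 2 * u x (nodeY D M j) t + u x (nodeY D M (j - 1)) t)
          / stepY D M ^ 2
        - (pdy D 2 u x (nodeY D M (j - 1)) t + 10 * pdy D 2 u x (nodeY D M j) t
          + pdy D 2 u x (nodeY D M (j + 1)) t) / 12| ≤ C * stepY D M ^ 4 := by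
  have hM : 1 ≤ M := by omega
  obtain ⟨j, rfl⟩ : ∃ k, j = k + 1 := ⟨j - 1, by omega⟩
  have e1 : nodeY D M (j + 1) = nodeY D M j + stepY D M := by rw [nodeY, nodeY]; push_cast; ring
  have e2 : nodeY D M (j + 1 + 1) = nodeY D M j + 2 * stepY D M := by
    rw [nodeY, nodeY]; push_cast; ring
  have hsub : Icc (nodeY D M j) (nodeY D M j + 2 * stepY D M) ⊆ Icc D.ly D.ry := by
    rw [← e2]
    exact Icc_subset_Icc (nodeY_mem D hM (by omega)).1 (nodeY_mem D hM h2).2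
  have := compact_truncation (φ := fun k y => pdy D k u x y t) (stepY_pos D hM)
    (fun k hk y hy => (h.chain_y hx (Ioc_subset_Icc_self ht) hk (hsub hy)).mono hsub)
    (fun y hy => (h.bound x y t ⟨hx, hsub hy⟩ ht).2.2.2.2.1)
  simp only [pdy_zero] at this
  rw [Nat.add_sub_cancel, e1, e2, abs_sub_comm]
  exact this

/-- The restriction of a function of `(x, y, t)` to a spatial grid. -/
def onGrid (D : Cylinder) (Mx My : ℕ) (w : ℝ → ℝ → ℝ → ℝ) (t : ℝ) (i j : ℕ) : ℝ :=
  w (nodeX D Mx i) (nodeY D My j) t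

/-- The residual of δ_x² u against the x-average of ∂_x² u is one-dimensional and of fourth order;
averaging it in y does not enlarge it, and the two averages commute. The y part is symmetric. -/
theorem compactLaplacian_truncation {D : Cylinder} {α₀ C : ℝ} {u : ℝ → ℝ → ℝ → ℝ}
    (h : IsRegular D α₀ C u) {Mx My i j : ℕ} (hI : Interior Mx My i j) {t : ℝ}
    (ht : t ∈ Ioc 0 D.T) :
    |compactLaplacian D Mx My (onGrid D Mx My u t) i j
        - avg Mx My (onGrid D Mx My (fun x y t => pdx D 2 u x y t + pdy D 2 u x y t) t) i j|
      ≤ C * (stepX D Mx ^ 4 + stepY D My ^ 4) := by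
  obtain ⟨⟨i1, i2⟩, j1, j2⟩ := hI
  have hMx : 1 ≤ Mx := by omega
  have hMy : 1 ≤ My := by omega
  set w := onGrid D Mx My u t with hw
  set wx := onGrid D Mx My (pdx D 2 u) t with hwx
  set wy := onGrid D Mx My (pdy D 2 u) t with hwy
  have kx : ∀ q ≤ My, |secondX D Mx w i q - avgX Mx wx i q| ≤ C * stepX D Mx ^ 4 := fun q hq => by
    rw [avgX, if_neg (by omega)]
    exact compact_truncation_x h i1 i2 (nodeY_mem D hMy hq) ht
  have ky : ∀ p ≤ Mx, |secondY D My w p j - avgY My wy p j| ≤ C * stepY D My ^ 4 := fun p hp => by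
    rw [avgY, if_neg (by omega)]
    exact compact_truncation_y h j1 j2 (nodeX_mem D hMx hp) ht
  have e : avg Mx My (onGrid D Mx My (fun x y t => pdx D 2 u x y t + pdy D 2 u x y t) t) i j
      = avgY My (avgX Mx wx) i j + avgX Mx (avgY My wy) i j := by
    rw [← avg_eq_avgY_avgX]
    exact (avgAt Mx My i j).map_add wx wy
  have a1 := abs_average_le (kx (j - 1) (by omega)) (kx j (by omega)) (kx (j + 1) (by omega))
  have a2 := abs_average_le (ky (i - 1) (by omega)) (ky i (by omega)) (ky (i + 1) (by omega))
  rw [e, compactLaplacian]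
  have e1 : avgY My (secondX D Mx w) i j - avgY My (avgX Mx wx) i j
      = (secondX D Mx w i (j - 1) - avgX Mx wx i (j - 1)
        + 10 * (secondX D Mx w i j - avgX Mx wx i j)
        + (secondX D Mx w i (j + 1) - avgX Mx wx i (j + 1))) / 12 := by
    rw [avgY, avgY, if_neg (by omega), if_neg (by omega)]; ring
  have e2 : avgX Mx (secondY D My w) i j - avgX Mx (avgY My wy) i j
      = (secondY D My w (i - 1) j - avgY My wy (i - 1) j
        + 10 * (secondY D My w i j - avgY My wy i j)
        + (secondY D My w (i + 1) j - avgY My wy (i + 1) j)) / 12 := by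
    rw [avgX, avgX, if_neg (by omega), if_neg (by omega)]; ring
  rw [← e1] at a1
  rw [← e2] at a2
  have := abs_add_le (avgY My (secondX D Mx w) i j - avgY My (avgX Mx wx) i j)
    (avgX Mx (secondY D My w) i j - avgX Mx (avgY My wy) i j)
  rw [show avgY My (secondX D Mx w) i j + avgX Mx (secondY D My w) i j
      - (avgY My (avgX Mx wx) i j + avgX Mx (avgY My wy) i j)
    = avgY My (secondX D Mx w) i j - avgY My (avgX Mx wx) i j
      + (avgX Mx (secondY D My w) i j - avgX Mx (avgY My wy) i j) by ring]
  linarith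

end TwoGrid

end

/-! ### Consistency, error equation and error estimate for the compact scheme. -/

noncomputable section

namespace TwoGrid

/-- The hypotheses on the continuous problem. -/
structure ProblemData (D : Cylinder) (α f : ℝ → ℝ) (u₀ v₀ : ℝ → ℝ → ℝ) (u : ℝ → ℝ → ℝ → ℝ)
    (a C Qg Qf Qf2 : ℝ) : Prop where
  a_pos : 0 < a
  a_lt : a < 1
  exponent : IsAdmissibleExponent D.T α
  initial : α 0 = 1 + a
  kernel : IsKernelBound D.T α Qg
  smooth : ContDiff ℝ 2 f
  deriv_le : ∀ v, |deriv f v| ≤ Qf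
  deriv2_le : ∀ v, |v| ≤ C → |deriv (deriv f) v| ≤ Qf2
  solution : IsSolution D α f u₀ v₀ u
  regular : IsRegular D (α 0) C u

namespace ProblemData

variable {D : Cylinder} {α f : ℝ → ℝ} {u₀ v₀ : ℝ → ℝ → ℝ} {u : ℝ → ℝ → ℝ → ℝ}
  {a C Qg Qf Qf2 : ℝ}

theorem C_nonneg (P : ProblemData D α f u₀ v₀ u a C Qg Qf Qf2) : 0 ≤ C := P.regular.nonneg

theorem Qf_nonneg (P : ProblemData D α f u₀ v₀ u a C Qg Qf Qf2) : 0 ≤ Qf :=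
  (abs_nonneg _).trans (P.deriv_le 0)

theorem Qf2_nonneg (P : ProblemData D α f u₀ v₀ u a C Qg Qf Qf2) : 0 ≤ Qf2 :=
  (abs_nonneg _).trans (P.deriv2_le 0 (by simpa using P.C_nonneg))

theorem Qg_nonneg (P : ProblemData D α f u₀ v₀ u a C Qg Qf Qf2) : 0 ≤ Qg :=
  P.kernel.nonneg D.hT

theorem source_nonneg (P : ProblemData D α f u₀ v₀ u a C Qg Qf Qf2) :
    0 ≤ sourceConst a C D.T Qf Qf2 :=
  sourceConst_nonneg P.a_pos P.C_nonneg D.hT.le P.Qf_nonneg P.Qf2_nonneg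

theorem lipschitz (P : ProblemData D α f u₀ v₀ u a C Qg Qf Qf2) (x y : ℝ) :
    |f x - f y| ≤ Qf * |x - y| := by
  have := convex_univ.norm_image_sub_le_of_norm_deriv_le (f := f) (C := Qf) (x := y) (y := x)
    (fun z _ => P.smooth.differentiable two_ne_zero z) (fun z _ => P.deriv_le z)
    (mem_univ _) (mem_univ _)
  simpa using this

theorem hasKernelModulus (P : ProblemData D α f u₀ v₀ u a C Qg Qf Qf2) :
    HasKernelModulus D.T Qg (kernelModulus D.T Qg) (gfun α) (deriv (gfun α)) :=
  P.kernel.hasKernelModulus P.a_pos P.a_lt D.hT P.exponent P.initial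

end ProblemData

/-- The elliptic part plus the source, `Δu + f(u)`. -/
def ellipticPart (D : Cylinder) (f : ℝ → ℝ) (u : ℝ → ℝ → ℝ → ℝ) (x y t : ℝ) : ℝ :=
  pdx D 2 u x y t + pdy D 2 u x y t + f (u x y t)

theorem cast_mul_tau (D : Cylinder) {N : ℕ} (hN : 1 ≤ N) : N * tau D N = D.T := by
  have : (N : ℝ) ≠ 0 := by positivity
  rw [tau]; field_simp

theorem cast_mul_tau_le (D : Cylinder) {N n : ℕ} (hN : 1 ≤ N) (hn : n ≤ N) :
    n * tau D N ≤ D.T := by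
  rw [← cast_mul_tau D hN]
  exact mul_le_mul_of_nonneg_right (by exact_mod_cast hn) (tau_pos D hN).le

theorem time_mem (D : Cylinder) {N n : ℕ} (hN : 1 ≤ N) (h1 : 1 ≤ n) (hn : n ≤ N) :
    (n : ℝ) * tau D N ∈ Ioc 0 D.T :=
  ⟨mul_pos (by exact_mod_cast h1) (tau_pos D hN), cast_mul_tau_le D hN hn⟩

variable {D : Cylinder} {α f : ℝ → ℝ} {u₀ v₀ : ℝ → ℝ → ℝ} {u : ℝ → ℝ → ℝ → ℝ}
  {a C Qg Qf Qf2 : ℝ}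

/-- Spatial averaging commutes with the operators in time and does not increase a maximum over
nodes. It reaches boundary nodes, which is why the equation is needed on the closed rectangle. -/
theorem averaged_consistency (P : ProblemData D α f u₀ v₀ u a C Qg Qf Qf2) {N Mx My : ℕ}
    (hN : 1 ≤ N) {n i j : ℕ} (hn1 : 1 ≤ n) (hn : n ≤ N) (hI : Interior Mx My i j) :
    |memOp (tau D N) (gfun α) (fun m => avg Mx My (onGrid D Mx My u (m * tau D N)) i j) n
        - piOp a (tau D N)
            (fun m => avg Mx My (onGrid D Mx My (ellipticPart D f u) (m * tau D N)) i j) n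
        - avg Mx My (bterm D N Mx My α v₀ n) i j|
      ≤ truncBound a (sourceConst a C D.T Qf Qf2) Qg D.T (tau D N) n := by
  have hMx : 1 ≤ Mx := by have := hI.1; omega
  have hMy : 1 ≤ My := by have := hI.2; omega
  have e1 := map_memOp (avgAt Mx My i j) (tau D N) (gfun α)
    (fun m => onGrid D Mx My u (m * tau D N)) n
  have e2 := map_piOp (avgAt Mx My i j) a (tau D N)
    (fun m => onGrid D Mx My (ellipticPart D f u) (m * tau D N)) n
  simp only [← avgAt_apply]
  rw [← e1, ← e2, ← map_sub, ← map_sub]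
  refine abs_avg_le (fun p hp q hq => ?_) hI
  exact pointwise_consistency P.a_pos P.a_lt P.exponent P.initial P.kernel P.smooth P.deriv_le
    P.deriv2_le P.solution P.regular (tau_pos D hN) hn1 (cast_mul_tau_le D hN hn)
    ⟨nodeX_mem D hMx hp, nodeY_mem D hMy hq⟩

/-- The source terms of the scheme at time level `n`: `f(U^k)` for `k < n`, and `Φ` for `k = n`. -/
def schemeSource (f : ℝ → ℝ) (U Φ : ℕ → ℕ → ℕ → ℝ) (n k : ℕ) : ℕ → ℕ → ℝ :=
  if k = n then Φ n else fun p q => f (U k p q)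

/-- `U` solves the compact difference scheme with the source `Φ` at the current time level. -/
structure SolvesScheme (D : Cylinder) (N Mx My : ℕ) (a : ℝ) (α f : ℝ → ℝ) (u₀ v₀ : ℝ → ℝ → ℝ)
    (U Φ : ℕ → ℕ → ℕ → ℝ) : Prop where
  eqn : ∀ n, 1 ≤ n → n ≤ N → ∀ i j, Interior Mx My i j →
    schemeLHS D N Mx My α U n i j
      = piOp a (tau D N) (fun k => avg Mx My (schemeSource f U Φ n k) i j) n
        + avg Mx My (bterm D N Mx My α v₀ n) i j
  values : HasInitialBoundaryValues D N Mx My u₀ U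

/-- In the first and in all later steps the source terms are the product rule applied to f(U^k),
with Φ in place of the current level. This common form covers the coarse and the fine scheme. -/
theorem solvesScheme_of {N Mx My : ℕ} (hN : 1 ≤ N) (ha : 0 < a) (h0 : α 0 = 1 + a)
    {U Φ : ℕ → ℕ → ℕ → ℝ}
    (first : ∀ i j, Interior Mx My i j →
      schemeLHS D N Mx My α U 1 i j =
        lam D N α 1 1 * avg Mx My (Φ 1) i j + avg Mx My (bterm D N Mx My α v₀ 1) i j)
    (later : ∀ n, 2 ≤ n → n ≤ N → ∀ i j, Interior Mx My i j →
      schemeLHS D N Mx My α U n i j =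
        lam D N α n n / 2 * avg Mx My (Φ n) i j
          + ∑ k ∈ Finset.Ico 1 n, lamTilde D N α n k * avg Mx My (fun p q => f (U k p q)) i j
          + avg Mx My (bterm D N Mx My α v₀ n) i j)
    (values : HasInitialBoundaryValues D N Mx My u₀ U) :
    SolvesScheme D N Mx My a α f u₀ v₀ U Φ := by
  refine ⟨fun n h1 hn i j hI => ?_, values⟩
  rcases h1.eq_or_lt with rfl | h2
  · rw [first i j hI]
    congr 1
    rw [piOp, Finset.Icc_self, Finset.sum_singleton, midValue_one,
      lam_eq_lamSeq D hN ha h0 le_rfl le_rfl]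
    simp [schemeSource]
  · rw [later n h2 hn i j hI, ← piOp_eq_source D hN ha h0 _ h2]
    congr 2
    · simp [schemeSource]
    · refine Finset.sum_congr rfl fun k hk => ?_
      rw [Finset.mem_Ico] at hk
      rw [schemeSource, if_neg (by omega)]

/-- The error equation at an interior node. -/
theorem error_equation (P : ProblemData D α f u₀ v₀ u a C Qg Qf Qf2) {N Mx My : ℕ} (hN : 1 ≤ N)
    {U Φ : ℕ → ℕ → ℕ → ℝ} (hU : SolvesScheme D N Mx My a α f u₀ v₀ U Φ)
    (hΦ : ∀ n, 1 ≤ n → n ≤ N → ∀ i j, Boundary Mx My i j → Φ n i j = f 0)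
    {n i j : ℕ} (hn1 : 1 ≤ n) (hn : n ≤ N) (hI : Interior Mx My i j) :
    memOp (tau D N) (gfun α) (fun m => avg Mx My (interiorPart Mx My
          (fun p q => onGrid D Mx My u (m * tau D N) p q - U m p q)) i j) n
        - piOp a (tau D N) (fun m => compactLaplacian D Mx My (interiorPart Mx My
          (fun p q => onGrid D Mx My u (m * tau D N) p q - U m p q)) i j) n
      = (memOp (tau D N) (gfun α) (fun m => avg Mx My (onGrid D Mx My u (m * tau D N)) i j) n
          - piOp a (tau D N)
            (fun m => avg Mx My (onGrid D Mx My (ellipticPart D f u) (m * tau D N)) i j) n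
          - avg Mx My (bterm D N Mx My α v₀ n) i j)
        - piOp a (tau D N) (fun m => compactLaplacian D Mx My (onGrid D Mx My u (m * tau D N)) i j
          - avg Mx My (onGrid D Mx My (fun x y t => pdx D 2 u x y t + pdy D 2 u x y t)
              (m * tau D N)) i j) n
        + piOp a (tau D N) (fun m => avg Mx My (interiorPart Mx My
          (fun p q => f (onGrid D Mx My u (m * tau D N) p q)
            - schemeSource f U Φ n m p q)) i j) n := by
  have hMx : 1 ≤ Mx := by have := hI.1; omega
  have hMy : 1 ≤ My := by have := hI.2; omega
  set τ := tau D N with hτ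
  have ubd : ∀ m ≤ N, ∀ p q, Boundary Mx My p q → onGrid D Mx My u (m * τ) p q = 0 :=
    fun m hm p q hB => P.solution.boundary _ _ _ (node_mem_boundary D hMx hMy hB)
      ⟨mul_nonneg (Nat.cast_nonneg m) (tau_pos D hN).le, cast_mul_tau_le D hN hm⟩
  have dbd : ∀ m ≤ N, ∀ p q, Boundary Mx My p q →
      onGrid D Mx My u (m * τ) p q - U m p q = 0 := fun m hm p q hB => by
    rw [ubd m hm p q hB, hU.values.2 m hm p q hB, sub_zero]
  -- On the boundary u and U vanish and Φ equals f(0), so the source differences vanish there too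
  -- and may be cut off to the interior.
  have gbd : ∀ m, 1 ≤ m → m ≤ n → ∀ p q, Boundary Mx My p q →
      f (onGrid D Mx My u (m * τ) p q) - schemeSource f U Φ n m p q = 0 := by
    intro m _ hm p q hB
    rw [ubd m (hm.trans hn) p q hB, schemeSource]
    split_ifs with h
    · rw [hΦ n hn1 hn p q hB, sub_self]
    · simp only [hU.values.2 m (hm.trans hn) p q hB, sub_self]
  have E := hU.eqn n hn1 hn i j hI
  rw [schemeLHS_eq D hN Mx My P.a_pos P.initial U hn1] at E
  have m1 : memOp τ (gfun α) (fun m => avg Mx My (interiorPart Mx My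
        (fun p q => onGrid D Mx My u (m * τ) p q - U m p q)) i j) n
      = memOp τ (gfun α) (fun m => avg Mx My (onGrid D Mx My u (m * τ)) i j) n
        - memOp τ (gfun α) (fun m => avg Mx My (U m) i j) n := by
    rw [← memOp_sub]
    refine memOp_congr fun m hm => ?_
    rw [avg_congr (fun p hp q hq => interiorPart_eq (dbd m (hm.trans hn)) hp hq) hI]
    exact (avgAt Mx My i j).map_sub _ _
  have p1 : piOp a τ (fun m => compactLaplacian D Mx My (interiorPart Mx My
        (fun p q => onGrid D Mx My u (m * τ) p q - U m p q)) i j) n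
      = piOp a τ (fun m => compactLaplacian D Mx My (onGrid D Mx My u (m * τ)) i j) n
        - piOp a τ (fun m => compactLaplacian D Mx My (U m) i j) n := by
    rw [← piOp_sub]
    refine piOp_congr fun m _ hm => ?_
    rw [compactLaplacian_congr D (fun p hp q hq => interiorPart_eq (dbd m (hm.trans hn)) hp hq) hI]
    exact (compactLaplacianAt D Mx My i j).map_sub _ _
  have p2 : piOp a τ (fun m => avg Mx My (interiorPart Mx My
        (fun p q => f (onGrid D Mx My u (m * τ) p q) - schemeSource f U Φ n m p q)) i j) n
      = piOp a τ (fun m => avg Mx My (fun p q => f (onGrid D Mx My u (m * τ) p q)) i j) n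
        - piOp a τ (fun m => avg Mx My (schemeSource f U Φ n m) i j) n := by
    rw [← piOp_sub]
    refine piOp_congr fun m h1 hm => ?_
    rw [avg_congr (fun p hp q hq => interiorPart_eq (gbd m h1 hm) hp hq) hI]
    exact (avgAt Mx My i j).map_sub _ _
  have p3 : piOp a τ
        (fun m => avg Mx My (onGrid D Mx My (ellipticPart D f u) (m * τ)) i j) n
      = piOp a τ (fun m => avg Mx My (onGrid D Mx My
          (fun x y t => pdx D 2 u x y t + pdy D 2 u x y t) (m * τ)) i j) n
        + piOp a τ (fun m => avg Mx My (fun p q => f (onGrid D Mx My u (m * τ) p q)) i j) n := by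
    rw [← piOp_add]
    refine piOp_congr fun m _ _ => ?_
    exact (avgAt Mx My i j).map_add
      (onGrid D Mx My (fun x y t => pdx D 2 u x y t + pdy D 2 u x y t) (m * τ))
      (fun p q => f (onGrid D Mx My u (m * τ) p q))
  rw [m1, p1, p2, p3, piOp_sub]
  linarith

/-- The constant in the discrete Gronwall inequality. -/
def stabConst (a Qg Qf T : ℝ) : ℝ :=
  Qg + 3 * kernelModulus T Qg T + 2 * betaInt a T * (3 / 2 * Qf)

/-- The constant in the error estimate for the scheme. -/
def errorConst (a C Qg Qf Qf2 T QL : ℝ) : ℝ :=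
  12 * Real.exp (8 * stabConst a Qg Qf T * T) *
    (3 / 2 * QL * ((Qg + 3 * kernelModulus T Qg T + 2 * betaInt a T)
        * (2 * sourceConst a C T Qf Qf2 + 2 * (sourceConst a C T Qf Qf2 * timeModulus a T)))
      + T * (3 / 2 * QL * (2 * betaInt a T * C)) + T * betaInt a T)

theorem sum_Icc_shift_eq (h : ℕ → ℝ) (k N : ℕ) :
    ∑ n ∈ Finset.Icc k N, h (n - k) = ∑ i ∈ Finset.range (N + 1 - k), h i := by
  rw [show Finset.Icc k N = Finset.Ico k (N + 1) from rfl, Finset.sum_Ico_eq_sum_range]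
  exact Finset.sum_congr rfl fun i _ => by rw [Nat.add_sub_cancel_left]

/-- Error estimate for the compact difference scheme with a perturbed source. -/
theorem scheme_error (P : ProblemData D α f u₀ v₀ u a C Qg Qf Qf2) {N Mx My : ℕ} (hN : 1 ≤ N)
    (hMx : 1 ≤ Mx) (hMy : 1 ≤ My) (hτ1 : Qg * tau D N ≤ 1)
    (hτ2 : 8 * stabConst a Qg Qf D.T * tau D N ≤ 1)
    {U Φ : ℕ → ℕ → ℕ → ℝ} (hU : SolvesScheme D N Mx My a α f u₀ v₀ U Φ)
    (hΦ : ∀ n, 1 ≤ n → n ≤ N → ∀ i j, Boundary Mx My i j → Φ n i j = f 0)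
    {ρ : ℝ} (hρ0 : 0 ≤ ρ) (ω : ℕ → ℕ → ℕ → ℝ) (hω : ∀ n, 1 ≤ n → n ≤ N → gridNorm D Mx My (ω n) ≤ ρ)
    (hΦω : ∀ n, 1 ≤ n → n ≤ N → ∀ i j, Interior Mx My i j →
      |f (onGrid D Mx My u (n * tau D N) i j) - Φ n i j|
        ≤ Qf * |onGrid D Mx My u (n * tau D N) i j - U n i j| + |ω n i j|) :
    ∀ n ≤ N, gridNorm D Mx My (fun i j => onGrid D Mx My u (n * tau D N) i j - U n i j)
      ≤ errorConst a C Qg Qf Qf2 D.T (Real.sqrt ((D.rx - D.lx) * (D.ry - D.ly)))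
        * (tau D N ^ 2 + stepX D Mx ^ 4 + stepY D My ^ 4 + ρ) := by
  have ha := P.a_pos
  have hτ := tau_pos D hN
  have hT := D.hT
  have hQf := P.Qf_nonneg
  have hQg := P.Qg_nonneg
  have hC := P.C_nonneg
  have hS := P.source_nonneg
  have hB := betaInt_nonneg ha hT.le
  have hΓ := kernelModulus_nonneg hT.le hQg D.T
  have hker := P.hasKernelModulus
  have hτT : tau D N ≤ D.T := by simpa using cast_mul_tau_le D hN hN
  set τ := tau D N with hτd
  set QL := Real.sqrt ((D.rx - D.lx) * (D.ry - D.ly)) with hQL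
  have hQL0 : 0 ≤ QL := Real.sqrt_nonneg _
  set h4 := stepX D Mx ^ 4 + stepY D My ^ 4 with hh4
  have h40 : 0 ≤ h4 := by positivity
  set A := massForm D Mx My with hA
  set L := stiffForm D Mx My with hL
  set e : ℕ → ℕ → ℕ → ℝ := fun n => interiorPart Mx My
    (fun p q => onGrid D Mx My u (n * τ) p q - U n p q) with he
  set G : ℕ → ℕ → ℕ → ℕ → ℝ := fun n m => interiorPart Mx My
    (fun p q => f (onGrid D Mx My u (m * τ) p q) - schemeSource f U Φ n m p q) with hG
  set K := stabConst a Qg Qf D.T with hK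
  have hK0 : 0 ≤ K := by rw [hK, stabConst]; positivity
  set tb := truncBound a (sourceConst a C D.T Qf Qf2) Qg D.T τ with htb
  have htb0 : ∀ n, 0 ≤ tb n := fun n => truncBound_nonneg ha hS hT.le hQg hτ n
  have evan : ∀ n, VanishesOff Mx My (e n) := fun n => vanishesOff_interiorPart _ _ _
  have e0 : e 0 = 0 := by
    ext i j
    by_cases hI : Interior Mx My i j
    · have := P.solution.init (nodeX D Mx i) (nodeY D My j)
        ⟨nodeX_mem D hMx (by have := hI.1; omega), nodeY_mem D hMy (by have := hI.2; omega)⟩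
      simp only [he]
      rw [interiorPart_of _ hI, hU.values.1 i j hI, onGrid, Nat.cast_zero, zero_mul, this, sub_self]
      rfl
    · exact evan 0 i j hI
  have midv : ∀ n, VanishesOff Mx My (midValue e n) := by
    intro n i j hI
    have := map_midValue (ev i j) e n
    rw [ev_apply] at this
    rw [this]
    unfold midValue
    split_ifs <;> simp [evan _ i j hI]
  have Gbound : ∀ n k, 1 ≤ n → n ≤ N → 1 ≤ k → k ≤ n →
      formNorm A (G n k) ≤ 3 / 2 * Qf * formNorm A (e k) + if k = n then ρ else 0 := by
    intro n k hn1 hn hk1 hk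
    have g1 := massNorm_le_gridNorm D (vanishesOff_interiorPart Mx My
      (fun p q => f (onGrid D Mx My u (k * τ) p q) - schemeSource f U Φ n k p q))
    have g2 := gridNorm_le_massNorm D Mx My (e k)
    have g3 := gridNorm_smul D Mx My Qf (e k)
    rw [abs_of_nonneg hQf] at g3
    refine g1.trans ?_
    split_ifs with hkn
    · subst hkn
      have g4 := gridNorm_add_le D Mx My (fun i j => |Qf * e k i j|) (fun i j => |ω k i j|)
      have g5 : gridNorm D Mx My (fun i j => |Qf * e k i j|)
          ≤ gridNorm D Mx My (fun i j => Qf * e k i j) :=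
        gridNorm_mono D fun i j _ => (abs_abs _).le
      have g6 : gridNorm D Mx My (fun i j => |ω k i j|) ≤ gridNorm D Mx My (ω k) :=
        gridNorm_mono D fun i j _ => (abs_abs _).le
      have g7 := hω k hk1 hn
      have g8 : gridNorm D Mx My (G k k)
          ≤ gridNorm D Mx My (fun i j => |Qf * e k i j| + |ω k i j|) := by
        refine gridNorm_mono D fun i j hI => ?_
        simp only [hG, he]
        rw [interiorPart_of _ hI, interiorPart_of _ hI, schemeSource, if_pos rfl, abs_mul,
          abs_of_nonneg hQf]
        refine (hΦω k hk1 hn i j hI).trans (le_abs_self _)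
      have g9 := mul_le_mul_of_nonneg_left g2 hQf
      simp only [hG] at g8
      linarith
    · have g8 : gridNorm D Mx My (G n k) ≤ gridNorm D Mx My (fun i j => Qf * e k i j) := by
        refine gridNorm_mono D fun i j hI => ?_
        simp only [hG, he]
        rw [interiorPart_of _ hI, interiorPart_of _ hI, schemeSource, if_neg hkn, abs_mul,
          abs_of_nonneg hQf]
        exact P.lipschitz _ _
      have g9 := mul_le_mul_of_nonneg_left g2 hQf
      simp only [hG] at g8
      linarith
  have lam0 : lamPair a τ 0 ≤ betaInt a D.T := by
    have := sum_lamSeq_le ha hτ (m := 1) (T := D.T) (by simpa using hτT)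
    simpa [lamPair] using this
  -- The memory coefficients plus the Lipschitz source, where 3/2 compares grid and mass norms.
  -- Column 0 is set to zero: it would reach lag N, beyond the range of the bounds, and e 0 = 0
  -- makes it unnecessary.
  set q : ℕ → ℕ → ℝ := fun n k =>
    if k = 0 then 0 else |memCoeff τ (gfun α) (n - k)| + lamPair a τ (n - k) * (3 / 2 * Qf) with hq
  set r : ℕ → ℝ := fun n => 3 / 2 * QL * (tb n + 2 * betaInt a D.T * (C * h4)) + betaInt a D.T * ρ
    with hr
  set b : ℕ → ℝ := fun i => τ ^ a / Real.Gamma (a + 2) * powWeight (a + 1) i with hb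
  have hc : 0 ≤ τ ^ a / Real.Gamma (a + 2) :=
    div_nonneg (Real.rpow_nonneg hτ.le _) (Real.Gamma_pos_of_pos (by linarith)).le
  have h1a : 1 < a + 1 := by linarith
  have h2a : a + 1 < 2 := by linarith [P.a_lt]
  have stab := energy_stability (A := A) (L := L) (massForm_nonneg D Mx My)
    (massForm_symm D Mx My) (stiffForm_nonneg D Mx My) (stiffForm_symm D Mx My) b (lamSeq a τ)
    (fun i => mul_nonneg hc (powWeight_nonneg h1a i))
    (fun i => mul_le_mul_of_nonneg_left (powWeight_antitone h1a h2a i) hc)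
    (fun i => by
      have := mul_nonneg hc (powWeight_convex h1a h2a i)
      simp only [hb]; linarith)
    (by rw [lamSeq_eq_powWeight ha hτ, if_pos rfl]; simp only [hb]; ring)
    (fun i hi => by rw [lamSeq_eq_powWeight ha hτ, if_neg (by omega), one_mul])
    e e0 hτ (half_le_memWeight_zero hτ hτT hker hτ1) hK0 hτ2 N q r
    (fun n => by have := htb0 n; simp only [hr]; positivity)
    (by
      intro k hk
      rcases Nat.eq_zero_or_pos k with rfl | hk0
      · simpa [hq] using hK0
      · have e1 := sum_Icc_shift_eq
          (fun i => |memCoeff τ (gfun α) i| + lamPair a τ i * (3 / 2 * Qf)) k N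
        simp only [hq, if_neg hk0.ne']
        rw [e1, Finset.sum_add_distrib, ← Finset.sum_mul]
        have hm : ((N + 1 - k : ℕ) : ℝ) * τ ≤ D.T := cast_mul_tau_le D hN (by omega)
        have s1 := sum_abs_memCoeff_le hT.le hQg hτ hker hm
        have s2 := mul_le_mul_of_nonneg_right (sum_lamPair_le ha hτ hm)
          (show 0 ≤ 3 / 2 * Qf by positivity)
        rw [hK, stabConst]
        linarith)
    (by
      intro n k
      simp only [hq]
      split_ifs
      · exact le_rfl
      · have := lamPair_nonneg ha hτ (n - k)
        positivity)
    (by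
      intro n hn1 hn
      set w := midValue e n with hw
      have hwv : VanishesOff Mx My w := midv n
      set W := formNorm A w with hW
      have hW0 : 0 ≤ W := formNorm_nonneg _ _
      set R : ℕ → ℕ → ℝ := fun i j =>
        (memOp τ (gfun α) (fun m => avg Mx My (onGrid D Mx My u (m * τ)) i j) n
          - piOp a τ (fun m => avg Mx My (onGrid D Mx My (ellipticPart D f u) (m * τ)) i j) n
          - avg Mx My (bterm D N Mx My α v₀ n) i j)
        - piOp a τ (fun m => compactLaplacian D Mx My (onGrid D Mx My u (m * τ)) i j
          - avg Mx My (onGrid D Mx My (fun x y t => pdx D 2 u x y t + pdy D 2 u x y t)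
              (m * τ)) i j) n with hR
      have Rb : gridNorm D Mx My R ≤ QL * (tb n + 2 * betaInt a D.T * (C * h4)) := by
        have := htb0 n
        refine gridNorm_le_of_bound D hMx hMy (by positivity) fun i j hI => ?_
        refine (abs_sub _ _).trans (add_le_add (averaged_consistency P hN hn1 hn hI) ?_)
        refine abs_piOp_le_const ha hτ (by positivity) (cast_mul_tau_le D hN hn) fun k hk1 hk => ?_
        exact compactLaplacian_truncation P.regular hI (time_mem D hN hk1 (hk.trans hn))
      have id1 : pairing D Mx My w (fun i j =>
            memOp τ (gfun α) (fun m => avg Mx My (e m) i j) n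
            - piOp a τ (fun m => compactLaplacian D Mx My (e m) i j) n)
          = pairing D Mx My w (fun i j => R i j + piOp a τ (fun m => avg Mx My (G n m) i j) n) :=
        pairing_congr D w fun i j hI => error_equation P hN hU hΦ hn1 hn hI
      have lin1 := (pairing D Mx My w).map_sub
        (fun i j => memOp τ (gfun α) (fun m => avg Mx My (e m) i j) n)
        (fun i j => piOp a τ (fun m => compactLaplacian D Mx My (e m) i j) n)
      have lin2 := (pairing D Mx My w).map_add R
        (fun i j => piOp a τ (fun m => avg Mx My (G n m) i j) n)
      have k1 := map_memOp (pairing D Mx My w) τ (gfun α)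
        (fun m i j => avg Mx My (e m) i j) n
      have k2 := map_piOp (pairing D Mx My w) a τ
        (fun m i j => compactLaplacian D Mx My (e m) i j) n
      have k3 := map_piOp (pairing D Mx My w) a τ (fun m i j => avg Mx My (G n m) i j) n
      simp only [pairing_avg D _ hwv, pairing_compactLaplacian D _ hwv] at k1 k2 k3
      -- Pairing the error equation with w turns averaging into the mass form and the compact
      -- Laplacian into minus the stiffness form.
      have main : memOp τ (gfun α) (fun m => A (e m) w) n - piOp a τ (fun m => -L (e m) w) n
          = pairing D Mx My w R + piOp a τ (fun m => A (G n m) w) n := by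
        rw [← k1, ← k2, ← k3]
        exact lin1.symm.trans (id1.trans lin2)
      have k4 : piOp a τ (fun m => -L (e m) w) n
          = -∑ j ∈ Finset.Icc 1 n, lamSeq a τ (n - j) * L (midValue e j) w := by
        rw [piOp, ← Finset.sum_neg_distrib]
        refine Finset.sum_congr rfl fun k _ => ?_
        have := map_midValue (-(L.flip w)) e k
        simp only [LinearMap.neg_apply] at this
        have this : -L (midValue e k) w = midValue (fun m => -L (e m) w) k := this
        rw [← this]; ring
      have k5 := memOp_eq τ (gfun α) (x := fun m => A (e m) w) (by simp [e0]) hn1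
      have k6 : A (τ⁻¹ • (e n - e (n - 1))) w = (A (e n) w - A (e (n - 1)) w) / τ := by
        rw [map_smul, map_sub, LinearMap.smul_apply, LinearMap.sub_apply, smul_eq_mul]
        ring
      have b1 := (pairing_le D Mx My R w).trans
        (mul_le_mul_of_nonneg_right Rb (show 0 ≤ 3 / 2 * W by positivity))
      have b2 : -∑ k ∈ Finset.Icc 1 n, memCoeff τ (gfun α) (n - k) * A (e k) w
          ≤ ∑ k ∈ Finset.Icc 1 n, |memCoeff τ (gfun α) (n - k)| * formNorm A (e k) * W := by
        rw [← Finset.sum_neg_distrib]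
        refine Finset.sum_le_sum fun k _ => ?_
        have := abs_form_le (massForm_nonneg D Mx My) (massForm_symm D Mx My) (e k) w
        refine (neg_le_abs _).trans ?_
        rw [abs_mul, mul_assoc]
        exact mul_le_mul_of_nonneg_left this (abs_nonneg _)
      have b3 : piOp a τ (fun m => A (G n m) w) n
          ≤ ∑ k ∈ Finset.Icc 1 n, lamPair a τ (n - k) * (3 / 2 * Qf) * formNorm A (e k) * W
            + betaInt a D.T * ρ * W := by
        have s1 := (le_abs_self _).trans (abs_piOp_le ha hτ (n := n)
          (x := fun m => A (G n m) w)
          (y := fun k => (3 / 2 * Qf * formNorm A (e k) + if k = n then ρ else 0) * W)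
          fun k hk1 hk => (abs_form_le (massForm_nonneg D Mx My) (massForm_symm D Mx My) _ w).trans
            (mul_le_mul_of_nonneg_right (Gbound n k hn1 hn hk1 hk) hW0))
        refine s1.trans ?_
        have s2 : ∑ k ∈ Finset.Icc 1 n, lamPair a τ (n - k)
              * ((3 / 2 * Qf * formNorm A (e k) + if k = n then ρ else 0) * W)
            = ∑ k ∈ Finset.Icc 1 n, lamPair a τ (n - k) * (3 / 2 * Qf) * formNorm A (e k) * W
              + ∑ k ∈ Finset.Icc 1 n, if k = n then lamPair a τ (n - k) * ρ * W else 0 := by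
          rw [← Finset.sum_add_distrib]
          refine Finset.sum_congr rfl fun k _ => ?_
          split_ifs <;> ring
        rw [s2, Finset.sum_ite_eq', if_pos (Finset.mem_Icc.2 ⟨hn1, le_rfl⟩), Nat.sub_self]
        have := mul_le_mul_of_nonneg_right (mul_le_mul_of_nonneg_right lam0 hρ0) hW0
        linarith
      have split : (∑ k ∈ Finset.Icc 1 n, q n k * formNorm A (e k) + r n) * W
          = ∑ k ∈ Finset.Icc 1 n, |memCoeff τ (gfun α) (n - k)| * formNorm A (e k) * W
            + ∑ k ∈ Finset.Icc 1 n, lamPair a τ (n - k) * (3 / 2 * Qf) * formNorm A (e k) * W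
            + r n * W := by
        rw [add_mul, Finset.sum_mul, ← Finset.sum_add_distrib]
        congr 1
        refine Finset.sum_congr rfl fun k hk => ?_
        rw [Finset.mem_Icc] at hk
        simp only [hq, if_neg (show k ≠ 0 by omega)]
        ring
      rw [split, k6]
      simp only [hr]
      rw [k4] at main
      linarith)
  intro n hn
  have fin := stab n hn
  have cong : gridNorm D Mx My (fun i j => onGrid D Mx My u (n * τ) i j - U n i j)
      ≤ gridNorm D Mx My (e n) := by
    refine gridNorm_mono D fun i j hI => ?_
    simp only [he]
    rw [interiorPart_of _ hI]
  refine cong.trans ((gridNorm_le_massNorm D Mx My (e n)).trans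
    ((mul_le_mul_of_nonneg_left fin (by norm_num)).trans ?_))
  have hNτ : (N : ℝ) * τ = D.T := cast_mul_tau D hN
  rw [hNτ]
  have st := sum_truncBound_le ha hS hT.le hQg hτ (hNτ.le)
  have sr : τ * ∑ n ∈ Finset.Icc 1 N, r n = 3 / 2 * QL * (τ * ∑ n ∈ Finset.Icc 1 N, tb n)
      + D.T * (3 / 2 * QL * (2 * betaInt a D.T * (C * h4)) + betaInt a D.T * ρ) := by
    simp only [hr, mul_add, Finset.sum_add_distrib, ← Finset.mul_sum, Finset.sum_const,
      Nat.card_Icc, Nat.add_sub_cancel, nsmul_eq_mul, ← hNτ]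
    ring
  rw [sr]
  set X := (Qg + 3 * kernelModulus D.T Qg D.T + 2 * betaInt a D.T)
        * (2 * sourceConst a C D.T Qf Qf2
          + 2 * (sourceConst a C D.T Qf Qf2 * timeModulus a D.T)) with hX
  have hψ : 0 ≤ timeModulus a D.T := by
    have := timeModulus_mono ha le_rfl hT.le
    rwa [timeModulus_zero ha] at this
  have hX0 : 0 ≤ X := by positivity
  have st2 := mul_le_mul_of_nonneg_left st (show 0 ≤ 3 / 2 * QL by positivity)
  have hE := (Real.exp_pos (8 * K * D.T)).le
  have bound : 3 / 2 * QL * (τ * ∑ n ∈ Finset.Icc 1 N, tb n)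
      + D.T * (3 / 2 * QL * (2 * betaInt a D.T * (C * h4)) + betaInt a D.T * ρ)
      ≤ (3 / 2 * QL * X + D.T * (3 / 2 * QL * (2 * betaInt a D.T * C)) + D.T * betaInt a D.T)
        * (τ ^ 2 + h4 + ρ) := by
    have y1 : 0 ≤ 3 / 2 * QL * X := by positivity
    have y2 : 0 ≤ D.T * (3 / 2 * QL * (2 * betaInt a D.T * C)) := by positivity
    have y3 : 0 ≤ D.T * betaInt a D.T := by positivity
    have z1 := mul_nonneg y1 (add_nonneg h40 hρ0)
    have z2 := mul_nonneg y2 (add_nonneg (sq_nonneg τ) hρ0)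
    have z3 := mul_nonneg y3 (add_nonneg (sq_nonneg τ) h40)
    linarith
  rw [errorConst]
  -- The factor 12 is 8 from the stability estimate times 3/2 from the norm comparison.
  have := mul_le_mul_of_nonneg_left bound (show 0 ≤ 12 * Real.exp (8 * K * D.T) by positivity)
  rw [show τ ^ 2 + stepX D Mx ^ 4 + stepY D My ^ 4 + ρ = τ ^ 2 + h4 + ρ by rw [hh4]; ring]
  linarith

end TwoGrid

end

noncomputable section

namespace TwoGrid

/-! ### Bicubic spline interpolation -/

theorem cubicSpline_zero {l H : ℝ} {M : ℕ} (hM : 1 ≤ M) {w : ℕ → ℝ} (h : ∀ i ≤ M, w i = 0)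
    (x : ℝ) : cubicSpline l H M w 0 0 x = 0 := by
  rw [cubicSpline_congr hM (w := fun i => w i - w i) (fun i hi => by rw [h i hi, sub_zero]) x,
    ← cubicSpline_sub, sub_self]

theorem stepX_mul (D : Cylinder) (J M : ℕ) : stepX D (J * M) = stepX D M / J := by
  rw [stepX, stepX, Nat.cast_mul, div_div, mul_comm (M : ℝ)]

theorem stepY_mul (D : Cylinder) (J M : ℕ) : stepY D (J * M) = stepY D M / J := by
  rw [stepY, stepY, Nat.cast_mul, div_div, mul_comm (M : ℝ)]

theorem bicubic_sub (D : Cylinder) {Mx My : ℕ} (v w : ℕ → ℕ → ℝ) (x y : ℝ) :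
    bicubic D Mx My 0 v x y - bicubic D Mx My 0 w x y
      = bicubic D Mx My 0 (fun i j => v i j - w i j) x y := by
  simp only [bicubic, cubicSpline_sub]

/-- At the ends of an interval the spline takes its nodal values, and zero data give the zero
spline. Hence the Newton source equals f(0) on the fine boundary, as the error equation requires. -/
theorem bicubic_boundary (D : Cylinder) {Mx My J i j : ℕ} (hMx : 1 ≤ Mx) (hMy : 1 ≤ My)
    (hJ : 1 ≤ J) {w : ℕ → ℕ → ℝ} (hw : ∀ i j, Boundary Mx My i j → w i j = 0)
    (hB : Boundary (J * Mx) (J * My) i j) :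
    bicubic D Mx My 0 w (nodeX D (J * Mx) i) (nodeY D (J * My) j) = 0 := by
  have hx : 1 ≤ J * Mx := Nat.one_le_iff_ne_zero.2 (by positivity)
  have hy : 1 ≤ J * My := Nat.one_le_iff_ne_zero.2 (by positivity)
  obtain ⟨⟨hi, hj⟩, hI⟩ := hB
  have ends : i = 0 ∨ i = J * Mx ∨ j = 0 ∨ j = J * My := by unfold Interior at hI; omega
  have hrx : D.rx = D.lx + Mx * stepX D Mx := by rw [mul_stepX D hMx]; ring
  have hry : D.ry = D.ly + My * stepY D My := by rw [mul_stepY D hMy]; ring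
  have b : ∀ {p q}, p ≤ Mx → q ≤ My → (p = 0 ∨ p = Mx ∨ q = 0 ∨ q = My) → w p q = 0 :=
    fun hp hq h => hw _ _ ⟨⟨hp, hq⟩, by unfold Interior; omega⟩
  rw [bicubic]
  rcases ends with rfl | rfl | rfl | rfl
  · refine cubicSpline_zero hMy (fun q hq => ?_) _
    rw [nodeX_zero, cubicSpline_first (stepX_pos D hMx)]
    exact b (Nat.zero_le _) hq (by simp)
  · refine cubicSpline_zero hMy (fun q hq => ?_) _
    rw [nodeX_last D hx, hrx, cubicSpline_last (stepX_pos D hMx) hMx]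
    exact b le_rfl hq (by simp)
  · rw [nodeY_zero, cubicSpline_first (stepY_pos D hMy)]
    exact cubicSpline_zero hMx (fun p hp => b hp (Nat.zero_le _) (by simp)) _
  · rw [nodeY_last D hy, hry, cubicSpline_last (stepY_pos D hMy) hMy]
    exact cubicSpline_zero hMx (fun p hp => b hp le_rfl (by simp)) _

/-- Each direction multiplies the sum of squares by at most 44 J. The fine mesh weight is smaller by
J², so 44² remains for the squared norm. -/
theorem gridNorm_bicubic_le (D : Cylinder) {Mx My J : ℕ} (hMx : 1 ≤ Mx) (hMy : 1 ≤ My)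
    (hJ : 1 ≤ J) {w : ℕ → ℕ → ℝ} (hw : ∀ i j, Boundary Mx My i j → w i j = 0) :
    gridNorm D (J * Mx) (J * My)
        (fun i j => bicubic D Mx My 0 w (nodeX D (J * Mx) i) (nodeY D (J * My) j))
      ≤ 44 * gridNorm D Mx My w := by
  have hJ' : (0 : ℝ) < J := by exact_mod_cast hJ
  have b : ∀ {p q}, p ≤ Mx → q ≤ My → (p = 0 ∨ p = Mx ∨ q = 0 ∨ q = My) → w p q = 0 :=
    fun hp hq h => hw _ _ ⟨⟨hp, hq⟩, by unfold Interior; omega⟩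
  have inner : ∀ q ∈ Finset.Ico 1 My, ∑ i ∈ Finset.Ico 1 (J * Mx),
      cubicSpline D.lx (stepX D Mx) Mx (fun p => w p q) 0 0 (nodeX D (J * Mx) i) ^ 2
        ≤ J * (44 * ∑ p ∈ Finset.Ico 1 Mx, w p q ^ 2) := fun q hq => by
    have hq := (Finset.mem_Ico.1 hq).2.le
    simp only [nodeX, stepX_mul]
    exact sum_cubicSpline_sq_le (stepX_pos D hMx) hMx hJ (w := fun p => w p q)
      (b (Nat.zero_le _) hq (by simp)) (b le_rfl hq (by simp))
  have outer : ∀ i ∈ Finset.Ico 1 (J * Mx), ∑ j ∈ Finset.Ico 1 (J * My),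
      bicubic D Mx My 0 w (nodeX D (J * Mx) i) (nodeY D (J * My) j) ^ 2
        ≤ J * (44 * ∑ q ∈ Finset.Ico 1 My,
          cubicSpline D.lx (stepX D Mx) Mx (fun p => w p q) 0 0 (nodeX D (J * Mx) i) ^ 2) :=
    fun i _ => by
      simp only [nodeY, stepY_mul]
      exact sum_cubicSpline_sq_le (stepY_pos D hMy) hMy hJ
        (cubicSpline_zero hMx (fun p hp => b hp (Nat.zero_le _) (by simp)) _)
        (cubicSpline_zero hMx (fun p hp => b hp le_rfl (by simp)) _)
  have key : ∑ i ∈ Finset.Ico 1 (J * Mx), ∑ j ∈ Finset.Ico 1 (J * My),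
      bicubic D Mx My 0 w (nodeX D (J * Mx) i) (nodeY D (J * My) j) ^ 2
        ≤ (J * 44) ^ 2 * ∑ p ∈ Finset.Ico 1 Mx, ∑ q ∈ Finset.Ico 1 My, w p q ^ 2 := by
    refine (Finset.sum_le_sum outer).trans ?_
    rw [← Finset.mul_sum, ← Finset.mul_sum, Finset.sum_comm]
    have := Finset.sum_le_sum inner
    rw [← Finset.mul_sum, ← Finset.mul_sum,
      Finset.sum_comm (s := Finset.Ico 1 My) (t := Finset.Ico 1 Mx)] at this
    have := mul_le_mul_of_nonneg_left this (show (0 : ℝ) ≤ J * 44 by positivity)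
    linarith
  refine abs_le_of_sq_le_sq' ?_ (mul_nonneg (by norm_num) (gridNorm_nonneg _ _ _ _)) |>.2
  rw [mul_pow, gridNorm_sq, gridNorm_sq, stepX_mul, stepY_mul]
  have := mul_le_mul_of_nonneg_left key
    (show 0 ≤ stepX D Mx / J * (stepY D My / J) from
      mul_nonneg (div_nonneg (stepX_nonneg _ _) hJ'.le) (div_nonneg (stepY_nonneg _ _) hJ'.le))
  refine this.trans (le_of_eq ?_)
  field_simp

variable {D : Cylinder} {α f : ℝ → ℝ} {u₀ v₀ : ℝ → ℝ → ℝ} {u : ℝ → ℝ → ℝ → ℝ}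
  {a C Qg Qf Qf2 : ℝ}

/-- Interpolation error of the bicubic spline of the exact solution. -/
theorem bicubic_error (P : ProblemData D α f u₀ v₀ u a C Qg Qf Qf2) {Mx My : ℕ}
    (hMx : 1 ≤ Mx) (hMy : 1 ≤ My) {x y t : ℝ} (hx : x ∈ Icc D.lx D.rx) (hy : y ∈ Icc D.ly D.ry)
    (ht : t ∈ Ioc 0 D.T) :
    |bicubic D Mx My 0 (onGrid D Mx My u t) x y - u x y t|
      ≤ 15 * C * stepX D Mx ^ 4 + 3 * C * stepY D My ^ 4 := by
  have hC := P.C_nonneg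
  obtain ⟨-, bx, by'⟩ := boundary_compatibility P.a_pos P.a_lt P.exponent P.initial
    P.smooth.continuous P.solution P.regular
  have htc : t ∈ Icc 0 D.T := ⟨ht.1.le, ht.2⟩
  have hrx : D.lx + Mx * stepX D Mx = D.rx := by rw [mul_stepX D hMx]; ring
  have hry : D.ly + My * stepY D My = D.ry := by rw [mul_stepY D hMy]; ring
  have sx : ∀ y ∈ Icc D.ly D.ry,
      |cubicSpline D.lx (stepX D Mx) Mx (fun i => u (nodeX D Mx i) y t) 0 0 x - u x y t|
        ≤ 3 * C * stepX D Mx ^ 4 := fun y hy => by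
    rw [← pdx_zero D u x y t]
    refine cubicSpline_error (stepX_pos D hMx) hMx (φ := fun k x => pdx D k u x y t)
      ?_ ?_ (bx _ _ _ (Or.inl rfl) hy ht) ?_ (fun i _ => (pdx_zero D u _ y t).symm) hx.1
      (by rw [hrx]; exact hx.2)
    · rw [hrx]
      exact fun k hk x hx => P.regular.chain_x hy htc (by omega) hx
    · rw [hrx]
      exact fun x hx => (P.regular.bound x y t ⟨hx, hy⟩ ht).2.1
    · exact bx _ _ _ (Or.inr hrx) hy ht
  have sy : |cubicSpline D.ly (stepY D My) My (fun j => u x (nodeY D My j) t) 0 0 y - u x y t|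
        ≤ 3 * C * stepY D My ^ 4 := by
    rw [← pdy_zero D u x y t]
    refine cubicSpline_error (stepY_pos D hMy) hMy (φ := fun k y => pdy D k u x y t)
      ?_ ?_ (by' _ _ _ hx (Or.inl rfl) ht) ?_ (fun i _ => (pdy_zero D u x _ t).symm) hy.1
      (by rw [hry]; exact hy.2)
    · rw [hry]
      exact fun k hk y hy => P.regular.chain_y hx htc (by omega) hy
    · rw [hry]
      exact fun y hy => (P.regular.bound x y t ⟨hx, hy⟩ ht).2.2.1
    · exact by' _ _ _ hx (Or.inr hry) ht
  -- The y-spline amplifies the error 3 C H_x⁴ of the x-splines by at most its stability constant 5.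
  have sxy : |bicubic D Mx My 0 (onGrid D Mx My u t) x y
      - cubicSpline D.ly (stepY D My) My (fun j => u x (nodeY D My j) t) 0 0 y|
        ≤ 5 * (3 * C * stepX D Mx ^ 4) := by
    rw [bicubic, cubicSpline_sub]
    exact abs_cubicSpline_le (stepY_pos D hMy) hMy (by positivity)
      (fun j hj => sx _ (nodeY_mem D hMy hj)) hy.1 (by rw [hry]; exact hy.2)
  have := abs_sub_le (bicubic D Mx My 0 (onGrid D Mx My u t) x y)
    (cubicSpline D.ly (stepY D My) My (fun j => u x (nodeY D My j) t) 0 0 y) (u x y t)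
  linarith

theorem onGrid_boundary (P : ProblemData D α f u₀ v₀ u a C Qg Qf Qf2) {Mx My i j : ℕ} {t : ℝ}
    (hMx : 1 ≤ Mx) (hMy : 1 ≤ My) (ht : t ∈ Icc 0 D.T) (hB : Boundary Mx My i j) :
    onGrid D Mx My u t i j = 0 :=
  P.solution.boundary _ _ _ (node_mem_boundary D hMx hMy hB) ht

/-- The interpolated coarse solution approximates the exact solution on the fine grid. -/
theorem interpolated_error (P : ProblemData D α f u₀ v₀ u a C Qg Qf Qf2) {Mx My J n : ℕ} {t : ℝ}
    (hMx : 1 ≤ Mx) (hMy : 1 ≤ My) (hJ : 1 ≤ J) (ht : t ∈ Ioc 0 D.T) {U : ℕ → ℕ → ℕ → ℝ}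
    (hU : ∀ i j, Boundary Mx My i j → U n i j = 0) :
    gridNorm D (J * Mx) (J * My)
        (fun i j => onGrid D (J * Mx) (J * My) u t i j - interpolated D Mx My J f U n i j)
      ≤ Real.sqrt ((D.rx - D.lx) * (D.ry - D.ly))
          * (15 * C * stepX D Mx ^ 4 + 3 * C * stepY D My ^ 4)
        + 44 * gridNorm D Mx My (fun i j => onGrid D Mx My u t i j - U n i j) := by
  have hC := P.C_nonneg
  have hx : 1 ≤ J * Mx := Nat.one_le_iff_ne_zero.2 (by positivity)
  have hy : 1 ≤ J * My := Nat.one_le_iff_ne_zero.2 (by positivity)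
  obtain ⟨f0, -⟩ := boundary_compatibility P.a_pos P.a_lt P.exponent P.initial
    P.smooth.continuous P.solution P.regular
  -- Since f(0) = 0, the interpolation is linear, and the interpolation error of u separates from
  -- the interpolated coarse error.
  have split : (fun i j => onGrid D (J * Mx) (J * My) u t i j - interpolated D Mx My J f U n i j)
      = fun i j => (onGrid D (J * Mx) (J * My) u t i j - bicubic D Mx My 0 (onGrid D Mx My u t)
          (nodeX D (J * Mx) i) (nodeY D (J * My) j))
        + bicubic D Mx My 0 (fun i j => onGrid D Mx My u t i j - U n i j)
          (nodeX D (J * Mx) i) (nodeY D (J * My) j) := by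
    ext i j
    rw [← bicubic_sub, interpolated, f0, neg_zero]
    ring
  rw [split]
  refine (gridNorm_add_le _ _ _ _ _).trans (add_le_add ?_ ?_)
  · refine gridNorm_le_of_bound D hx hy (by positivity) fun i j hI => ?_
    rw [abs_sub_comm]
    exact bicubic_error P hMx hMy (nodeX_mem D hx (by have := hI.1; omega))
      (nodeY_mem D hy (by have := hI.2; omega)) ht
  · refine gridNorm_bicubic_le D hMx hMy hJ fun i j hB => ?_
    rw [onGrid_boundary P hMx hMy ⟨ht.1.le, ht.2⟩ hB, hU i j hB, sub_zero]

/-! ### The two-grid method -/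

theorem errorConst_nonneg (P : ProblemData D α f u₀ v₀ u a C Qg Qf Qf2) {QL : ℝ} (hQL : 0 ≤ QL) :
    0 ≤ errorConst a C Qg Qf Qf2 D.T QL := by
  have hT := D.hT.le
  have hQg := P.Qg_nonneg
  have hC := P.C_nonneg
  have hS := P.source_nonneg
  have hB := betaInt_nonneg P.a_pos hT
  have hΓ := kernelModulus_nonneg hT hQg D.T
  have hM : 0 ≤ timeModulus a D.T := add_nonneg hT (Real.rpow_nonneg hT a)
  unfold errorConst
  positivity

theorem coarse_error (P : ProblemData D α f u₀ v₀ u a C Qg Qf Qf2) {N Mx My : ℕ} (hN : 1 ≤ N)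
    (hMx : 1 ≤ Mx) (hMy : 1 ≤ My) (hτ1 : Qg * tau D N ≤ 1)
    (hτ2 : 8 * stabConst a Qg Qf D.T * tau D N ≤ 1)
    {U : ℕ → ℕ → ℕ → ℝ} (hU : IsCoarseSolution D N Mx My α f u₀ v₀ U) {n : ℕ} (hn : n ≤ N) :
    gridNorm D Mx My (fun i j => onGrid D Mx My u (n * tau D N) i j - U n i j)
      ≤ errorConst a C Qg Qf Qf2 D.T (Real.sqrt ((D.rx - D.lx) * (D.ry - D.ly)))
        * (tau D N ^ 2 + stepX D Mx ^ 4 + stepY D My ^ 4) := by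
  have hS : SolvesScheme D N Mx My a α f u₀ v₀ U (fun n p q => f (U n p q)) :=
    solvesScheme_of hN P.a_pos P.initial hU.first hU.later hU.values
  have := scheme_error P hN hMx hMy hτ1 hτ2 hS
    (fun n _ hn i j hB => by simp only [hU.values.2 n hn i j hB]) le_rfl (fun _ _ _ => 0)
    (fun n _ _ => by simp [gridNorm]) (fun n _ _ i j _ => by simpa using P.lipschitz _ _) n hn
  simpa using this

/-- The constant in the error estimate for the two-grid method, in terms of the constant `E` of
the underlying scheme. -/
def twoGridConst (E C Qf QL : ℝ) : ℝ := E * (1 + 2 * Qf * (QL * (15 * C) + 44 * E))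

theorem fine_error (P : ProblemData D α f u₀ v₀ u a C Qg Qf Qf2) {N Mx My J : ℕ} (hN : 1 ≤ N)
    (hMx : 1 ≤ Mx) (hMy : 1 ≤ My) (hJ : 1 ≤ J) (hτ1 : Qg * tau D N ≤ 1)
    (hτ2 : 8 * stabConst a Qg Qf D.T * tau D N ≤ 1)
    {UH Uh : ℕ → ℕ → ℕ → ℝ} (hUH : IsCoarseSolution D N Mx My α f u₀ v₀ UH)
    (hUh : IsFineSolution D N Mx My J α f u₀ v₀ UH Uh) {n : ℕ} (hn : n ≤ N) {QL : ℝ}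
    (hQL : Real.sqrt ((D.rx - D.lx) * (D.ry - D.ly)) = QL) :
    gridNorm D (J * Mx) (J * My)
        (fun i j => onGrid D (J * Mx) (J * My) u (n * tau D N) i j - Uh n i j)
      ≤ twoGridConst (errorConst a C Qg Qf Qf2 D.T QL) C Qf QL
        * (tau D N ^ 2 + stepX D (J * Mx) ^ 4 + stepY D (J * My) ^ 4
          + stepX D Mx ^ 4 + stepY D My ^ 4) := by
  have hx : 1 ≤ J * Mx := Nat.one_le_iff_ne_zero.2 (by positivity)
  have hy : 1 ≤ J * My := Nat.one_le_iff_ne_zero.2 (by positivity)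
  have hC := P.C_nonneg
  have hQf := P.Qf_nonneg
  have hQL0 : 0 ≤ QL := hQL ▸ Real.sqrt_nonneg _
  have hE := errorConst_nonneg P hQL0
  obtain ⟨f0, -⟩ := boundary_compatibility P.a_pos P.a_lt P.exponent P.initial
    P.smooth.continuous P.solution P.regular
  set E := errorConst a C Qg Qf Qf2 D.T QL with hEd
  set S := tau D N ^ 2 + stepX D Mx ^ 4 + stepY D My ^ 4 with hSd
  have hS0 : 0 ≤ S := by positivity
  set R := QL * (15 * C) + 44 * E with hR
  have hR0 : 0 ≤ R := by positivity
  have interp : ∀ n, 1 ≤ n → n ≤ N → gridNorm D (J * Mx) (J * My)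
      (fun i j => onGrid D (J * Mx) (J * My) u (n * tau D N) i j
        - interpolated D Mx My J f UH n i j) ≤ R * S := fun n h1 hn => by
    have e1 := interpolated_error P hMx hMy hJ (time_mem D hN h1 hn) (hUH.values.2 n hn)
    have e2 := coarse_error P hN hMx hMy hτ1 hτ2 hUH hn
    rw [hQL] at e1 e2
    have e3 : 15 * C * stepX D Mx ^ 4 + 3 * C * stepY D My ^ 4 ≤ 15 * C * S := by
      have h1 : 0 ≤ C * stepY D My ^ 4 := by positivity
      have h2 : 0 ≤ C * tau D N ^ 2 := by positivity
      rw [hSd]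
      linarith
    have e4 := mul_le_mul_of_nonneg_left e3 hQL0
    rw [hR]
    linarith
  have hScheme : SolvesScheme D N (J * Mx) (J * My) a α f u₀ v₀ Uh (newtonF D Mx My J f UH Uh) :=
    solvesScheme_of hN P.a_pos P.initial hUh.first hUh.later hUh.values
  have main := scheme_error P hN hx hy hτ1 hτ2 hScheme (fun n _ hn i j hB => ?_)
    (ρ := 2 * Qf * (R * S)) (by positivity)
    (fun n i j => 2 * Qf * (onGrid D (J * Mx) (J * My) u (n * tau D N) i j
      - interpolated D Mx My J f UH n i j)) (fun n h1 hn => ?_) (fun n h1 hn i j hI => ?_) n hn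
  · rw [hQL, ← hEd] at main
    refine main.trans ?_
    rw [twoGridConst, mul_assoc E, ← hR]
    refine mul_le_mul_of_nonneg_left ?_ hE
    have h1 : 0 ≤ 2 * Qf * R * (stepX D (J * Mx) ^ 4 + stepY D (J * My) ^ 4) := by positivity
    have h2 : 0 ≤ stepX D Mx ^ 4 + stepY D My ^ 4 := by positivity
    rw [hSd]
    linarith
  · have b : interpolated D Mx My J f UH n i j = 0 := by
      rw [interpolated, f0, neg_zero]
      exact bicubic_boundary D hMx hMy hJ (hUH.values.2 n hn) hB
    rw [newtonF, b, hUh.values.2 n hn i j hB]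
    simp
  · rw [gridNorm_smul, abs_of_nonneg (by positivity)]
    exact mul_le_mul_of_nonneg_left (interp n h1 hn) (by positivity)
  · rw [newtonF]
    set v := onGrid D (J * Mx) (J * My) u (n * tau D N) i j
    set p := interpolated D Mx My J f UH n i j
    -- The Newton source is estimated through |f'| ≤ Qf only: Qf |v - p| from f, and Qf (|v - Uh| +
    -- |v - p|) from the linear term. This is where ω = 2 Qf (u - Π_H U_H) comes from.
    have e1 := P.lipschitz v p
    have e2 : |deriv f p * (Uh n i j - p)| ≤ Qf * (|v - Uh n i j| + |v - p|) := by
      rw [abs_mul]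
      refine mul_le_mul (P.deriv_le p) ?_ (abs_nonneg _) hQf
      have := abs_sub_le (Uh n i j) v p
      rwa [abs_sub_comm (Uh n i j) v] at this
    have e3 := abs_sub (f v - f p) (deriv f p * (Uh n i j - p))
    rw [abs_mul, abs_of_nonneg (show 0 ≤ 2 * Qf by positivity), ← sub_sub]
    linarith

end TwoGrid

end

/-! ### Choice of the constants and conclusion. -/

theorem theorem4p4 (T a : ℝ) (hT : 0 < T) (ha0 : 0 < a) (ha1 : a < 1) :
    (∀ α : ℝ → ℝ, TwoGrid.IsAdmissibleExponent T α → α 0 = 1 + a →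
      ∃ Qg : ℝ, TwoGrid.IsKernelBound T α Qg) ∧
    ∀ QL Qg Qf Qf2 C : ℝ, ∃ Q δ : ℝ, 0 < Q ∧ 0 < δ ∧
      ∀ (D : TwoGrid.Cylinder) (α f : ℝ → ℝ) (u₀ v₀ : ℝ → ℝ → ℝ) (u : ℝ → ℝ → ℝ → ℝ),
        D.T = T → Real.sqrt ((D.rx - D.lx) * (D.ry - D.ly)) = QL →
        TwoGrid.IsAdmissibleExponent T α → α 0 = 1 + a → TwoGrid.IsKernelBound T α Qg →
        ContDiff ℝ 2 f → (∀ v : ℝ, |deriv f v| ≤ Qf) →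
        (∀ v : ℝ, |v| ≤ C → |deriv (deriv f) v| ≤ Qf2) →
        TwoGrid.IsSolution D α f u₀ v₀ u → TwoGrid.IsRegular D (α 0) C u →
        ∀ N MHx MHy J : ℕ, 1 ≤ N → 1 ≤ MHx → 1 ≤ MHy → 2 ≤ J →
          TwoGrid.tau D N ≤ δ →
          TwoGrid.stepX D (J * MHx) ≤ δ → TwoGrid.stepY D (J * MHy) ≤ δ →
          ∀ UH Uh : ℕ → ℕ → ℕ → ℝ,
            TwoGrid.IsCoarseSolution D N MHx MHy α f u₀ v₀ UH →
            TwoGrid.IsFineSolution D N MHx MHy J α f u₀ v₀ UH Uh →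
            ∀ n : ℕ, 1 ≤ n → n ≤ N →
              TwoGrid.gridNorm D (J * MHx) (J * MHy)
                  (fun i j => u (TwoGrid.nodeX D (J * MHx) i) (TwoGrid.nodeY D (J * MHy) j)
                      (TwoGrid.time D N n) - Uh n i j)
                ≤ Q * (TwoGrid.tau D N ^ 2
                    + TwoGrid.stepX D (J * MHx) ^ 4 + TwoGrid.stepY D (J * MHy) ^ 4
                    + TwoGrid.stepX D MHx ^ 4 + TwoGrid.stepY D MHy ^ 4) := by
  refine ⟨fun α hα h0 => TwoGrid.exists_isKernelBound ha0 ha1 hT hα h0,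
    fun QL Qg Qf Qf2 C => ?_⟩
  set B := TwoGrid.twoGridConst (TwoGrid.errorConst a C Qg Qf Qf2 T QL) C Qf QL
  set K := 8 * TwoGrid.stabConst a Qg Qf T with hK
  have hden : 0 < 1 + |Qg| + |K| := by positivity
  -- The constants are fixed before the data, when no signs are known, hence the absolute values.
  -- The bound on τ yields Qg τ ≤ 1, which keeps c₀ ≥ 1/2, and K τ ≤ 1, which permits the absorption
  -- in the energy estimate.
  refine ⟨|B| + 1, 1 / (1 + |Qg| + |K|), by positivity, by positivity, ?_⟩
  intro D α f u₀ v₀ u hDT hQL hα h0 hg hf hf1 hf2 hsol hreg N MHx MHy J hN hMx hMy hJ hτ _ _ UH Uh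
    hUH hUh n _ hn
  subst hDT
  have P : TwoGrid.ProblemData D α f u₀ v₀ u a C Qg Qf Qf2 :=
    ⟨ha0, ha1, hα, h0, hg, hf, hf1, hf2, hsol, hreg⟩
  have hτ0 := (TwoGrid.tau_pos D hN).le
  have hτ' : TwoGrid.tau D N + |Qg| * TwoGrid.tau D N + |K| * TwoGrid.tau D N ≤ 1 := by
    have := (le_div_iff₀ hden).1 hτ
    linarith
  have hg0 := mul_nonneg (abs_nonneg Qg) hτ0
  have hK0 := mul_nonneg (abs_nonneg K) hτ0
  have hτ1 := (mul_le_mul_of_nonneg_right (le_abs_self Qg) hτ0).trans (by linarith : _ ≤ (1 : ℝ))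
  have hτ2 := (mul_le_mul_of_nonneg_right (le_abs_self K) hτ0).trans (by linarith : _ ≤ (1 : ℝ))
  refine (TwoGrid.fine_error P hN hMx hMy (by omega) hτ1 hτ2 hUH hUh hn hQL).trans ?_
  exact mul_le_mul_of_nonneg_right (by linarith [le_abs_self B]) (by positivity)
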